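/- All graphs are finite and simple. The Maker-Maker domination game on a graph $G$: Alice and Bob alternately claim an unclaimed vertex; the first player whose claimed vertices form a dominating set of $G$ wins, and the game is a draw if all vertices have been claimed and nobody dominates $G$. A position with a specified next player is Alice-win if Alice has a strategy which ensures that she dominates $G$ before Bob does. Let $F$ be a tree in which no vertex is adjacent to two distinct leaves. Let $L_F$ be the set of leaves (vertices of degree $1$) of $F$, $M_F$ the set of vertices adjacent to a leaf, and $S_F = V(F)\setminus (L_F\cup M_F)$ (the skeleton). Root $F$ in a vertex $v_0\in M_F$ and label the vertices other than $v_0$ inductively, starting from the leaves: a vertex is labelled $0$ if all its children are labelled $1$ (in particular if it has no child), and $1$ if at least one of its children is labelled $0$. Assume that 1. the subgraph of $F$ induced by $S_F\cup\{v_0\}$ is a tree, and 2. every vertex labelled $1$ has exactly one child. Let $C$ be a connected component of the subgraph induced by $S_F$. *Path type.* Suppose that $C$ is a path $v_1,\dots,v_n$ ($n\ge 1$) whose end $v_1$ is its unique vertex adjacent to $v_0$. Let $U\subseteq\{1,\dots,n-1\}$ be the set of those $i\le n-1$ for which $v_i$ is adjacent to a vertex of $M_F\setminus\{v_0\}$.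 Consider the cases * (1.a) $n\in\{1,2\}$ and $U=\emptyset$; * (1.b) $n=3$ and ($U\subseteq\{1\}$ or $U\subseteq\{2\}$); * (1.c) $n\ge 4$ and $U\subseteq\{2,3,n-2\}$; * (1.d) $n\ge 9$, $n$ is odd, and $U\subseteq\{2,5,n-2\}$; * (1.e) $n\in\{9,11\}$ and $\{3,5\}\subseteq U\subseteq\{2,3,5,n-2\}$. *Fork type.* Case (2): $C$ is a fork, i.e. it is obtained from a star with center $c$ and at least three branches by subdividing each edge exactly once; the unique vertex of $C$ adjacent to $v_0$ is a leaf of the fork; and the only vertices of $C$ that may be adjacent to a vertex of $M_F\setminus\{v_0\}$ are $c$, the leaves of the fork other than the one adjacent to $v_0$, and the neighbour of $c$ on the path from $c$ to $v_0$. The component $C$ is *favorable* if one of the cases (1.a)–(1.e), (2) holds, and *weakly favorable* if (1.e) or (2) holds. **Theorem.** The position on $F$ in which Alice has claimed exactly $v_0$, Bob has claimed nothing, and Bob is to move is Alice-win if and only if every connected component of $S_F$ is favorable and at most one of them is weakly favorable. -/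

import Mathlib

namespace DominationGame

variable {V : Type*}

/-! ### The Maker-Maker domination game -/

/-- The two players. -/
inductive Player where
  | alice
  | bob

/-- `S` is a dominating set of `G`: every vertex is in `S` or has a neighbour in `S`. -/
def IsDominating (G : SimpleGraph V) (S : Set V) : Prop :=
  ∀ v, ∃ x ∈ S, x = v ∨ G.Adj x v

/-- `AliceWin G A B t`: in the Maker-Maker domination game on `G`, when Alice has already claimed
the vertices of `A`, Bob those of `B`, and `t` is the next player, Alice has a strategy which
ensures that she dominates `G` before Bob. A play stops as soon as one of the players dominates
`G`, or when no vertex is unclaimed (a draw if nobody dominates). -/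
inductive AliceWin (G : SimpleGraph V) : Set V → Set V → Player → Prop where
  /-- Alice dominates and Bob does not: she has won. -/
  | won {A B : Set V} {t : Player} (hA : IsDominating G A) (hB : ¬ IsDominating G B) :
      AliceWin G A B t
  /-- It is Alice's turn and one of her moves leads to a position that she wins. -/
  | aliceMove {A B : Set V} (hA : ¬ IsDominating G A) (hB : ¬ IsDominating G B)
      (x : V) (hxA : x ∉ A) (hxB : x ∉ B) (h : AliceWin G (insert x A) B .bob) :
      AliceWin G A B .alice
  /-- It is Bob's turn, he can move, and each of his moves leads to a position that Alice wins. -/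
  | bobMove {A B : Set V} (hA : ¬ IsDominating G A) (hB : ¬ IsDominating G B)
      (hne : ∃ x, x ∉ A ∧ x ∉ B)
      (h : ∀ x, x ∉ A → x ∉ B → AliceWin G A (insert x B) .alice) :
      AliceWin G A B .bob

/-! ### Leaves, parents of leaves, skeleton -/

/-- `L_F`: the leaves of `G`, i.e. the vertices of degree `1`. -/
def leaves (G : SimpleGraph V) : Set V :=
  {v | (G.neighborSet v).ncard = 1}

/-- `M_F`: the vertices adjacent to a leaf. -/
def leafParents (G : SimpleGraph V) : Set V :=
  {v | ∃ l ∈ leaves G, G.Adj v l}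

/-- `S_F`: the set of vertices of the skeleton, i.e. those that are neither a leaf nor adjacent to
a leaf. -/
def skeleton (G : SimpleGraph V) : Set V :=
  {v | v ∉ leaves G ∧ v ∉ leafParents G}

/-- `G` has a cherry: a vertex adjacent to two distinct leaves. -/
def HasCherry (G : SimpleGraph V) : Prop :=
  ∃ c, ∃ l₁ ∈ leaves G, ∃ l₂ ∈ leaves G, l₁ ≠ l₂ ∧ G.Adj c l₁ ∧ G.Adj c l₂

/-! ### The 0-1 labelling of a rooted tree and the condition on the first move -/

/-- In the tree `G` rooted in `r`, the vertex `w` is a child of `v`. -/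
def IsChild (G : SimpleGraph V) (r v w : V) : Prop :=
  G.Adj v w ∧ G.dist r w = G.dist r v + 1

/-- The labelling of the tree `G` rooted in `r`: `Label G r v false` means that `v` is labelled `0`,
and `Label G r v true` that `v` is labelled `1`. The root receives no label; another vertex is
labelled `0` if all its children are labelled `1` (in particular if it has no child), and `1` if at
least one of its children is labelled `0`. -/
inductive Label (G : SimpleGraph V) (r : V) : V → Bool → Prop where
  | zero {v : V} (hv : v ≠ r) (h : ∀ w, IsChild G r v w → Label G r w true) : Label G r v false
  | one {v w : V} (hv : v ≠ r) (hw : IsChild G r v w) (h : Label G r w false) : Label G r v true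

/-- The condition on the first move `v₀` of Alice: `S_F ∪ {v₀}` induces a tree, and in the labelling
of the tree rooted in `v₀` each vertex labelled `1` has a unique child. -/
def FirstMoveCondition (G : SimpleGraph V) (v₀ : V) : Prop :=
  (G.induce (skeleton G ∪ {v₀})).IsTree ∧
    ∀ v, Label G v₀ v true → ∃! w, IsChild G v₀ v w

/-! ### Favorable components of the skeleton -/

/-- The vertex set of a connected component of the skeleton, as a set of vertices of `G`. -/
def componentSet (G : SimpleGraph V) (C : (G.induce (skeleton G)).ConnectedComponent) : Set V :=
  Subtype.val '' C.supp

/-- `v` is adjacent to a vertex of `M_F` other than `v₀`. After Alice has claimed `v₀` and Bob all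
the other vertices of `M_F`, these are the vertices of the skeleton that Bob dominates. -/
def MeetsParents (G : SimpleGraph V) (v₀ v : V) : Prop :=
  ∃ m ∈ leafParents G, m ≠ v₀ ∧ G.Adj v m

/-- The set of vertices `K` induces a path `p 1, …, p n` (with `n ≥ 1`), attached to `v₀` by its
end `p 1` and by no other vertex. Values of `p` outside `{1, …, n}` are irrelevant. -/
structure IsPathFrom (G : SimpleGraph V) (v₀ : V) (K : Set V) (n : ℕ) (p : ℕ → V) : Prop where
  pos : 1 ≤ n
  injOn : Set.InjOn p (Set.Icc 1 n)
  image_eq : p '' Set.Icc 1 n = K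
  adj_iff : ∀ i ∈ Set.Icc 1 n, ∀ j ∈ Set.Icc 1 n, (G.Adj (p i) (p j) ↔ i + 1 = j ∨ j + 1 = i)
  root_adj_iff : ∀ i ∈ Set.Icc 1 n, (G.Adj v₀ (p i) ↔ i = 1)

/-- The set `U ⊆ {1, …, n - 1}` of the indices `i` such that `p i` is adjacent to a vertex of
`M_F` other than `v₀`. -/
def pendantIndices (G : SimpleGraph V) (v₀ : V) (n : ℕ) (p : ℕ → V) : Set ℕ :=
  {i | 1 ≤ i ∧ i + 1 ≤ n ∧ MeetsParents G v₀ (p i)}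

/-- The path has at most two vertices and `U` is empty. -/
def PathCaseA (n : ℕ) (U : Set ℕ) : Prop := (n = 1 ∨ n = 2) ∧ U = ∅

/-- The path has three vertices and `U` is contained in `{1}` or in `{2}`. -/
def PathCaseB (n : ℕ) (U : Set ℕ) : Prop := n = 3 ∧ (U ⊆ {1} ∨ U ⊆ {2})

/-- The path has at least four vertices and `U ⊆ {2, 3, n - 2}`. -/
def PathCaseC (n : ℕ) (U : Set ℕ) : Prop := 4 ≤ n ∧ U ⊆ {2, 3, n - 2}

/-- The path has an odd number `n ≥ 9` of vertices and `U ⊆ {2, 5, n - 2}`. -/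
def PathCaseD (n : ℕ) (U : Set ℕ) : Prop := 9 ≤ n ∧ Odd n ∧ U ⊆ {2, 5, n - 2}

/-- The path has `9` or `11` vertices and `{3, 5} ⊆ U ⊆ {2, 3, 5, n - 2}`; such a component is only
weakly favorable. -/
def PathCaseE (n : ℕ) (U : Set ℕ) : Prop :=
  (n = 9 ∨ n = 11) ∧ {3, 5} ⊆ U ∧ U ⊆ {2, 3, 5, n - 2}

/-- The set of vertices `K` induces a fork, i.e. a star with center `c` and `k ≥ 3` branches each of
which is subdivided exactly once: the `i`-th branch is the path `c, a i, b i`. The fork is attached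
to `v₀` by the leaf `b i₀` and by no other vertex. -/
structure IsForkFrom (G : SimpleGraph V) (v₀ : V) (K : Set V) {k : ℕ} (c : V) (a b : Fin k → V)
    (i₀ : Fin k) : Prop where
  three_le : 3 ≤ k
  a_injective : Function.Injective a
  b_injective : Function.Injective b
  a_ne_c : ∀ i, a i ≠ c
  b_ne_c : ∀ i, b i ≠ c
  a_ne_b : ∀ i j, a i ≠ b j
  eq_union : K = {c} ∪ Set.range a ∪ Set.range b
  adj_c_a : ∀ i, G.Adj c (a i)
  not_adj_c_b : ∀ i, ¬ G.Adj c (b i)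
  adj_a_b : ∀ i j, G.Adj (a i) (b j) ↔ i = j
  not_adj_a_a : ∀ i j, ¬ G.Adj (a i) (a j)
  not_adj_b_b : ∀ i j, ¬ G.Adj (b i) (b j)
  root_adj_iff : ∀ v ∈ K, (G.Adj v₀ v ↔ v = b i₀)

/-- `K` induces a fork attached to `v₀` by a leaf, and the only vertices of `K` that may
be adjacent to a vertex of `M_F` other than `v₀` are the center, the leaves of the fork except the
one adjacent to `v₀`, and the neighbour of the center on the path from the center to `v₀`. -/
def FavorableFork (G : SimpleGraph V) (v₀ : V) (K : Set V) : Prop :=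
  ∃ (k : ℕ) (c : V) (a b : Fin k → V) (i₀ : Fin k), IsForkFrom G v₀ K c a b i₀ ∧
    ∀ v ∈ K, MeetsParents G v₀ v → v = c ∨ (∃ i, i ≠ i₀ ∧ v = b i) ∨ v = a i₀

/-- The set of vertices `K` of a component of the skeleton is favorable for Alice, with respect to
the first move `v₀`. -/
def Favorable (G : SimpleGraph V) (v₀ : V) (K : Set V) : Prop :=
  (∃ n p, IsPathFrom G v₀ K n p ∧
    (PathCaseA n (pendantIndices G v₀ n p) ∨ PathCaseB n (pendantIndices G v₀ n p) ∨
      PathCaseC n (pendantIndices G v₀ n p) ∨ PathCaseD n (pendantIndices G v₀ n p) ∨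
      PathCaseE n (pendantIndices G v₀ n p))) ∨
  FavorableFork G v₀ K

/-- The set of vertices `K` of a component of the skeleton is weakly favorable: it is favorable
through the last of the path cases, or as a fork. -/
def WeaklyFavorable (G : SimpleGraph V) (v₀ : V) (K : Set V) : Prop :=
  (∃ n p, IsPathFrom G v₀ K n p ∧ PathCaseE n (pendantIndices G v₀ n p)) ∨ FavorableFork G v₀ K

end DominationGame

/-! Sufficiency. The game is replaced by a sum of disjoint local games, given by the sets that each
player still has to hit. Since Alice owns `v₀`, Bob must eventually claim the leaf at `v₀`. This is
a standing threat: once Alice takes that leaf, Bob can never dominate, and any pairing strategy that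
lets her dominate is enough. Every other leaf forms a pair with its neighbour, and every component
of the skeleton gives a path or a fork.

Each local game carries a weight, a measure of how many claims Bob needs beyond those that Alice
needs. Alice answers Bob locally without losing weight, and cashes in her threat whenever Bob leaves
her a pairing everywhere. When Bob parries the threat she either creates a new one or enters a pure
race, in which having the move is worth one unit (`IsRaceClass.win`). A weakly favorable component
may have to be turned into race positions by a move of Alice inside it. This uses up her free move,
so one such component can be afforded (`IsMainClass.win`, `MainTok.win`).

Necessity. Each vertex labelled `1` forms a pair with its only child. If Bob claims vertices
labelled `1` from the bottom up, Alice is forced to answer with the child each time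
(`Rooted.clear`). So Bob can clear the tree down to any upwards closed set of pairs, and by
`Rooted.WinsOn.prune` he can also detach such a set from what lies above it. A configuration with at
most eight pairs remains, for which an explicit strategy of Bob is checked by evaluation
(`Strategy.not_aliceWin_of_check`). These forbidden configurations restrict the positions of the
vertices adjacent to parents of leaves, the branchings, and the number of weak components; the
components that survive are the favorable ones. -/

namespace DominationGame

variable {V : Type*}

/-! ### Sufficiency: the clause game, pairings, threats and weights. -/

/-! ### Positions given by clauses -/

/-- A position of the clause game: Alice has to claim a vertex of each set of `EA`, Bob one of
each set of `EB`, and the vertices of `X` are known to be unclaimed. -/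
structure Pos (V : Type*) where
  X : Set V
  EA : Set (Set V)
  EB : Set (Set V)

namespace Pos

/-- The position after Alice has claimed `y`. -/
def aMove (P : Pos V) (y : V) : Pos V :=
  ⟨P.X \ {y}, {c | c ∈ P.EA ∧ y ∉ c}, {d | ∃ e ∈ P.EB, d = e \ {y}}⟩

/-- The position after Bob has claimed `z`. -/
def bMove (P : Pos V) (z : V) : Pos V :=
  ⟨P.X \ {z}, {c | ∃ e ∈ P.EA, c = e \ {z}}, {d | d ∈ P.EB ∧ z ∉ d}⟩

/-- The sum of two positions. -/
def add (P Q : Pos V) : Pos V := ⟨P.X ∪ Q.X, P.EA ∪ Q.EA, P.EB ∪ Q.EB⟩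

/-- The sum of a list of positions. -/
def sum (L : List (Pos V)) : Pos V :=
  ⟨{v | ∃ p ∈ L, v ∈ p.X}, {c | ∃ p ∈ L, c ∈ p.EA}, {d | ∃ p ∈ L, d ∈ p.EB}⟩

/-- The clauses only contain vertices known to be unclaimed. -/
def WF (P : Pos V) : Prop := (∀ c ∈ P.EA, c ⊆ P.X) ∧ ∀ d ∈ P.EB, d ⊆ P.X

/-- `P` is at least as good as `Q` for Alice. -/
def Better (P Q : Pos V) : Prop :=
  Q.X ⊆ P.X ∧ (∀ c ∈ P.EA, ∃ c' ∈ Q.EA, c' ⊆ c) ∧ ∀ d ∈ Q.EB, ∃ d' ∈ P.EB, d' ⊆ d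

/-- Disjointness of the vertex sets of two positions. -/
def Disj (P Q : Pos V) : Prop := ∀ v, v ∈ P.X → v ∉ Q.X

/-- Alice wins the clause game with Bob to move. -/
inductive W : Pos V → Prop
  | done {P : Pos V} (hA : P.EA = ∅) (hB : P.EB.Nonempty) : W P
  -- Here `z` ranges over all vertices, also those outside `X`: Bob may play where no clause sees
  -- it, and Alice needs an answer to that as well.
  | step {P : Pos V} (f : V → V) (hB : P.EB.Nonempty) (hB' : ∀ z, (P.bMove z).EB.Nonempty)
      (hX : ∀ z, f z ∈ P.X) (hz : ∀ z, f z ≠ z) (h : ∀ z, W ((P.bMove z).aMove (f z))) : W P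

theorem W.of_forall {P : Pos V} (hB : P.EB.Nonempty)
    (h : ∀ z, (P.bMove z).EB.Nonempty ∧ ∃ y ∈ P.X, y ≠ z ∧ W ((P.bMove z).aMove y)) : W P := by
  choose h1 f hf h2 h3 using h
  exact W.step f hB h1 hf h2 h3

theorem Better.refl (P : Pos V) : Better P P :=
  ⟨subset_rfl, fun c hc => ⟨c, hc, subset_rfl⟩, fun d hd => ⟨d, hd, subset_rfl⟩⟩

theorem Better.trans {P Q R : Pos V} (h : Better P Q) (h' : Better Q R) : Better P R := by
  refine ⟨h'.1.trans h.1, fun c hc => ?_, fun d hd => ?_⟩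
  · obtain ⟨c1, h1, h2⟩ := h.2.1 c hc
    obtain ⟨c2, h3, h4⟩ := h'.2.1 c1 h1
    exact ⟨c2, h3, h4.trans h2⟩
  · obtain ⟨c1, h1, h2⟩ := h'.2.2 d hd
    obtain ⟨c2, h3, h4⟩ := h.2.2 c1 h1
    exact ⟨c2, h3, h4.trans h2⟩

theorem Better.aMove {P Q : Pos V} (h : Better P Q) (y : V) : Better (P.aMove y) (Q.aMove y) := by
  refine ⟨Set.sdiff_subset_sdiff_left h.1, ?_, ?_⟩
  · rintro c ⟨hc, hy⟩
    obtain ⟨c1, h1, h2⟩ := h.2.1 c hc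
    exact ⟨c1, ⟨h1, fun hh => hy (h2 hh)⟩, h2⟩
  · rintro d ⟨e, he, rfl⟩
    obtain ⟨c1, h1, h2⟩ := h.2.2 e he
    exact ⟨c1 \ {y}, ⟨c1, h1, rfl⟩, Set.sdiff_subset_sdiff_left h2⟩

theorem Better.bMove {P Q : Pos V} (h : Better P Q) (z : V) : Better (P.bMove z) (Q.bMove z) := by
  refine ⟨Set.sdiff_subset_sdiff_left h.1, ?_, ?_⟩
  · rintro c ⟨e, he, rfl⟩
    obtain ⟨c1, h1, h2⟩ := h.2.1 e he
    exact ⟨c1 \ {z}, ⟨c1, h1, rfl⟩, Set.sdiff_subset_sdiff_left h2⟩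
  · rintro c ⟨hc, hy⟩
    obtain ⟨c1, h1, h2⟩ := h.2.2 c hc
    exact ⟨c1, ⟨h1, fun hh => hy (h2 hh)⟩, h2⟩

theorem Better.nonempty {P Q : Pos V} (h : Better P Q) (hQ : Q.EB.Nonempty) : P.EB.Nonempty := by
  obtain ⟨d, hd⟩ := hQ
  obtain ⟨d', h', -⟩ := h.2.2 d hd
  exact ⟨d', h'⟩

/-- Both kinds of moves preserve `Better`, so the answers for the worse position can be copied. -/
theorem W.mono {Q : Pos V} (hQ : W Q) : ∀ {P : Pos V}, Better P Q → W P := by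
  induction hQ with
  | @done Q hA hB =>
    intro P h
    refine W.done (Set.eq_empty_of_forall_notMem fun c hc => ?_) (h.nonempty hB)
    obtain ⟨c', h', -⟩ := h.2.1 c hc
    simp [hA] at h'
  | @step Q f hB hB' hX hz _ ih =>
    intro P h
    exact W.step f (h.nonempty hB) (fun z => (h.bMove z).nonempty (hB' z)) (fun z => h.1 (hX z)) hz
      fun z => ih z ((h.bMove z).aMove _)

/-! ### Sums -/

theorem Better.add {P P' Q Q' : Pos V} (h : Better P P') (h' : Better Q Q') :
    Better (P.add Q) (P'.add Q') := by
  refine ⟨Set.union_subset_union h.1 h'.1, ?_, ?_⟩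
  · rintro c (hc | hc)
    · obtain ⟨c1, h1, h2⟩ := h.2.1 c hc
      exact ⟨c1, Or.inl h1, h2⟩
    · obtain ⟨c1, h1, h2⟩ := h'.2.1 c hc
      exact ⟨c1, Or.inr h1, h2⟩
  · rintro c (hc | hc)
    · obtain ⟨c1, h1, h2⟩ := h.2.2 c hc
      exact ⟨c1, Or.inl h1, h2⟩
    · obtain ⟨c1, h1, h2⟩ := h'.2.2 c hc
      exact ⟨c1, Or.inr h1, h2⟩

theorem aMove_add (P Q : Pos V) (y : V) : (P.add Q).aMove y = (P.aMove y).add (Q.aMove y) := by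
  simp only [aMove, add, Pos.mk.injEq]
  refine ⟨Set.union_sdiff_distrib, ?_, ?_⟩
  · ext c; simp only [Set.mem_union, Set.mem_ofPred_eq]; tauto
  · ext c; simp only [Set.mem_union, Set.mem_ofPred_eq]
    constructor
    · rintro ⟨e, h | h, rfl⟩
      exacts [Or.inl ⟨e, h, rfl⟩, Or.inr ⟨e, h, rfl⟩]
    · rintro (⟨e, h, rfl⟩ | ⟨e, h, rfl⟩)
      exacts [⟨e, Or.inl h, rfl⟩, ⟨e, Or.inr h, rfl⟩]

theorem bMove_add (P Q : Pos V) (y : V) : (P.add Q).bMove y = (P.bMove y).add (Q.bMove y) := by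
  simp only [bMove, add, Pos.mk.injEq]
  refine ⟨Set.union_sdiff_distrib, ?_, ?_⟩
  · ext c; simp only [Set.mem_union, Set.mem_ofPred_eq]
    constructor
    · rintro ⟨e, h | h, rfl⟩
      exacts [Or.inl ⟨e, h, rfl⟩, Or.inr ⟨e, h, rfl⟩]
    · rintro (⟨e, h, rfl⟩ | ⟨e, h, rfl⟩)
      exacts [⟨e, Or.inl h, rfl⟩, ⟨e, Or.inr h, rfl⟩]
  · ext c; simp only [Set.mem_union, Set.mem_ofPred_eq]; tauto

/-- An extra claim of Alice does no harm as long as it uses up no vertex of `X`. -/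
theorem better_aMove {P : Pos V} {y : V} (hy : y ∉ P.X) : Better (P.aMove y) P := by
  refine ⟨fun v hv => ⟨hv, fun e => hy (e ▸ hv)⟩, fun c hc => ⟨c, hc.1, subset_rfl⟩, fun d hd =>
    ⟨d \ {y}, ⟨d, hd, rfl⟩, Set.sdiff_subset⟩⟩

theorem WF.better_bMove {P : Pos V} (h : WF P) {z : V} (hz : z ∉ P.X) : Better (P.bMove z) P := by
  refine ⟨fun v hv => ⟨hv, fun e => hz (e ▸ hv)⟩, ?_, fun d hd =>
    ⟨d, ⟨hd, fun hh => hz (h.2 d hd hh)⟩, subset_rfl⟩⟩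
  rintro c ⟨e, he, rfl⟩
  exact ⟨e, he, fun v hv => ⟨hv, fun e' => hz (e' ▸ h.1 e he hv)⟩⟩

theorem WF.add {P Q : Pos V} (h : WF P) (h' : WF Q) : WF (P.add Q) := by
  constructor
  · rintro c (hc | hc)
    exacts [(h.1 c hc).trans Set.subset_union_left, (h'.1 c hc).trans Set.subset_union_right]
  · rintro c (hc | hc)
    exacts [(h.2 c hc).trans Set.subset_union_left, (h'.2 c hc).trans Set.subset_union_right]

theorem WF.sum {L : List (Pos V)} (h : ∀ p ∈ L, WF p) : WF (sum L) :=
  ⟨fun c ⟨p, hp, hc⟩ _ hv => ⟨p, hp, (h p hp).1 c hc hv⟩,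
    fun c ⟨p, hp, hc⟩ _ hv => ⟨p, hp, (h p hp).2 c hc hv⟩⟩

theorem WF.bMove {P : Pos V} (h : WF P) (z : V) : WF (P.bMove z) := by
  constructor
  · rintro c ⟨e, he, rfl⟩
    exact Set.sdiff_subset_sdiff_left (h.1 e he)
  · rintro d ⟨hd, hz⟩ v hv
    exact ⟨h.2 d hd hv, fun e => hz (e ▸ hv)⟩

theorem WF.aMove {P : Pos V} (h : WF P) (z : V) : WF (P.aMove z) := by
  constructor
  · rintro d ⟨hd, hz⟩ v hv
    exact ⟨h.1 d hd hv, fun e => hz (e ▸ hv)⟩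
  · rintro c ⟨e, he, rfl⟩
    exact Set.sdiff_subset_sdiff_left (h.2 e he)

theorem sum_perm {L L' : List (Pos V)} (h : L.Perm L') : sum L = sum L' := by
  simp only [sum, h.mem_iff]

theorem sum_cons (P : Pos V) (L : List (Pos V)) : sum (P :: L) = P.add (sum L) := by
  simp only [sum, add, Pos.mk.injEq]
  refine ⟨?_, ?_, ?_⟩ <;> (ext v; simp)

theorem sum_append (L L' : List (Pos V)) : sum (L ++ L') = (sum L).add (sum L') := by
  simp only [sum, add, Pos.mk.injEq]
  refine ⟨?_, ?_, ?_⟩ <;> (ext v; simp [or_and_right, exists_or])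

theorem add_comm' (P Q : Pos V) : P.add Q = Q.add P := by
  simp only [add, Set.union_comm]

theorem add_assoc' (P Q R : Pos V) : (P.add Q).add R = P.add (Q.add R) := by
  simp only [add, Set.union_assoc]

theorem Better.bMove_add {T R N : Pos V} {z : V} (hR : WF R) (hz : z ∉ R.X)
    (h : Better (T.bMove z) N) : Better ((T.add R).bMove z) (N.add R) := by
  rw [Pos.bMove_add]; exact h.add (hR.better_bMove hz)

theorem Better.aMove_add {T R N : Pos V} {y : V} (hy : y ∉ R.X)
    (h : Better (T.aMove y) N) : Better ((T.add R).aMove y) (N.add R) := by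
  rw [Pos.aMove_add]; exact h.add (better_aMove hy)

theorem Better.move_add {T R N : Pos V} {y z : V} (hR : WF R) (hz : z ∉ R.X) (hy : y ∉ R.X)
    (h : Better ((T.bMove z).aMove y) N) :
    Better (((T.add R).bMove z).aMove y) (N.add R) :=
  ((Better.bMove_add hR hz (Better.refl _)).aMove y).trans (Better.aMove_add hy h)

theorem Disj.symm {P Q : Pos V} (h : Disj P Q) : Disj Q P := fun v hQ hP => h v hP hQ

/-! ### From the clause game to the domination game -/

/-- The hypotheses form an invariant. Each vertex not dominated by Alice has a clause inside its
closed neighbourhood; each clause of Bob covers what Alice does not own of a closed neighbourhood in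
which Bob owns nothing. So an unhit clause of Bob witnesses that he does not dominate. -/
theorem W.aliceWin {G : SimpleGraph V} {P : Pos V} (hP : W P) : ∀ {A B : Set V},
    (∀ v ∈ P.X, v ∉ A ∧ v ∉ B) →
    (∀ v, (∀ x, x = v ∨ G.Adj x v → x ∉ A) → ∃ c ∈ P.EA, ∀ x ∈ c, x = v ∨ G.Adj x v) →
    (∀ d ∈ P.EB, ∃ w, ∀ x, x = w ∨ G.Adj x w → x ∉ B ∧ (x ∈ A ∨ x ∈ d)) →
    AliceWin G A B .bob := by
  have key : ∀ {P : Pos V} {A B : Set V}, P.EB.Nonempty →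
      (∀ d ∈ P.EB, ∃ w, ∀ x, x = w ∨ G.Adj x w → x ∉ B ∧ (x ∈ A ∨ x ∈ d)) →
      ¬ IsDominating G B := by
    rintro P A B ⟨d, hd⟩ h hdom
    obtain ⟨w, hw⟩ := h d hd
    obtain ⟨x, hx, hxw⟩ := hdom w
    exact (hw x hxw).1 hx
  induction hP with
  | @done P hA hB =>
    intro A B hX hEA hEB
    refine AliceWin.won (fun v => ?_) (key hB hEB)
    by_contra hcon
    push Not at hcon
    obtain ⟨c, hc, -⟩ := hEA v (fun x hx hxA => by
      rcases hx with rfl | hx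
      · exact (hcon x hxA).1 rfl
      · exact (hcon x hxA).2 hx)
    simp [hA] at hc
  | @step P f hB hB' hX' hz hW ih =>
    intro A B hX hEA hEB
    have hBn := key hB hEB
    -- Alice may dominate although some of her clauses are left, since these need not be minimal.
    by_cases hA : IsDominating G A
    · exact AliceWin.won hA hBn
    have hEB' : ∀ z, z ∉ A → ∀ d ∈ (P.bMove z).EB, ∃ w, ∀ x, x = w ∨ G.Adj x w →
        x ∉ insert z B ∧ (x ∈ A ∨ x ∈ d) := by
      rintro z hzA d ⟨hd, hzd⟩
      obtain ⟨w, hw⟩ := hEB d hd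
      refine ⟨w, fun x hx => ⟨?_, (hw x hx).2⟩⟩
      rintro (rfl | hxB)
      · rcases (hw x hx).2 with h | h
        exacts [hzA h, hzd h]
      · exact (hw x hx).1 hxB
    obtain ⟨d, hd⟩ := hB
    obtain ⟨w, -⟩ := hEB d hd
    refine AliceWin.bobMove hA hBn ⟨f w, hX _ (hX' w)⟩ fun z hzA hzB => ?_
    have hfz := hX _ (hX' z)
    refine AliceWin.aliceMove hA (key (hB' z) (hEB' z hzA)) (f z) hfz.1
      (by rintro (h | h); exacts [hz z h, hfz.2 h]) ?_
    refine ih z ?_ ?_ ?_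
    · rintro v ⟨⟨hv, hvz⟩, hvf⟩
      exact ⟨by rintro (h | h); exacts [hvf h, (hX v hv).1 h],
        by rintro (h | h); exacts [hvz h, (hX v hv).2 h]⟩
    · intro v hv
      obtain ⟨c, hc, hcv⟩ := hEA v (fun x hx hxA => hv x hx (Or.inr hxA))
      refine ⟨c \ {z}, ⟨⟨c, hc, rfl⟩, fun hh => hv _ (hcv _ hh.1) (Or.inl rfl)⟩,
        fun x hx => hcv x hx.1⟩
    · rintro d ⟨e, he, rfl⟩
      obtain ⟨w, hw⟩ := hEB' z hzA e he
      refine ⟨w, fun x hx => ⟨(hw x hx).1, ?_⟩⟩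
      by_cases hxf : x = f z
      · exact Or.inl (Or.inl hxf)
      · rcases (hw x hx).2 with h | h
        exacts [Or.inl (Or.inr h), Or.inr ⟨h, hxf⟩]

/-! ### Pairings -/

/-- Alice can hit all her clauses with a pairing strategy. -/
def Paired (P : Pos V) : Prop :=
  ∃ r : V → V → Prop, (∀ a b, r a b → r b a) ∧ (∀ a b, r a b → a ∈ P.X ∧ a ≠ b) ∧
    (∀ a b c, r a b → r a c → b = c) ∧ ∀ c ∈ P.EA, ∃ a ∈ c, ∃ b ∈ c, r a b

theorem Paired.of_EA_eq_empty {P : Pos V} (h : P.EA = ∅) : Paired P :=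
  ⟨fun _ _ => False, by simp, by simp, by simp, by simp [h]⟩

theorem Paired.add {P Q : Pos V} (hP : Paired P) (hQ : Paired Q) (hd : Disj P Q) :
    Paired (P.add Q) := by
  obtain ⟨r, h1, h2, h3, h4⟩ := hP
  obtain ⟨s, k1, k2, k3, k4⟩ := hQ
  refine ⟨fun a b => r a b ∨ s a b, ?_, ?_, ?_, ?_⟩
  · rintro a b (h | h)
    exacts [Or.inl (h1 _ _ h), Or.inr (k1 _ _ h)]
  · rintro a b (h | h)
    exacts [⟨Or.inl (h2 _ _ h).1, (h2 _ _ h).2⟩, ⟨Or.inr (k2 _ _ h).1, (k2 _ _ h).2⟩]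
  · rintro a b c (h | h) (k | k)
    · exact h3 _ _ _ h k
    · exact absurd (k2 _ _ k).1 (hd _ (h2 _ _ h).1)
    · exact absurd (k2 _ _ h).1 (hd _ (h2 _ _ k).1)
    · exact k3 _ _ _ h k
  · rintro c (hc | hc)
    · obtain ⟨a, ha, b, hb, hab⟩ := h4 c hc
      exact ⟨a, ha, b, hb, Or.inl hab⟩
    · obtain ⟨a, ha, b, hb, hab⟩ := k4 c hc
      exact ⟨a, ha, b, hb, Or.inr hab⟩

theorem Paired.sum {L : List (Pos V)} (h : ∀ p ∈ L, Paired p) (hd : L.Pairwise Disj) :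
    Paired (sum L) := by
  induction L with
  | nil => exact Paired.of_EA_eq_empty (by simp [Pos.sum])
  | cons p L ih =>
    rw [sum_cons]
    rw [List.pairwise_cons] at hd
    refine (h p (by simp)).add (ih (fun q hq => h q (by simp [hq])) hd.2) ?_
    rintro v hv ⟨q, hq, hvq⟩
    exact hd.1 q hq v hv hvq

/-- Alice answers a move of Bob according to the pairing. -/
theorem Paired.reply {P : Pos V} {z z' : V} {r : V → V → Prop} (h1 : ∀ a b, r a b → r b a)
    (h2 : ∀ a b, r a b → a ∈ P.X ∧ a ≠ b) (h3 : ∀ a b c, r a b → r a c → b = c)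
    (h4 : ∀ c ∈ P.EA, ∃ a ∈ c, ∃ b ∈ c, r a b) (hz : r z z') :
    Paired ((P.bMove z).aMove z') := by
  refine ⟨fun a b => r a b ∧ a ≠ z ∧ a ≠ z' ∧ b ≠ z ∧ b ≠ z', ?_, ?_, ?_, ?_⟩
  · rintro a b ⟨h, k⟩
    exact ⟨h1 _ _ h, by tauto⟩
  · rintro a b ⟨h, k⟩
    exact ⟨⟨⟨(h2 a b h).1, k.1⟩, k.2.1⟩, (h2 a b h).2⟩
  · rintro a b c ⟨h, -⟩ ⟨k, -⟩
    exact h3 _ _ _ h k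
  · rintro c ⟨⟨e, he, rfl⟩, hy⟩
    obtain ⟨a, ha, b, hb, hab⟩ := h4 e he
    have hz'e : z' ∉ e := fun hh => hy ⟨hh, fun e' => (h2 _ _ hz).2 (Eq.symm e')⟩
    have ha' : a ≠ z' := fun e' => hz'e (e' ▸ ha)
    have hb' : b ≠ z' := fun e' => hz'e (e' ▸ hb)
    have haz : a ≠ z := by
      rintro rfl
      exact hb' (h3 _ _ _ hab hz)
    have hbz : b ≠ z := by
      rintro rfl
      exact ha' (h3 _ _ _ (h1 _ _ hab) hz)
    exact ⟨a, ⟨ha, haz⟩, b, ⟨hb, hbz⟩, hab, haz, ha', hbz, hb'⟩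

/-- A move of Bob outside the pairing destroys no pair, so Alice gets a free move. -/
theorem Paired.bMove_of_unpaired {P : Pos V} {z : V} {r : V → V → Prop}
    (h1 : ∀ a b, r a b → r b a)
    (h2 : ∀ a b, r a b → a ∈ P.X ∧ a ≠ b) (h3 : ∀ a b c, r a b → r a c → b = c)
    (h4 : ∀ c ∈ P.EA, ∃ a ∈ c, ∃ b ∈ c, r a b) (hz : ∀ z', ¬ r z z') : Paired (P.bMove z) := by
  refine ⟨r, h1, fun a b hab => ⟨⟨(h2 a b hab).1, ?_⟩, (h2 a b hab).2⟩, h3, ?_⟩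
  · rintro rfl
    exact hz _ hab
  · rintro c ⟨e, he, rfl⟩
    obtain ⟨a, ha, b, hb, hab⟩ := h4 e he
    refine ⟨a, ⟨ha, ?_⟩, b, ⟨hb, ?_⟩, hab⟩
    · rintro rfl
      exact hz _ hab
    · rintro rfl
      exact hz _ (h1 _ _ hab)

theorem Paired.aMove {P : Pos V} (hP : Paired P) (y : V) : Paired (P.aMove y) := by
  obtain ⟨r, h1, h2, h3, h4⟩ := hP
  refine ⟨fun a b => r a b ∧ a ≠ y ∧ b ≠ y, fun a b h => ⟨h1 _ _ h.1, h.2.symm⟩,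
    fun a b h => ⟨⟨(h2 _ _ h.1).1, h.2.1⟩, (h2 _ _ h.1).2⟩, fun a b c h k => h3 _ _ _ h.1 k.1, ?_⟩
  rintro c ⟨hc, hy⟩
  obtain ⟨a, ha, b, hb, hab⟩ := h4 c hc
  exact ⟨a, ha, b, hb, hab, fun e => hy (e ▸ ha), fun e => hy (e ▸ hb)⟩

theorem ncard_move_lt [Finite V] {P : Pos V} {y z : V} (hy : y ∈ P.X) :
    ((P.bMove z).aMove y).X.ncard < P.X.ncard :=
  Set.ncard_lt_ncard ⟨fun _ hv => hv.1.1, fun h => (h hy).2 rfl⟩ (Set.toFinite _)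

theorem ncard_aMove_lt [Finite V] {P : Pos V} {y : V} (hy : y ∈ P.X) :
    (P.aMove y).X.ncard < P.X.ncard :=
  Set.ncard_lt_ncard ⟨fun _ hv => hv.1, fun h => (h hy).2 rfl⟩ (Set.toFinite _)

/-- If Bob cannot dominate any more, a pairing suffices. -/
theorem Paired.W_of_killed [Finite V] {P : Pos V} (hP : Paired P) (hk : ∅ ∈ P.EB) : W P := by
  suffices ∀ n, ∀ P : Pos V, P.X.ncard ≤ n → Paired P → ∅ ∈ P.EB → W P from
    this _ _ le_rfl hP hk
  clear! P
  intro n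
  induction n using Nat.strong_induction_on with
  | _ n ih =>
  intro P hn hP hk
  rcases Set.eq_empty_or_nonempty P.EA with hE | ⟨c, hc⟩
  · exact W.done hE ⟨_, hk⟩
  refine W.of_forall ⟨_, hk⟩ fun z => ⟨⟨∅, hk, by simp⟩, ?_⟩
  have hk' : ∀ y, ∅ ∈ ((P.bMove z).aMove y).EB := fun y => ⟨∅, ⟨hk, by simp⟩, by simp⟩
  have hP' := hP
  obtain ⟨r, h1, h2, h3, h4⟩ := hP
  by_cases hz : ∃ z', r z z'
  · obtain ⟨z', hz⟩ := hz
    have hX := (h2 _ _ (h1 _ _ hz)).1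
    exact ⟨z', hX, ((h2 _ _ hz).2).symm, ih _ (lt_of_lt_of_le (ncard_move_lt hX) hn) _ le_rfl
      (Paired.reply h1 h2 h3 h4 hz) (hk' _)⟩
  · push Not at hz
    -- No answer is needed, so Alice may claim a member of any pair.
    obtain ⟨a, ha, b, hb, hab⟩ := h4 c hc
    have hX := (h2 _ _ hab).1
    exact ⟨a, hX, fun e => hz _ (e ▸ hab), ih _ (lt_of_lt_of_le (ncard_move_lt hX) hn) _ le_rfl
      ((Paired.bMove_of_unpaired h1 h2 h3 h4 hz).aMove a) (hk' _)⟩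

/-- The position in which Bob has to claim a vertex of `d`, and nothing else matters. -/
def need (d : Set V) : Pos V := ⟨d, ∅, {d}⟩

theorem need_WF (d : Set V) : WF (need d) := ⟨by simp [need], by simp [need]⟩

/-- Alice wins moving in `S`, if a pairing suffices elsewhere. -/
def Threat (S : Pos V) : Prop :=
  ∀ R : Pos V, WF R → Paired R → Disj S R → ∃ y ∈ S.X, W ((S.add R).aMove y)

/-- Alice wins if she has two independent threats. -/
theorem W_of_two_threats [Finite V] {d : V} {S R : Pos V} (hS : Threat S) (hSA : S.EA = ∅)
    (hSW : WF S) (hR : WF R) (hP : Paired R) (hSR : Disj S R) (hdS : d ∉ S.X) (hdR : d ∉ R.X) :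
    W ((need {d}).add (S.add R)) := by
  suffices ∀ n, ∀ R : Pos V, R.X.ncard ≤ n → WF R → Paired R → Disj S R → d ∉ R.X →
      W ((need {d}).add (S.add R)) from this _ _ le_rfl hR hP hSR hdR
  clear! R
  intro n
  induction n using Nat.strong_induction_on with
  | _ n ih =>
  intro R hn hR hP hSR hdR
  have hne : ((need {d}).add (S.add R)).EB.Nonempty := ⟨{d}, Or.inl rfl⟩
  have hdSR : d ∉ (S.add R).X := by rintro (h | h); exacts [hdS h, hdR h]
  have hWSR : WF (S.add R) := hSW.add hR
  refine W.of_forall hne fun z => ?_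
  -- Taking `d` is Bob's way to parry the first threat; Alice then executes the one in `S`.
  by_cases hzd : z = d
  · subst hzd
    obtain ⟨y, hy, hW⟩ := hS R hR hP hSR
    have hb : Better (((need {z}).add (S.add R)).bMove z) (S.add R) := by
      rw [bMove_add]
      refine Better.trans ?_ (WF.better_bMove hWSR hdSR)
      refine ⟨Set.subset_union_right, ?_, fun d hd => ⟨d, Or.inr hd, subset_rfl⟩⟩
      rintro c (⟨e, he, rfl⟩ | hc)
      · simp [need] at he
      · exact ⟨c, hc, subset_rfl⟩
    refine ⟨hb.nonempty ?_, y, Or.inr (Or.inl hy), fun e => hdS (e ▸ hy), hW.mono (hb.aMove y)⟩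
    by_contra hcon
    have hcon' : (S.add R).EB = ∅ := Set.not_nonempty_iff_eq_empty.1 hcon
    have : ((S.add R).aMove y).EB.Nonempty := by
      cases hW with
      | done _ h => exact h
      | step _ h => exact h
    obtain ⟨e, e', he, -⟩ := this
    simp [hcon'] at he
  · have hne' : (((need {d}).add (S.add R)).bMove z).EB.Nonempty :=
      ⟨{d}, Or.inl rfl, by simpa using hzd⟩
    refine ⟨hne', ?_⟩
    have hP' := hP
    obtain ⟨r, h1, h2, h3, h4⟩ := hP
    -- A move inside the pairing is answered by the partner, and both threats persist.
    by_cases hz : ∃ z', r z z'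
    · obtain ⟨z', hz⟩ := hz
      have hX := (h2 _ _ (h1 _ _ hz)).1
      have hzX := (h2 _ _ hz).1
      refine ⟨z', Or.inr (Or.inr hX), ((h2 _ _ hz).2).symm, ?_⟩
      have hlt : ((R.bMove z).aMove z').X.ncard < R.X.ncard := ncard_move_lt hX
      refine (ih _ (lt_of_lt_of_le hlt hn) _ le_rfl ((hR.bMove z).aMove z')
        (Paired.reply h1 h2 h3 h4 hz) (fun v hv hv' => hSR v hv hv'.1.1)
        (fun h => hdR h.1.1)).mono ?_
      have hb : Better ((((need {d}).add S).bMove z).aMove z') ((need {d}).add S) :=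
        ((((need_WF _).add hSW).better_bMove ?_).aMove z').trans (better_aMove ?_)
      · rw [← add_assoc', ← add_assoc', bMove_add, aMove_add]
        exact hb.add (Better.refl _)
      · rintro (h | h)
        exacts [hzd h, hSR _ h hzX]
      · rintro (h | h)
        exacts [hdR (by rw [← show z' = d from h]; exact hX), hSR _ h hX]
    · push Not at hz
      -- Bob has moved outside the pairing, possibly in `S`, where Alice has no obligation. She
      -- takes `d`: the set `{d}` becomes empty, and Bob can never hit it.
      refine ⟨d, Or.inl rfl, Ne.symm hzd, ?_⟩
      refine Paired.W_of_killed (Paired.aMove ?_ _) ⟨{d}, ⟨Or.inl rfl, by simpa using hzd⟩, by simp⟩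
      have hPR := Paired.bMove_of_unpaired h1 h2 h3 h4 hz
      rw [← add_assoc', bMove_add]
      refine Paired.add (Paired.of_EA_eq_empty ?_) hPR ?_
      · simp [bMove, Pos.add, need, hSA]
      · rintro v ⟨hv | hv, -⟩ ⟨hv', -⟩
        · exact hdR (by rw [← show v = d from hv]; exact hv')
        · exact hSR _ hv hv'

theorem W.EB_nonempty {P : Pos V} (h : W P) : P.EB.Nonempty := by
  cases h with
  | done _ h => exact h
  | step _ h => exact h

theorem EB_nonempty_of_aMove {P : Pos V} {y : V} (h : (P.aMove y).EB.Nonempty) :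
    P.EB.Nonempty := by
  obtain ⟨d, e, he, -⟩ := h
  exact ⟨e, he⟩

theorem W.of_replies {P : Pos V} (hB : P.EB.Nonempty)
    (h : ∀ z, ∃ y ∈ P.X, y ≠ z ∧ W ((P.bMove z).aMove y)) : W P := by
  refine W.of_forall hB fun z => ⟨?_, h z⟩
  obtain ⟨y, -, -, hW⟩ := h z
  exact EB_nonempty_of_aMove hW.EB_nonempty

/-! ### Positions with a weight -/

/-- A position with a weight, which counts the vertices that Bob has to claim in addition to those
that Alice has to claim, and a degree of weakness. -/
structure Tok (V : Type*) where
  pos : Pos V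
  wt : ℤ
  weak : ℕ

/-- The sum of the positions of a list. -/
def total (L : List (Tok V)) : Pos V := sum (L.map Tok.pos)

/-- The total weight of a list of positions. -/
def wts (L : List (Tok V)) : ℤ := (L.map Tok.wt).sum

/-- The total weakness of a list of positions. -/
def weaks (L : List (Tok V)) : ℕ := (L.map Tok.weak).sum

/-- All members of the list belong to the class `T` and they are disjoint. -/
def Good (T : Tok V → Prop) (L : List (Tok V)) : Prop :=
  (∀ t ∈ L, T t) ∧ L.Pairwise fun s t => Disj s.pos t.pos

theorem total_cons (t : Tok V) (L : List (Tok V)) : total (t :: L) = t.pos.add (total L) := by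
  simp [total, sum_cons]

theorem total_append (L L' : List (Tok V)) : total (L ++ L') = (total L).add (total L') := by
  simp [total, sum_append]

@[simp] theorem wts_cons (t : Tok V) (L : List (Tok V)) : wts (t :: L) = t.wt + wts L := by
  simp [wts]

@[simp] theorem wts_nil : wts ([] : List (Tok V)) = 0 := rfl

@[simp] theorem weaks_nil : weaks ([] : List (Tok V)) = 0 := rfl

@[simp] theorem wts_append (L L' : List (Tok V)) : wts (L ++ L') = wts L + wts L' := by
  simp [wts]

@[simp] theorem weaks_cons (t : Tok V) (L : List (Tok V)) : weaks (t :: L) = t.weak + weaks L := by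
  simp [weaks]

@[simp] theorem weaks_append (L L' : List (Tok V)) : weaks (L ++ L') = weaks L + weaks L' := by
  simp [weaks]

theorem mem_total_X {L : List (Tok V)} {v : V} : v ∈ (total L).X ↔ ∃ t ∈ L, v ∈ t.pos.X := by
  simp [total, sum]

theorem mem_total_EA {L : List (Tok V)} {c : Set V} :
    c ∈ (total L).EA ↔ ∃ t ∈ L, c ∈ t.pos.EA := by
  simp [total, sum]

theorem mem_total_EB {L : List (Tok V)} {c : Set V} :
    c ∈ (total L).EB ↔ ∃ t ∈ L, c ∈ t.pos.EB := by
  simp [total, sum]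

theorem exists_wt_pos {L : List (Tok V)} (h : 0 < wts L) : ∃ t ∈ L, 0 < t.wt := by
  induction L with
  | nil => simp at h
  | cons t L ih =>
    by_cases ht : 0 < t.wt
    · exact ⟨t, by simp, ht⟩
    · obtain ⟨s, hs, hs'⟩ := ih (by simp at h; omega)
      exact ⟨s, by simp [hs], hs'⟩

/-- Bring a member of a list to the front. -/
theorem exists_front {T : Tok V → Prop} {L : List (Tok V)} (hL : Good T L) {t : Tok V}
    (ht : t ∈ L) : ∃ L0, total L = t.pos.add (total L0) ∧ wts L = t.wt + wts L0 ∧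
      weaks L = t.weak + weaks L0 ∧ T t ∧ Good T L0 ∧ (∀ s ∈ L0, Disj t.pos s.pos) ∧
      ∀ s ∈ L0, s ∈ L := by
  obtain ⟨a, b, rfl⟩ := List.append_of_mem ht
  have hp : (a ++ t :: b).Perm (t :: (a ++ b)) := List.perm_middle
  have hpw := (hp.pairwise_iff (R := fun s t : Tok V => Disj s.pos t.pos)
    (fun h => Disj.symm h)).1 hL.2
  rw [List.pairwise_cons] at hpw
  refine ⟨a ++ b, ?_, ?_, ?_, hL.1 t ht, ⟨fun s hs => hL.1 s ?_, hpw.2⟩, hpw.1, fun s hs => ?_⟩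
  · rw [← total_cons]
    exact sum_perm (hp.map _)
  · simp; ring
  · simp; ring
  · simp at hs ⊢; tauto
  · simp at hs ⊢; tauto

theorem Good.disj_total {t : Pos V} {L : List (Tok V)} (h : ∀ s ∈ L, Disj t s.pos) :
    Disj t (total L) := by
  intro v hv hv'
  obtain ⟨s, hs, hvs⟩ := mem_total_X.1 hv'
  exact h s hs v hv hvs

theorem Good.append {T : Tok V → Prop} {L L' : List (Tok V)} (hL : Good T L) (hL' : Good T L')
    (h : Disj (total L) (total L')) : Good T (L ++ L') := by
  refine ⟨fun t ht => ?_, List.pairwise_append.2 ⟨hL.2, hL'.2, fun s hs t ht v hv hv' => ?_⟩⟩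
  · rcases List.mem_append.1 ht with h | h
    exacts [hL.1 t h, hL'.1 t h]
  · exact h v (mem_total_X.2 ⟨s, hs, hv⟩) (mem_total_X.2 ⟨t, ht, hv'⟩)

theorem Good.total_WF {T : Tok V → Prop} (hT : ∀ t, T t → WF t.pos) {L : List (Tok V)}
    (hL : Good T L) : WF (total L) :=
  WF.sum fun p hp => by
    obtain ⟨t, ht, rfl⟩ := List.mem_map.1 hp
    exact hT t (hL.1 t ht)

theorem Disj.mono {P P' Q Q' : Pos V} (h : Disj P Q) (hP : P'.X ⊆ P.X) (hQ : Q'.X ⊆ Q.X) :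
    Disj P' Q' := fun v hv hv' => h v (hP hv) (hQ hv')

theorem exists_EA {L : List (Tok V)} (h : (total L).EA.Nonempty) :
    ∃ t ∈ L, t.pos.EA.Nonempty := by
  obtain ⟨c, hc⟩ := h
  obtain ⟨t, ht, hc⟩ := mem_total_EA.1 hc
  exact ⟨t, ht, c, hc⟩

/-! ### Races: positions without obligation to kill -/

/-- A class of positions for which Alice can answer each move of Bob without loss of weight, and
gains one unit of weight if she is to move. -/
structure IsRaceClass (T : Tok V → Prop) : Prop where
  wf : ∀ t, T t → WF t.pos
  nonempty_of_pos : ∀ t, T t → 0 < t.wt → t.pos.EB.Nonempty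
  -- In the first alternative Bob spends his move where Alice has no obligation: at most one unit is
  -- lost, and she moves elsewhere.
  bob : ∀ t, T t → ∀ z ∈ t.pos.X, (t.pos.EA = ∅ ∧ t.wt ≤ 1) ∨
    ∃ y ∈ t.pos.X, y ≠ z ∧ ∃ L, Good T L ∧ t.wt ≤ wts L ∧
      Better ((t.pos.bMove z).aMove y) (total L)
  alice : ∀ t, T t → t.pos.EA.Nonempty → ∃ y ∈ t.pos.X, ∃ L, Good T L ∧ t.wt + 1 ≤ wts L ∧
    Better (t.pos.aMove y) (total L)

theorem IsRaceClass.alice_move {T : Tok V → Prop} (hT : IsRaceClass T) {L : List (Tok V)}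
    (hL : Good T L) (hA : (total L).EA.Nonempty) : ∃ y ∈ (total L).X, ∃ L', Good T L' ∧
      wts L + 1 ≤ wts L' ∧ Better ((total L).aMove y) (total L') := by
  obtain ⟨t, ht, hA⟩ := exists_EA hA
  obtain ⟨L0, h1, h2, -, h3, h4, h5, -⟩ := exists_front hL ht
  obtain ⟨y, hy, L1, k1, k2, k3⟩ := hT.alice t h3 hA
  have hd := Good.disj_total h5
  have hyL : y ∉ (total L0).X := hd y hy
  refine ⟨y, by rw [h1]; exact Or.inl hy, L1 ++ L0, k1.append h4 (hd.mono (k3.1.trans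
    Set.sdiff_subset) subset_rfl), by simp; omega, ?_⟩
  rw [h1, total_append]
  exact Better.aMove_add hyL k3

/-- The invariant is weight at least `1` with Bob to move. Positive weight guarantees an unhit set
of Bob, so Alice wins when she has hit her last set. If Bob moves outside the sum, or where no
answer is needed, her free move gains the unit that may have been lost. -/
theorem IsRaceClass.win [Finite V] {T : Tok V → Prop} (hT : IsRaceClass T) {L : List (Tok V)}
    (hL : Good T L) (hw : 1 ≤ wts L) : W (total L) := by
  suffices ∀ n, ∀ L : List (Tok V), (total L).X.ncard ≤ n → Good T L → 1 ≤ wts L → W (total L) from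
    this _ _ le_rfl hL hw
  clear! L
  intro n
  induction n using Nat.strong_induction_on with
  | _ n ih =>
  intro L hn hL hw
  have hB : (total L).EB.Nonempty := by
    obtain ⟨t, ht, h⟩ := exists_wt_pos (show 0 < wts L by omega)
    obtain ⟨d, hd⟩ := hT.nonempty_of_pos t (hL.1 t ht) h
    exact ⟨d, mem_total_EB.2 ⟨t, ht, hd⟩⟩
  rcases Set.eq_empty_or_nonempty (total L).EA with hE | hE
  · exact W.done hE hB
  refine W.of_replies hB fun z => ?_
  -- Alice to move in a good list of nonnegative weight
  have key : ∀ L', Good T L' → 0 ≤ wts L' → (total L').EA.Nonempty → (total L').X ⊆ (total L).X →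
      ∃ y ∈ (total L').X, W ((total L').aMove y) := by
    intro L' hL' hw' hE' hX
    obtain ⟨y, hy, L1, h1, h2, h3⟩ := hT.alice_move hL' hE'
    refine ⟨y, hy, W.mono (ih (total L1).X.ncard ?_ L1 le_rfl h1 (by omega)) h3⟩
    refine lt_of_lt_of_le (lt_of_le_of_lt (Set.ncard_le_ncard h3.1 (Set.toFinite _))
      (ncard_aMove_lt hy)) (le_trans (Set.ncard_le_ncard hX (Set.toFinite _)) hn)
  by_cases hz : z ∈ (total L).X
  · obtain ⟨t, ht, hzt⟩ := mem_total_X.1 hz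
    obtain ⟨L0, h1, h2, -, h3, h4, h5, -⟩ := exists_front hL ht
    have hd := Good.disj_total h5
    have hW0 := h4.total_WF hT.wf
    rcases hT.bob t h3 z hzt with ⟨hA, hwt⟩ | ⟨y, hy, hyz, L1, k1, k2, k3⟩
    · have hE0 : (total L0).EA.Nonempty := by
        obtain ⟨c, hc⟩ := hE
        rw [h1] at hc
        rcases hc with hc | hc
        · simp [hA] at hc
        · exact ⟨c, hc⟩
      obtain ⟨y, hy, hW⟩ := key L0 h4 (by omega) hE0 (by rw [h1]; exact Set.subset_union_right)
      refine ⟨y, by rw [h1]; exact Or.inr hy, ?_, hW.mono (Better.aMove ?_ y)⟩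
      · rintro rfl
        exact hd _ hzt hy
      · rw [h1, bMove_add]
        refine Better.trans ?_ (hW0.better_bMove (hd z hzt))
        refine ⟨Set.subset_union_right, ?_, fun d hd => ⟨d, Or.inr hd, subset_rfl⟩⟩
        rintro c (⟨e, he, rfl⟩ | hc)
        · simp [hA] at he
        · exact ⟨c, hc, subset_rfl⟩
    · have hX : y ∈ (total L).X := by rw [h1]; exact Or.inl hy
      refine ⟨y, hX, hyz, ?_⟩
      have hb : Better (((total L).bMove z).aMove y) (total (L1 ++ L0)) := by
        rw [h1, total_append]
        exact Better.move_add hW0 (hd z hzt) (hd y hy) k3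
      refine W.mono (ih _ ?_ (L1 ++ L0) le_rfl (k1.append h4 (hd.mono (k3.1.trans
        (Set.sdiff_subset.trans Set.sdiff_subset)) subset_rfl)) (by simp; omega)) hb
      exact lt_of_lt_of_le (lt_of_le_of_lt (Set.ncard_le_ncard hb.1 (Set.toFinite _))
        (ncard_move_lt hX)) hn
  · obtain ⟨y, hy, hW⟩ := key L hL (by omega) hE subset_rfl
    exact ⟨y, hy, fun e => hz (e ▸ hy), hW.mono
      (((hL.total_WF hT.wf).better_bMove hz).aMove y)⟩

/-! ### Positions in which Alice has a threat -/

/-- Alice has a threat with `S`: she wins if she is to move and a pairing suffices elsewhere, and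
when Bob moves in `S` either this persists, or he leaves positions of the class `T`. -/
structure IsThreatClass (T S : Tok V → Prop) : Prop where
  wf : ∀ s, S s → WF s.pos
  EA_eq : ∀ s, S s → s.pos.EA = ∅
  EB_nonempty : ∀ s, S s → s.pos.EB.Nonempty
  threat : ∀ s, S s → Threat s.pos
  -- Either Bob parries and Alice, being on move, finds the weight preserved, or his move in `S`
  -- does not parry and she wins at once.
  bob : ∀ s, S s → ∀ z ∈ s.pos.X,
    (∃ L, Good T L ∧ s.wt ≤ wts L ∧ weaks L = 0 ∧ Better (s.pos.bMove z) (total L)) ∨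
    ∀ R : Pos V, WF R → Paired R → Disj s.pos R →
      ∃ y ∈ s.pos.X, y ≠ z ∧ W (((s.pos.bMove z).add R).aMove y)

/-- A class of positions which Alice can handle if she has a threat elsewhere. -/
structure IsMainClass (R T S : Tok V → Prop) : Prop where
  wf : ∀ t, T t → WF t.pos
  paired : ∀ t, T t → Paired t.pos
  -- Three kinds of answers: a local one that preserves the weight; executing the threat elsewhere,
  -- because a pairing is left here; or making a second threat at `d` that leaves a pairing.
  bob : ∀ t, T t → ∀ z ∈ t.pos.X,
    (∃ y ∈ t.pos.X, y ≠ z ∧ ∃ L, Good T L ∧ t.wt ≤ wts L ∧ weaks L ≤ t.weak ∧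
      Better ((t.pos.bMove z).aMove y) (total L)) ∨
    Paired (t.pos.bMove z) ∨
    ∃ y ∈ t.pos.X, y ≠ z ∧ ∃ d, ∃ Q : Pos V, WF Q ∧ Paired Q ∧ d ∉ Q.X ∧
      Better ((t.pos.bMove z).aMove y) ((need {d}).add Q)
  -- This is used after Bob has parried the threat. Alice makes a new threat here, or the position
  -- already counts as a race, or, if it is weak, her move gains a unit while turning it into a
  -- race.
  alice : ∀ t, T t →
    (∃ y ∈ t.pos.X, ∃ s, S s ∧ ∃ L, Good T L ∧ t.wt ≤ s.wt + wts L ∧ weaks L ≤ t.weak ∧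
      Disj s.pos (total L) ∧ Better (t.pos.aMove y) (s.pos.add (total L))) ∨
    (∃ L, Good R L ∧ t.wt ≤ wts L ∧ Better t.pos (total L)) ∨
    (1 ≤ t.weak ∧ ∃ y ∈ t.pos.X, ∃ L, Good R L ∧ t.wt + 1 ≤ wts L ∧
      Better (t.pos.aMove y) (total L))

theorem exists_race_list {R T : Tok V → Prop} {L : List (Tok V)} (hL : Good T L)
    (h : ∀ t ∈ L, ∃ L', Good R L' ∧ t.wt ≤ wts L' ∧ Better t.pos (total L')) :
    ∃ L', Good R L' ∧ wts L ≤ wts L' ∧ Better (total L) (total L') := by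
  induction L with
  | nil => exact ⟨[], ⟨by simp, by simp⟩, le_rfl, Better.refl _⟩
  | cons t L ih =>
    have hp := List.pairwise_cons.1 hL.2
    obtain ⟨L1, h1, h2, h3⟩ := ih ⟨fun s hs => hL.1 s (by simp [hs]), hp.2⟩
      (fun s hs => h s (by simp [hs]))
    obtain ⟨L2, k1, k2, k3⟩ := h t (by simp)
    refine ⟨L2 ++ L1, k1.append h1 ((Good.disj_total hp.1).mono k3.1 h3.1), by simp; omega, ?_⟩
    rw [total_cons, total_append]
    exact k3.add h3

/-- With a threat on the board, total weight `0` suffices, one unit less than in a race: Bob must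
spend a move on the threat, and Alice's free move then brings the missing unit or a new threat. -/
theorem IsMainClass.win [Finite V] {R T S : Tok V → Prop} (hR : IsRaceClass R)
    (hT : IsMainClass R T S) (hS : IsThreatClass T S) {s : Tok V} {L : List (Tok V)} (hs : S s)
    (hL : Good T L) (hd : Disj s.pos (total L)) (hw : 0 ≤ s.wt + wts L) (hk : weaks L ≤ 1) :
    W (s.pos.add (total L)) := by
  suffices ∀ n, ∀ (s : Tok V) (L : List (Tok V)), (s.pos.add (total L)).X.ncard ≤ n → S s →
      Good T L → Disj s.pos (total L) → 0 ≤ s.wt + wts L → weaks L ≤ 1 →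
      W (s.pos.add (total L)) from this _ _ _ le_rfl hs hL hd hw hk
  clear! s L
  intro n
  induction n using Nat.strong_induction_on with
  | _ n ih =>
  intro s L hn hs hL hd hw hk
  have hWL := hL.total_WF hT.wf
  have hWs := hS.wf s hs
  have hPL : ∀ L, Good T L → Paired (total L) := fun L hL =>
    Paired.sum (fun p hp => by
      obtain ⟨t, ht, rfl⟩ := List.mem_map.1 hp
      exact hT.paired t (hL.1 t ht)) (List.pairwise_map.2 hL.2)
  have hB : (s.pos.add (total L)).EB.Nonempty := (hS.EB_nonempty s hs).mono Set.subset_union_left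
  rcases Set.eq_empty_or_nonempty (total L).EA with hE | hE
  · exact W.done (by simp [Pos.add, hE, hS.EA_eq s hs]) hB
  -- Alice to move
  have key : ∀ L', Good T L' → 0 ≤ wts L' → weaks L' ≤ 1 → (total L').EA.Nonempty →
      (total L').X.ncard ≤ n → ∃ y ∈ (total L').X, W ((total L').aMove y) := by
    intro L' hL' hw' hk' hE' hX
    by_cases h1 : ∃ t ∈ L', ∃ y ∈ t.pos.X, ∃ s, S s ∧ ∃ L, Good T L ∧ t.wt ≤ s.wt + wts L ∧
        weaks L ≤ t.weak ∧ Disj s.pos (total L) ∧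
        Better (t.pos.aMove y) (s.pos.add (total L))
    · obtain ⟨t, ht, y, hy, s', hs', L1, k1, k2, k3, k4, k5⟩ := h1
      obtain ⟨L0, e1, e2, e3, e4, e5, e6, -⟩ := exists_front hL' ht
      have hd0 := Good.disj_total e6
      have hyX : y ∈ (total L').X := by rw [e1]; exact Or.inl hy
      have hb : Better ((total L').aMove y) (s'.pos.add (total (L1 ++ L0))) := by
        rw [e1, total_append, ← add_assoc']
        exact Better.aMove_add (hd0 y hy) k5
      have hsub : s'.pos.X ∪ (total L1).X ⊆ t.pos.X := k5.1.trans Set.sdiff_subset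
      refine ⟨y, hyX, W.mono (ih _ ?_ s' (L1 ++ L0) le_rfl hs' ?_ ?_ ?_ ?_) hb⟩
      · exact lt_of_lt_of_le (lt_of_le_of_lt (Set.ncard_le_ncard hb.1 (Set.toFinite _))
          (ncard_aMove_lt hyX)) hX
      · exact k1.append e5 (hd0.mono (Set.subset_union_right.trans hsub) subset_rfl)
      · rw [total_append]
        rintro v hv (h | h)
        · exact k4 v hv h
        · exact hd0 v (hsub (Or.inl hv)) h
      · simp; omega
      · simp; omega
    by_cases h2 : ∃ t ∈ L', 1 ≤ t.weak ∧ ∃ y ∈ t.pos.X, ∃ L, Good R L ∧ t.wt + 1 ≤ wts L ∧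
        Better (t.pos.aMove y) (total L)
    · obtain ⟨t, ht, hwk, y, hy, L1, k1, k2, k3⟩ := h2
      obtain ⟨L0, e1, e2, e3, e4, e5, e6, e7⟩ := exists_front hL' ht
      have hd0 := Good.disj_total e6
      have hyX : y ∈ (total L').X := by rw [e1]; exact Or.inl hy
      obtain ⟨L2, f1, f2, f3⟩ := exists_race_list (R := R) e5 (fun u hu => by
        have huT := e5.1 u hu
        -- The total weakness is at most one and `t` uses it up, so all other positions convert into
        -- races without a move.
        have hu0 : u.weak = 0 := by
          obtain ⟨a, b, hab⟩ := List.append_of_mem hu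
          have : weaks L0 = u.weak + weaks (a ++ b) := by rw [hab]; simp; ring
          omega
        rcases hT.alice u huT with h | h | h
        · exfalso
          exact h1 ⟨u, e7 u hu, h⟩
        · exact h
        · omega)
      have hb : Better ((total L').aMove y) (total (L1 ++ L2)) := by
        rw [e1, total_append]
        exact (Better.aMove_add (hd0 y hy) k3).trans ((Better.refl _).add f3)
      refine ⟨y, hyX, W.mono (hR.win (k1.append f1 ?_) ?_) hb⟩
      · exact hd0.mono (k3.1.trans Set.sdiff_subset) f3.1
      · simp; omega
    -- Nothing offers a threat or a weak conversion: all positions are races, and Alice's move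
    -- raises the weight to one.
    · obtain ⟨L2, f1, f2, f3⟩ := exists_race_list (R := R) hL' (fun u hu => by
        rcases hT.alice u (hL'.1 u hu) with h | h | h
        · exact absurd ⟨u, hu, h⟩ h1
        · exact h
        · exact absurd ⟨u, hu, h⟩ h2)
      have hE2 : (total L2).EA.Nonempty := by
        obtain ⟨c, hc⟩ := hE'
        obtain ⟨c', hc', -⟩ := f3.2.1 c hc
        exact ⟨c', hc'⟩
      obtain ⟨y, hy, L3, g1, g2, g3⟩ := hR.alice_move f1 hE2
      exact ⟨y, f3.1 hy, W.mono (hR.win g1 (by omega)) ((f3.aMove y).trans g3)⟩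
  refine W.of_replies hB fun z => ?_
  by_cases hzs : z ∈ s.pos.X
  · have hzL : z ∉ (total L).X := hd z hzs
    rcases hS.bob s hs z hzs with ⟨L1, k1, k2, k3, k4⟩ | h
    · have hb : Better ((s.pos.add (total L)).bMove z) (total (L1 ++ L)) := by
        rw [total_append]
        exact Better.bMove_add hWL hzL k4
      have hg : Good T (L1 ++ L) := k1.append hL (hd.mono (k4.1.trans Set.sdiff_subset) subset_rfl)
      obtain ⟨y, hy, hW⟩ := key (L1 ++ L) hg (by simp; omega) (by simp; omega)
        (by rw [total_append]; exact hE.mono Set.subset_union_right)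
        (le_trans (Set.ncard_le_ncard (hb.1.trans Set.sdiff_subset) (Set.toFinite _)) hn)
      exact ⟨y, (hb.1 hy).1, (hb.1 hy).2, hW.mono (hb.aMove y)⟩
    · obtain ⟨y, hy, hyz, hW⟩ := h (total L) hWL (hPL L hL) hd
      refine ⟨y, Or.inl hy, hyz, hW.mono (Better.aMove ?_ y)⟩
      rw [bMove_add]
      exact (Better.refl _).add (hWL.better_bMove hzL)
  by_cases hzL : z ∈ (total L).X
  · obtain ⟨t, ht, hzt⟩ := mem_total_X.1 hzL
    obtain ⟨L0, e1, e2, e3, e4, e5, e6, -⟩ := exists_front hL ht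
    have hd0 := Good.disj_total e6
    have hW0 := e5.total_WF hT.wf
    have hzL0 : z ∉ (total L0).X := hd0 z hzt
    have hsX : Disj s.pos t.pos := fun v hv hv' => hd v hv (by rw [e1]; exact Or.inl hv')
    have hsX0 : Disj s.pos (total L0) := fun v hv hv' => hd v hv (by rw [e1]; exact Or.inr hv')
    have hbz : Better ((s.pos.add (total L)).bMove z)
        (s.pos.add ((t.pos.bMove z).add (total L0))) := by
      rw [bMove_add, e1, bMove_add]
      exact (hWs.better_bMove hzs).add ((Better.refl _).add (hW0.better_bMove hzL0))
    rcases hT.bob t e4 z hzt with ⟨y, hy, hyz, L1, k1, k2, k3, k4⟩ | h | ⟨y, hy, hyz, d, Q, q1, q2, q3, q4⟩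
    · have hyX : y ∈ (s.pos.add (total L)).X := by rw [e1]; exact Or.inr (Or.inl hy)
      have hb : Better (((s.pos.add (total L)).bMove z).aMove y)
          (s.pos.add (total (L1 ++ L0))) := by
        refine (hbz.aMove y).trans ?_
        rw [total_append, aMove_add, aMove_add]
        exact (better_aMove fun h => hsX y h hy).add (k4.add (better_aMove (hd0 y hy)))
      have hsub : (total L1).X ⊆ t.pos.X := k4.1.trans (Set.sdiff_subset.trans Set.sdiff_subset)
      refine ⟨y, hyX, hyz, W.mono (ih _ ?_ s (L1 ++ L0) le_rfl hs ?_ ?_ ?_ ?_) hb⟩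
      · exact lt_of_lt_of_le (lt_of_le_of_lt (Set.ncard_le_ncard hb.1 (Set.toFinite _))
          (ncard_move_lt hyX)) hn
      · exact k1.append e5 (hd0.mono hsub subset_rfl)
      · rw [total_append]
        rintro v hv (h | h)
        · exact hsX v hv (hsub h)
        · exact hsX0 v hv h
      · simp; omega
      · simp; omega
    · have hdd : Disj (t.pos.bMove z) (total L0) := hd0.mono Set.sdiff_subset subset_rfl
      -- The pairing has survived Bob's move, so the threat can be executed now.
      obtain ⟨y, hy, hW⟩ := hS.threat s hs ((t.pos.bMove z).add (total L0))
        (((hT.wf t e4).bMove z).add hW0) (h.add (hPL L0 e5) hdd) (by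
          rintro v hv (h | h)
          exacts [hsX v hv h.1, hsX0 v hv h])
      exact ⟨y, Or.inl hy, fun e => hzs (e ▸ hy), hW.mono (hbz.aMove y)⟩
    · have hyX : y ∈ (s.pos.add (total L)).X := by rw [e1]; exact Or.inr (Or.inl hy)
      have hsub : (need {d}).X ∪ Q.X ⊆ t.pos.X := q4.1.trans (Set.sdiff_subset.trans Set.sdiff_subset)
      have hdt : d ∈ t.pos.X := hsub (Or.inl rfl)
      have hb : Better (((s.pos.add (total L)).bMove z).aMove y)
          ((need {d}).add (s.pos.add (Q.add (total L0)))) := by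
        refine (hbz.aMove y).trans ?_
        rw [← add_assoc' (need {d}), add_comm' (need {d}) s.pos, add_assoc' s.pos,
          ← add_assoc' (need {d}), aMove_add, aMove_add]
        exact (better_aMove fun h => hsX y h hy).add (q4.add (better_aMove (hd0 y hy)))
      refine ⟨y, hyX, hyz, W.mono (W_of_two_threats (hS.threat s hs) (hS.EA_eq s hs) hWs
        (q1.add hW0) (q2.add (hPL L0 e5) ?_) ?_ ?_ ?_) hb⟩
      · exact hd0.mono (Set.subset_union_right.trans hsub) subset_rfl
      · rintro v hv (h | h)
        exacts [hsX v hv (hsub (Or.inr h)), hsX0 v hv h]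
      · exact fun h => hsX d h hdt
      · rintro (h | h)
        exacts [q3 h, hd0 d hdt h]
  · obtain ⟨y, hy, hW⟩ := hS.threat s hs (total L) hWL (hPL L hL) hd
    refine ⟨y, Or.inl hy, fun e => hzs (e ▸ hy), hW.mono (Better.aMove ?_ y)⟩
    exact (hWs.add hWL).better_bMove (by rintro (h | h); exacts [hzs h, hzL h])

/-! ### Sufficiency: paths and forks as local games. -/

/-! ### Segments -/

/-- The vertices of the sequence `q 1, …, q N` at distance at most one from `q t`. -/
def clause (q : ℕ → V) (N t : ℕ) : Set V :=
  {v | ∃ s, 1 ≤ s ∧ s ≤ N ∧ s ≤ t + 1 ∧ t ≤ s + 1 ∧ q s = v}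

/-- A path `q 1, …, q N` of unclaimed vertices. Its first vertex is dominated by Alice if `a = 1`
and by Bob if `a = 0`, the same holds for its last vertex and `b`, and those of the other vertices
that satisfy `U` are dominated by nobody. -/
def seg (q : ℕ → V) (N a b : ℕ) (U : ℕ → Prop) : Pos V :=
  ⟨{v | ∃ s, 1 ≤ s ∧ s ≤ N ∧ q s = v},
    {c | ∃ t, 1 ≤ t ∧ t ≤ N ∧ 1 + a ≤ t ∧ t + b ≤ N ∧ c = clause q N t},
    {d | ∃ t, 1 ≤ t ∧ t ≤ N ∧ 2 ≤ t + a ∧ t + 1 ≤ N + b ∧ U t ∧ d = clause q N t}⟩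

/-- The part `q (s + 1), …, q (s + n)` of a path. -/
abbrev subseg (q : ℕ → V) (U : ℕ → Prop) (s n a b : ℕ) : Pos V :=
  seg (fun t => q (s + t)) n a b fun t => U (s + t)

/-- Injectivity on `{1, …, N}`. -/
def Inj (q : ℕ → V) (N : ℕ) : Prop :=
  ∀ s t, 1 ≤ s → s ≤ N → 1 ≤ t → t ≤ N → q s = q t → s = t

theorem Inj.sub {q : ℕ → V} {N : ℕ} (h : Inj q N) {s n : ℕ} (hn : n = 0 ∨ s + n ≤ N) :
    Inj (fun t => q (s + t)) n := fun t r h1 h2 h3 h4 e => by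
  have := h (s + t) (s + r) (by omega) (by omega) (by omega) (by omega) e
  omega

theorem Inj.rev {q : ℕ → V} {N : ℕ} (h : Inj q N) : Inj (fun t => q (N + 1 - t)) N :=
  fun t r h1 h2 h3 h4 e => by
  have := h (N + 1 - t) (N + 1 - r) (by omega) (by omega) (by omega) (by omega) e
  omega

theorem seg_WF (q : ℕ → V) (N a b : ℕ) (U : ℕ → Prop) : WF (seg q N a b U) := by
  constructor
  · rintro c ⟨t, -, -, -, -, rfl⟩ v ⟨s, h1, h2, -, -, h⟩
    exact ⟨s, h1, h2, h⟩
  · rintro c ⟨t, -, -, -, -, -, rfl⟩ v ⟨s, h1, h2, -, -, h⟩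
    exact ⟨s, h1, h2, h⟩

theorem clause_rev (q : ℕ → V) {N t : ℕ} (h2 : t ≤ N) :
    clause (fun t => q (N + 1 - t)) N t = clause q N (N + 1 - t) := by
  ext v
  constructor
  · rintro ⟨s, k1, k2, k3, k4, rfl⟩
    exact ⟨N + 1 - s, by omega, by omega, by omega, by omega, rfl⟩
  · rintro ⟨s, k1, k2, k3, k4, rfl⟩
    exact ⟨N + 1 - s, by omega, by omega, by omega, by omega, by
      simp only; congr 1; omega⟩

theorem seg_rev (q : ℕ → V) (N a b : ℕ) (U : ℕ → Prop) :
    Better (seg q N a b U) (seg (fun t => q (N + 1 - t)) N b a fun t => U (N + 1 - t)) := by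
  refine ⟨?_, ?_, ?_⟩
  · rintro v ⟨s, h1, h2, rfl⟩
    exact ⟨N + 1 - s, by omega, by omega, rfl⟩
  · rintro c ⟨t, h1, h2, h3, h4, rfl⟩
    refine ⟨_, ⟨N + 1 - t, by omega, by omega, by omega, by omega, rfl⟩, ?_⟩
    rw [clause_rev q (by omega)]
    have : N + 1 - (N + 1 - t) = t := by omega
    rw [this]
  · rintro c ⟨t, h1, h2, h3, h4, h5, rfl⟩
    exact ⟨_, ⟨N + 1 - t, by omega, by omega, by omega, by omega, h5, rfl⟩,
      (clause_rev q h2).symm.subset⟩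

/-- The effect of a move of Bob and an answer of Alice: two parts of the path remain. -/
theorem seg_move {q : ℕ → V} {N a b : ℕ} {U : ℕ → Prop} (hq : Inj q N) {i j : ℕ}
    (hi : 1 ≤ i ∧ i ≤ N) (hj : 1 ≤ j ∧ j ≤ N) (hij : i ≠ j) (s n a₁ b₁ s' n' a₂ b₂ : ℕ)
    (hX : n = 0 ∨ (s + n ≤ N ∧ (i ≤ s ∨ s + n < i) ∧ (j ≤ s ∨ s + n < j)))
    (hX' : n' = 0 ∨ (s' + n' ≤ N ∧ (i ≤ s' ∨ s' + n' < i) ∧ (j ≤ s' ∨ s' + n' < j)))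
    (hA : ∀ t, 1 ≤ t → t ≤ N → 1 + a ≤ t → t + b ≤ N → (j + 1 < t ∨ t + 1 < j) →
      (s < t ∧ t ≤ s + n ∧ s + 1 + a₁ ≤ t ∧ t + b₁ ≤ s + n) ∨
      (s' < t ∧ t ≤ s' + n' ∧ s' + 1 + a₂ ≤ t ∧ t + b₂ ≤ s' + n'))
    -- A set of Bob kept in a part must avoid his own vertex `q i`. Around an end of the part it is
    -- the truncation of a larger set, which is harmless only if the vertex cut off is Alice's `q
    -- j`.
    (hB : ∀ t, s < t → t ≤ s + n → s + 2 ≤ t + a₁ → t + 1 ≤ s + n + b₁ →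
      2 ≤ t + a ∧ t + 1 ≤ N + b ∧ (i + 1 < t ∨ t + 1 < i) ∧
      (1 ≤ s → s + 1 = t → s = j) ∧ (s + n = t → s + n < N → s + n + 1 = j))
    (hB' : ∀ t, s' < t → t ≤ s' + n' → s' + 2 ≤ t + a₂ → t + 1 ≤ s' + n' + b₂ →
      2 ≤ t + a ∧ t + 1 ≤ N + b ∧ (i + 1 < t ∨ t + 1 < i) ∧
      (1 ≤ s' → s' + 1 = t → s' = j) ∧ (s' + n' = t → s' + n' < N → s' + n' + 1 = j)) :
    Better (((seg q N a b U).bMove (q i)).aMove (q j))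
      (sum [subseg q U s n a₁ b₁, subseg q U s' n' a₂ b₂]) := by
  have hX0 : ∀ s n, (n = 0 ∨ (s + n ≤ N ∧ (i ≤ s ∨ s + n < i) ∧ (j ≤ s ∨ s + n < j))) →
      ∀ a b, (subseg q U s n a b).X ⊆ (((seg q N a b U).bMove (q i)).aMove (q j)).X := by
    rintro s n h a b v ⟨t, h1, h2, rfl⟩
    refine ⟨⟨⟨s + t, by omega, by omega, rfl⟩, fun e => ?_⟩, fun e => ?_⟩
    · have := hq _ _ (by omega) (by omega) hi.1 hi.2 e; omega
    · have := hq _ _ (by omega) (by omega) hj.1 hj.2 e; omega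
  have hB0 : ∀ s n a₁ b₁, (n = 0 ∨ (s + n ≤ N ∧ (i ≤ s ∨ s + n < i) ∧ (j ≤ s ∨ s + n < j))) →
      (∀ t, s < t → t ≤ s + n → s + 2 ≤ t + a₁ → t + 1 ≤ s + n + b₁ →
      2 ≤ t + a ∧ t + 1 ≤ N + b ∧ (i + 1 < t ∨ t + 1 < i) ∧
      (1 ≤ s → s + 1 = t → s = j) ∧ (s + n = t → s + n < N → s + n + 1 = j)) →
      ∀ d ∈ (subseg q U s n a₁ b₁).EB,
        ∃ d' ∈ (((seg q N a b U).bMove (q i)).aMove (q j)).EB, d' ⊆ d := by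
    rintro s n a₁ b₁ h hB d ⟨t, h1, h2, h3, h4, h5, rfl⟩
    obtain ⟨k1, k2, k3, k4, k5⟩ := hB (s + t) (by omega) (by omega) (by omega) (by omega)
    refine ⟨clause q N (s + t) \ {q j}, ⟨clause q N (s + t), ⟨⟨s + t, by omega, by omega, k1, k2,
      h5, rfl⟩, ?_⟩, rfl⟩, ?_⟩
    · rintro ⟨r, r1, r2, r3, r4, r5⟩
      have := hq _ _ r1 r2 hi.1 hi.2 r5
      omega
    · rintro v ⟨⟨r, r1, r2, r3, r4, rfl⟩, hr⟩
      have hrj : r ≠ j := fun e => hr (e ▸ rfl)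
      refine ⟨r - s, by omega, by omega, by omega, by omega, ?_⟩
      simp only; congr 1; omega
  have hA0 : ∀ s n a₁ b₁, (n = 0 ∨ (s + n ≤ N ∧ (i ≤ s ∨ s + n < i) ∧ (j ≤ s ∨ s + n < j))) →
      ∀ t, (s < t ∧ t ≤ s + n ∧ s + 1 + a₁ ≤ t ∧ t + b₁ ≤ s + n) →
      ∃ c' ∈ (subseg q U s n a₁ b₁).EA, c' ⊆ clause q N t \ {q i} := by
    rintro s n a₁ b₁ h t ⟨h1, h2, h3, h4⟩
    refine ⟨_, ⟨t - s, by omega, by omega, by omega, by omega, rfl⟩, ?_⟩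
    rintro v ⟨r, r1, r2, r3, r4, rfl⟩
    refine ⟨⟨s + r, by omega, by omega, by omega, by omega, rfl⟩, fun e => ?_⟩
    have := hq _ _ (by omega) (by omega) hi.1 hi.2 e
    omega
  refine ⟨?_, ?_, ?_⟩
  · rintro v ⟨p, hp, hv⟩
    simp only [List.mem_cons, List.not_mem_nil, or_false] at hp
    rcases hp with rfl | rfl
    exacts [hX0 _ _ hX _ _ hv, hX0 _ _ hX' _ _ hv]
  · rintro c ⟨⟨e, ⟨t, h1, h2, h3, h4, rfl⟩, rfl⟩, hc⟩
    have ht : j + 1 < t ∨ t + 1 < j := by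
      by_contra hcon
      refine hc ⟨⟨j, hj.1, hj.2, by omega, by omega, rfl⟩, fun e => hij ?_⟩
      exact hq _ _ hi.1 hi.2 hj.1 hj.2 e.symm
    rcases hA t h1 h2 h3 h4 ht with h | h
    · obtain ⟨c', hc', hs⟩ := hA0 _ _ _ _ hX t h
      exact ⟨c', ⟨_, by simp, hc'⟩, hs⟩
    · obtain ⟨c', hc', hs⟩ := hA0 _ _ _ _ hX' t h
      exact ⟨c', ⟨_, by simp, hc'⟩, hs⟩
  · rintro d ⟨p, hp, hd⟩
    simp only [List.mem_cons, List.not_mem_nil, or_false] at hp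
    rcases hp with rfl | rfl
    exacts [hB0 _ _ _ _ hX hB d hd, hB0 _ _ _ _ hX' hB' d hd]

/-- The effect of a move of Alice: two parts of the path remain. -/
theorem seg_aMove {q : ℕ → V} {N a b : ℕ} {U : ℕ → Prop} (hq : Inj q N) {j : ℕ}
    (hj : 1 ≤ j ∧ j ≤ N) (s n a₁ b₁ s' n' a₂ b₂ : ℕ)
    (hX : n = 0 ∨ (s + n ≤ N ∧ (j ≤ s ∨ s + n < j)))
    (hX' : n' = 0 ∨ (s' + n' ≤ N ∧ (j ≤ s' ∨ s' + n' < j)))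
    (hA : ∀ t, 1 ≤ t → t ≤ N → 1 + a ≤ t → t + b ≤ N → (j + 1 < t ∨ t + 1 < j) →
      (s < t ∧ t ≤ s + n ∧ s + 1 + a₁ ≤ t ∧ t + b₁ ≤ s + n) ∨
      (s' < t ∧ t ≤ s' + n' ∧ s' + 1 + a₂ ≤ t ∧ t + b₂ ≤ s' + n'))
    (hB : ∀ t, s < t → t ≤ s + n → s + 2 ≤ t + a₁ → t + 1 ≤ s + n + b₁ →
      2 ≤ t + a ∧ t + 1 ≤ N + b ∧
      (1 ≤ s → s + 1 = t → s = j) ∧ (s + n = t → s + n < N → s + n + 1 = j))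
    (hB' : ∀ t, s' < t → t ≤ s' + n' → s' + 2 ≤ t + a₂ → t + 1 ≤ s' + n' + b₂ →
      2 ≤ t + a ∧ t + 1 ≤ N + b ∧
      (1 ≤ s' → s' + 1 = t → s' = j) ∧ (s' + n' = t → s' + n' < N → s' + n' + 1 = j)) :
    Better ((seg q N a b U).aMove (q j))
      (sum [subseg q U s n a₁ b₁, subseg q U s' n' a₂ b₂]) := by
  have hX0 : ∀ s n, (n = 0 ∨ (s + n ≤ N ∧ (j ≤ s ∨ s + n < j))) →
      ∀ a b, (subseg q U s n a b).X ⊆ ((seg q N a b U).aMove (q j)).X := by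
    rintro s n h a b v ⟨t, h1, h2, rfl⟩
    refine ⟨⟨s + t, by omega, by omega, rfl⟩, fun e => ?_⟩
    have := hq _ _ (by omega) (by omega) hj.1 hj.2 e; omega
  have hB0 : ∀ s n a₁ b₁, (n = 0 ∨ (s + n ≤ N ∧ (j ≤ s ∨ s + n < j))) →
      (∀ t, s < t → t ≤ s + n → s + 2 ≤ t + a₁ → t + 1 ≤ s + n + b₁ →
      2 ≤ t + a ∧ t + 1 ≤ N + b ∧
      (1 ≤ s → s + 1 = t → s = j) ∧ (s + n = t → s + n < N → s + n + 1 = j)) →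
      ∀ d ∈ (subseg q U s n a₁ b₁).EB,
        ∃ d' ∈ ((seg q N a b U).aMove (q j)).EB, d' ⊆ d := by
    rintro s n a₁ b₁ h hB d ⟨t, h1, h2, h3, h4, h5, rfl⟩
    obtain ⟨k1, k2, k4, k5⟩ := hB (s + t) (by omega) (by omega) (by omega) (by omega)
    refine ⟨clause q N (s + t) \ {q j}, ⟨clause q N (s + t), ⟨s + t, by omega, by omega, k1, k2,
      h5, rfl⟩, rfl⟩, ?_⟩
    rintro v ⟨⟨r, r1, r2, r3, r4, rfl⟩, hr⟩
    have hrj : r ≠ j := fun e => hr (e ▸ rfl)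
    refine ⟨r - s, by omega, by omega, by omega, by omega, ?_⟩
    simp only; congr 1; omega
  have hA0 : ∀ s n a₁ b₁, (n = 0 ∨ (s + n ≤ N ∧ (j ≤ s ∨ s + n < j))) →
      ∀ t, (s < t ∧ t ≤ s + n ∧ s + 1 + a₁ ≤ t ∧ t + b₁ ≤ s + n) →
      ∃ c' ∈ (subseg q U s n a₁ b₁).EA, c' ⊆ clause q N t := by
    rintro s n a₁ b₁ h t ⟨h1, h2, h3, h4⟩
    refine ⟨_, ⟨t - s, by omega, by omega, by omega, by omega, rfl⟩, ?_⟩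
    rintro v ⟨r, r1, r2, r3, r4, rfl⟩
    exact ⟨s + r, by omega, by omega, by omega, by omega, rfl⟩
  refine ⟨?_, ?_, ?_⟩
  · rintro v ⟨p, hp, hv⟩
    simp only [List.mem_cons, List.not_mem_nil, or_false] at hp
    rcases hp with rfl | rfl
    exacts [hX0 _ _ hX _ _ hv, hX0 _ _ hX' _ _ hv]
  · rintro c ⟨⟨t, h1, h2, h3, h4, rfl⟩, hc⟩
    have ht : j + 1 < t ∨ t + 1 < j := by
      by_contra hcon
      exact hc ⟨j, hj.1, hj.2, by omega, by omega, rfl⟩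
    rcases hA t h1 h2 h3 h4 ht with h | h
    · obtain ⟨c', hc', hs⟩ := hA0 _ _ _ _ hX t h
      exact ⟨c', ⟨_, by simp, hc'⟩, hs⟩
    · obtain ⟨c', hc', hs⟩ := hA0 _ _ _ _ hX' t h
      exact ⟨c', ⟨_, by simp, hc'⟩, hs⟩
  · rintro d ⟨p, hp, hd⟩
    simp only [List.mem_cons, List.not_mem_nil, or_false] at hp
    rcases hp with rfl | rfl
    exacts [hB0 _ _ _ _ hX hB d hd, hB0 _ _ _ _ hX' hB' d hd]

theorem subseg_disj {q : ℕ → V} {N : ℕ} (hq : Inj q N) {U U' : ℕ → Prop}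
    {s n a₁ b₁ s' n' a₂ b₂ : ℕ} (h : n = 0 ∨ n' = 0 ∨
      (s + n ≤ N ∧ s' + n' ≤ N ∧ (s + n ≤ s' ∨ s' + n' ≤ s))) :
    Disj (subseg q U s n a₁ b₁) (subseg q U' s' n' a₂ b₂) := by
  rintro v ⟨t, h1, h2, rfl⟩ ⟨r, k1, k2, e⟩
  have := hq (s' + r) (s + t) (by omega) (by omega) (by omega) (by omega) e
  omega

/-- A pairing of consecutive vertices of a path. -/
theorem paired_of_path {q : ℕ → V} {N : ℕ} (hq : Inj q N) {P : Pos V} {lo hi : ℕ}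
    (hlo : 1 ≤ lo) (hhi : hi ≤ N) (hX : ∀ s, lo ≤ s → s ≤ hi → q s ∈ P.X)
    (hA : ∀ c ∈ P.EA, ∃ t, lo ≤ t ∧ t + 1 ≤ hi ∧ (t - lo) % 2 = 0 ∧ q t ∈ c ∧ q (t + 1) ∈ c) :
    Paired P := by
  refine ⟨fun x y => ∃ t, lo ≤ t ∧ t + 1 ≤ hi ∧ (t - lo) % 2 = 0 ∧
    ((x = q t ∧ y = q (t + 1)) ∨ (x = q (t + 1) ∧ y = q t)), ?_, ?_, ?_, ?_⟩
  · rintro x y ⟨t, h1, h2, h3, h | h⟩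
    exacts [⟨t, h1, h2, h3, Or.inr h.symm⟩, ⟨t, h1, h2, h3, Or.inl h.symm⟩]
  · rintro x y ⟨t, h1, h2, h3, ⟨rfl, rfl⟩ | ⟨rfl, rfl⟩⟩
    · refine ⟨hX _ h1 (by omega), fun e => ?_⟩
      have := hq _ _ (by omega) (by omega) (by omega) (by omega) e
      omega
    · refine ⟨hX _ (by omega) (by omega), fun e => ?_⟩
      have := hq _ _ (by omega) (by omega) (by omega) (by omega) e
      omega
  · rintro x y y' ⟨t, h1, h2, h3, ⟨rfl, rfl⟩ | ⟨rfl, rfl⟩⟩ ⟨t', h1', h2', h3', ⟨e, rfl⟩ | ⟨e, rfl⟩⟩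
    all_goals
      have := hq _ _ (by omega) (by omega) (by omega) (by omega) e
      congr 1
      omega
  · intro c hc
    obtain ⟨t, h1, h2, h3, h4, h5⟩ := hA c hc
    exact ⟨_, h4, _, h5, t, h1, h2, h3, Or.inl ⟨rfl, rfl⟩⟩

/-- The pairs are `(lo, lo + 1), (lo + 2, lo + 3), …`. Each vertex that Alice still has to dominate
must belong to a pair, and then the whole pair lies in its closed neighbourhood. -/
theorem seg_paired {q : ℕ → V} {N a b : ℕ} {U : ℕ → Prop} (hq : Inj q N) (lo hi : ℕ)
    (hlo : 1 ≤ lo) (hhi : hi ≤ N)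
    (hA : ∀ t, 1 ≤ t → t ≤ N → 1 + a ≤ t → t + b ≤ N →
      (lo ≤ t ∧ t + 1 ≤ hi ∧ (t - lo) % 2 = 0) ∨
      (lo + 1 ≤ t ∧ t ≤ hi ∧ (t - lo) % 2 = 1)) :
    Paired (seg q N a b U) := by
  refine paired_of_path hq hlo hhi (fun s h1 h2 => ⟨s, by omega, by omega, rfl⟩) ?_
  rintro c ⟨t, h1, h2, h3, h4, rfl⟩
  rcases hA t h1 h2 h3 h4 with ⟨k1, k2, k3⟩ | ⟨k1, k2, k3⟩
  · exact ⟨t, k1, k2, k3, ⟨t, by omega, by omega, by omega, by omega, rfl⟩,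
      ⟨t + 1, by omega, by omega, by omega, by omega, rfl⟩⟩
  · exact ⟨t - 1, by omega, by omega, by omega, ⟨t - 1, by omega, by omega, by omega, by omega, rfl⟩,
      ⟨t - 1 + 1, by omega, by omega, by omega, by omega, rfl⟩⟩

theorem seg_bMove_paired {q : ℕ → V} {N a b : ℕ} {U : ℕ → Prop} (hq : Inj q N) {i : ℕ}
    (hi : 1 ≤ i ∧ i ≤ N) (lo hi' : ℕ)
    (hlo : 1 ≤ lo) (hhi : hi' ≤ N) (hii : i < lo ∨ hi' < i)
    (hA : ∀ t, 1 ≤ t → t ≤ N → 1 + a ≤ t → t + b ≤ N →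
      (lo ≤ t ∧ t + 1 ≤ hi' ∧ (t - lo) % 2 = 0) ∨
      (lo + 1 ≤ t ∧ t ≤ hi' ∧ (t - lo) % 2 = 1)) :
    Paired ((seg q N a b U).bMove (q i)) := by
  have hne : ∀ s, lo ≤ s → s ≤ hi' → q s ≠ q i := fun s h1 h2 e => by
    have := hq _ _ (by omega) (by omega) hi.1 hi.2 e
    omega
  refine paired_of_path hq hlo hhi (fun s h1 h2 => ⟨⟨s, by omega, by omega, rfl⟩, hne s h1 h2⟩) ?_
  rintro c ⟨_, ⟨t, h1, h2, h3, h4, rfl⟩, rfl⟩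
  rcases hA t h1 h2 h3 h4 with ⟨k1, k2, k3⟩ | ⟨k1, k2, k3⟩
  · exact ⟨t, k1, k2, k3, ⟨⟨t, by omega, by omega, by omega, by omega, rfl⟩, hne _ k1 (by omega)⟩,
      ⟨⟨t + 1, by omega, by omega, by omega, by omega, rfl⟩, hne _ (by omega) k2⟩⟩
  · exact ⟨t - 1, by omega, by omega, by omega,
      ⟨⟨t - 1, by omega, by omega, by omega, by omega, rfl⟩, hne _ (by omega) (by omega)⟩,
      ⟨⟨t - 1 + 1, by omega, by omega, by omega, by omega, rfl⟩, hne _ (by omega) (by omega)⟩⟩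

/-- A path of one vertex that Bob still has to claim. -/
theorem seg_one_better {q : ℕ → V} {U : ℕ → Prop} (hU : U 1) :
    Better (seg q 1 1 1 U) (need {q 1}) := by
  refine ⟨?_, ?_, ?_⟩
  · rintro v rfl
    exact ⟨1, le_rfl, le_rfl, rfl⟩
  · rintro c ⟨t, h1, h2, h3, h4, rfl⟩
    omega
  · rintro d rfl
    refine ⟨_, ⟨1, le_rfl, le_rfl, by omega, by omega, hU, rfl⟩, ?_⟩
    rintro v ⟨s, h1, h2, -, -, rfl⟩
    have : s = 1 := by omega
    rw [this]; rfl

/-- `p` is at least as good for Alice as a sum of disjoint positions of the class `T`, of total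
weight at least `w` and of total weakness at most `k`. -/
def Reduces (T : Tok V → Prop) (p : Pos V) (w : ℤ) (k : ℕ) : Prop :=
  ∃ L, Good T L ∧ w ≤ wts L ∧ weaks L ≤ k ∧ Better p (total L)

theorem Reduces.of_mem {T : Tok V → Prop} {p : Pos V} {w : ℤ} {k : ℕ} (h : T ⟨p, w, k⟩) :
    Reduces T p w k :=
  ⟨[⟨p, w, k⟩], ⟨by simpa using h, by simp⟩, by simp, by simp, by
    simpa [total, sum] using Better.refl p⟩

theorem Reduces.of_EA_eq_empty {T : Tok V → Prop} {p : Pos V} (h : p.EA = ∅) : Reduces T p 0 0 :=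
  ⟨[], ⟨by simp, by simp⟩, by simp, by simp, by simp [total, sum], by simp [h], by simp [total, sum]⟩

theorem Reduces.mono {T : Tok V → Prop} {p p' : Pos V} {w w' : ℤ} {k k' : ℕ}
    (h : Reduces T p w k) (hp : Better p' p) (hw : w' ≤ w) (hk : k ≤ k') : Reduces T p' w' k' := by
  obtain ⟨L, h1, h2, h3, h4⟩ := h
  exact ⟨L, h1, by omega, by omega, hp.trans h4⟩

theorem Reduces.better {T : Tok V → Prop} {p p' : Pos V} {w : ℤ} {k : ℕ}
    (h : Reduces T p w k) (hp : Better p' p) : Reduces T p' w k :=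
  h.mono hp le_rfl le_rfl

theorem Reduces.add {T : Tok V → Prop} {p p' : Pos V} {w w' : ℤ} {k k' : ℕ}
    (h : Reduces T p w k) (h' : Reduces T p' w' k') (hd : Disj p p') :
    Reduces T (p.add p') (w + w') (k + k') := by
  obtain ⟨L, h1, h2, h3, h4⟩ := h
  obtain ⟨L', h1', h2', h3', h4'⟩ := h'
  refine ⟨L ++ L', h1.append h1' (hd.mono h4.1 h4'.1), by simp; omega, by simp; omega, ?_⟩
  rw [total_append]
  exact h4.add h4'

theorem sum_pair (p p' : Pos V) : sum [p, p'] = p.add p' := by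
  rw [sum_cons]; simp [sum]

theorem seg_X_ne {q : ℕ → V} {N a b : ℕ} {U : ℕ → Prop} (hq : Inj q N) {i j : ℕ}
    (hi : 1 ≤ i ∧ i ≤ N) (hj : 1 ≤ j ∧ j ≤ N) (hij : i ≠ j) :
    q j ∈ (seg q N a b U).X ∧ q j ≠ q i :=
  ⟨⟨j, hj.1, hj.2, rfl⟩, fun e => hij (hq _ _ hi.1 hi.2 hj.1 hj.2 e.symm)⟩

/-- An answer of Alice that leaves two parts of a path. -/
theorem seg_reply {T : Tok V → Prop} {q : ℕ → V} {N a b : ℕ} {U : ℕ → Prop} (hq : Inj q N) {i : ℕ}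
    (j : ℕ) (s n a₁ b₁ s' n' a₂ b₂ : ℕ) {w w₁ w₂ : ℤ} {k k₁ k₂ : ℕ}
    (h1 : Reduces T (subseg q U s n a₁ b₁) w₁ k₁) (h2 : Reduces T (subseg q U s' n' a₂ b₂) w₂ k₂)
    (hi : 1 ≤ i ∧ i ≤ N := by omega) (hj : 1 ≤ j ∧ j ≤ N := by omega) (hij : i ≠ j := by omega)
    (hw : w ≤ w₁ + w₂ := by omega) (hk : k₁ + k₂ ≤ k := by omega)
    (hd : n = 0 ∨ n' = 0 ∨ (s + n ≤ N ∧ s' + n' ≤ N ∧ (s + n ≤ s' ∨ s' + n' ≤ s)) := by omega)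
    (hX : n = 0 ∨ (s + n ≤ N ∧ (i ≤ s ∨ s + n < i) ∧ (j ≤ s ∨ s + n < j)) := by omega)
    (hX' : n' = 0 ∨ (s' + n' ≤ N ∧ (i ≤ s' ∨ s' + n' < i) ∧ (j ≤ s' ∨ s' + n' < j)) := by omega)
    (hA : ∀ t, 1 ≤ t → t ≤ N → 1 + a ≤ t → t + b ≤ N → (j + 1 < t ∨ t + 1 < j) →
      (s < t ∧ t ≤ s + n ∧ s + 1 + a₁ ≤ t ∧ t + b₁ ≤ s + n) ∨
      (s' < t ∧ t ≤ s' + n' ∧ s' + 1 + a₂ ≤ t ∧ t + b₂ ≤ s' + n') := by intros; omega)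
    (hB : ∀ t, s < t → t ≤ s + n → s + 2 ≤ t + a₁ → t + 1 ≤ s + n + b₁ →
      2 ≤ t + a ∧ t + 1 ≤ N + b ∧ (i + 1 < t ∨ t + 1 < i) ∧
      (1 ≤ s → s + 1 = t → s = j) ∧ (s + n = t → s + n < N → s + n + 1 = j) := by
        intros; omega)
    (hB' : ∀ t, s' < t → t ≤ s' + n' → s' + 2 ≤ t + a₂ → t + 1 ≤ s' + n' + b₂ →
      2 ≤ t + a ∧ t + 1 ≤ N + b ∧ (i + 1 < t ∨ t + 1 < i) ∧
      (1 ≤ s' → s' + 1 = t → s' = j) ∧ (s' + n' = t → s' + n' < N → s' + n' + 1 = j) := by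
        intros; omega) :
    ∃ y ∈ (seg q N a b U).X, y ≠ q i ∧ Reduces T (((seg q N a b U).bMove (q i)).aMove y) w k := by
  obtain ⟨h3, h4⟩ := seg_X_ne (a := a) (b := b) (U := U) hq hi hj hij
  refine ⟨q j, h3, h4, ((h1.add h2 (subseg_disj hq hd)).mono ?_ hw hk)⟩
  rw [← sum_pair]
  exact seg_move hq hi hj hij s n a₁ b₁ s' n' a₂ b₂ hX hX' hA hB hB'

theorem subseg_zero_reduces {T : Tok V → Prop} {q : ℕ → V} {U : ℕ → Prop} :
    Reduces T (subseg q U 0 0 0 0) 0 0 :=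
  Reduces.of_EA_eq_empty (Set.eq_empty_of_forall_notMem (by rintro c ⟨t, h1, h2, -⟩; omega))

theorem seg_EA_eq_empty {q : ℕ → V} {N a b : ℕ} {U : ℕ → Prop} (h : N ≤ a + b) : (seg q N a b U).EA = ∅ :=
  Set.eq_empty_of_forall_notMem (by rintro c ⟨t, h1, h2, h3, h4, -⟩; omega)

theorem seg_two_better {q : ℕ → V} {U : ℕ → Prop} (hU : U 1) :
    Better (seg q 2 1 1 U) (need {q 1, q 2}) := by
  refine ⟨?_, ?_, ?_⟩
  · rintro v (rfl | rfl)
    exacts [⟨1, by omega, by omega, rfl⟩, ⟨2, by omega, by omega, rfl⟩]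
  · rintro c ⟨t, h1, h2, h3, h4, rfl⟩
    omega
  · rintro d rfl
    refine ⟨_, ⟨1, le_rfl, by omega, by omega, by omega, hU, rfl⟩, ?_⟩
    rintro v ⟨s, h1, h2, -, -, rfl⟩
    obtain rfl | rfl : s = 1 ∨ s = 2 := by omega
    exacts [Or.inl rfl, Or.inr rfl]

/-! ### Three kinds of paths -/

/-- A path with only its first end dominated by Alice, with few vertices dominated by Bob. -/
structure IsAB (q : ℕ → V) (N : ℕ) (U : ℕ → Prop) : Prop where
  inj : Inj q N
  unmarked : ∀ t, 1 ≤ t → t + 1 ≤ N → t ≠ 2 → t ≠ 3 → t + 2 ≠ N → U t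
  -- For three vertices the other conditions are void; without this one Bob might have nothing left
  -- to hit, and a move of Alice would gain no weight.
  three : N = 3 → U 1 ∨ U 2

/-- A path with no end dominated by Alice, with few vertices dominated by Bob. -/
structure IsBB (q : ℕ → V) (N : ℕ) (U : ℕ → Prop) : Prop where
  inj : Inj q N
  even : N % 2 = 0
  unmarked : ∀ t, 2 ≤ t → t + 1 ≤ N → t + 2 ≠ N → U t

/-- A class that contains the paths of the two kinds above. -/
structure HasPaths (T : Tok V → Prop) : Prop where
  ab : ∀ {q N U}, IsAB q N U → T ⟨seg q N 1 0 U, 0, 0⟩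
  bb : ∀ {q N U}, IsBB q N U → T ⟨seg q N 0 0 U, -1, 0⟩

theorem HasPaths.subAB {T : Tok V → Prop} (hT : HasPaths T) {q : ℕ → V} {N : ℕ} {U : ℕ → Prop}
    (hq : Inj q N) (s n : ℕ) (hn : n = 0 ∨ s + n ≤ N)
    (hU : ∀ t, s < t → t + 1 ≤ s + n → t ≠ s + 2 → t ≠ s + 3 → t + 2 ≠ s + n → U t)
    (h3 : n = 3 → U (s + 1) ∨ U (s + 2)) : Reduces T (subseg q U s n 1 0) 0 0 :=
  .of_mem (hT.ab ⟨hq.sub hn, fun t h1 h2 h3 h4 h5 => hU _ (by omega) (by omega) (by omega)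
    (by omega) (by omega), h3⟩)

theorem HasPaths.subBB {T : Tok V → Prop} (hT : HasPaths T) {q : ℕ → V} {N : ℕ} {U : ℕ → Prop}
    (hq : Inj q N) (s n : ℕ) (hn : n = 0 ∨ s + n ≤ N) (h2 : n % 2 = 0)
    (hU : ∀ t, s + 2 ≤ t → t + 1 ≤ s + n → t + 2 ≠ s + n → U t) :
    Reduces T (subseg q U s n 0 0) (-1) 0 :=
  .of_mem (hT.bb ⟨hq.sub hn, h2, fun t h1 h2 h3 => hU _ (by omega) (by omega) (by omega)⟩)

theorem HasPaths.subBA {T : Tok V → Prop} (hT : HasPaths T) {q : ℕ → V} {N : ℕ} {U : ℕ → Prop}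
    (hq : Inj q N) (s n : ℕ) (hn : n = 0 ∨ s + n ≤ N) (hU : ∀ t, s + 2 ≤ t → t ≤ s + n → U t) :
    Reduces T (subseg q U s n 0 1) 0 0 :=
  (Reduces.of_mem (hT.ab ⟨(hq.sub hn).rev, fun t h1 h2 _ _ _ => hU _ (by omega) (by omega),
    fun h => Or.inl (hU _ (by omega) (by omega))⟩)).better (seg_rev _ _ _ _ _)

/-- Alice plays next to Bob, on the side away from the end that she dominates. The left part then
ends at Bob's vertex and the right part starts at hers, so both are of the same kind, of weight `0`.
If Bob plays `q 1` she prefers `q 3` to `q 2`: otherwise a vertex `q 3` dominated by Bob would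
become the first of the remaining path. -/
theorem IsAB.reply {T : Tok V → Prop} (hT : HasPaths T) {q : ℕ → V} {N : ℕ} {U : ℕ → Prop}
    (h : IsAB q N U) (h2 : 2 ≤ N) {i : ℕ} (hi : 1 ≤ i ∧ i ≤ N) :
    ∃ y ∈ (seg q N 1 0 U).X, y ≠ q i ∧ Reduces T (((seg q N 1 0 U).bMove (q i)).aMove y) 0 0 := by
  have hq := h.inj
  rcases (by omega : (i = 1 ∧ N = 2) ∨ (i = 1 ∧ 3 ≤ N) ∨ (2 ≤ i ∧ i = N) ∨ (2 ≤ i ∧ i < N)) with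
    hc | hc | hc | hc
  · exact seg_reply hq 2 0 0 0 0 0 0 0 0 subseg_zero_reduces subseg_zero_reduces
  · refine seg_reply hq 3 3 (N - 3) 1 0 0 0 0 0
      (hT.subAB hq 3 (N - 3) (by omega)
        (fun t _ _ _ _ _ => h.unmarked t (by omega) (by omega) (by omega) (by omega) (by omega))
        (fun _ => Or.inr (h.unmarked _ (by omega) (by omega) (by omega) (by omega) (by omega))))
      subseg_zero_reduces
  · refine seg_reply hq (N - 1) 0 (N - 2) 1 0 0 0 0 0
      (hT.subAB hq 0 (N - 2) (by omega)
        (fun t _ _ _ _ _ => h.unmarked t (by omega) (by omega) (by omega) (by omega) (by omega))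
        (fun _ => Or.inl (h.unmarked _ (by omega) (by omega) (by omega) (by omega) (by omega))))
      subseg_zero_reduces
  · refine seg_reply hq (i + 1) 0 (i - 1) 1 0 (i + 1) (N - i - 1) 1 0
      (hT.subAB hq 0 (i - 1) (by omega)
        (fun t _ _ _ _ _ => h.unmarked t (by omega) (by omega) (by omega) (by omega) (by omega))
        (fun _ => Or.inl (h.unmarked _ (by omega) (by omega) (by omega) (by omega) (by omega))))
      (hT.subAB hq (i + 1) (N - i - 1) (by omega)
        (fun t _ _ _ _ _ => h.unmarked t (by omega) (by omega) (by omega) (by omega) (by omega))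
        (fun _ => Or.inr (h.unmarked _ (by omega) (by omega) (by omega) (by omega) (by omega))))

/-- Parity decides on which side of Bob's vertex Alice plays: the part without an end of hers has to
keep even length. The other part has one end dominated by Alice and weight `0`. -/
theorem IsBB.reply {T : Tok V → Prop} (hT : HasPaths T) {q : ℕ → V} {N : ℕ} {U : ℕ → Prop}
    (h : IsBB q N U) {i : ℕ} (hi : 1 ≤ i ∧ i ≤ N) :
    ∃ y ∈ (seg q N 0 0 U).X, y ≠ q i ∧
      Reduces T (((seg q N 0 0 U).bMove (q i)).aMove y) (-1) 0 := by
  have hq := h.inj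
  have he := h.even
  rcases (by omega : (i % 2 = 1 ∧ i + 1 ≤ N) ∨ i = N ∨ (i % 2 = 0 ∧ i < N)) with hc | hc | hc
  · refine seg_reply hq (i + 1) 0 (i - 1) 0 0 (i + 1) (N - i - 1) 1 0
      (hT.subBB hq 0 (i - 1) (by omega) (by omega)
        (fun t _ _ _ => h.unmarked t (by omega) (by omega) (by omega)))
      (hT.subAB hq (i + 1) (N - i - 1) (by omega)
        (fun t _ _ _ _ _ => h.unmarked t (by omega) (by omega) (by omega))
        (fun _ => by omega))
  · refine seg_reply hq (N - 1) 0 (N - 2) 0 0 0 0 0 0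
      (hT.subBB hq 0 (N - 2) (by omega) (by omega)
        (fun t _ _ _ => h.unmarked t (by omega) (by omega) (by omega)))
      subseg_zero_reduces
  · refine seg_reply hq (i - 1) 0 (i - 2) 0 1 i (N - i) 0 0
      (hT.subBA hq 0 (i - 2) (by omega)
        (fun t _ _ => h.unmarked t (by omega) (by omega) (by omega)))
      (hT.subBB hq i (N - i) (by omega) (by omega)
        (fun t _ _ _ => h.unmarked t (by omega) (by omega) (by omega)))

theorem mem_seg_X {q : ℕ → V} {N a b j : ℕ} {U : ℕ → Prop} (h : 1 ≤ j ∧ j ≤ N := by omega) :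
    q j ∈ (seg q N a b U).X := ⟨j, h.1, h.2, rfl⟩

/-- A move of Alice that leaves two parts of a path. -/
theorem seg_aMove_reduces {T : Tok V → Prop} {q : ℕ → V} {N a b : ℕ} {U : ℕ → Prop}
    (hq : Inj q N) (j : ℕ) (s n a₁ b₁ s' n' a₂ b₂ : ℕ) {w w₁ w₂ : ℤ} {k k₁ k₂ : ℕ}
    (h1 : Reduces T (subseg q U s n a₁ b₁) w₁ k₁) (h2 : Reduces T (subseg q U s' n' a₂ b₂) w₂ k₂)
    (hj : 1 ≤ j ∧ j ≤ N := by omega)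
    (hw : w ≤ w₁ + w₂ := by omega) (hk : k₁ + k₂ ≤ k := by omega)
    (hd : n = 0 ∨ n' = 0 ∨ (s + n ≤ N ∧ s' + n' ≤ N ∧ (s + n ≤ s' ∨ s' + n' ≤ s)) := by omega)
    (hX : n = 0 ∨ (s + n ≤ N ∧ (j ≤ s ∨ s + n < j)) := by omega)
    (hX' : n' = 0 ∨ (s' + n' ≤ N ∧ (j ≤ s' ∨ s' + n' < j)) := by omega)
    (hA : ∀ t, 1 ≤ t → t ≤ N → 1 + a ≤ t → t + b ≤ N → (j + 1 < t ∨ t + 1 < j) →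
      (s < t ∧ t ≤ s + n ∧ s + 1 + a₁ ≤ t ∧ t + b₁ ≤ s + n) ∨
      (s' < t ∧ t ≤ s' + n' ∧ s' + 1 + a₂ ≤ t ∧ t + b₂ ≤ s' + n') := by intros; omega)
    (hB : ∀ t, s < t → t ≤ s + n → s + 2 ≤ t + a₁ → t + 1 ≤ s + n + b₁ →
      2 ≤ t + a ∧ t + 1 ≤ N + b ∧
      (1 ≤ s → s + 1 = t → s = j) ∧ (s + n = t → s + n < N → s + n + 1 = j) := by
        intros; omega)
    (hB' : ∀ t, s' < t → t ≤ s' + n' → s' + 2 ≤ t + a₂ → t + 1 ≤ s' + n' + b₂ →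
      2 ≤ t + a ∧ t + 1 ≤ N + b ∧
      (1 ≤ s' → s' + 1 = t → s' = j) ∧ (s' + n' = t → s' + n' < N → s' + n' + 1 = j) := by
        intros; omega) :
    ∃ y ∈ (seg q N a b U).X, Reduces T ((seg q N a b U).aMove y) w k := by
  refine ⟨q j, mem_seg_X hj, ((h1.add h2 (subseg_disj hq hd)).mono ?_ hw hk)⟩
  rw [← sum_pair]
  exact seg_aMove hq hj s n a₁ b₁ s' n' a₂ b₂ hX hX' hA hB hB'

/-! ### The class of races -/

/-- The paths above, and the positions in which Bob still has to hit a set. -/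
inductive RaceTok : Tok V → Prop
  | ab {q : ℕ → V} {N : ℕ} {U : ℕ → Prop} (h : IsAB q N U) : RaceTok ⟨seg q N 1 0 U, 0, 0⟩
  | bb {q : ℕ → V} {N : ℕ} {U : ℕ → Prop} (h : IsBB q N U) : RaceTok ⟨seg q N 0 0 U, -1, 0⟩
  | need (d : Set V) : RaceTok ⟨need d, 1, 0⟩

theorem RaceTok.hasPaths : HasPaths (RaceTok (V := V)) := ⟨.ab, .bb⟩

theorem RaceTok.sub_two {q : ℕ → V} {U : ℕ → Prop} (s : ℕ) (hU : U (s + 1)) :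
    Reduces RaceTok (subseg q U s 2 1 1) 1 0 :=
  (Reduces.of_mem (RaceTok.need _)).better (seg_two_better hU)

theorem RaceTok.sub_one {q : ℕ → V} {U : ℕ → Prop} (s : ℕ) (hU : U (s + 1)) :
    Reduces RaceTok (subseg q U s 1 1 1) 1 0 :=
  (Reduces.of_mem (RaceTok.need _)).better (seg_one_better hU)

theorem seg_three_better {q : ℕ → V} {U : ℕ → Prop} (hq : Inj q 3) (hU : U 2) :
    Better ((seg q 3 1 0 U).aMove (q 2)) (need {q 1, q 3}) := by
  refine ⟨?_, ?_, ?_⟩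
  · rintro v (rfl | rfl)
    · exact ⟨mem_seg_X, fun e => by
        have := hq _ _ (by omega) (by omega) (by omega) (by omega) e; omega⟩
    · exact ⟨mem_seg_X, fun e => by
        have := hq _ _ (by omega) (by omega) (by omega) (by omega) e; omega⟩
  · rintro c ⟨⟨t, h1, h2, h3, h4, rfl⟩, h⟩
    exact absurd ⟨2, by omega, by omega, by omega, by omega, rfl⟩ h
  · rintro d rfl
    refine ⟨_, ⟨_, ⟨2, by omega, by omega, by omega, by omega, hU, rfl⟩, rfl⟩, ?_⟩
    rintro v ⟨⟨s, h1, h2, -, -, rfl⟩, hs⟩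
    obtain rfl | rfl | rfl : s = 1 ∨ s = 2 ∨ s = 3 := by omega
    exacts [Or.inl rfl, absurd rfl hs, Or.inr rfl]

/-- The gain of one unit: in a path with one end of Alice, `q 3` leaves Bob the additional
obligation `{q 1, q 2}`; in a path without an end of hers, `q 2` creates one, which lifts the weight
from `-1` to `0`. -/
theorem RaceTok.isRaceClass : IsRaceClass (RaceTok (V := V)) where
  wf := by
    rintro _ (h | h | d)
    exacts [seg_WF _ _ _ _ _, seg_WF _ _ _ _ _, need_WF d]
  nonempty_of_pos := by
    rintro _ (h | h | d) hw
    · simp at hw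
    · simp at hw
    · exact ⟨d, rfl⟩
  bob := by
    rintro _ (@⟨q, N, U, h⟩ | @⟨q, N, U, h⟩ | d) z hz
    · obtain ⟨i, h1, h2, rfl⟩ := hz
      by_cases hN : 2 ≤ N
      · obtain ⟨y, hy, hyz, L, k1, k2, -, k3⟩ := h.reply hasPaths hN ⟨h1, h2⟩
        exact Or.inr ⟨y, hy, hyz, L, k1, k2, k3⟩
      · exact Or.inl ⟨seg_EA_eq_empty (by omega), by simp⟩
    · obtain ⟨i, h1, h2, rfl⟩ := hz
      obtain ⟨y, hy, hyz, L, k1, k2, -, k3⟩ := h.reply hasPaths ⟨h1, h2⟩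
      exact Or.inr ⟨y, hy, hyz, L, k1, k2, k3⟩
    · exact Or.inl ⟨rfl, by simp⟩
  alice := by
    suffices ∀ t : Tok V, RaceTok t → t.pos.EA.Nonempty →
        ∃ y ∈ t.pos.X, Reduces RaceTok (t.pos.aMove y) (t.wt + 1) 0 by
      intro t ht hE
      obtain ⟨y, hy, L, k1, k2, -, k3⟩ := this t ht hE
      exact ⟨y, hy, L, k1, k2, k3⟩
    rintro _ (@⟨q, N, U, h⟩ | @⟨q, N, U, h⟩ | d) hE
    · have h2 : 2 ≤ N := by obtain ⟨c, t, h1, h2, h3, h4, -⟩ := hE; omega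
      have hq := h.inj
      have hT := RaceTok.hasPaths (V := V)
      simp only [zero_add]
      rcases eq_or_ne N 2 with rfl | hN
      · exact seg_aMove_reduces hq 2 0 1 1 1 0 0 0 0
          (sub_one 0 (h.unmarked 1 (by omega) (by omega) (by omega) (by omega) (by omega)))
          subseg_zero_reduces
      by_cases hU : U 1
      · exact seg_aMove_reduces hq 3 0 2 1 1 3 (N - 3) 1 0 (sub_two 0 hU)
          (hT.subAB hq 3 (N - 3) (by omega)
            (fun t _ _ _ _ _ => h.unmarked t (by omega) (by omega) (by omega) (by omega)
              (by omega))
            (fun _ => Or.inr (h.unmarked _ (by omega) (by omega) (by omega) (by omega)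
              (by omega))))
      -- The first vertex can be dominated by Bob only because `N - 2 = 1`. Then the second is not,
      -- and Alice's middle move leaves Bob the two ends.
      · obtain rfl : N = 3 := by
          by_contra hN3
          exact hU (h.unmarked 1 (by omega) (by omega) (by omega) (by omega) (by omega))
        exact ⟨q 2, mem_seg_X, (Reduces.of_mem (RaceTok.need _)).better
          (seg_three_better hq ((h.three rfl).resolve_left hU))⟩
    · have he := h.even
      have h2 : 2 ≤ N := by obtain ⟨c, t, h1, h2, h3, h4, -⟩ := hE; omega
      exact seg_aMove_reduces (w := -1 + 1) h.inj 2 2 (N - 2) 1 0 0 0 0 0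
        (hasPaths.subAB h.inj 2 (N - 2) (by omega)
          (fun t _ _ _ _ _ => h.unmarked t (by omega) (by omega) (by omega)) (by omega))
        subseg_zero_reduces
    · simp [Pos.need] at hE

/-! ### Pairs and forks -/

/-- Pairs of vertices, each of which contains a vertex that Alice has to claim and a vertex that
Bob has to claim. -/
def pairs {ι : Type} (a b : ι → V) (I : Finset ι) : Pos V :=
  ⟨{v | ∃ i ∈ I, v = a i ∨ v = b i}, {e | ∃ i ∈ I, e = {a i, b i}}, {d | ∃ i ∈ I, d = {a i, b i}}⟩

/-- The vertices of the pairs are distinct. -/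
structure IsPairs {ι : Type} (a b : ι → V) (I : Finset ι) : Prop where
  a_inj : ∀ i ∈ I, ∀ j ∈ I, a i = a j → i = j
  b_inj : ∀ i ∈ I, ∀ j ∈ I, b i = b j → i = j
  a_ne_b : ∀ i ∈ I, ∀ j ∈ I, a i ≠ b j

theorem IsPairs.mono {ι : Type} {a b : ι → V} {I J : Finset ι} (h : IsPairs a b I) (hJ : J ⊆ I) :
    IsPairs a b J :=
  ⟨fun i hi j hj => h.a_inj i (hJ hi) j (hJ hj), fun i hi j hj => h.b_inj i (hJ hi) j (hJ hj),
    fun i hi j hj => h.a_ne_b i (hJ hi) j (hJ hj)⟩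

theorem pairs_WF {ι : Type} (a b : ι → V) (I : Finset ι) : WF (pairs a b I) := by
  constructor <;>
  · rintro c ⟨i, hi, rfl⟩ v (rfl | rfl)
    exacts [⟨i, hi, Or.inl rfl⟩, ⟨i, hi, Or.inr rfl⟩]

/-- A pairing strategy suffices if each clause of Alice contains one of the pairs. -/
theorem IsPairs.paired {ι : Type} {a b : ι → V} {I : Finset ι} (h : IsPairs a b I) {P : Pos V}
    (hX : ∀ i ∈ I, a i ∈ P.X ∧ b i ∈ P.X) (hA : ∀ c ∈ P.EA, ∃ i ∈ I, a i ∈ c ∧ b i ∈ c) :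
    Paired P := by
  refine ⟨fun x y => ∃ i ∈ I, (x = a i ∧ y = b i) ∨ (x = b i ∧ y = a i), ?_, ?_, ?_, ?_⟩
  · rintro x y ⟨i, hi, h | h⟩
    exacts [⟨i, hi, Or.inr h.symm⟩, ⟨i, hi, Or.inl h.symm⟩]
  · rintro x y ⟨i, hi, ⟨rfl, rfl⟩ | ⟨rfl, rfl⟩⟩
    exacts [⟨(hX i hi).1, h.a_ne_b i hi i hi⟩, ⟨(hX i hi).2, (h.a_ne_b i hi i hi).symm⟩]
  · rintro x y y' ⟨i, hi, ⟨rfl, rfl⟩ | ⟨rfl, rfl⟩⟩ ⟨j, hj, ⟨e, rfl⟩ | ⟨e, rfl⟩⟩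
    · rw [h.a_inj i hi j hj e]
    · exact absurd e (h.a_ne_b i hi j hj)
    · exact absurd e.symm (h.a_ne_b j hj i hi)
    · rw [h.b_inj i hi j hj e]
  · intro c hc
    obtain ⟨i, hi, h1, h2⟩ := hA c hc
    exact ⟨_, h1, _, h2, i, hi, Or.inl ⟨rfl, rfl⟩⟩

/-- A pair is a path with two vertices, one end dominated by Alice and the other by Bob: the only
set of each player is the whole pair. -/
theorem IsPairs.reduces {T : Tok V → Prop} (hT : HasPaths T) {ι : Type} {a b : ι → V}
    {I : Finset ι} (h : IsPairs a b I) : Reduces T (pairs a b I) 0 0 := by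
  classical
  induction I using Finset.induction_on with
  | empty => exact Reduces.of_EA_eq_empty (by simp [pairs])
  | @insert i I hi ih =>
    have hi' : i ∈ insert i I := Finset.mem_insert_self _ _
    have hI : ∀ {j}, j ∈ I → j ∈ insert i I := fun hj => Finset.mem_insert_of_mem hj
    have ih := ih (h.mono (Finset.subset_insert _ _))
    let q : ℕ → V := fun t => if t = 1 then a i else b i
    have hq : Inj q 2 := by
      intro s t h1 h2 h3 h4 e
      by_cases hs : s = 1 <;> by_cases ht : t = 1 <;> simp only [q, hs, ht, if_true, if_false] at e
      · omega
      · exact absurd e (h.a_ne_b i hi' i hi')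
      · exact absurd e.symm (h.a_ne_b i hi' i hi')
      · omega
    have h1 : Reduces T (seg q 2 1 0 fun _ => True) 0 0 :=
      Reduces.of_mem (hT.ab ⟨hq, by simp, by simp⟩)
    have hcl : ∀ t, 1 ≤ t → t ≤ 2 → clause q 2 t = {a i, b i} := by
      intro t k1 k2
      ext v
      constructor
      · rintro ⟨s, s1, s2, -, -, rfl⟩
        obtain rfl | rfl : s = 1 ∨ s = 2 := by omega
        exacts [Or.inl rfl, Or.inr rfl]
      · rintro (rfl | rfl)
        exacts [⟨1, by omega, by omega, by omega, by omega, rfl⟩,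
          ⟨2, by omega, by omega, by omega, by omega, rfl⟩]
    have hX : ∀ v, v ∈ (seg q 2 1 0 fun _ => True).X → v = a i ∨ v = b i := by
      rintro v ⟨s, s1, s2, rfl⟩
      obtain rfl | rfl : s = 1 ∨ s = 2 := by omega
      exacts [Or.inl rfl, Or.inr rfl]
    refine (h1.add ih ?_).mono ?_ le_rfl le_rfl
    · rintro v hv ⟨j, hj, hv'⟩
      have hij : i ≠ j := fun e => hi (e ▸ hj)
      rcases hX v hv with rfl | rfl <;> rcases hv' with hv' | hv'
      · exact hij (h.a_inj _ hi' _ (hI hj) hv')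
      · exact h.a_ne_b _ hi' _ (hI hj) hv'
      · exact h.a_ne_b _ (hI hj) _ hi' hv'.symm
      · exact hij (h.b_inj _ hi' _ (hI hj) hv')
    · refine ⟨?_, ?_, ?_⟩
      · rintro v (hv | ⟨j, hj, hv⟩)
        exacts [⟨i, hi', hX v hv⟩, ⟨j, hI hj, hv⟩]
      · rintro c ⟨j, hj, rfl⟩
        rcases Finset.mem_insert.1 hj with rfl | hj
        · exact ⟨_, Or.inl ⟨2, by omega, by omega, by omega, by omega, rfl⟩,
            (hcl 2 (by omega) (by omega)).subset⟩
        · exact ⟨_, Or.inr ⟨j, hj, rfl⟩, subset_rfl⟩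
      · rintro c (⟨t, t1, t2, -, -, -, rfl⟩ | ⟨j, hj, rfl⟩)
        · exact ⟨_, ⟨i, hi', rfl⟩, (hcl t t1 t2).symm.subset⟩
        · exact ⟨_, ⟨j, hI hj, rfl⟩, subset_rfl⟩

/-- A fork with center `c` of which one branch is `c, a₀, b₀`, with `b₀` dominated by Alice, and
the other branches are `c, a i, b i`. -/
def fork {ι : Type} (c a₀ b₀ : V) (a b : ι → V) (I : Finset ι) : Pos V :=
  ⟨{v | v = c ∨ v = a₀ ∨ v = b₀ ∨ ∃ i ∈ I, v = a i ∨ v = b i},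
    {e | e = {v | v = c ∨ v = a₀ ∨ ∃ i ∈ I, v = a i} ∨ e = {c, a₀, b₀} ∨
      ∃ i ∈ I, e = {c, a i, b i} ∨ e = {a i, b i}},
    -- Bob's sets belong to `b₀` and to the `a i`; the center, `a₀` and the `b i` may already be
    -- dominated by him.
    {d | d = {a₀, b₀} ∨ ∃ i ∈ I, d = {c, a i, b i}}⟩

/-- The vertices of the fork are distinct. -/
structure IsFork {ι : Type} (c a₀ b₀ : V) (a b : ι → V) (I : Finset ι) : Prop where
  isPairs : IsPairs a b I
  ca : c ≠ a₀
  cb : c ≠ b₀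
  ab : a₀ ≠ b₀
  a_ne : ∀ i ∈ I, a i ≠ c ∧ a i ≠ a₀ ∧ a i ≠ b₀
  b_ne : ∀ i ∈ I, b i ≠ c ∧ b i ≠ a₀ ∧ b i ≠ b₀

theorem IsFork.mono {ι : Type} {c a₀ b₀ : V} {a b : ι → V} {I J : Finset ι}
    (h : IsFork c a₀ b₀ a b I) (hJ : J ⊆ I) : IsFork c a₀ b₀ a b J :=
  ⟨h.isPairs.mono hJ, h.ca, h.cb, h.ab, fun i hi => h.a_ne i (hJ hi), fun i hi => h.b_ne i (hJ hi)⟩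

theorem fork_WF {ι : Type} (c a₀ b₀ : V) (a b : ι → V) (I : Finset ι) :
    WF (fork c a₀ b₀ a b I) := by
  constructor
  · rintro e (rfl | rfl | ⟨i, hi, rfl | rfl⟩)
    · rintro v (rfl | rfl | ⟨i, hi, rfl⟩)
      exacts [Or.inl rfl, Or.inr (Or.inl rfl), Or.inr (Or.inr (Or.inr ⟨i, hi, Or.inl rfl⟩))]
    · rintro v (rfl | rfl | rfl)
      exacts [Or.inl rfl, Or.inr (Or.inl rfl), Or.inr (Or.inr (Or.inl rfl))]
    · rintro v (rfl | rfl | rfl)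
      exacts [Or.inl rfl, Or.inr (Or.inr (Or.inr ⟨i, hi, Or.inl rfl⟩)),
        Or.inr (Or.inr (Or.inr ⟨i, hi, Or.inr rfl⟩))]
    · rintro v (rfl | rfl)
      exacts [Or.inr (Or.inr (Or.inr ⟨i, hi, Or.inl rfl⟩)),
        Or.inr (Or.inr (Or.inr ⟨i, hi, Or.inr rfl⟩))]
  · rintro e (rfl | ⟨i, hi, rfl⟩)
    · rintro v (rfl | rfl)
      exacts [Or.inr (Or.inl rfl), Or.inr (Or.inr (Or.inl rfl))]
    · rintro v (rfl | rfl | rfl)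
      exacts [Or.inl rfl, Or.inr (Or.inr (Or.inr ⟨i, hi, Or.inl rfl⟩)),
        Or.inr (Or.inr (Or.inr ⟨i, hi, Or.inr rfl⟩))]

/-- A pairing of the vertices of a fork other than `b₀`. -/
theorem IsFork.paired {ι : Type} {c a₀ b₀ : V} {a b : ι → V} {I : Finset ι}
    (h : IsFork c a₀ b₀ a b I) {P : Pos V} (hc : c ∈ P.X) (ha : a₀ ∈ P.X)
    (hX : ∀ i ∈ I, a i ∈ P.X ∧ b i ∈ P.X)
    (hA : ∀ e ∈ P.EA, (c ∈ e ∧ a₀ ∈ e) ∨ ∃ i ∈ I, a i ∈ e ∧ b i ∈ e) : Paired P := by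
  have hp : IsPairs (fun o : Option ι => o.elim c a) (fun o => o.elim a₀ b)
      (Finset.insertNone I) := by
    constructor
    · rintro (_ | i) hi (_ | j) hj e
      · rfl
      · exact absurd e.symm (h.a_ne j (by simpa using hj)).1
      · exact absurd e (h.a_ne i (by simpa using hi)).1
      · exact congrArg some (h.isPairs.a_inj i (by simpa using hi) j (by simpa using hj) e)
    · rintro (_ | i) hi (_ | j) hj e
      · rfl
      · exact absurd e.symm (h.b_ne j (by simpa using hj)).2.1
      · exact absurd e (h.b_ne i (by simpa using hi)).2.1
      · exact congrArg some (h.isPairs.b_inj i (by simpa using hi) j (by simpa using hj) e)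
    · rintro (_ | i) hi (_ | j) hj e
      · exact h.ca e
      · exact absurd e.symm (h.b_ne j (by simpa using hj)).1
      · exact absurd e (h.a_ne i (by simpa using hi)).2.1
      · exact h.isPairs.a_ne_b i (by simpa using hi) j (by simpa using hj) e
  refine hp.paired ?_ ?_
  · rintro (_ | i) hi
    exacts [⟨hc, ha⟩, hX i (by simpa using hi)]
  · intro e he
    rcases hA e he with h | ⟨i, hi, h⟩
    exacts [⟨none, by simp, h⟩, ⟨some i, by simpa using hi, h⟩]

theorem mem_fork_X {ι : Type} {c a₀ b₀ : V} {a b : ι → V} {I : Finset ι} :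
    c ∈ (fork c a₀ b₀ a b I).X ∧ a₀ ∈ (fork c a₀ b₀ a b I).X ∧ b₀ ∈ (fork c a₀ b₀ a b I).X ∧
      ∀ i ∈ I, a i ∈ (fork c a₀ b₀ a b I).X ∧ b i ∈ (fork c a₀ b₀ a b I).X :=
  ⟨Or.inl rfl, Or.inr (Or.inl rfl), Or.inr (Or.inr (Or.inl rfl)), fun i hi =>
    ⟨Or.inr (Or.inr (Or.inr ⟨i, hi, Or.inl rfl⟩)), Or.inr (Or.inr (Or.inr ⟨i, hi, Or.inr rfl⟩))⟩⟩

theorem fork_EA {ι : Type} {c a₀ b₀ : V} {a b : ι → V} {I : Finset ι} :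
    ∀ e ∈ (fork c a₀ b₀ a b I).EA, (c ∈ e ∧ a₀ ∈ e) ∨ ∃ i ∈ I, a i ∈ e ∧ b i ∈ e := by
  rintro e (rfl | rfl | ⟨i, hi, rfl | rfl⟩)
  · exact Or.inl ⟨Or.inl rfl, Or.inr (Or.inl rfl)⟩
  · exact Or.inl ⟨Or.inl rfl, Or.inr (Or.inl rfl)⟩
  · exact Or.inr ⟨i, hi, Or.inr (Or.inl rfl), Or.inr (Or.inr rfl)⟩
  · exact Or.inr ⟨i, hi, Or.inl rfl, Or.inr rfl⟩

theorem IsFork.fork_paired {ι : Type} {c a₀ b₀ : V} {a b : ι → V} {I : Finset ι}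
    (h : IsFork c a₀ b₀ a b I) : Paired (fork c a₀ b₀ a b I) :=
  h.paired mem_fork_X.1 mem_fork_X.2.1 mem_fork_X.2.2.2 fork_EA

theorem IsFork.bMove_paired {ι : Type} {c a₀ b₀ : V} {a b : ι → V} {I : Finset ι}
    (h : IsFork c a₀ b₀ a b I) : Paired ((fork c a₀ b₀ a b I).bMove b₀) := by
  refine h.paired ⟨mem_fork_X.1, h.cb⟩ ⟨mem_fork_X.2.1, h.ab⟩ (fun i hi =>
    ⟨⟨(mem_fork_X.2.2.2 i hi).1, (h.a_ne i hi).2.2⟩, ⟨(mem_fork_X.2.2.2 i hi).2, (h.b_ne i hi).2.2⟩⟩) ?_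
  rintro _ ⟨e, he, rfl⟩
  rcases fork_EA e he with ⟨h1, h2⟩ | ⟨i, hi, h1, h2⟩
  · exact Or.inl ⟨⟨h1, h.cb⟩, ⟨h2, h.ab⟩⟩
  · exact Or.inr ⟨i, hi, ⟨h1, (h.a_ne i hi).2.2⟩, ⟨h2, (h.b_ne i hi).2.2⟩⟩

/-- The center hits Bob's sets in all branches but the first. Alice's `a₀` turns the remaining set
`{a₀, b₀}` into a threat, and what she still has to hit is paired. -/
theorem IsFork.center {ι : Type} {c a₀ b₀ : V} {a b : ι → V} {I : Finset ι}
    (h : IsFork c a₀ b₀ a b I) : Better (((fork c a₀ b₀ a b I).bMove c).aMove a₀)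
      ((need {b₀}).add ⟨(pairs a b I).X, (pairs a b I).EA, ∅⟩) := by
  refine ⟨?_, ?_, ?_⟩
  · rintro v (rfl | ⟨i, hi, rfl | rfl⟩)
    · exact ⟨⟨mem_fork_X.2.2.1, h.cb.symm⟩, h.ab.symm⟩
    · exact ⟨⟨(mem_fork_X.2.2.2 i hi).1, (h.a_ne i hi).1⟩, (h.a_ne i hi).2.1⟩
    · exact ⟨⟨(mem_fork_X.2.2.2 i hi).2, (h.b_ne i hi).1⟩, (h.b_ne i hi).2.1⟩
  · rintro _ ⟨⟨e, he, rfl⟩, he'⟩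
    rcases fork_EA e he with ⟨h1, h2⟩ | ⟨i, hi, h1, h2⟩
    · exact absurd ⟨h2, h.ca.symm⟩ he'
    · refine ⟨_, Or.inr ⟨i, hi, rfl⟩, ?_⟩
      rintro v (rfl | rfl)
      exacts [⟨h1, (h.a_ne i hi).1⟩, ⟨h2, (h.b_ne i hi).1⟩]
  · rintro d (rfl | h)
    · refine ⟨_, ⟨_, ⟨Or.inl rfl, ?_⟩, rfl⟩, ?_⟩
      · rintro (e | e)
        exacts [h.ca e, h.cb e]
      · rintro v ⟨rfl | rfl, hv⟩
        exacts [absurd rfl hv, rfl]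
    · exact h.elim

/-- Bob has claimed `a₀` and Alice the center. -/
theorem IsFork.side {ι : Type} {c a₀ b₀ : V} {a b : ι → V} {I : Finset ι}
    (h : IsFork c a₀ b₀ a b I) : Better (((fork c a₀ b₀ a b I).bMove a₀).aMove c) (pairs a b I) := by
  refine ⟨?_, ?_, ?_⟩
  · rintro v ⟨i, hi, rfl | rfl⟩
    · exact ⟨⟨(mem_fork_X.2.2.2 i hi).1, (h.a_ne i hi).2.1⟩, (h.a_ne i hi).1⟩
    · exact ⟨⟨(mem_fork_X.2.2.2 i hi).2, (h.b_ne i hi).2.1⟩, (h.b_ne i hi).1⟩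
  · rintro _ ⟨⟨e, he, rfl⟩, he'⟩
    rcases fork_EA e he with ⟨h1, h2⟩ | ⟨i, hi, h1, h2⟩
    · exact absurd ⟨h1, h.ca⟩ he'
    · refine ⟨_, ⟨i, hi, rfl⟩, ?_⟩
      rintro v (rfl | rfl)
      exacts [⟨h1, (h.a_ne i hi).2.1⟩, ⟨h2, (h.b_ne i hi).2.1⟩]
  · rintro d ⟨i, hi, rfl⟩
    refine ⟨_, ⟨_, ⟨Or.inr ⟨i, hi, rfl⟩, ?_⟩, rfl⟩, ?_⟩
    · rintro (e | e | e)
      exacts [h.ca e.symm, (h.a_ne i hi).2.1 e.symm, (h.b_ne i hi).2.1 e.symm]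
    · rintro v ⟨rfl | rfl | rfl, hv⟩
      exacts [absurd rfl hv, Or.inl rfl, Or.inr rfl]

/-- Only the pairs remain to Alice, while Bob is left with one more set, `{a₀, b₀}`: this is the
unit gained by a weak conversion. -/
theorem IsFork.alice {ι : Type} {c a₀ b₀ : V} {a b : ι → V} {I : Finset ι}
    (h : IsFork c a₀ b₀ a b I) :
    Better ((fork c a₀ b₀ a b I).aMove c) ((need {a₀, b₀}).add (pairs a b I)) := by
  refine ⟨?_, ?_, ?_⟩
  · rintro v ((rfl | rfl) | ⟨i, hi, rfl | rfl⟩)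
    · exact ⟨mem_fork_X.2.1, h.ca.symm⟩
    · exact ⟨mem_fork_X.2.2.1, h.cb.symm⟩
    · exact ⟨(mem_fork_X.2.2.2 i hi).1, (h.a_ne i hi).1⟩
    · exact ⟨(mem_fork_X.2.2.2 i hi).2, (h.b_ne i hi).1⟩
  · rintro e ⟨he, he'⟩
    rcases fork_EA e he with ⟨h1, h2⟩ | ⟨i, hi, h1, h2⟩
    · exact absurd h1 he'
    · refine ⟨_, Or.inr ⟨i, hi, rfl⟩, ?_⟩
      rintro v (rfl | rfl)
      exacts [h1, h2]
  · rintro d (rfl | ⟨i, hi, rfl⟩)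
    · exact ⟨_, ⟨_, Or.inl rfl, rfl⟩, Set.sdiff_subset⟩
    · refine ⟨_, ⟨_, Or.inr ⟨i, hi, rfl⟩, rfl⟩, ?_⟩
      rintro v ⟨rfl | rfl | rfl, hv⟩
      exacts [absurd rfl hv, Or.inl rfl, Or.inr rfl]

/-- A move in a branch is answered in the same branch, which then disappears. For this reason
`IsFork` has no lower bound on the number of branches. -/
theorem IsFork.branch {ι : Type} [DecidableEq ι] {c a₀ b₀ : V} {a b : ι → V} {I : Finset ι}
    (h : IsFork c a₀ b₀ a b I) {i : ι} (hi : i ∈ I) {x y : V}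
    (hxy : (x = a i ∧ y = b i) ∨ (x = b i ∧ y = a i)) :
    y ∈ (fork c a₀ b₀ a b I).X ∧ y ≠ x ∧
    Better (((fork c a₀ b₀ a b I).bMove x).aMove y) (fork c a₀ b₀ a b (I.erase i)) := by
  obtain ⟨ha, hb⟩ := (mem_fork_X (c := c) (a₀ := a₀) (b₀ := b₀) (a := a) (b := b)).2.2.2 i hi
  have hab := h.isPairs.a_ne_b i hi i hi
  have hx : ∀ v, (v = c ∨ v = a₀ ∨ v = b₀ ∨ ∃ j ∈ I.erase i, v = a j ∨ v = b j) →
      v ≠ x ∧ v ≠ y := by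
    have h1 := h.a_ne i hi
    have h2 := h.b_ne i hi
    intro v hv
    suffices v ≠ a i ∧ v ≠ b i by
      rcases hxy with ⟨rfl, rfl⟩ | ⟨rfl, rfl⟩
      exacts [this, this.symm]
    rcases hv with rfl | rfl | rfl | ⟨j, hj, rfl | rfl⟩
    · exact ⟨h1.1.symm, h2.1.symm⟩
    · exact ⟨h1.2.1.symm, h2.2.1.symm⟩
    · exact ⟨h1.2.2.symm, h2.2.2.symm⟩
    · rw [Finset.mem_erase] at hj
      exact ⟨fun e => hj.1 (h.isPairs.a_inj j hj.2 i hi e), h.isPairs.a_ne_b j hj.2 i hi⟩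
    · rw [Finset.mem_erase] at hj
      exact ⟨(h.isPairs.a_ne_b i hi j hj.2).symm, fun e => hj.1 (h.isPairs.b_inj j hj.2 i hi e)⟩
  have hW := fork_WF c a₀ b₀ a b (I.erase i)
  refine ⟨?_, ?_, ?_, ?_, ?_⟩
  · rcases hxy with ⟨rfl, rfl⟩ | ⟨rfl, rfl⟩
    exacts [hb, ha]
  · rcases hxy with ⟨rfl, rfl⟩ | ⟨rfl, rfl⟩
    exacts [hab.symm, hab]
  · intro v hv
    refine ⟨⟨?_, (hx v hv).1⟩, (hx v hv).2⟩
    rcases hv with rfl | rfl | rfl | ⟨j, hj, hv⟩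
    · exact mem_fork_X.1
    · exact mem_fork_X.2.1
    · exact mem_fork_X.2.2.1
    · exact Or.inr (Or.inr (Or.inr ⟨j, Finset.mem_of_mem_erase hj, hv⟩))
  · rintro _ ⟨⟨e, he, rfl⟩, hy⟩
    have key : ∀ e' ∈ (fork c a₀ b₀ a b (I.erase i)).EA, e' ⊆ e →
        ∃ c' ∈ (fork c a₀ b₀ a b (I.erase i)).EA, c' ⊆ e \ {x} :=
      fun e' h1 h2 => ⟨e', h1, fun v hv => ⟨h2 hv, (hx v (hW.1 e' h1 hv)).1⟩⟩
    rcases he with rfl | rfl | ⟨j, hj, he⟩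
    · refine key _ (Or.inl rfl) ?_
      rintro v (rfl | rfl | ⟨j, hj, rfl⟩)
      exacts [Or.inl rfl, Or.inr (Or.inl rfl), Or.inr (Or.inr ⟨j, Finset.mem_of_mem_erase hj, rfl⟩)]
    · exact key _ (Or.inr (Or.inl rfl)) subset_rfl
    · by_cases hji : j = i
      · subst hji
        refine absurd ⟨?_, ?_⟩ hy
        · rcases hxy with ⟨rfl, rfl⟩ | ⟨rfl, rfl⟩ <;> rcases he with rfl | rfl <;> simp
        · rcases hxy with ⟨rfl, rfl⟩ | ⟨rfl, rfl⟩
          exacts [hab.symm, hab]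
      · exact key e (Or.inr (Or.inr ⟨j, Finset.mem_erase.2 ⟨hji, hj⟩, he⟩)) subset_rfl
  · intro d hd
    refine ⟨d \ {y}, ⟨d, ⟨?_, fun hxd => (hx x (hW.2 d hd hxd)).1 rfl⟩, rfl⟩, Set.sdiff_subset⟩
    rcases hd with rfl | ⟨j, hj, rfl⟩
    exacts [Or.inl rfl, Or.inr ⟨j, Finset.mem_of_mem_erase hj, rfl⟩]

/-! ### Longer paths -/

/-- A long odd path with only its first end dominated by Alice; if `k = 1`, then its third vertex
may be dominated by Bob. -/
structure IsOdd (q : ℕ → V) (N : ℕ) (U : ℕ → Prop) (k : ℕ) : Prop where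
  inj : Inj q N
  odd : N % 2 = 1
  nine_le : 9 ≤ N
  -- For `k = 1` the length is `9` or `11`; the parts that Alice's answers cut off at the left are
  -- then of type `IsAB`, have five or seven vertices as in `IsAW`, or form the nine-vertex path of
  -- the same type.
  weak : k = 0 ∨ (k = 1 ∧ N ≤ 11)
  unmarked : ∀ t, 1 ≤ t → t + 1 ≤ N → t ≠ 2 → t ≠ 5 → t + 2 ≠ N → (k = 1 → t ≠ 3) → U t

/-- A path with both ends dominated by Alice, with few vertices dominated by Bob. -/
structure IsAA (q : ℕ → V) (N : ℕ) (U : ℕ → Prop) : Prop where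
  inj : Inj q N
  pos : 1 ≤ N
  -- The exception for four vertices is needed when Bob plays the sixth vertex of an `IsAW` path
  -- with seven vertices.
  unmarked : ∀ t, 1 ≤ t → t ≤ N → t ≠ 2 → t ≠ 5 → (t = 3 → N ≠ 4) → U t

/-- A path with five or seven vertices and both ends dominated by Alice, in which three given
vertices may be dominated by Bob. -/
structure IsAW (q : ℕ → V) (N : ℕ) (U : ℕ → Prop) : Prop where
  inj : Inj q N
  five_or_seven : N = 5 ∨ N = 7
  unmarked : ∀ t, 1 ≤ t → t ≤ N → t ≠ 2 → t ≠ 3 → t ≠ 5 → U t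

/-- A class that contains all these paths. -/
structure HasLongPaths (T : Tok V → Prop) : Prop extends HasPaths T where
  odd : ∀ {q N U k}, IsOdd q N U k → T ⟨seg q N 1 0 U, 0, k⟩
  aa : ∀ {q N U}, IsAA q N U → T ⟨seg q N 1 1 U, 1, 0⟩
  aw : ∀ {q N U}, IsAW q N U → T ⟨seg q N 1 1 U, 1, 1⟩

theorem HasLongPaths.subOdd {T : Tok V → Prop} (hT : HasLongPaths T) {q : ℕ → V} {N : ℕ}
    {U : ℕ → Prop} (hq : Inj q N) (n : ℕ) (hn : n ≤ N) (ho : n % 2 = 1)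
    (hU : ∀ t, 1 ≤ t → t + 1 ≤ n → t ≠ 2 → t ≠ 5 → U t) :
    Reduces T (subseg q U 0 n 1 0) 0 0 := by
  by_cases h9 : 9 ≤ n
  · exact .of_mem (hT.odd ⟨hq.sub (by omega), ho, h9, Or.inl rfl, fun t _ _ _ _ _ _ =>
      hU _ (by omega) (by omega) (by omega) (by omega)⟩)
  · exact hT.subAB hq 0 n (by omega)
      (fun t _ _ _ _ _ => hU t (by omega) (by omega) (by omega) (by omega))
      (fun _ => Or.inl (hU _ (by omega) (by omega) (by omega) (by omega)))

theorem HasLongPaths.subAA {T : Tok V → Prop} (hT : HasLongPaths T) {q : ℕ → V} {N : ℕ}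
    {U : ℕ → Prop} (hq : Inj q N) (s n : ℕ) (hn : s + n ≤ N) (h1 : 1 ≤ n)
    (hU : ∀ t, s < t → t ≤ s + n → t ≠ s + 2 → t ≠ s + 5 → (t = s + 3 → n ≠ 4) → U t) :
    Reduces T (subseg q U s n 1 1) 1 0 :=
  .of_mem (hT.aa ⟨hq.sub (by omega), h1, fun t _ _ _ _ _ =>
    hU _ (by omega) (by omega) (by omega) (by omega) (by omega)⟩)

theorem HasLongPaths.subAW {T : Tok V → Prop} (hT : HasLongPaths T) {q : ℕ → V} {N : ℕ}
    {U : ℕ → Prop} (hq : Inj q N) (n : ℕ) (hn : n ≤ N) (h1 : n = 5 ∨ n = 7)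
    (hU : ∀ t, 1 ≤ t → t ≤ n → t ≠ 2 → t ≠ 3 → t ≠ 5 → U t) :
    Reduces T (subseg q U 0 n 1 1) 1 1 :=
  .of_mem (hT.aw ⟨hq.sub (by omega), h1, fun t _ _ _ _ _ =>
    hU _ (by omega) (by omega) (by omega) (by omega) (by omega)⟩)

/-- Alice makes a threat at the first vertex, and a pairing suffices elsewhere. -/
theorem seg_double {q : ℕ → V} {N b : ℕ} {U : ℕ → Prop} (hq : Inj q N) (hN : 3 ≤ N)
    (hb : b ≤ 1) (hU : U 1) (hP : Paired (subseg q (fun _ => False) 3 (N - 3) 0 b)) :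
    ∃ y ∈ (seg q N 1 b U).X, y ≠ q 3 ∧ ∃ d, ∃ Q : Pos V, WF Q ∧ Paired Q ∧ d ∉ Q.X ∧
      Better (((seg q N 1 b U).bMove (q 3)).aMove y) ((need {d}).add Q) := by
  obtain ⟨h3, h4⟩ := seg_X_ne (a := 1) (b := b) (U := U) hq (i := 3) (j := 2) (by omega) (by omega)
    (by omega)
  refine ⟨q 2, h3, h4, q 1, _, seg_WF _ _ _ _ _, hP, ?_, ?_⟩
  · rintro ⟨s, h1, h2, e⟩
    have := hq _ _ (by omega) (by omega) (by omega) (by omega) e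
    omega
  · have h := seg_move (a := 1) (b := b) (U := fun t => t = 1) hq (i := 3) (j := 2) (by omega)
      (by omega) (by omega) 0 1 1 1 3 (N - 3) 0 b
      (by omega) (by omega) (by intros; omega) (by intros; omega) (by intros; omega)
    rw [sum_pair] at h
    refine Better.trans ?_ (h.trans ?_)
    · refine Better.aMove (Better.bMove (show Better (seg q N 1 b U) (seg q N 1 b fun t => t = 1)
        from ⟨subset_rfl, fun c hc => ⟨c, hc, subset_rfl⟩, ?_⟩) _) _
      rintro d ⟨t, h1, h2, h3, h4, rfl, rfl⟩
      exact ⟨_, ⟨_, h1, h2, h3, h4, hU, rfl⟩, subset_rfl⟩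
    · exact (seg_one_better (by omega)).add ⟨subset_rfl, fun c hc => ⟨c, hc, subset_rfl⟩, by
        rintro d ⟨t, -, -, -, -, hf, -⟩; exact hf.elim⟩

/-! ### The threats -/

/-- Bob needs to claim one given vertex, or one of the two vertices of each of three consecutive
pairs. -/
inductive ThreatTok : Tok V → Prop
  | single (d : V) : ThreatTok ⟨need {d}, 0, 0⟩
  -- Bob needs two vertices to hit the three sets but one for a single threat, hence the weight `1`
  -- instead of `0`.
  | three {x y z u : V} (h : [x, y, z, u].Nodup) :
    ThreatTok ⟨⟨{x, y, z, u}, ∅, {{x, y}, {y, z}, {z, u}}⟩, 1, 0⟩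

theorem threat_need [Finite V] (e : V) : Threat (need {e}) := fun _ _ hP hd => ⟨e, rfl,
  Paired.W_of_killed (Paired.aMove (Paired.add (.of_EA_eq_empty rfl) hP hd) e)
    ⟨{e}, Or.inl rfl, by simp⟩⟩

/-- One move of Alice creates two threats of one vertex each; Bob can parry only one of them. -/
theorem W_of_need [Finite V] {d e y : V} {P R : Pos V} (hde : d ≠ e)
    (hP : Better (P.aMove y) ((need {d}).add (need {e}))) (hR : WF R) (hPR : Paired R)
    (hd : d ∉ R.X) (he : e ∉ R.X) (hy : y ∉ R.X) : W ((P.add R).aMove y) := by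
  have h := W_of_two_threats (d := d) (threat_need e) rfl (need_WF _) hR hPR
    (by rintro v rfl; exact he) hde hd
  refine h.mono ?_
  rw [← add_assoc']
  exact Better.aMove_add hy hP

/-! ### The main class -/

/-- The positions that Alice can handle if she has a threat elsewhere. -/
inductive MainTok : Tok V → Prop
  | ab {q : ℕ → V} {N : ℕ} {U : ℕ → Prop} (h : IsAB q N U) : MainTok ⟨seg q N 1 0 U, 0, 0⟩
  | bb {q : ℕ → V} {N : ℕ} {U : ℕ → Prop} (h : IsBB q N U) : MainTok ⟨seg q N 0 0 U, -1, 0⟩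
  | odd {q : ℕ → V} {N k : ℕ} {U : ℕ → Prop} (h : IsOdd q N U k) : MainTok ⟨seg q N 1 0 U, 0, k⟩
  | aa {q : ℕ → V} {N : ℕ} {U : ℕ → Prop} (h : IsAA q N U) : MainTok ⟨seg q N 1 1 U, 1, 0⟩
  | aw {q : ℕ → V} {N : ℕ} {U : ℕ → Prop} (h : IsAW q N U) : MainTok ⟨seg q N 1 1 U, 1, 1⟩
  | need (d : Set V) : MainTok ⟨need d, 1, 0⟩
  | fork {ι : Type} {c a₀ b₀ : V} {a b : ι → V} {I : Finset ι} (h : IsFork c a₀ b₀ a b I) :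
    MainTok ⟨fork c a₀ b₀ a b I, 0, 1⟩

theorem MainTok.hasLongPaths : HasLongPaths (MainTok (V := V)) := ⟨⟨.ab, .bb⟩, .odd, .aa, .aw⟩

theorem ThreatTok.isThreatClass [Finite V] : IsThreatClass (MainTok (V := V)) ThreatTok where
  wf := by
    rintro _ (d | h)
    · exact need_WF _
    · constructor
      · rintro c hc
        simp at hc
      · rintro c (rfl | rfl | rfl) v (rfl | rfl) <;> simp
  EA_eq := by rintro _ (d | h) <;> rfl
  EB_nonempty := by
    rintro _ (d | h)
    exacts [⟨_, rfl⟩, ⟨_, Or.inl rfl⟩]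
  threat := by
    rintro _ (d | @⟨x, y, z, u, h⟩)
    · exact threat_need d
    · intro R hR hP hd
      simp only [List.nodup_cons, List.mem_cons, List.not_mem_nil, or_false, not_or] at h
      refine ⟨y, by simp, W_of_need (d := x) (e := z) (by tauto) ?_ hR hP (hd _ (by simp))
        (hd _ (by simp)) (hd _ (by simp))⟩
      refine ⟨?_, by simp [Pos.aMove], ?_⟩
      · rintro v (rfl | rfl)
        exacts [⟨by simp, by simp; tauto⟩, ⟨by simp, by simp; tauto⟩]
      · rintro d (rfl | rfl)
        · exact ⟨_, ⟨{x, y}, by simp, rfl⟩, by simp⟩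
        · exact ⟨_, ⟨{y, z}, by simp, rfl⟩, by simp⟩
  bob := by
    rintro _ (d | @⟨x, y, z, u, h⟩) w hw
    · obtain rfl : w = d := hw
      refine Or.inl ⟨[], ⟨by simp, by simp⟩, by simp, rfl, by simp [total, sum], ?_,
        by simp [total, sum]⟩
      rintro c ⟨e, he, -⟩
      simp [Pos.need] at he
    · simp only [List.nodup_cons, List.mem_cons, List.not_mem_nil, or_false, not_or] at h
      -- A middle vertex hits two of the three sets; the last one becomes an ordinary obligation of
      -- weight one.
      have key : ∀ v v', v ∈ ({x, y, z, u} : Set V) → v' ∈ ({x, y, z, u} : Set V) →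
          v ≠ w → v' ≠ w →
          {v, v'} ∈ ({{x, y}, {y, z}, {z, u}} : Set (Set V)) →
          ∃ L, Good (MainTok (V := V)) L ∧ 1 ≤ wts L ∧ weaks L = 0 ∧
            Better ((⟨{x, y, z, u}, ∅, {{x, y}, {y, z}, {z, u}}⟩ : Pos V).bMove w) (total L) := by
        intro v v' h1 h2 h3 h4 h5
        refine ⟨[⟨Pos.need {v, v'}, 1, 0⟩], ⟨by simpa using .need _, by simp⟩, by simp, by simp, ?_,
          by simp [Pos.bMove], ?_⟩
        · rintro t ⟨p, hp, ht⟩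
          simp only [List.map_cons, List.map_nil, List.mem_singleton] at hp
          subst hp
          rcases ht with rfl | rfl
          exacts [⟨h1, h3⟩, ⟨h2, h4⟩]
        · rintro t ⟨p, hp, ht⟩
          simp only [List.map_cons, List.map_nil, List.mem_singleton] at hp
          subst hp
          obtain rfl := ht
          refine ⟨_, ⟨h5, ?_⟩, subset_rfl⟩
          rintro (e | e)
          exacts [h3 e.symm, h4 e.symm]
      rcases hw with rfl | rfl | rfl | rfl
      -- After an end vertex two sets with a common member remain, and Alice doubles her threat
      -- there.
      · refine Or.inr fun R hR hP hd => ⟨z, by simp, by tauto, W_of_need (d := y) (e := u)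
          (by tauto) ?_ hR hP (hd _ (by simp)) (hd _ (by simp)) (hd _ (by simp))⟩
        refine ⟨?_, by simp [Pos.aMove, Pos.bMove], ?_⟩
        · rintro v (rfl | rfl)
          · exact ⟨⟨by simp, by simp; tauto⟩, by simp; tauto⟩
          · exact ⟨⟨by simp, by simp; tauto⟩, by simp; tauto⟩
        · rintro d (rfl | rfl)
          · exact ⟨_, ⟨{y, z}, ⟨by simp, by simp; tauto⟩, rfl⟩, by simp⟩
          · exact ⟨_, ⟨{z, u}, ⟨by simp, by simp; tauto⟩, rfl⟩, by simp⟩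
      · exact Or.inl (key z u (by simp) (by simp) (by tauto) (by tauto) (by simp))
      · exact Or.inl (key x y (by simp) (by simp) (by tauto) (by tauto) (by simp))
      · refine Or.inr fun R hR hP hd => ⟨y, by simp, by tauto, W_of_need (d := x) (e := z)
          (by tauto) ?_ hR hP (hd _ (by simp)) (hd _ (by simp)) (hd _ (by simp))⟩
        refine ⟨?_, by simp [Pos.aMove, Pos.bMove], ?_⟩
        · rintro v (rfl | rfl)
          · exact ⟨⟨by simp, by simp; tauto⟩, by simp; tauto⟩
          · exact ⟨⟨by simp, by simp; tauto⟩, by simp; tauto⟩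
        · rintro d (rfl | rfl)
          · exact ⟨_, ⟨{x, y}, ⟨by simp, by simp; tauto⟩, rfl⟩, by simp⟩
          · exact ⟨_, ⟨{y, z}, ⟨by simp, by simp; tauto⟩, rfl⟩, by simp⟩

/-- The possible answers of Alice to a move of Bob. -/
def Answer (T : Tok V → Prop) (p : Pos V) (z : V) (w : ℤ) (k : ℕ) : Prop :=
  (∃ y ∈ p.X, y ≠ z ∧ Reduces T ((p.bMove z).aMove y) w k) ∨ Paired (p.bMove z) ∨
    ∃ y ∈ p.X, y ≠ z ∧ ∃ d, ∃ Q : Pos V, WF Q ∧ Paired Q ∧ d ∉ Q.X ∧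
      Better ((p.bMove z).aMove y) ((need {d}).add Q)

/-- Odd length matters if Bob plays `q 1` or `q 3`: the vertices from `q 2`, respectively `q 4`,
onwards can be paired, so Alice executes her other threat, respectively adds one at `q 1`. Other
moves are answered next to Bob. For odd `i` with `7 ≤ i < N` she plays on the left of him, and the
part with two ends of hers (weight `1`) makes up for the part with none (weight `-1`). -/
theorem IsOdd.answer {T : Tok V → Prop} (hT : HasLongPaths T) {q : ℕ → V} {N k : ℕ}
    {U : ℕ → Prop} (h : IsOdd q N U k) {i : ℕ} (hi : 1 ≤ i ∧ i ≤ N) :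
    Answer T (seg q N 1 0 U) (q i) 0 k := by
  have hq := h.inj
  have ho := h.odd
  have h9 := h.nine_le
  have hw := h.weak
  rcases (by omega : i = 1 ∨ i = 3 ∨ (i % 2 = 0 ∧ (k = 0 ∨ i ≤ 8)) ∨ (i = 10 ∧ N = 11 ∧ k = 1) ∨
    i = 5 ∨ (7 ≤ i ∧ i % 2 = 1 ∧ i < N) ∨ (i = N ∧ (k = 0 ∨ N = 9)) ∨ (i = 11 ∧ N = 11 ∧ k = 1)) with
    hc | hc | hc | hc | hc | hc | hc | hc
  · subst hc
    exact Or.inr (Or.inl (seg_bMove_paired hq hi 2 N (by omega) (by omega) (by omega)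
      (by intros; omega)))
  · subst hc
    exact Or.inr (Or.inr (seg_double hq (by omega) (by omega)
      (h.unmarked 1 (by omega) (by omega) (by omega) (by omega) (by omega) (by omega))
      (seg_paired (hq.sub (by omega)) 1 (N - 3) (by omega) (by omega) (by intros; omega))))
  · refine Or.inl (seg_reply hq (i + 1) 0 (i - 1) 1 0 (i + 1) (N - i - 1) 1 0 (k₁ := 0) (w₁ := 0) ?_
      (hT.subAB hq (i + 1) (N - i - 1) (by omega)
        (fun t _ _ _ _ _ => h.unmarked t (by omega) (by omega) (by omega) (by omega) (by omega)
          (by omega))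
        (by omega)))
    rcases hc.2 with hk | hk
    · exact hT.subOdd hq (i - 1) (by omega) (by omega) (fun t _ _ _ _ =>
        h.unmarked t (by omega) (by omega) (by omega) (by omega) (by omega) (by omega))
    · exact hT.subAB hq 0 (i - 1) (by omega)
        (fun t _ _ _ _ _ => h.unmarked t (by omega) (by omega) (by omega) (by omega) (by omega)
          (by omega))
        (fun _ => Or.inl (h.unmarked 1 (by omega) (by omega) (by omega) (by omega) (by omega)
          (by omega)))
  · obtain ⟨rfl, rfl, rfl⟩ := hc
    exact Or.inl (seg_reply hq 11 0 9 1 0 0 0 0 0 (k₁ := 1) (w₁ := 0)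
      (.of_mem (hT.odd ⟨hq.sub (by omega), by omega, by omega, by omega, fun t _ _ _ _ _ _ =>
        h.unmarked _ (by omega) (by omega) (by omega) (by omega) (by omega) (by omega)⟩))
      subseg_zero_reduces)
  · subst hc
    exact Or.inl (seg_reply hq 6 0 4 1 0 6 (N - 6) 1 0
      (hT.subAB hq 0 4 (by omega)
        (fun t _ _ _ _ _ => h.unmarked t (by omega) (by omega) (by omega) (by omega) (by omega)
          (by omega)) (by omega))
      (hT.subAB hq 6 (N - 6) (by omega)
        (fun t _ _ _ _ _ => h.unmarked t (by omega) (by omega) (by omega) (by omega) (by omega)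
          (by omega))
        (fun _ => Or.inr (h.unmarked _ (by omega) (by omega) (by omega) (by omega) (by omega)
          (by omega)))))
  · have hB := hT.subBB hq i (N - i) (by omega) (by omega)
      (fun t _ _ _ => h.unmarked t (by omega) (by omega) (by omega) (by omega) (by omega) (by omega))
    rcases (by omega : k = 0 ∨ k = 1) with rfl | rfl
    · exact Or.inl (seg_reply hq (i - 1) 0 (i - 2) 1 1 i (N - i) 0 0
        (hT.subAA hq 0 (i - 2) (by omega) (by omega) (fun t _ _ _ _ _ =>
          h.unmarked t (by omega) (by omega) (by omega) (by omega) (by omega) (by omega))) hB)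
    · exact Or.inl (seg_reply hq (i - 1) 0 (i - 2) 1 1 i (N - i) 0 0
        (hT.subAW hq (i - 2) (by omega) (by omega) (fun t _ _ _ _ _ =>
          h.unmarked t (by omega) (by omega) (by omega) (by omega) (by omega) (by omega))) hB)
  · refine Or.inl (seg_reply hq (N - 1) 0 (N - 2) 1 0 0 0 0 0 (k₁ := 0) (w₁ := 0) ?_
      subseg_zero_reduces)
    rcases hc.2 with hk | hk
    · exact hT.subOdd hq (N - 2) (by omega) (by omega) (fun t _ _ _ _ =>
        h.unmarked t (by omega) (by omega) (by omega) (by omega) (by omega) (by omega))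
    · exact hT.subAB hq 0 (N - 2) (by omega)
        (fun t _ _ _ _ _ => h.unmarked t (by omega) (by omega) (by omega) (by omega) (by omega)
          (by omega)) (by omega)
  · obtain ⟨rfl, rfl, rfl⟩ := hc
    exact Or.inl (seg_reply hq 10 0 9 1 0 0 0 0 0 (k₁ := 1) (w₁ := 0)
      (.of_mem (hT.odd ⟨hq.sub (by omega), by omega, by omega, by omega, fun t _ _ _ _ _ _ =>
        h.unmarked _ (by omega) (by omega) (by omega) (by omega) (by omega) (by omega)⟩))
      subseg_zero_reduces)

/-- The middle of a path with three vertices. -/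
theorem seg_three_paired {q : ℕ → V} {U : ℕ → Prop} (hq : Inj q 3) :
    Paired ((seg q 3 1 1 U).bMove (q 2)) := by
  have hne : ∀ s t, 1 ≤ s → s ≤ 3 → 1 ≤ t → t ≤ 3 → s ≠ t → q s ≠ q t :=
    fun s t h1 h2 h3 h4 h5 e => h5 (hq _ _ h1 h2 h3 h4 e)
  have h : IsPairs (fun _ : Unit => q 1) (fun _ => q 3) {()} :=
    ⟨fun _ _ _ _ _ => rfl, fun _ _ _ _ _ => rfl, fun _ _ _ _ =>
      hne _ _ (by omega) (by omega) (by omega) (by omega) (by omega)⟩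
  have h12 := hne 1 2 (by omega) (by omega) (by omega) (by omega) (by omega)
  have h32 := hne 3 2 (by omega) (by omega) (by omega) (by omega) (by omega)
  refine h.paired (fun _ _ => ⟨⟨mem_seg_X, h12⟩, ⟨mem_seg_X, h32⟩⟩) ?_
  rintro _ ⟨_, ⟨t, h1, h2, h3, h4, rfl⟩, rfl⟩
  exact ⟨(), by simp, ⟨⟨1, by omega, by omega, by omega, by omega, rfl⟩, h12⟩,
    ⟨⟨3, by omega, by omega, by omega, by omega, rfl⟩, h32⟩⟩

/-- Unless Bob leaves a pairing or plays `q 3`, where Alice gets a second threat at `q 1`, she keeps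
one part with both ends dominated by her, which retains the weight `1`; the other part, if any, has
weight `0`. -/
theorem IsAA.answer {T : Tok V → Prop} (hT : HasLongPaths T) {q : ℕ → V} {N : ℕ}
    {U : ℕ → Prop} (h : IsAA q N U) {i : ℕ} (hi : 1 ≤ i ∧ i ≤ N) :
    Answer T (seg q N 1 1 U) (q i) 1 0 := by
  have hq := h.inj
  rcases (by omega : i = 1 ∨ N ≤ 2 ∨ (i = 2 ∧ N = 3) ∨ (i = 3 ∧ N = 3) ∨ (4 ≤ N ∧ i = N) ∨
    (4 ≤ N ∧ i % 2 = 0 ∧ i + 2 ≤ N) ∨ (5 ≤ N ∧ i % 2 = 0 ∧ i + 1 = N) ∨ (4 ≤ N ∧ i = 3) ∨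
    (5 ≤ i ∧ i % 2 = 1 ∧ i < N)) with hc | hc | hc | hc | hc | hc | hc | hc | hc
  · subst hc
    exact Or.inr (Or.inl (seg_bMove_paired hq hi 2 N (by omega) (by omega) (by omega)
      (by intros; omega)))
  · refine Or.inr (Or.inl (Paired.of_EA_eq_empty (Set.eq_empty_of_forall_notMem ?_)))
    rintro _ ⟨_, ⟨t, h1, h2, h3, h4, rfl⟩, -⟩
    omega
  · obtain ⟨rfl, rfl⟩ := hc
    exact Or.inr (Or.inl (seg_three_paired hq))
  · obtain ⟨rfl, rfl⟩ := hc
    exact Or.inr (Or.inl (seg_bMove_paired hq hi 1 2 (by omega) (by omega) (by omega)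
      (by intros; omega)))
  · exact Or.inl (seg_reply hq (N - 1) 0 (N - 2) 1 1 0 0 0 0
      (hT.subAA hq 0 (N - 2) (by omega) (by omega) (fun t _ _ _ _ _ =>
        h.unmarked t (by omega) (by omega) (by omega) (by omega) (by omega)))
      subseg_zero_reduces)
  · exact Or.inl (seg_reply hq (i + 1) 0 (i - 1) 1 0 (i + 1) (N - i - 1) 1 1
      (hT.subOdd hq (i - 1) (by omega) (by omega) (fun t _ _ _ _ =>
        h.unmarked t (by omega) (by omega) (by omega) (by omega) (by omega)))
      (hT.subAA hq (i + 1) (N - i - 1) (by omega) (by omega) (fun t _ _ _ _ _ =>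
        h.unmarked t (by omega) (by omega) (by omega) (by omega) (by omega))))
  · exact Or.inl (seg_reply hq (N - 2) 0 (N - 3) 1 1 0 0 0 0
      (hT.subAA hq 0 (N - 3) (by omega) (by omega) (fun t _ _ _ _ _ =>
        h.unmarked t (by omega) (by omega) (by omega) (by omega) (by omega)))
      subseg_zero_reduces)
  · obtain ⟨hN, rfl⟩ := hc
    exact Or.inr (Or.inr (seg_double hq (by omega) (by omega)
      (h.unmarked 1 (by omega) (by omega) (by omega) (by omega) (by omega))
      (seg_paired (hq.sub (by omega)) 1 (N - 3) (by omega) (by omega) (by intros; omega))))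
  · exact Or.inl (seg_reply hq (i - 1) 0 (i - 2) 1 1 i (N - i) 0 1
      (hT.subAA hq 0 (i - 2) (by omega) (by omega) (fun t _ _ _ _ _ =>
        h.unmarked t (by omega) (by omega) (by omega) (by omega) (by omega)))
      (hT.subBA hq i (N - i) (by omega) (fun t _ _ =>
        h.unmarked t (by omega) (by omega) (by omega) (by omega) (by omega))))

/-- There are only two lengths, so all moves are listed. A weak part is left only when Bob plays the
last of seven vertices; the path then shrinks to five. -/
theorem IsAW.answer {T : Tok V → Prop} (hT : HasLongPaths T) {q : ℕ → V} {N : ℕ}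
    {U : ℕ → Prop} (h : IsAW q N U) {i : ℕ} (hi : 1 ≤ i ∧ i ≤ N) :
    Answer T (seg q N 1 1 U) (q i) 1 1 := by
  have hq := h.inj
  have hN := h.five_or_seven
  rcases (by omega : i = 1 ∨ i = 2 ∨ i = 3 ∨ ((i = 4 ∨ i = 5) ∧ N = 5) ∨ (i = 4 ∧ N = 7) ∨
    (i = 5 ∧ N = 7) ∨ (i = 6 ∧ N = 7) ∨ (i = 7 ∧ N = 7)) with hc | hc | hc | hc | hc | hc | hc | hc
  · subst hc
    exact Or.inr (Or.inl (seg_bMove_paired hq hi 2 N (by omega) (by omega) (by omega)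
      (by intros; omega)))
  · subst hc
    exact Or.inl (seg_reply hq 3 3 (N - 3) 1 1 0 0 0 0
      (hT.subAA hq 3 (N - 3) (by omega) (by omega) (fun t _ _ _ _ _ =>
        h.unmarked t (by omega) (by omega) (by omega) (by omega) (by omega)))
      subseg_zero_reduces)
  · subst hc
    exact Or.inr (Or.inr (seg_double hq (by omega) (by omega)
      (h.unmarked 1 (by omega) (by omega) (by omega) (by omega) (by omega))
      (seg_paired (hq.sub (by omega)) 1 (N - 3) (by omega) (by omega) (by intros; omega))))
  · obtain ⟨hc, rfl⟩ := hc
    exact Or.inl (seg_reply hq 3 0 2 1 1 0 0 0 0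
      (hT.subAA hq 0 2 (by omega) (by omega) (fun t _ _ _ _ _ =>
        h.unmarked t (by omega) (by omega) (by omega) (by omega) (by omega)))
      subseg_zero_reduces)
  · obtain ⟨rfl, rfl⟩ := hc
    exact Or.inl (seg_reply hq 5 0 3 1 0 5 2 1 1
      (hT.subAB hq 0 3 (by omega) (fun t _ _ _ _ _ =>
          h.unmarked t (by omega) (by omega) (by omega) (by omega) (by omega))
        (fun _ => Or.inl (h.unmarked 1 (by omega) (by omega) (by omega) (by omega) (by omega))))
      (hT.subAA hq 5 2 (by omega) (by omega) (fun t _ _ _ _ _ =>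
        h.unmarked t (by omega) (by omega) (by omega) (by omega) (by omega))))
  · obtain ⟨rfl, rfl⟩ := hc
    exact Or.inl (seg_reply hq 6 0 4 1 0 6 1 1 1
      (hT.subAB hq 0 4 (by omega) (fun t _ _ _ _ _ =>
          h.unmarked t (by omega) (by omega) (by omega) (by omega) (by omega)) (by omega))
      (hT.subAA hq 6 1 (by omega) (by omega) (fun t _ _ _ _ _ =>
        h.unmarked t (by omega) (by omega) (by omega) (by omega) (by omega))))
  · obtain ⟨rfl, rfl⟩ := hc
    exact Or.inl (seg_reply hq 5 0 4 1 1 0 0 0 0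
      (hT.subAA hq 0 4 (by omega) (by omega) (fun t _ _ _ _ _ =>
        h.unmarked t (by omega) (by omega) (by omega) (by omega) (by omega)))
      subseg_zero_reduces)
  · obtain ⟨rfl, rfl⟩ := hc
    exact Or.inl (seg_reply hq 6 0 5 1 1 0 0 0 0
      (hT.subAW hq 5 (by omega) (by omega) (fun t _ _ _ _ _ =>
        h.unmarked t (by omega) (by omega) (by omega) (by omega) (by omega)))
      subseg_zero_reduces)

/-- If Bob plays the center, `a₀` creates a second threat. If he plays `a₀`, the center leaves pairs
of weight `0`. The vertex `b₀` lies outside the pairing of center with `a₀` and `a i` with `b i`.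
Any other move is answered in its branch. -/
theorem IsFork.answer {ι : Type} {c a₀ b₀ : V} {a b : ι → V} {I : Finset ι}
    (h : IsFork c a₀ b₀ a b I) {z : V} (hz : z ∈ (Pos.fork c a₀ b₀ a b I).X) :
    Answer MainTok (Pos.fork c a₀ b₀ a b I) z 0 1 := by
  classical
  rcases hz with rfl | rfl | rfl | ⟨i, hi, hz⟩
  · refine Or.inr (Or.inr ⟨a₀, mem_fork_X.2.1, h.ca.symm, b₀, _, ?_, ?_, ?_, h.center⟩)
    · exact ⟨(pairs_WF a b I).1, by simp⟩
    · exact h.isPairs.paired (fun i hi => ⟨⟨i, hi, Or.inl rfl⟩, ⟨i, hi, Or.inr rfl⟩⟩)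
        (by rintro c ⟨i, hi, rfl⟩; exact ⟨i, hi, Or.inl rfl, Or.inr rfl⟩)
    · rintro ⟨i, hi, e | e⟩
      exacts [(h.a_ne i hi).2.2 e.symm, (h.b_ne i hi).2.2 e.symm]
  · exact Or.inl ⟨c, mem_fork_X.1, h.ca,
      (h.isPairs.reduces MainTok.hasLongPaths.toHasPaths).mono h.side le_rfl (by omega)⟩
  · exact Or.inr (Or.inl h.bMove_paired)
  · obtain ⟨y, hy⟩ : ∃ y, (z = a i ∧ y = b i) ∨ (z = b i ∧ y = a i) := by
      rcases hz with hz | hz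
      exacts [⟨_, Or.inl ⟨hz, rfl⟩⟩, ⟨_, Or.inr ⟨hz, rfl⟩⟩]
    obtain ⟨h1, h2, h3⟩ := h.branch hi hy
    exact Or.inl ⟨y, h1, h2, (Reduces.of_mem (.fork (h.mono (Finset.erase_subset _ _)))).better h3⟩

/-- The middle vertex hits all sets of Alice. Bob's sets of the vertices `1`, `3` and `4` become
three consecutive pairs; the vertices `2` and `5`, which may be dominated by him, are not used. -/
theorem seg_five_better {q : ℕ → V} {U : ℕ → Prop} (hq : Inj q 5) (h1 : U 1) (h3 : U 3)
    (h4 : U 4) : Better ((seg q 5 1 1 U).aMove (q 3))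
      ⟨{q 1, q 2, q 4, q 5}, ∅, {{q 1, q 2}, {q 2, q 4}, {q 4, q 5}}⟩ := by
  have hne : ∀ s t, 1 ≤ s → s ≤ 5 → 1 ≤ t → t ≤ 5 → s ≠ t → q s ≠ q t :=
    fun s t h1 h2 h3 h4 h5 e => h5 (hq _ _ h1 h2 h3 h4 e)
  refine ⟨?_, ?_, ?_⟩
  · rintro v (rfl | rfl | rfl | rfl) <;>
    exact ⟨mem_seg_X, hne _ _ (by omega) (by omega) (by omega) (by omega) (by omega)⟩
  · rintro c ⟨⟨t, k1, k2, k3, k4, rfl⟩, hc⟩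
    exact absurd ⟨3, by omega, by omega, by omega, by omega, rfl⟩ hc
  · have key : ∀ t, 1 ≤ t → t ≤ 5 → U t → ∀ d : Set V,
        (∀ s, 1 ≤ s → s ≤ 5 → s ≤ t + 1 → t ≤ s + 1 → s ≠ 3 → q s ∈ d) →
        ∃ d' ∈ ((seg q 5 1 1 U).aMove (q 3)).EB, d' ⊆ d := by
      intro t k1 k2 hU d hd
      refine ⟨_, ⟨_, ⟨t, k1, k2, by omega, by omega, hU, rfl⟩, rfl⟩, ?_⟩
      rintro v ⟨⟨s, s1, s2, s3, s4, rfl⟩, hs⟩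
      exact hd s s1 s2 s3 s4 fun e => hs (e ▸ rfl)
    rintro d (rfl | rfl | rfl)
    · refine key 1 (by omega) (by omega) h1 _ fun s s1 s2 s3 s4 s5 => ?_
      obtain rfl | rfl : s = 1 ∨ s = 2 := by omega
      exacts [Or.inl rfl, Or.inr rfl]
    · refine key 3 (by omega) (by omega) h3 _ fun s s1 s2 s3 s4 s5 => ?_
      obtain rfl | rfl : s = 2 ∨ s = 4 := by omega
      exacts [Or.inl rfl, Or.inr rfl]
    · refine key 4 (by omega) (by omega) h4 _ fun s s1 s2 s3 s4 s5 => ?_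
      obtain rfl | rfl : s = 4 ∨ s = 5 := by omega
      exacts [Or.inl rfl, Or.inr rfl]

/-- Alice moves next to an end of the path that she dominates, and threatens the end. -/
theorem seg_threat_left {q : ℕ → V} {N : ℕ} {U : ℕ → Prop} (hq : Inj q N) (hN : 2 ≤ N)
    (hU : U 1) : Better ((seg q N 1 0 U).aMove (q 2))
      ((need {q 1}).add (subseg q U 2 (N - 2) 1 0)) := by
  have h := seg_aMove (a := 1) (b := 0) (U := U) hq (j := 2) (by omega) 0 1 1 1 2 (N - 2) 1 0
    (by omega) (by omega) (by intros; omega) (by intros; omega) (by intros; omega)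
  rw [sum_pair] at h
  have h1 : Better (subseg q U 0 1 1 1) (need {q 1}) :=
    seg_one_better (q := fun t => q (0 + t)) (U := fun t => U (0 + t)) hU
  exact h.trans (h1.add (Better.refl _))

theorem seg_threat_right {q : ℕ → V} {N : ℕ} {U : ℕ → Prop} (hq : Inj q N) (hN : 3 ≤ N)
    (hU : U N) : Better ((seg q N 1 1 U).aMove (q (N - 1)))
      ((need {q N}).add (subseg q U 0 (N - 2) 1 1)) := by
  have h := seg_aMove (a := 1) (b := 1) (U := U) hq (j := N - 1) (by omega) (N - 1) 1 1 1
    0 (N - 2) 1 1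
    (by omega) (by omega) (by intros; omega) (by intros; omega) (by intros; omega)
  rw [sum_pair] at h
  have e : N - 1 + 1 = N := by omega
  have h1 : Better (subseg q U (N - 1) 1 1 1) (need {q (N - 1 + 1)}) :=
    seg_one_better (q := fun t => q (N - 1 + t)) (U := fun t => U (N - 1 + t)) (by rwa [e])
  rw [e] at h1
  exact h.trans (h1.add (Better.refl _))

/-- Alice's options when she is to move. -/
def Advance (t : Tok V) : Prop :=
  (∃ y ∈ t.pos.X, ∃ s, ThreatTok s ∧ ∃ L, Good MainTok L ∧ t.wt ≤ s.wt + wts L ∧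
    weaks L ≤ t.weak ∧ Disj s.pos (total L) ∧ Better (t.pos.aMove y) (s.pos.add (total L))) ∨
  (∃ L, Good RaceTok L ∧ t.wt ≤ wts L ∧ Better t.pos (total L)) ∨
  (1 ≤ t.weak ∧ ∃ y ∈ t.pos.X, ∃ L, Good RaceTok L ∧ t.wt + 1 ≤ wts L ∧
    Better (t.pos.aMove y) (total L))

theorem Advance.of_single {p p' : Pos V} {w : ℤ} {k : ℕ} {d y : V} (hy : y ∈ p.X)
    (h : Reduces MainTok p' w k) (hd : d ∉ p'.X)
    (hp : Better (p.aMove y) ((need {d}).add p')) : Advance ⟨p, w, k⟩ := by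
  obtain ⟨L, h1, h2, h3, h4⟩ := h
  refine Or.inl ⟨y, hy, _, .single d, L, h1, by simpa using h2, h3, ?_,
    hp.trans ((Better.refl _).add h4)⟩
  rintro v rfl hv
  exact hd (h4.1 hv)

theorem Advance.of_race {p : Pos V} {w : ℤ} {k : ℕ} (h : Reduces RaceTok p w 0) :
    Advance ⟨p, w, k⟩ := by
  obtain ⟨L, h1, h2, -, h4⟩ := h
  exact Or.inr (Or.inl ⟨L, h1, h2, h4⟩)

theorem Advance.of_weak {p : Pos V} {w : ℤ} (h : ∃ y ∈ p.X, Reduces RaceTok (p.aMove y) (w + 1) 0) :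
    Advance ⟨p, w, 1⟩ := by
  obtain ⟨y, hy, L, h1, h2, -, h4⟩ := h
  exact Or.inr (Or.inr ⟨le_rfl, y, hy, L, h1, h2, h4⟩)

/-- Without weakness, `q 2` threatens `q 1` and shifts a mark at `5` to the third place of the rest,
where `IsAB` tolerates it. A mark at `3` would become the first place; therefore the weak path is
instead converted by `q 3`, which shifts the mark at `5` to the second place. -/
theorem IsOdd.advance {q : ℕ → V} {N k : ℕ} {U : ℕ → Prop} (h : IsOdd q N U k) :
    Advance ⟨seg q N 1 0 U, 0, k⟩ := by
  have hq := h.inj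
  have ho := h.odd
  have h9 := h.nine_le
  have h1 := h.unmarked 1 (by omega) (by omega) (by omega) (by omega) (by omega) (by omega)
  rcases h.weak with rfl | ⟨rfl, hN⟩
  · refine Advance.of_single (y := q 2) mem_seg_X (MainTok.hasLongPaths.subAB hq 2 (N - 2) (by omega)
      (fun t _ _ _ _ _ => h.unmarked t (by omega) (by omega) (by omega) (by omega) (by omega)
        (by omega)) (by omega)) ?_ (seg_threat_left hq (by omega) h1)
    rintro ⟨s, h1, h2, e⟩
    have := hq _ _ (by omega) (by omega) (by omega) (by omega) e
    omega
  · exact Advance.of_weak (seg_aMove_reduces hq 3 0 2 1 1 3 (N - 3) 1 0 (RaceTok.sub_two 0 h1)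
      (RaceTok.hasPaths.subAB hq 3 (N - 3) (by omega)
        (fun t _ _ _ _ _ => h.unmarked t (by omega) (by omega) (by omega) (by omega) (by omega)
          (by omega)) (by omega)))

/-- Alice threatens the last vertex, and the path loses two vertices. This requires that Bob does
not dominate the last vertex, which may fail for `N = 5`; there the middle vertex makes the threat
of three pairs. -/
theorem IsAA.advance {q : ℕ → V} {N : ℕ} {U : ℕ → Prop} (h : IsAA q N U) :
    Advance ⟨seg q N 1 1 U, 1, 0⟩ := by
  have hq := h.inj
  have h0 := h.pos
  have h1 := h.unmarked 1 (by omega) (by omega) (by omega) (by omega) (by omega)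
  rcases (by omega : N = 1 ∨ N = 2 ∨ N = 5 ∨ (3 ≤ N ∧ N ≠ 5)) with rfl | rfl | rfl | ⟨hN, hN5⟩
  · exact .of_race ((Reduces.of_mem (RaceTok.need _)).better (seg_one_better h1))
  · exact .of_race ((Reduces.of_mem (RaceTok.need _)).better (seg_two_better h1))
  · have hn : [q 1, q 2, q 4, q 5].Nodup := by
      have hne : ∀ s t, 1 ≤ s → s ≤ 5 → 1 ≤ t → t ≤ 5 → s ≠ t → q s ≠ q t :=
        fun s t h1 h2 h3 h4 h5 e => h5 (hq _ _ h1 h2 h3 h4 e)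
      simp only [List.nodup_cons, List.mem_cons, List.not_mem_nil, or_false, not_or,
        not_false_eq_true, List.nodup_nil, and_true]
      refine ⟨⟨?_, ?_, ?_⟩, ⟨?_, ?_⟩, ?_⟩ <;>
      exact hne _ _ (by omega) (by omega) (by omega) (by omega) (by omega)
    refine Or.inl ⟨q 3, mem_seg_X, _, .three hn, [], ⟨by simp, by simp⟩, by simp, by simp, ?_, ?_⟩
    · simp [Disj, total, sum]
    · refine (seg_five_better hq h1
        (h.unmarked 3 (by omega) (by omega) (by omega) (by omega) (by omega))
        (h.unmarked 4 (by omega) (by omega) (by omega) (by omega) (by omega))).trans ?_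
      simpa [total, sum, Pos.add] using Better.refl _
  · refine Advance.of_single (y := q (N - 1)) mem_seg_X (MainTok.hasLongPaths.subAA hq 0 (N - 2)
      (by omega) (by omega)
      (fun t _ _ _ _ _ => h.unmarked t (by omega) (by omega) (by omega) (by omega) (by omega)))
      ?_ (seg_threat_right hq hN (h.unmarked N (by omega) (by omega) (by omega) (by omega)
        (by omega)))
    rintro ⟨s, h1, h2, e⟩
    have := hq _ _ (by omega) (by omega) (by omega) (by omega) e
    omega

/-- Five vertices are converted by the middle one into two obligations of Bob, of total weight `2`.
With seven vertices Alice can still threaten the last one and leave the case of five. -/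
theorem IsAW.advance {q : ℕ → V} {N : ℕ} {U : ℕ → Prop} (h : IsAW q N U) :
    Advance ⟨seg q N 1 1 U, 1, 1⟩ := by
  have hq := h.inj
  rcases h.five_or_seven with rfl | rfl
  · exact Advance.of_weak (seg_aMove_reduces (w := 1 + 1) hq 3 0 2 1 1 3 2 1 1
      (RaceTok.sub_two 0 (h.unmarked 1 (by omega) (by omega) (by omega) (by omega) (by omega)))
      (RaceTok.sub_two 3 (h.unmarked 4 (by omega) (by omega) (by omega) (by omega) (by omega))))
  · refine Advance.of_single (y := q (7 - 1)) mem_seg_X (MainTok.hasLongPaths.subAW hq 5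
      (by omega) (by omega)
      (fun t _ _ _ _ _ => h.unmarked t (by omega) (by omega) (by omega) (by omega) (by omega)))
      ?_ (seg_threat_right hq (by omega) (h.unmarked 7 (by omega) (by omega) (by omega) (by omega)
        (by omega)))
    rintro ⟨s, h1, h2, e⟩
    have := hq _ _ (by omega) (by omega) (by omega) (by omega) e
    omega

theorem IsFork.advance {ι : Type} {c a₀ b₀ : V} {a b : ι → V} {I : Finset ι}
    (h : IsFork c a₀ b₀ a b I) : Advance ⟨Pos.fork c a₀ b₀ a b I, 0, 1⟩ := by
  refine Advance.of_weak ⟨c, mem_fork_X.1, (Reduces.add (Reduces.of_mem (RaceTok.need {a₀, b₀}))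
    (h.isPairs.reduces RaceTok.hasPaths) ?_).mono h.alice (by omega) (by omega)⟩
  rintro v (rfl | rfl) ⟨i, hi, e | e⟩
  exacts [(h.a_ne i hi).2.1 e.symm, (h.b_ne i hi).2.1 e.symm, (h.a_ne i hi).2.2 e.symm,
    (h.b_ne i hi).2.2 e.symm]

theorem MainTok.isMainClass : IsMainClass (RaceTok (V := V)) MainTok ThreatTok where
  wf := by
    rintro _ (h | h | h | h | h | d | h)
    exacts [seg_WF _ _ _ _ _, seg_WF _ _ _ _ _, seg_WF _ _ _ _ _, seg_WF _ _ _ _ _,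
      seg_WF _ _ _ _ _, need_WF d, fork_WF _ _ _ _ _ _]
  paired := by
    rintro _ (@⟨q, N, U, h⟩ | @⟨q, N, U, h⟩ | @⟨q, N, k, U, h⟩ | @⟨q, N, U, h⟩ | @⟨q, N, U, h⟩ | d | h)
    -- For odd length the pairing omits the first vertex, which Alice dominates already.
    · rcases Nat.mod_two_eq_zero_or_one N with hN | hN
      · exact seg_paired h.inj 1 N (by omega) (by omega) (by intros; omega)
      · exact seg_paired h.inj 2 N (by omega) (by omega) (by intros; omega)
    · have he := h.even
      exact seg_paired h.inj 1 N (by omega) (by omega) (by intros; omega)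
    · have he := h.odd
      exact seg_paired h.inj 2 N (by omega) (by omega) (by intros; omega)
    · exact seg_paired h.inj 2 N (by omega) (by omega) (by intros; omega)
    · exact seg_paired h.inj 2 N (by omega) (by omega) (by intros; omega)
    · exact .of_EA_eq_empty rfl
    · exact h.fork_paired
  bob := by
    suffices ∀ t : Tok V, MainTok t → ∀ z ∈ t.pos.X, Answer MainTok t.pos z t.wt t.weak from this
    rintro _ (@⟨q, N, U, h⟩ | @⟨q, N, U, h⟩ | h | h | h | d | h) z hz
    · obtain ⟨i, h1, h2, rfl⟩ := hz
      by_cases hN : 2 ≤ N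
      · exact Or.inl (h.reply hasLongPaths.toHasPaths hN ⟨h1, h2⟩)
      · refine Or.inr (Or.inl (Paired.of_EA_eq_empty (Set.eq_empty_of_forall_notMem ?_)))
        rintro _ ⟨_, ⟨t, h1, h2, h3, h4, rfl⟩, -⟩
        omega
    · obtain ⟨i, h1, h2, rfl⟩ := hz
      exact Or.inl (h.reply hasLongPaths.toHasPaths ⟨h1, h2⟩)
    · obtain ⟨i, h1, h2, rfl⟩ := hz
      exact h.answer hasLongPaths ⟨h1, h2⟩
    · obtain ⟨i, h1, h2, rfl⟩ := hz
      exact h.answer hasLongPaths ⟨h1, h2⟩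
    · obtain ⟨i, h1, h2, rfl⟩ := hz
      exact h.answer hasLongPaths ⟨h1, h2⟩
    · exact Or.inr (Or.inl (Paired.of_EA_eq_empty (by simp [Pos.need, Pos.bMove])))
    · exact h.answer hz
  alice := by
    suffices ∀ t : Tok V, MainTok t → Advance t from this
    rintro _ (h | h | h | h | h | d | h)
    · exact .of_race (.of_mem (.ab h))
    · exact .of_race (.of_mem (.bb h))
    · exact h.advance
    · exact h.advance
    · exact h.advance
    · exact .of_race (.of_mem (.need d))
    · exact h.advance

/-- Alice wins a sum of positions of the main class if she has a threat elsewhere. -/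
theorem MainTok.win [Finite V] {p : Pos V} {d : V} (h : Reduces MainTok p 0 1) (hd : d ∉ p.X) :
    W ((Pos.need {d}).add p) := by
  obtain ⟨L, h1, h2, h3, h4⟩ := h
  refine (MainTok.isMainClass.win RaceTok.isRaceClass ThreatTok.isThreatClass (.single d) h1 ?_
    (by simpa using h2) h3).mono ((Better.refl _).add h4)
  rintro v rfl hv
  exact hd (h4.1 hv)

end Pos

/-! ### Sufficiency: from favorable components to local games. -/

open Pos

/-! ### Leaves of a tree -/

theorem eq_of_adj_leaf {G : SimpleGraph V} {l x y : V} (hl : l ∈ leaves G) (hx : G.Adj l x)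
    (hy : G.Adj l y) : x = y := by
  obtain ⟨a, ha⟩ := Set.ncard_eq_one.1 hl
  have h1 : x ∈ G.neighborSet l := hx
  have h2 : y ∈ G.neighborSet l := hy
  rw [ha] at h1 h2
  exact h1.trans h2.symm

theorem eq_univ_of_closed {G : SimpleGraph V} (hG : G.Connected) {S : Set V} {s : V} (hs : s ∈ S)
    (h : ∀ x ∈ S, ∀ y, G.Adj x y → y ∈ S) (v : V) : v ∈ S := by
  obtain ⟨w⟩ := hG.preconnected s v
  induction w with
  | nil => exact hs
  | cons hadj _ ih => exact ih (h _ hs _ hadj)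

/-- If a leaf is adjacent to a leaf, then each vertex is adjacent to all others. -/
theorem isDominating_of_leaf_of_leafParent {G : SimpleGraph V} (hG : G.Connected) {m : V}
    (hm : m ∈ leaves G) (hm' : m ∈ leafParents G) (v : V) : IsDominating G {v} := by
  obtain ⟨l, hl, hml⟩ := hm'
  have key : ∀ x, x = m ∨ x = l := eq_univ_of_closed hG (S := {x | x = m ∨ x = l}) (Or.inl rfl) (by
    rintro x (rfl | rfl) y hy
    exacts [Or.inr (eq_of_adj_leaf hm hy hml), Or.inl (eq_of_adj_leaf hl hy hml.symm)])
  intro w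
  refine ⟨v, rfl, ?_⟩
  rcases key v with rfl | rfl <;> rcases key w with rfl | rfl
  exacts [Or.inl rfl, Or.inr hml, Or.inr hml.symm, Or.inl rfl]

theorem skeleton_adj {G : SimpleGraph V} {v x : V} (hv : v ∈ skeleton G) (h : G.Adj v x) :
    x ∈ skeleton G ∨ x ∈ leafParents G := by
  by_contra! hcon
  refine hcon.1 ⟨fun hx => hv.2 ⟨x, hx, h⟩, hcon.2⟩

theorem componentSet_subset {G : SimpleGraph V} (C : (G.induce (skeleton G)).ConnectedComponent) :
    componentSet G C ⊆ skeleton G := by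
  rintro _ ⟨v, -, rfl⟩
  exact v.2

theorem mem_componentSet {G : SimpleGraph V} {C : (G.induce (skeleton G)).ConnectedComponent}
    {v : V} (hv : v ∈ skeleton G) :
    v ∈ componentSet G C ↔ (G.induce (skeleton G)).connectedComponentMk ⟨v, hv⟩ = C := by
  constructor
  · rintro ⟨x, hx, rfl⟩
    exact hx
  · intro h
    exact ⟨⟨v, hv⟩, h, rfl⟩

theorem componentSet_adj {G : SimpleGraph V} {C : (G.induce (skeleton G)).ConnectedComponent}
    {v x : V} (hv : v ∈ componentSet G C) (h : G.Adj v x) :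
    x ∈ componentSet G C ∨ x ∈ leafParents G := by
  refine (skeleton_adj (componentSet_subset C hv) h).imp_left fun hx => ?_
  have hv' := componentSet_subset C hv
  rw [mem_componentSet hv'] at hv
  rw [mem_componentSet hx, ← hv]
  exact SimpleGraph.ConnectedComponent.sound (SimpleGraph.Adj.reachable (by simpa using h.symm))

theorem componentSet_disjoint {G : SimpleGraph V}
    {C C' : (G.induce (skeleton G)).ConnectedComponent} {v : V} (h : v ∈ componentSet G C)
    (h' : v ∈ componentSet G C') : C = C' := by
  have hv := componentSet_subset C h
  rw [mem_componentSet hv] at h h'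
  exact h.symm.trans h'

/-! ### Positions on favorable components -/

/-- The position `p` describes the game on the component `K` of the skeleton. -/
structure Describes (G : SimpleGraph V) (v₀ : V) (K : Set V) (p : Pos V) : Prop where
  subset : p.X ⊆ K
  alice : ∀ v ∈ K, ¬ G.Adj v₀ v → ∃ c ∈ p.EA, ∀ x ∈ c, x = v ∨ G.Adj x v
  bob : ∀ d ∈ p.EB, ∃ w, ∀ x, x = w ∨ G.Adj x w → x = v₀ ∨ x ∈ d

/-- The first vertex is dominated by `v₀`. At the last vertex Bob is credited with domination (`b =
0`): dropping a set of his can only help him. -/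
theorem IsPathFrom.describes {G : SimpleGraph V} {v₀ : V}
    {C : (G.induce (skeleton G)).ConnectedComponent} {n : ℕ} {p : ℕ → V}
    (h : IsPathFrom G v₀ (componentSet G C) n p) :
    Describes G v₀ (componentSet G C) (seg p n 1 0 fun t => ¬ MeetsParents G v₀ (p t)) := by
  have himg := h.image_eq
  have hmem : ∀ t, 1 ≤ t → t ≤ n → p t ∈ componentSet G C := fun t h1 h2 =>
    himg ▸ ⟨t, ⟨h1, h2⟩, rfl⟩
  refine ⟨?_, fun v hv hadj => ?_, ?_⟩
  · rintro v ⟨s, h1, h2, rfl⟩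
    exact hmem s h1 h2
  · rw [← himg] at hv
    obtain ⟨t, ht, rfl⟩ := hv
    have ht1 : t ≠ 1 := fun e => hadj ((h.root_adj_iff t ht).2 e)
    refine ⟨_, ⟨t, ht.1, ht.2, by have := ht.1; omega, ht.2, rfl⟩, ?_⟩
    rintro x ⟨s, s1, s2, s3, s4, rfl⟩
    rcases eq_or_ne s t with rfl | hst
    · exact Or.inl rfl
    · exact Or.inr ((h.adj_iff s ⟨s1, s2⟩ t ht).2 (by omega))
  · rintro d ⟨t, h1, h2, h3, h4, hU, rfl⟩
    refine ⟨p t, fun x hx => ?_⟩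
    rcases hx with rfl | hx
    · exact Or.inr ⟨t, h1, h2, by omega, by omega, rfl⟩
    rcases componentSet_adj (hmem t h1 h2) hx.symm with hxC | hxM
    · rw [← himg] at hxC
      obtain ⟨s, hs, rfl⟩ := hxC
      have := (h.adj_iff s hs t ⟨h1, h2⟩).1 hx
      exact Or.inr ⟨s, hs.1, hs.2, by omega, by omega, rfl⟩
    · by_contra! hcon
      exact hU ⟨x, hxM, hcon.1, hx.symm⟩

theorem IsPathFrom.inj {G : SimpleGraph V} {v₀ : V} {K : Set V} {n : ℕ} {p : ℕ → V}
    (h : IsPathFrom G v₀ K n p) : Inj p n :=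
  fun _ _ h1 h2 h3 h4 e => h.injOn ⟨h1, h2⟩ ⟨h3, h4⟩ e

/-- The cases A, B and C are paths of type `IsAB`; D and E are of type `IsOdd` with weakness `0` and
`1`. -/
theorem IsPathFrom.reduces {G : SimpleGraph V} {v₀ : V} {K : Set V} {n : ℕ} {p : ℕ → V}
    (h : IsPathFrom G v₀ K n p) {U : Set ℕ} (hU : U = pendantIndices G v₀ n p) :
    (PathCaseA n U ∨ PathCaseB n U ∨ PathCaseC n U ∨ PathCaseD n U →
      Reduces MainTok (seg p n 1 0 fun t => ¬ MeetsParents G v₀ (p t)) 0 0) ∧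
    (PathCaseE n U → Reduces MainTok (seg p n 1 0 fun t => ¬ MeetsParents G v₀ (p t)) 0 1) := by
  have key : ∀ t, 1 ≤ t → t + 1 ≤ n → t ∉ U → ¬ MeetsParents G v₀ (p t) := by
    rintro t h1 h2 h3 h4
    exact h3 (hU ▸ ⟨h1, h2, h4⟩)
  have hn := h.pos
  refine ⟨?_, ?_⟩
  · rintro (⟨h1, h2⟩ | ⟨rfl, h2⟩ | ⟨h1, h2⟩ | ⟨h1, ho, h2⟩)
    · exact .of_mem (.ab ⟨h.inj, fun t k1 k2 _ _ _ => key t k1 k2 (by simp [h2]), by omega⟩)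
    · refine .of_mem (.ab ⟨h.inj, fun t k1 k2 _ _ _ => by omega, fun _ => ?_⟩)
      rcases h2 with h2 | h2
      · exact Or.inr (key 2 (by omega) (by omega) fun h => by simpa using h2 h)
      · exact Or.inl (key 1 (by omega) (by omega) fun h => by simpa using h2 h)
    · refine .of_mem (.ab ⟨h.inj, fun t k1 k2 k3 k4 k5 => key t k1 k2 fun ht => ?_, by omega⟩)
      have := h2 ht
      simp only [Set.mem_insert_iff, Set.mem_singleton_iff] at this
      omega
    · refine .of_mem (.odd ⟨h.inj, Nat.odd_iff.1 ho, h1, Or.inl rfl,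
        fun t k1 k2 k3 k4 k5 _ => key t k1 k2 fun ht => ?_⟩)
      have := h2 ht
      simp only [Set.mem_insert_iff, Set.mem_singleton_iff] at this
      omega
  · rintro ⟨h1, -, h2⟩
    refine .of_mem (.odd ⟨h.inj, by omega, by omega, by omega,
      fun t k1 k2 k3 k4 k5 k6 => key t k1 k2 fun ht => ?_⟩)
    have := h2 ht
    simp only [Set.mem_insert_iff, Set.mem_singleton_iff] at this
    omega

/-- Bob's sets come from `b i₀` and from the `a i` with `i ≠ i₀`, the vertices that the hypothesis
keeps away from the parents of leaves other than `v₀`. -/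
theorem FavorableFork.reduces {G : SimpleGraph V} {v₀ : V}
    {C : (G.induce (skeleton G)).ConnectedComponent}
    (h : FavorableFork G v₀ (componentSet G C)) :
    ∃ p, Describes G v₀ (componentSet G C) p ∧ Reduces MainTok p 0 1 := by
  obtain ⟨k, c, a, b, i₀, h, hM⟩ := h
  have hU := h.eq_union
  have hc : c ∈ componentSet G C := by rw [hU]; simp
  have ha : ∀ i, a i ∈ componentSet G C := by intro i; rw [hU]; simp
  have hb : ∀ i, b i ∈ componentSet G C := by intro i; rw [hU]; simp
  have hmem : ∀ v ∈ componentSet G C, v = c ∨ (∃ i, v = a i) ∨ ∃ i, v = b i := by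
    intro v hv
    rw [hU] at hv
    rcases hv with (hv | ⟨i, hi⟩) | ⟨i, hi⟩
    exacts [Or.inl hv, Or.inr (Or.inl ⟨i, hi.symm⟩), Or.inr (Or.inr ⟨i, hi.symm⟩)]
  let I : Finset (Fin k) := Finset.univ.erase i₀
  have hI : ∀ i, i ∈ I ↔ i ≠ i₀ := fun i => by simp [I]
  refine ⟨fork c (a i₀) (b i₀) a b I, ⟨?_, ?_, ?_⟩, .of_mem (.fork ⟨⟨fun _ _ _ _ e => h.a_injective e,
    fun _ _ _ _ e => h.b_injective e, fun i _ j _ => h.a_ne_b i j⟩, (h.a_ne_c _).symm,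
    (h.b_ne_c _).symm, h.a_ne_b _ _, fun i hi => ⟨h.a_ne_c i, ?_, h.a_ne_b _ _⟩,
    fun i hi => ⟨h.b_ne_c i, (h.a_ne_b _ _).symm, ?_⟩⟩)⟩
  · rintro v (rfl | rfl | rfl | ⟨i, -, rfl | rfl⟩)
    exacts [hc, ha _, hb _, ha _, hb _]
  · intro v hv hadj
    rcases hmem v hv with rfl | ⟨i, rfl⟩ | ⟨i, rfl⟩
    · refine ⟨_, Or.inl rfl, ?_⟩
      rintro x (rfl | rfl | ⟨i, hi, rfl⟩)
      exacts [Or.inl rfl, Or.inr (h.adj_c_a _).symm, Or.inr (h.adj_c_a _).symm]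
    · by_cases hi : i = i₀
      · subst hi
        refine ⟨_, Or.inr (Or.inl rfl), ?_⟩
        rintro x (rfl | rfl | rfl)
        exacts [Or.inr (h.adj_c_a _), Or.inl rfl, Or.inr ((h.adj_a_b _ _).2 rfl).symm]
      · refine ⟨_, Or.inr (Or.inr ⟨i, (hI i).2 hi, Or.inl rfl⟩), ?_⟩
        rintro x (rfl | rfl | rfl)
        exacts [Or.inr (h.adj_c_a _), Or.inl rfl, Or.inr ((h.adj_a_b _ _).2 rfl).symm]
    · have hi : i ≠ i₀ := fun e => hadj ((h.root_adj_iff _ hv).2 (by rw [e]))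
      refine ⟨_, Or.inr (Or.inr ⟨i, (hI i).2 hi, Or.inr rfl⟩), ?_⟩
      rintro x (rfl | rfl)
      exacts [Or.inr ((h.adj_a_b _ _).2 rfl), Or.inl rfl]
  · have key : ∀ w ∈ componentSet G C, (MeetsParents G v₀ w → False) → ∀ x, x = w ∨ G.Adj x w →
        x = v₀ ∨ x ∈ componentSet G C := by
      rintro w hw hw' x (rfl | hx)
      · exact Or.inr hw
      rcases componentSet_adj hw hx.symm with hx' | hx'
      · exact Or.inr hx'
      · by_contra! hcon
        exact hw' ⟨x, hx', hcon.1, hx.symm⟩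
    rintro d (rfl | ⟨i, hi, rfl⟩)
    · refine ⟨b i₀, fun x hx => ?_⟩
      refine (key _ (hb i₀) (fun hm => ?_) x hx).imp_right fun hxC => ?_
      · rcases hM _ (hb i₀) hm with e | ⟨i, hi, e⟩ | e
        exacts [h.b_ne_c _ e, hi (h.b_injective e).symm, h.a_ne_b _ _ e.symm]
      · rcases hx with rfl | hx
        · exact Or.inr rfl
        rcases hmem x hxC with rfl | ⟨i, rfl⟩ | ⟨i, rfl⟩
        · exact absurd hx (h.not_adj_c_b _)
        · rw [(h.adj_a_b _ _).1 hx]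
          exact Or.inl rfl
        · exact absurd hx (h.not_adj_b_b _ _)
    · refine ⟨a i, fun x hx => ?_⟩
      refine (key _ (ha i) (fun hm => ?_) x hx).imp_right fun hxC => ?_
      · rcases hM _ (ha i) hm with e | ⟨j, hj, e⟩ | e
        exacts [h.a_ne_c _ e, h.a_ne_b _ _ e, (hI i).1 hi (h.a_injective e)]
      · rcases hx with rfl | hx
        · exact Or.inr (Or.inl rfl)
        rcases hmem x hxC with rfl | ⟨j, rfl⟩ | ⟨j, rfl⟩
        · exact Or.inl rfl
        · exact absurd hx (h.not_adj_a_a _ _)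
        · rw [(h.adj_a_b _ _).1 hx.symm]
          exact Or.inr (Or.inr rfl)
  · exact fun e => (hI i).1 hi (h.a_injective e)
  · exact fun e => (hI i).1 hi (h.b_injective e)

theorem Favorable.reduces {G : SimpleGraph V} {v₀ : V}
    {C : (G.induce (skeleton G)).ConnectedComponent}
    (h : Favorable G v₀ (componentSet G C)) :
    ∃ (p : Pos V) (k : ℕ), Describes G v₀ (componentSet G C) p ∧ Reduces MainTok p 0 k ∧
      (k = 0 ∨ (k = 1 ∧ WeaklyFavorable G v₀ (componentSet G C))) := by
  rcases h with ⟨n, p, hp, h⟩ | h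
  · obtain ⟨h0, h1⟩ := hp.reduces rfl
    by_cases hE : PathCaseE n (pendantIndices G v₀ n p)
    · exact ⟨_, 1, hp.describes, h1 hE, Or.inr ⟨rfl, Or.inl ⟨n, p, hp, hE⟩⟩⟩
    · exact ⟨_, 0, hp.describes, h0 (by tauto), Or.inl rfl⟩
  · obtain ⟨p, hd, hp⟩ := h.reduces
    exact ⟨p, 1, hd, hp, Or.inr ⟨rfl, Or.inr h⟩⟩

theorem Pos.Reduces.list {T : Tok V → Prop} {ι : Type*} {p : ι → Pos V} {k : ι → ℕ}
    (h : ∀ i, Reduces T (p i) 0 (k i)) (hd : ∀ i j, i ≠ j → Disj (p i) (p j)) {L : List ι}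
    (hL : L.Nodup) : Reduces T (sum (L.map p)) 0 (L.map k).sum := by
  induction L with
  | nil => exact Reduces.of_EA_eq_empty (by simp [sum])
  | cons i L ih =>
    rw [List.nodup_cons] at hL
    rw [List.map_cons, sum_cons, List.map_cons, List.sum_cons]
    refine ((h i).add (ih hL.2) ?_).mono (Better.refl _) (by omega) le_rfl
    rintro v hv ⟨q, hq, hvq⟩
    obtain ⟨j, hj, rfl⟩ := List.mem_map.1 hq
    exact hd i j (by rintro rfl; exact hL.1 hj) v hv hvq

/-- If all components are favorable and at most one of them is only weakly favorable, then Alice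
wins. -/
theorem aliceWin_of_favorable [Finite V] {F : SimpleGraph V} (hF : F.Connected)
    (hcherry : ¬ HasCherry F) {v₀ : V} (hv₀ : v₀ ∈ leafParents F)
    (hfav : ∀ C : (F.induce (skeleton F)).ConnectedComponent,
      Favorable F v₀ (componentSet F C))
    (hweak : ∀ C C' : (F.induce (skeleton F)).ConnectedComponent,
      WeaklyFavorable F v₀ (componentSet F C) → WeaklyFavorable F v₀ (componentSet F C') → C = C') :
    AliceWin F {v₀} ∅ .bob := by
  classical
  -- This disposes in particular of the tree with two vertices; afterwards no leaf is the neighbour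
  -- of a leaf.
  by_cases hdom : IsDominating F {v₀}
  · exact .won hdom fun h => by obtain ⟨x, hx, -⟩ := h v₀; exact hx
  have hLM : ∀ m, m ∈ leaves F → m ∉ leafParents F := fun m h1 h2 =>
    hdom (isDominating_of_leaf_of_leafParent hF h1 h2 v₀)
  obtain ⟨l₀, hl₀, hvl⟩ := hv₀
  choose p k hp hr hk using fun C => (hfav C).reduces
  have : Fintype (F.induce (skeleton F)).ConnectedComponent := Fintype.ofFinite _
  have hC := Pos.Reduces.list hr (fun C C' hne v hv hv' =>
    hne (componentSet_disjoint ((hp C).subset hv) ((hp C').subset hv')))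
    (Finset.nodup_toList (Finset.univ : Finset (F.induce (skeleton F)).ConnectedComponent))
  have hsum : (Finset.univ.toList.map k).sum ≤ 1 := by
    rw [Finset.sum_map_toList]
    by_cases h : ∃ C, k C ≠ 0
    · obtain ⟨C, hkC⟩ := h
      rw [Finset.sum_eq_single C]
      · rcases hk C with h | h <;> omega
      · intro C' _ hne
        rcases hk C' with h | ⟨-, h⟩
        · exact h
        · exact absurd (hweak _ _ h ((hk C).resolve_left hkC).2) hne
      · simp
    · push Not at h
      simp [h]
  -- the pairs that consist of a leaf and its neighbour
  obtain ⟨n, ⟨e⟩⟩ := Finite.exists_equiv_fin {m : V // m ∈ leafParents F ∧ m ≠ v₀}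
  choose ℓ hℓ hmℓ using fun m : {m : V // m ∈ leafParents F ∧ m ≠ v₀} => m.2.1
  have hpairs : IsPairs (fun i => (e.symm i : V)) (fun i => ℓ (e.symm i)) Finset.univ := by
    refine ⟨fun i _ j _ h => e.symm.injective (Subtype.ext h), fun i _ j _ h => ?_,
      fun i _ j _ h => ?_⟩
    · refine e.symm.injective (Subtype.ext (eq_of_adj_leaf (hℓ (e.symm i)) (hmℓ _).symm ?_))
      rw [show ℓ (e.symm i) = ℓ (e.symm j) from h]
      exact (hmℓ _).symm
    · exact hLM _ (hℓ (e.symm j)) (by rw [← show (e.symm i : V) = ℓ (e.symm j) from h]; exact (e.symm i).2.1)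
  have hP := hpairs.reduces MainTok.hasLongPaths.toHasPaths
  have hskel : ∀ v, v ∈ (sum (Finset.univ.toList.map p)).X → v ∈ skeleton F := by
    rintro v ⟨q, hq, hv⟩
    obtain ⟨C, -, rfl⟩ := List.mem_map.1 hq
    exact componentSet_subset C ((hp C).subset hv)
  have hpX : ∀ v, v ∈ (pairs (fun i => (e.symm i : V)) (fun i => ℓ (e.symm i)) Finset.univ).X →
      v ≠ v₀ ∧ v ≠ l₀ ∧ (v ∈ leafParents F ∨ v ∈ leaves F) := by
    rintro v ⟨i, -, rfl | rfl⟩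
    · exact ⟨(e.symm i).2.2, fun h => hLM _ hl₀ (h ▸ (e.symm i).2.1), Or.inl (e.symm i).2.1⟩
    · refine ⟨fun h => hLM v₀ (h ▸ hℓ (e.symm i)) ⟨l₀, hl₀, hvl⟩, fun h => ?_, Or.inr (hℓ _)⟩
      exact (e.symm i).2.2 (eq_of_adj_leaf hl₀ (h ▸ (hmℓ _).symm) hvl.symm)
  -- The leaf at `v₀` is the initial threat: its only neighbour is Alice's, so Bob has to claim it.
  have hW := MainTok.win (d := l₀) ((hC.add hP (by
    intro v hv hv'
    have h1 := hskel v hv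
    rcases (hpX v hv').2.2 with h | h
    exacts [h1.2 h, h1.1 h])).mono (Better.refl _) (by omega) (by omega)) (by
    rintro (h | h)
    exacts [(hskel _ h).1 hl₀, (hpX _ h).2.1 rfl])
  refine hW.aliceWin ?_ ?_ ?_
  · rintro v (rfl | hv | hv)
    · exact ⟨fun h => hLM _ hl₀ (h ▸ ⟨v, hl₀, hvl⟩), fun h => h⟩
    · exact ⟨fun h => (hskel v hv).2 (h ▸ ⟨l₀, hl₀, hvl⟩), fun h => h⟩
    · exact ⟨(hpX v hv).1, fun h => h⟩
  · intro v hv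
    have hv1 : v ≠ v₀ := fun h => hv v (Or.inl rfl) h
    have hv2 : ¬ F.Adj v₀ v := fun h => hv v₀ (Or.inr h) rfl
    have hpair : ∀ m : {m : V // m ∈ leafParents F ∧ m ≠ v₀}, (v = m ∨ v = ℓ m) →
        ∃ c ∈ ((need {l₀}).add ((sum (Finset.univ.toList.map p)).add
          (pairs (fun i => (e.symm i : V)) (fun i => ℓ (e.symm i)) Finset.univ))).EA,
          ∀ x ∈ c, x = v ∨ F.Adj x v := by
      intro m hm
      refine ⟨_, Or.inr (Or.inr ⟨e m, Finset.mem_univ _, rfl⟩), ?_⟩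
      simp only [Equiv.symm_apply_apply]
      rintro x (rfl | rfl) <;> rcases hm with rfl | rfl
      exacts [Or.inl rfl, Or.inr (hmℓ m), Or.inr (hmℓ m).symm, Or.inl rfl]
    by_cases h1 : v ∈ leafParents F
    · exact hpair ⟨v, h1, hv1⟩ (Or.inl rfl)
    by_cases h2 : v ∈ leaves F
    · obtain ⟨m, hm⟩ := Set.ncard_eq_one.1 h2
      have hvm : F.Adj v m := by
        have : m ∈ F.neighborSet v := hm ▸ rfl
        exact this
      have hmv : m ≠ v₀ := by rintro rfl; exact hv2 hvm.symm
      refine hpair ⟨m, ⟨v, h2, hvm.symm⟩, hmv⟩ (Or.inr ?_)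
      -- Without cherries the leaf chosen for `m` can only be `v`.
      by_contra hne
      exact hcherry ⟨m, v, h2, _, hℓ _, hne, hvm.symm, hmℓ ⟨m, ⟨v, h2, hvm.symm⟩, hmv⟩⟩
    · have hvs : v ∈ skeleton F := ⟨h2, h1⟩
      obtain ⟨c, hc, hcx⟩ := (hp ((F.induce (skeleton F)).connectedComponentMk ⟨v, hvs⟩)).alice v
        ((mem_componentSet hvs).2 rfl) hv2
      exact ⟨c, Or.inr (Or.inl ⟨_, List.mem_map.2 ⟨_, by simp, rfl⟩, hc⟩), hcx⟩
  · rintro d (rfl | ⟨q, hq, hd⟩ | ⟨i, -, rfl⟩)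
    · refine ⟨l₀, fun x hx => ⟨fun h => h, ?_⟩⟩
      rcases hx with rfl | hx
      exacts [Or.inr rfl, Or.inl (eq_of_adj_leaf hl₀ hx.symm hvl.symm)]
    · obtain ⟨C, -, rfl⟩ := List.mem_map.1 hq
      obtain ⟨w, hw⟩ := (hp C).bob d hd
      exact ⟨w, fun x hx => ⟨fun h => h, hw x hx⟩⟩
    · refine ⟨ℓ (e.symm i), fun x hx => ⟨fun h => h, Or.inr ?_⟩⟩
      rcases hx with rfl | hx
      exacts [Or.inr rfl, Or.inl (eq_of_adj_leaf (hℓ _) hx.symm (hmℓ _).symm)]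

/-! ### Necessity: forced moves of Alice and verified strategies of Bob. -/

/-! ### Positions that Alice does not win -/

/-- A closed neighbourhood owned by Bob stays his, so Alice never dominates its center. -/
theorem not_aliceWin_of_blocked {G : SimpleGraph V} {A B : Set V} {t : Player} {v : V}
    (h : ∀ x, x = v ∨ G.Adj x v → x ∈ B ∧ x ∉ A) : ¬ AliceWin G A B t := by
  intro hW
  have hdom : ∀ {A B : Set V}, (∀ x, x = v ∨ G.Adj x v → x ∈ B ∧ x ∉ A) → ¬ IsDominating G A :=
    fun h hA => by
      obtain ⟨x, hx, hxv⟩ := hA v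
      exact (h x hxv).2 hx
  induction hW with
  | won hA _ => exact hdom h hA
  | aliceMove _ _ x hxA hxB _ ih =>
    refine ih fun y hy => ⟨(h y hy).1, ?_⟩
    rintro (rfl | hyA)
    exacts [hxB (h y hy).1, (h y hy).2 hyA]
  | bobMove _ _ hne _ ih =>
    obtain ⟨x, hxA, hxB⟩ := hne
    exact ih x hxA hxB fun y hy => ⟨Or.inr (h y hy).1, (h y hy).2⟩

theorem not_aliceWin_of_isDominating {G : SimpleGraph V} {A B : Set V} {t : Player}
    (h : IsDominating G B) : ¬ AliceWin G A B t := by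
  rintro (⟨_, hB⟩ | ⟨_, hB⟩ | ⟨_, hB⟩)
  all_goals exact hB h

theorem AliceWin.bob_move {G : SimpleGraph V} {A B : Set V} (h : AliceWin G A B .bob)
    (hA : ¬ IsDominating G A) {x : V} (hxA : x ∉ A) (hxB : x ∉ B) :
    AliceWin G A (insert x B) .alice := by
  cases h with
  | won h => exact absurd h hA
  | bobMove _ _ _ h => exact h x hxA hxB

theorem AliceWin.alice_move {G : SimpleGraph V} {A B : Set V} (h : AliceWin G A B .alice)
    (hA : ¬ IsDominating G A) : ∃ y, y ∉ A ∧ y ∉ B ∧ AliceWin G (insert y A) B .bob := by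
  cases h with
  | won h => exact absurd h hA
  | aliceMove _ _ y h1 h2 h => exact ⟨y, h1, h2, h⟩

theorem not_isDominating_of_forall {G : SimpleGraph V} {A : Set V} {v : V}
    (h : ∀ x, x = v ∨ G.Adj x v → x ∉ A) : ¬ IsDominating G A := fun hA => by
  obtain ⟨x, hx, hxv⟩ := hA v
  exact h x hxv hx

/-- If only one vertex is left to Alice that dominates `v`, she has to claim it. -/
theorem AliceWin.forced {G : SimpleGraph V} {A B : Set V} (h : AliceWin G A B .alice) {v x : V}
    (hx : x = v ∨ G.Adj x v) (hv : ∀ y, y = v ∨ G.Adj y v → y ∉ A ∧ (y ∈ B ∨ y = x)) :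
    AliceWin G (insert x A) B .bob := by
  obtain ⟨y, hyA, hyB, hy⟩ := h.alice_move (not_isDominating_of_forall fun y hy => (hv y hy).1)
  rcases eq_or_ne y x with rfl | hyx
  · exact hy
  have hyv : ∀ z, z = v ∨ G.Adj z v → z ∉ insert y A := by
    rintro z hz (rfl | h)
    · exact (hv z hz).2.elim hyB hyx
    · exact (hv z hz).1 h
  by_cases hxB : x ∈ B
  · exact absurd hy (not_aliceWin_of_blocked fun z hz => ⟨(hv z hz).2.elim id fun e => e ▸ hxB,
      hyv z hz⟩)
  -- Had Alice played elsewhere, Bob would take `x` and own the closed neighbourhood of `v`.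
  · refine absurd (hy.bob_move (not_isDominating_of_forall hyv) (hyv x hx) hxB)
      (not_aliceWin_of_blocked (v := v) fun z hz => ⟨?_, hyv z hz⟩)
    exact (hv z hz).2.elim Or.inr fun e => Or.inl e

/-! ### Strategies of Bob on positions with a bounded number of vertices -/

/-- The set of bits of `c` that are not in `m`. -/
def maskErase (c m : ℕ) : ℕ := c ^^^ (c &&& m)

theorem testBit_maskErase (c m i : ℕ) :
    (maskErase c m).testBit i = (c.testBit i && !m.testBit i) := by
  simp only [maskErase, Nat.testBit_xor, Nat.testBit_and]
  cases c.testBit i <;> cases m.testBit i <;> rfl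

theorem and_eq_zero_iff_testBit {c m : ℕ} :
    c &&& m = 0 ↔ ∀ i, c.testBit i = true → m.testBit i = true → False := by
  constructor
  · intro h i h1 h2
    have := congrArg (fun n => n.testBit i) h
    simp [h1, h2] at this
  · intro h
    refine Nat.eq_of_testBit_eq fun i => ?_
    rw [Nat.testBit_and, Nat.zero_testBit]
    cases h1 : c.testBit i <;> cases h2 : m.testBit i <;> try rfl
    exact (h i h1 h2).elim

theorem testBit_two_pow_iff {z i : ℕ} : (2 ^ z).testBit i = true ↔ i = z := by
  rw [Nat.testBit_two_pow]
  simp [eq_comm]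

/-- A position in which sets of vertices are given by the bits of natural numbers: the unclaimed
vertices, the sets that Alice has to hit, and the sets that Bob has to hit. -/
structure MaskPos where
  free : ℕ
  EA : List ℕ
  EB : List ℕ

namespace MaskPos

/-- Alice claims the vertices of `m`. -/
def alice (S : MaskPos) (m : ℕ) : MaskPos :=
  ⟨maskErase S.free m, S.EA.filter fun c => c &&& m == 0, S.EB.map fun c => maskErase c m⟩

/-- Bob claims the vertices of `m`. -/
def bob (S : MaskPos) (m : ℕ) : MaskPos :=
  ⟨maskErase S.free m, S.EA.map fun c => maskErase c m, S.EB.filter fun c => c &&& m == 0⟩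

/-- Alice cannot dominate, or Bob dominates. -/
def won (S : MaskPos) : Bool := (S.EA.any fun c => c == 0) || S.EB.isEmpty

/-- The answers of Alice which do not lose immediately; the empty set stands for a vertex without
relevance. -/
def replies (K : ℕ) (S : MaskPos) : List ℕ :=
  -- A power of two is a set with one vertex left, which Alice must claim at once; listing one such
  -- set suffices, because each of them forces her. The empty set is not matched, as `Nat.log2 0 =
  -- 0`.
  match S.EA.find? fun c => c == 2 ^ c.log2 with
  | some c => [c]
  | none => 0 :: ((List.range K).map fun j => 2 ^ j).filter fun m => S.free &&& m != 0

/-- The position in the game on `G` after Alice has claimed `A` and Bob has claimed `B` is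
described by `S`. -/
structure Rep (G : SimpleGraph V) (φ : ℕ → V) (K : ℕ) (A B : Set V) (S : MaskPos) : Prop where
  free : ∀ i, S.free.testBit i = true ↔ i < K ∧ φ i ∉ A ∧ φ i ∉ B
  -- The two conditions are asymmetric. Listed sets of Alice only have to be genuine obligations,
  -- while Bob's list must account for every vertex, so that he dominates once it is empty.
  EA : ∀ c ∈ S.EA, ∃ v, ∀ x, x = v ∨ G.Adj x v →
    x ∉ A ∧ (x ∈ B ∨ ∃ i < K, c.testBit i = true ∧ φ i = x)
  EB : ∀ v, (∃ x ∈ B, x = v ∨ G.Adj x v) ∨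
    ∃ d ∈ S.EB, ∀ i < K, d.testBit i = true → φ i = v ∨ G.Adj (φ i) v

variable {G : SimpleGraph V} {φ : ℕ → V} {K : ℕ} {A B : Set V} {S : MaskPos}

theorem alice_zero (S : MaskPos) : S.alice 0 = S := by
  simp [alice, maskErase]

theorem Rep.bob (h : Rep G φ K A B S) (hφ : ∀ i < K, ∀ j < K, φ i = φ j → i = j) {z : ℕ}
    (hz : S.free.testBit z = true) : Rep G φ K A (insert (φ z) B) (S.bob (2 ^ z)) := by
  have hzK := ((h.free z).1 hz).1
  refine ⟨fun i => ?_, fun c hc => ?_, fun v => ?_⟩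
  · simp only [MaskPos.bob, testBit_maskErase, Bool.and_eq_true, Bool.not_eq_true',
      ← Bool.not_eq_true, testBit_two_pow_iff, h.free, Set.mem_insert_iff, not_or]
    constructor
    · rintro ⟨⟨h1, h2, h3⟩, h4⟩
      exact ⟨h1, h2, fun e => h4 (hφ i h1 z hzK e), h3⟩
    · rintro ⟨h1, h2, h3, h4⟩
      exact ⟨⟨h1, h2, h4⟩, fun e => h3 (e ▸ rfl)⟩
  · obtain ⟨e, he, rfl⟩ := List.mem_map.1 hc
    obtain ⟨v, hv⟩ := h.EA e he
    refine ⟨v, fun x hx => ⟨(hv x hx).1, ?_⟩⟩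
    rcases (hv x hx).2 with hB | ⟨i, hi, hci, rfl⟩
    · exact Or.inl (Or.inr hB)
    · rcases eq_or_ne i z with rfl | hne
      · exact Or.inl (Or.inl rfl)
      · refine Or.inr ⟨i, hi, ?_, rfl⟩
        rw [testBit_maskErase, hci, Bool.true_and, Bool.not_eq_true', ← Bool.not_eq_true,
          testBit_two_pow_iff]
        exact hne
  · rcases h.EB v with ⟨x, hx, hxv⟩ | ⟨d, hd, hdv⟩
    · exact Or.inl ⟨x, Or.inr hx, hxv⟩
    · by_cases hdz : d.testBit z = true
      · exact Or.inl ⟨φ z, Or.inl rfl, hdv z hzK hdz⟩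
      · refine Or.inr ⟨d, List.mem_filter.2 ⟨hd, ?_⟩, hdv⟩
        rw [beq_iff_eq, and_eq_zero_iff_testBit]
        intro i h1 h2
        rw [testBit_two_pow_iff] at h2
        exact hdz (h2 ▸ h1)

theorem Rep.alice (h : Rep G φ K A B S) (hφ : ∀ i < K, ∀ j < K, φ i = φ j → i = j) {z : ℕ}
    (hz : S.free.testBit z = true) : Rep G φ K (insert (φ z) A) B (S.alice (2 ^ z)) := by
  obtain ⟨hzK, -, hzB⟩ := (h.free z).1 hz
  refine ⟨fun i => ?_, fun c hc => ?_, fun v => ?_⟩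
  · simp only [MaskPos.alice, testBit_maskErase, Bool.and_eq_true, Bool.not_eq_true',
      ← Bool.not_eq_true, testBit_two_pow_iff, h.free, Set.mem_insert_iff, not_or]
    constructor
    · rintro ⟨⟨h1, h2, h3⟩, h4⟩
      exact ⟨h1, ⟨fun e => h4 (hφ i h1 z hzK e), h2⟩, h3⟩
    · rintro ⟨h1, ⟨h2, h3⟩, h4⟩
      exact ⟨⟨h1, h3, h4⟩, fun e => h2 (e ▸ rfl)⟩
  · obtain ⟨hc, hcz⟩ := List.mem_filter.1 hc
    rw [beq_iff_eq, and_eq_zero_iff_testBit] at hcz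
    obtain ⟨v, hv⟩ := h.EA c hc
    refine ⟨v, fun x hx => ⟨?_, (hv x hx).2⟩⟩
    rintro (rfl | hxA)
    · rcases (hv _ hx).2 with h | ⟨i, hi, hci, e⟩
      · exact hzB h
      · exact hcz i hci (testBit_two_pow_iff.2 (hφ i hi z hzK e))
    · exact (hv x hx).1 hxA
  · refine (h.EB v).imp_right ?_
    rintro ⟨d, hd, hdv⟩
    refine ⟨_, List.mem_map.2 ⟨d, hd, rfl⟩, fun i hi hdi => hdv i hi ?_⟩
    rw [testBit_maskErase, Bool.and_eq_true] at hdi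
    exact hdi.1

theorem Rep.pass (h : Rep G φ K A B S) {y : V} (hyB : y ∉ B) (hy : ∀ i < K, φ i ≠ y) :
    Rep G φ K (insert y A) B S := by
  refine ⟨fun i => ?_, fun c hc => ?_, h.EB⟩
  · rw [h.free, Set.mem_insert_iff, not_or]
    constructor
    · rintro ⟨h1, h2, h3⟩
      exact ⟨h1, ⟨hy i h1, h2⟩, h3⟩
    · rintro ⟨h1, ⟨-, h2⟩, h3⟩
      exact ⟨h1, h2, h3⟩
  · obtain ⟨v, hv⟩ := h.EA c hc
    refine ⟨v, fun x hx => ⟨?_, (hv x hx).2⟩⟩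
    rintro (rfl | hxA)
    · rcases (hv _ hx).2 with h | ⟨i, hi, -, e⟩
      exacts [hyB h, hy i hi e]
    · exact (hv x hx).1 hxA

theorem Rep.not_isDominating (h : Rep G φ K A B S) (hS : S.EA ≠ []) : ¬ IsDominating G A := by
  obtain ⟨c, hc⟩ := List.exists_mem_of_ne_nil _ hS
  obtain ⟨v, hv⟩ := h.EA c hc
  exact not_isDominating_of_forall fun x hx => (hv x hx).1

theorem Rep.not_aliceWin_of_won (h : Rep G φ K A B S) (hS : S.won = true) {t : Player} :
    ¬ AliceWin G A B t := by
  rw [won, Bool.or_eq_true, List.any_eq_true] at hS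
  rcases hS with ⟨c, hc, hc0⟩ | hS
  · rw [beq_iff_eq] at hc0
    subst hc0
    obtain ⟨v, hv⟩ := h.EA 0 hc
    refine not_aliceWin_of_blocked (v := v) fun x hx => ⟨?_, (hv x hx).1⟩
    rcases (hv x hx).2 with h | ⟨i, -, hi, -⟩
    · exact h
    · simp at hi
  · rw [List.isEmpty_iff] at hS
    refine not_aliceWin_of_isDominating fun v => ?_
    rcases h.EB v with h | ⟨d, hd, -⟩
    · exact h
    · simp [hS] at hd

/-- A set with one vertex left forces Alice by `AliceWin.forced`. Otherwise her move is a numbered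
vertex, or it lies outside the fight and leaves the masks unchanged. -/
theorem Rep.exists_reply (h : Rep G φ K A B S) (hφ : ∀ i < K, ∀ j < K, φ i = φ j → i = j)
    (hS : S.EA ≠ []) (hW : AliceWin G A B .alice) :
    ∃ m ∈ S.replies K, ∃ A', Rep G φ K A' B (S.alice m) ∧ AliceWin G A' B .bob := by
  unfold replies
  split
  · rename_i c hc
    have hcE := List.mem_of_find?_eq_some hc
    have hc2 : c = 2 ^ c.log2 := by simpa using List.find?_some hc
    obtain ⟨v, hv⟩ := h.EA c hcE
    have hbit : ∀ i, c.testBit i = true ↔ i = c.log2 := fun i => by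
      conv_lhs => rw [hc2]
      exact testBit_two_pow_iff
    obtain ⟨x, hx, hxB⟩ : ∃ x, (x = v ∨ G.Adj x v) ∧ x ∉ B := by
      by_contra! hcon
      exact not_aliceWin_of_blocked (fun x hx => ⟨hcon x hx, (hv x hx).1⟩) hW
    obtain ⟨i, hi, hci, rfl⟩ := (hv x hx).2.resolve_left hxB
    rw [hbit] at hci
    have hfree : S.free.testBit i = true := (h.free i).2 ⟨hi, (hv _ hx).1, hxB⟩
    refine ⟨c, by simp, insert (φ i) A, ?_, hW.forced hx fun y hy => ⟨(hv y hy).1, ?_⟩⟩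
    · rw [hc2, ← hci]
      exact h.alice hφ hfree
    · rcases (hv y hy).2 with hyB | ⟨j, -, hj, rfl⟩
      · exact Or.inl hyB
      · rw [hbit, ← hci] at hj
        exact Or.inr (by rw [hj])
  · obtain ⟨y, hyA, hyB, hy⟩ := hW.alice_move (h.not_isDominating hS)
    by_cases hyφ : ∃ j < K, φ j = y
    · obtain ⟨j, hj, rfl⟩ := hyφ
      have hfree : S.free.testBit j = true := (h.free j).2 ⟨hj, hyA, hyB⟩
      refine ⟨2 ^ j, List.mem_cons_of_mem _ (List.mem_filter.2
        ⟨List.mem_map.2 ⟨j, List.mem_range.2 hj, rfl⟩, ?_⟩), _, h.alice hφ hfree, hy⟩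
      rw [bne_iff_ne, Ne, and_eq_zero_iff_testBit]
      exact fun hcon => hcon j hfree (testBit_two_pow_iff.2 rfl)
    · push Not at hyφ
      refine ⟨0, by simp, _, ?_, hy⟩
      rw [alice_zero]
      exact h.pass hyB hyφ

end MaskPos

/-- A strategy of Bob: `win z` claims the vertex `z` and wins, `go z s` claims `z` and continues
with `s`, and `alt m s t` continues with `s` if Alice has answered with a vertex of `m` and with
`t` otherwise. -/
inductive Strategy where
  | win (z : ℕ)
  | go (z : ℕ) (s : Strategy)
  | alt (m : ℕ) (s t : Strategy)

namespace Strategy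

/-- Bob can claim the vertex `z`, and Alice has not won. -/
def legal (S : MaskPos) (z : ℕ) : Bool := S.free.testBit z && !S.EA.isEmpty

/-- The strategy prevents a win of Alice if she answers with a member of `R`. -/
def check (K : ℕ) : Strategy → List ℕ → MaskPos → Bool
  | .win z, R, S => R.all fun m => legal (S.alice m) z && ((S.alice m).bob (2 ^ z)).won
  | .go z s, R, S => R.all fun m => legal (S.alice m) z &&
      -- Against some answers Bob has won already after `z`; ignoring the rest of the strategy then
      -- lets one node serve several answers.
      (((S.alice m).bob (2 ^ z)).won ||
        s.check K (((S.alice m).bob (2 ^ z)).replies K) ((S.alice m).bob (2 ^ z)))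
  -- An irrelevant answer, coded by `0`, always falls into the branch `t`.
  | .alt m s t, R, S => s.check K (R.filter fun r => r &&& m != 0) S &&
      t.check K (R.filter fun r => r &&& m == 0) S

theorem not_aliceWin_of_check {G : SimpleGraph V} {φ : ℕ → V} {K : ℕ}
    (hφ : ∀ i < K, ∀ j < K, φ i = φ j → i = j) (s : Strategy) :
    ∀ {R : List ℕ} {S : MaskPos} {A B : Set V} {m : ℕ}, s.check K R S = true → m ∈ R →
      MaskPos.Rep G φ K A B (S.alice m) → ¬ AliceWin G A B .bob := by
  induction s with
  | win z =>
    intro R S A B m hc hm h hW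
    have h1 := List.all_eq_true.1 hc m hm
    rw [Bool.and_eq_true, legal, Bool.and_eq_true] at h1
    obtain ⟨⟨h1, h2⟩, h3⟩ := h1
    have hE : (S.alice m).EA ≠ [] := by simpa using h2
    obtain ⟨-, h4, h5⟩ := (h.free z).1 h1
    exact (h.bob hφ h1).not_aliceWin_of_won h3 (hW.bob_move (h.not_isDominating hE) h4 h5)
  | go z s ih =>
    intro R S A B m hc hm h hW
    have h1 := List.all_eq_true.1 hc m hm
    rw [Bool.and_eq_true, legal, Bool.and_eq_true, Bool.or_eq_true] at h1
    obtain ⟨⟨h1, h2⟩, h3⟩ := h1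
    have hE : (S.alice m).EA ≠ [] := by simpa using h2
    obtain ⟨-, h4, h5⟩ := (h.free z).1 h1
    have hb := h.bob hφ h1
    have hW' := hW.bob_move (h.not_isDominating hE) h4 h5
    rcases h3 with h3 | h3
    · exact hb.not_aliceWin_of_won h3 hW'
    · obtain ⟨m', hm', A', hA', hWA'⟩ := hb.exists_reply hφ
        (by simpa [MaskPos.bob] using hE) hW'
      exact ih h3 hm' hA' hWA'
  | alt m' s t ihs iht =>
    intro R S A B m hc hm h
    rw [check, Bool.and_eq_true] at hc
    by_cases hm' : m &&& m' = 0
    · exact iht hc.2 (List.mem_filter.2 ⟨hm, by simpa using hm'⟩) h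
    · exact ihs hc.1 (List.mem_filter.2 ⟨hm, by simpa using hm'⟩) h

end Strategy

/-! ### Necessity: Bob reduces the tree to a bounded local fight. -/

/-! ### Rooted trees in which each vertex labelled `1` has a unique child -/

/-- A tree with root `r`, in which `up v` is the parent of `v` and `O` is the set of vertices
labelled `1`; the vertex `ch p` is the unique child of `p ∈ O`, and `l₀` is the unique leaf adjacent
to the root. -/
structure Rooted (G : SimpleGraph V) (r l₀ : V) (up ch : V → V) (O : Set V) : Prop where
  adj_iff : ∀ x y, G.Adj x y ↔ (y ≠ r ∧ up y = x) ∨ (x ≠ r ∧ up x = y)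
  depth : ∀ v, v ≠ r → G.dist r v = G.dist r (up v) + 1
  up_root : up r = r
  root_notMem : r ∉ O
  ch_ne : ∀ p ∈ O, ch p ≠ r
  up_ch : ∀ p ∈ O, up (ch p) = p
  ch_notMem : ∀ p ∈ O, ch p ∉ O
  eq_ch : ∀ w, w ≠ r → up w ∈ O → w = ch (up w)
  mem_of_up : ∀ w, w ≠ r → up w ≠ r → up w ∉ O → w ∈ O
  l₀_ne : l₀ ≠ r
  up_l₀ : up l₀ = r
  l₀_childless : ∀ w, w ≠ r → up w ≠ l₀
  eq_l₀ : ∀ v, v ≠ r → up v = r → (∀ w, w ≠ r → up w ≠ v) → v = l₀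

namespace Rooted

variable {G : SimpleGraph V} {r l₀ : V} {up ch : V → V} {O : Set V}

theorem ne_root (h : Rooted G r l₀ up ch O) {p : V} (hp : p ∈ O) : p ≠ r :=
  fun e => h.root_notMem (e ▸ hp)

theorem ch_ne_mem (h : Rooted G r l₀ up ch O) {p q : V} (hp : p ∈ O) (hq : q ∈ O) : ch p ≠ q :=
  fun e => h.ch_notMem p hp (e ▸ hq)

theorem ch_inj (h : Rooted G r l₀ up ch O) {p q : V} (hp : p ∈ O) (hq : q ∈ O)
    (e : ch p = ch q) : p = q := by
  rw [← h.up_ch p hp, ← h.up_ch q hq, e]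

/-- Labels alternate along the tree: the only child of a vertex labelled `1` is labelled `0`. -/
theorem up_notMem (h : Rooted G r l₀ up ch O) {p : V} (hp : p ∈ O) : up p ∉ O := fun hu =>
  h.ch_notMem _ hu (by rw [← h.eq_ch p (h.ne_root hp) hu]; exact hp)

theorem up_mem (h : Rooted G r l₀ up ch O) {w : V} (hw : w ≠ r) (hwO : w ∉ O) (hu : up w ≠ r) :
    up w ∈ O := by
  by_contra hcon
  exact hwO (h.mem_of_up w hw hu hcon)

theorem mem_of_up_ch (h : Rooted G r l₀ up ch O) {p w : V} (hp : p ∈ O) (hw : w ≠ r)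
    (e : up w = ch p) : w ∈ O :=
  h.mem_of_up w hw (e ▸ h.ch_ne p hp) (e ▸ h.ch_notMem p hp)

/-- Truncated subtraction fits here because `up` fixes the root. -/
theorem depth_iterate (h : Rooted G r l₀ up ch O) (n : ℕ) (v : V) :
    G.dist r (up^[n] v) = G.dist r v - n := by
  induction n with
  | zero => rfl
  | succ n ih =>
    rw [Function.iterate_succ_apply']
    by_cases hr : up^[n] v = r
    · rw [hr, SimpleGraph.dist_self] at ih
      rw [hr, h.up_root, SimpleGraph.dist_self]
      omega
    · have := h.depth _ hr
      omega

theorem depth_ch (h : Rooted G r l₀ up ch O) {p : V} (hp : p ∈ O) :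
    G.dist r (ch p) = G.dist r p + 1 := by
  rw [h.depth _ (h.ch_ne p hp), h.up_ch p hp]

/-- The neighbourhood of a vertex below a vertex labelled `1`. -/
theorem nhds_ch (h : Rooted G r l₀ up ch O) {p : V} (hp : p ∈ O) {x : V}
    (hx : x = ch p ∨ G.Adj x (ch p)) : x = ch p ∨ x = p ∨ (x ∈ O ∧ up x = ch p) := by
  rw [h.adj_iff, h.up_ch p hp] at hx
  rcases hx with hx | ⟨-, hx⟩ | ⟨hx, hx'⟩
  · exact Or.inl hx
  · exact Or.inr (Or.inl hx.symm)
  · exact Or.inr (Or.inr ⟨h.mem_of_up_ch hp hx hx', hx'⟩)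

theorem nhds_mem (h : Rooted G r l₀ up ch O) {p : V} (hp : p ∈ O) {x : V}
    (hx : x = p ∨ G.Adj x p) : x = p ∨ x = ch p ∨ x = up p := by
  rw [h.adj_iff] at hx
  rcases hx with hx | ⟨-, hx⟩ | ⟨hx, rfl⟩
  · exact Or.inl hx
  · exact Or.inr (Or.inr hx.symm)
  · exact Or.inr (Or.inl (h.eq_ch x hx hp))

/-- Bob claims the vertices of `D`, and Alice has to claim their children. -/
theorem clear [Finite V] (h : Rooted G r l₀ up ch O) {A B : Set V} (hW : AliceWin G A B .bob)
    {D : Set V} (hDO : D ⊆ O) (hD : ∀ p ∈ D, p ∉ A ∧ p ∉ B ∧ ch p ∉ A ∧ ch p ∉ B)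
    (hch : ∀ p ∈ D, ∀ w ∈ O, up w = ch p → w ∈ D ∨ (w ∈ B ∧ w ∉ A)) :
    AliceWin G (A ∪ ch '' D) (B ∪ D) .bob := by
  obtain ⟨n, hn⟩ : ∃ n, D.ncard = n := ⟨_, rfl⟩
  induction n generalizing A B D with
  | zero =>
    rw [Set.ncard_eq_zero] at hn
    simpa [hn] using hW
  | succ n ih =>
    -- Bob starts with a deepest `p`. The children of `ch p` are Bob's already, since one that still
    -- lay in `D` would be deeper; so only `ch p` itself is left to Alice in its closed
    -- neighbourhood.
    obtain ⟨p, hp, hmax⟩ := Set.exists_max_image D (fun v => G.dist r v) (Set.toFinite D)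
      (Set.nonempty_of_ncard_ne_zero (by omega))
    have hpO := hDO hp
    obtain ⟨hpA, hpB, hcA, hcB⟩ := hD p hp
    have hN : ∀ y, y = ch p ∨ G.Adj y (ch p) → y ∉ A ∧ (y ∈ insert p B ∨ y = ch p) := by
      intro y hy
      rcases h.nhds_ch hpO hy with rfl | rfl | ⟨hyO, hy⟩
      · exact ⟨hcA, Or.inr rfl⟩
      · exact ⟨hpA, Or.inl (Or.inl rfl)⟩
      · rcases hch p hp y hyO hy with hyD | ⟨hyB, hyA⟩
        · have h1 := hmax y hyD
          have h2 := h.depth y (h.ne_root hyO)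
          rw [hy, h.depth_ch hpO] at h2
          omega
        · exact ⟨hyA, Or.inl (Or.inr hyB)⟩
    have hW1 := (hW.bob_move (not_isDominating_of_forall fun x hx => (hN x hx).1) hpA hpB).forced
      (Or.inl rfl) hN
    have := ih hW1 (D := D \ {p}) (Set.sdiff_subset.trans hDO) ?_ ?_ ?_
    · convert this using 1
      · ext v
        constructor
        · rintro (hv | ⟨q, hq, rfl⟩)
          · exact Or.inl (Or.inr hv)
          · rcases eq_or_ne q p with rfl | hqp
            exacts [Or.inl (Or.inl rfl), Or.inr ⟨q, ⟨hq, hqp⟩, rfl⟩]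
        · rintro ((rfl | hv) | ⟨q, hq, rfl⟩)
          exacts [Or.inr ⟨p, hp, rfl⟩, Or.inl hv, Or.inr ⟨q, hq.1, rfl⟩]
      · ext v
        constructor
        · rintro (hv | hv)
          · exact Or.inl (Or.inr hv)
          · rcases eq_or_ne v p with rfl | hqp
            exacts [Or.inl (Or.inl rfl), Or.inr ⟨hv, hqp⟩]
        · rintro ((rfl | hv) | hv)
          exacts [Or.inr hp, Or.inl hv, Or.inr hv.1]
    · rintro q ⟨hq, hqp⟩
      have hqO := hDO hq
      obtain ⟨h1, h2, h3, h4⟩ := hD q hq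
      refine ⟨?_, ?_, ?_, ?_⟩
      · rintro (rfl | h)
        exacts [h.ch_notMem p hpO hqO, h1 h]
      · rintro (rfl | h)
        exacts [hqp rfl, h2 h]
      · rintro (e | h')
        exacts [hqp (h.ch_inj hqO hpO e), h3 h']
      · rintro (e | h')
        exacts [h.ch_ne_mem hqO hpO e, h4 h']
    · rintro q ⟨hq, hqp⟩ w hw hwq
      rcases hch q hq w hw hwq with hwD | ⟨hwB, hwA⟩
      · rcases eq_or_ne w p with rfl | hwp
        · refine Or.inr ⟨Or.inl rfl, ?_⟩
          rintro (e | h')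
          exacts [h.ch_ne_mem hpO hpO e.symm, hpA h']
        · exact Or.inl ⟨hwD, hwp⟩
      · refine Or.inr ⟨Or.inr hwB, ?_⟩
        rintro (rfl | h')
        exacts [hcB hwB, hwA h']
    · rw [Set.ncard_sdiff_singleton_of_mem hp, hn]
      rfl

/-- Alice wins if Bob has claimed all vertices labelled `1` that are not in `R`, and Alice the root
and the children of these vertices. -/
def WinsOn (G : SimpleGraph V) (r : V) (ch : V → V) (O R : Set V) : Prop :=
  AliceWin G ({r} ∪ ch '' (O \ R)) (O \ R) .bob

theorem mem_notMem (h : Rooted G r l₀ up ch O) {R : Set V} {p : V} (hp : p ∈ O) :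
    p ∉ ({r} ∪ ch '' (O \ R) : Set V) := by
  rintro (e | ⟨q, hq, e⟩)
  exacts [h.ne_root hp e, h.ch_ne_mem hq.1 hp e]

theorem ch_mem_notMem (h : Rooted G r l₀ up ch O) {R : Set V} {p : V} (hp : p ∈ O) (hpR : p ∈ R) :
    ch p ∉ ({r} ∪ ch '' (O \ R) : Set V) := by
  rintro (e | ⟨q, hq, e⟩)
  exacts [h.ch_ne p hp e, hq.2 (h.ch_inj hq.1 hp e ▸ hpR)]

/-- As `R'` is upwards closed in `R`, the difference `R \ R'` contains with `p` all members of `R`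
below `ch p`, as `Rooted.clear` requires. -/
theorem WinsOn.clear [Finite V] (h : Rooted G r l₀ up ch O) {R R' : Set V}
    (hW : WinsOn G r ch O R) (hR : R ⊆ O) (hRR : R' ⊆ R)
    (hcl : ∀ w ∈ R', ∀ p ∈ R, up w = ch p → p ∈ R') : WinsOn G r ch O R' := by
  have := h.clear hW (D := R \ R') (Set.sdiff_subset.trans hR) ?_ ?_
  · unfold WinsOn
    have e : O \ R' = O \ R ∪ R \ R' := by
      ext v
      constructor
      · rintro ⟨h1, h2⟩
        by_cases hv : v ∈ R
        exacts [Or.inr ⟨hv, h2⟩, Or.inl ⟨h1, hv⟩]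
      · rintro (⟨h1, h2⟩ | ⟨h1, h2⟩)
        exacts [⟨h1, fun hh => h2 (hRR hh)⟩, ⟨hR h1, h2⟩]
    rwa [e, Set.image_union, ← Set.union_assoc]
  · rintro p ⟨hp, hp'⟩
    exact ⟨h.mem_notMem (hR hp), fun hh => hh.2 hp, h.ch_mem_notMem (hR hp) hp, fun hh =>
      h.ch_notMem p (hR hp) hh.1⟩
  · rintro p ⟨hp, hp'⟩ w hw hwp
    by_cases hwR : w ∈ R
    · exact Or.inl ⟨hwR, fun hh => hp' (hcl w hh p hp hwp)⟩
    · exact Or.inr ⟨⟨hw, hwR⟩, h.mem_notMem hw⟩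

/-- Bob may claim a vertex of `R` if the vertex above it has no other child in `R`. -/
theorem WinsOn.prune [Finite V] (h : Rooted G r l₀ up ch O) {R : Set V}
    (hW : WinsOn G r ch O R) (hR : R ⊆ O) {p q : V} (hp : p ∈ R) (hq : q ∈ R) (hpq : up p = ch q)
    (huniq : ∀ w ∈ R, up w = ch q → w = p) : WinsOn G r ch O (R \ {p}) := by
  have hpO := hR hp
  have hqO := hR hq
  have hd1 := h.depth p (h.ne_root hpO)
  rw [hpq] at hd1
  have hd2 := h.depth_ch hpO
  have hd3 := h.depth_ch hqO
  have hxp : ch p ≠ p := h.ch_ne_mem hpO hpO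
  have hxw : ch p ≠ ch q := fun e => by rw [e] at hd2; omega
  have hpq' : p ≠ q := fun e => by rw [e] at hd1; omega
  obtain ⟨A, hA⟩ : ∃ A : Set V, A = {r} ∪ ch '' (O \ R) := ⟨_, rfl⟩
  have hAO : ∀ v ∈ O, v ∉ A := fun v hv => hA ▸ h.mem_notMem hv
  have hAc : ∀ v ∈ R, ch v ∉ A := fun v hv => hA ▸ h.ch_mem_notMem (hR hv) hv
  have hBc : ∀ v ∈ O, ch v ∉ O \ R := fun v hv hh => h.ch_notMem v hv hh.1
  unfold WinsOn at hW
  rw [← hA] at hW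
  have hNw : ∀ y, y = ch q ∨ G.Adj y (ch q) → y ∉ A ∧ (y ∈ insert p (O \ R) ∨ y = ch q ∨ y = q) := by
    intro y hy
    rcases h.nhds_ch hqO hy with rfl | rfl | ⟨hyO, hy⟩
    · exact ⟨hAc _ hq, Or.inr (Or.inl rfl)⟩
    · exact ⟨hAO _ hqO, Or.inr (Or.inr rfl)⟩
    · refine ⟨hAO _ hyO, Or.inl ?_⟩
      by_cases hyR : y ∈ R
      exacts [Or.inl (huniq y hyR hy), Or.inr ⟨hyO, hyR⟩]
  have hW1 := hW.bob_move (not_isDominating_of_forall fun x hx => (hNw x hx).1) (hAO p hpO)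
    (fun hh => hh.2 hp)
  obtain ⟨y, hyA, hyB, hy⟩ := hW1.alice_move
    (not_isDominating_of_forall fun x hx => (hNw x hx).1)
  -- The answer `ch p` leads to the claimed position; every other answer loses.
  by_cases hyx : y = ch p
  · subst hyx
    unfold WinsOn
    have e : O \ (R \ {p}) = insert p (O \ R) := by
      ext v
      simp only [Set.mem_sdiff, Set.mem_singleton_iff, not_and, not_not, Set.mem_insert_iff]
      constructor
      · rintro ⟨h1, h2⟩
        by_cases hv : v ∈ R
        exacts [Or.inl (h2 hv), Or.inr ⟨h1, hv⟩]
      · rintro (rfl | ⟨h1, h2⟩)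
        exacts [⟨hpO, fun _ => rfl⟩, ⟨h1, fun hh => absurd hh h2⟩]
    rw [e, Set.image_insert_eq]
    convert hy using 1
    rw [hA]
    ext v
    simp only [Set.mem_union, Set.mem_insert_iff, Set.mem_singleton_iff]
    tauto
  exfalso
  -- If Alice answers at `ch q` or `q`, Bob clears everything below `ch p`. He then owns the closed
  -- neighbourhood of `ch p` except for `ch p` itself, and takes it.
  by_cases hyw : y = ch q ∨ y = q
  · have hyd : G.dist r y < G.dist r p := by
      rcases hyw with rfl | rfl <;> omega
    have hdesc : ∀ {v n}, up^[n] v = ch p → G.dist r (ch p) ≤ G.dist r v := by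
      intro v n hv
      have := h.depth_iterate n v
      rw [hv] at this
      omega
    have hyO : ∀ v, ch v = y → v ∈ O → v = q := by
      rintro v rfl hv
      rcases hyw with e | e
      exacts [h.ch_inj hv hqO e, absurd e (h.ch_ne_mem hv hqO)]
    have hD := h.clear hy (D := {d | d ∈ R ∧ ∃ n, up^[n] d = ch p}) (fun d hd => hR hd.1) ?_ ?_
    · have hxA : ch p ∉ insert y A ∪ ch '' {d | d ∈ R ∧ ∃ n, up^[n] d = ch p} := by
        rintro ((e | hh) | ⟨d, ⟨hd, n, hn⟩, e⟩)
        · exact hyx e.symm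
        · exact hAc p hp hh
        · have := hdesc hn
          rw [h.ch_inj (hR hd) hpO e] at this
          omega
      have hpA : ∀ v ∈ O, v ≠ y → v ∉ insert y A ∪ ch '' {d | d ∈ R ∧ ∃ n, up^[n] d = ch p} := by
        rintro v hv hvy ((e | hh) | ⟨d, ⟨hd, -⟩, e⟩)
        exacts [hvy e, hAO v hv hh, h.ch_ne_mem (hR hd) hv e]
      have hNx : ∀ z, z = ch p ∨ G.Adj z (ch p) →
          z ∉ insert y A ∪ ch '' {d | d ∈ R ∧ ∃ n, up^[n] d = ch p} ∧
          (z ∈ insert p (O \ R) ∪ {d | d ∈ R ∧ ∃ n, up^[n] d = ch p} ∨ z = ch p) := by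
        intro z hz
        rcases h.nhds_ch hpO hz with rfl | rfl | ⟨hzO, hz⟩
        · exact ⟨hxA, Or.inr rfl⟩
        · exact ⟨hpA _ hpO fun e => by rw [e] at hyd; omega, Or.inl (Or.inl (Or.inl rfl))⟩
        · refine ⟨hpA z hzO fun e => ?_, Or.inl ?_⟩
          · have := hdesc (v := z) (n := 1) hz
            rw [e] at this
            omega
          · by_cases hzR : z ∈ R
            exacts [Or.inr ⟨hzR, 1, hz⟩, Or.inl (Or.inr ⟨hzO, hzR⟩)]
      refine not_aliceWin_of_blocked (v := ch p) (fun z hz => ⟨?_, (hNx z hz).1⟩)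
        (hD.bob_move (not_isDominating_of_forall fun x hx => (hNx x hx).1) hxA ?_)
      · exact (hNx z hz).2.elim Or.inr fun e => Or.inl e
      · rintro ((e | hh) | ⟨hh, -⟩)
        exacts [hxp e, hBc p hpO hh, h.ch_notMem p hpO (hR hh)]
    · rintro d ⟨hd, n, hn⟩
      have hdd := hdesc hn
      have hdO := hR hd
      refine ⟨?_, ?_, ?_, ?_⟩
      · rintro (e | hh)
        · rw [e] at hdd
          omega
        · exact hAO d hdO hh
      · rintro (e | hh)
        · rw [e] at hdd
          omega
        · exact hh.2 hd
      · rintro (e | hh)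
        · rw [hyO d e hdO] at hdd
          omega
        · exact hAc d hd hh
      · rintro (e | hh)
        exacts [h.ch_ne_mem hdO hpO e, hBc d hdO hh]
    · rintro d ⟨hd, n, hn⟩ w hw hwd
      by_cases hwR : w ∈ R
      · refine Or.inl ⟨hwR, n + 2, ?_⟩
        rw [Function.iterate_add_apply]
        change up^[n] (up (up w)) = ch p
        rw [hwd, h.up_ch d (hR hd), hn]
      · refine Or.inr ⟨Or.inr ⟨hw, hwR⟩, ?_⟩
        rintro (rfl | hh)
        exacts [hyB (Or.inr ⟨hw, hwR⟩), hAO w hw hh]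
  -- If she answers elsewhere, Bob takes `ch q`, whose neighbours other than `q` are all his, so `q`
  -- is forced. Then `ch p` completes the closed neighbourhood `{p, ch p, up p}` of `p`, as `up p =
  -- ch q`.
  · push Not at hyw
    have hwA : ch q ∉ insert y A := by
      rintro (e | hh)
      exacts [hyw.1 e.symm, hAc q hq hh]
    have hNw' : ∀ z, z = ch q ∨ G.Adj z (ch q) → z ∉ insert y A := by
      rintro z hz (rfl | hh)
      · rcases (hNw z hz).2 with h1 | h1 | h1
        exacts [hyB h1, hyw.1 h1, hyw.2 h1]
      · exact (hNw z hz).1 hh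
    have hwB : ch q ∉ insert p (O \ R) := by
      rintro (e | hh)
      exacts [h.ch_ne_mem hqO hpO e, hBc q hqO hh]
    have hW2 := (hy.bob_move (not_isDominating_of_forall hNw') hwA hwB).forced (x := q)
      (v := ch q) (Or.inr ((h.adj_iff _ _).2 (Or.inl ⟨h.ch_ne q hqO, h.up_ch q hqO⟩)))
      (fun z hz => ⟨hNw' z hz, by
        rcases (hNw z hz).2 with h1 | h1 | h1
        exacts [Or.inl (Or.inr h1), Or.inl (Or.inl h1), Or.inr h1]⟩)
    have hNp : ∀ z, z = p ∨ G.Adj z p → z ∉ insert q (insert y A) ∧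
        (z ∈ insert (ch q) (insert p (O \ R)) ∨ z = ch p) := by
      intro z hz
      rcases h.nhds_mem hpO hz with rfl | rfl | rfl
      · refine ⟨?_, Or.inl (Or.inr (Or.inl rfl))⟩
        rintro (e | rfl | hh)
        exacts [hpq' e, hyB (Or.inl rfl), hAO _ hpO hh]
      · refine ⟨?_, Or.inr rfl⟩
        rintro (e | e | hh)
        exacts [h.ch_ne_mem hpO hqO e, hyx e.symm, hAc _ hp hh]
      · rw [hpq]
        refine ⟨?_, Or.inl (Or.inl rfl)⟩
        rintro (e | hh)
        exacts [h.ch_ne_mem hqO hqO e, hwA hh]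
    have hx := hNp (ch p) (Or.inr ((h.adj_iff _ _).2 (Or.inr ⟨h.ch_ne p hpO, h.up_ch p hpO⟩)))
    refine not_aliceWin_of_blocked (v := p) (fun z hz => ⟨?_, (hNp z hz).1⟩)
      (hW2.bob_move (not_isDominating_of_forall fun x hx => (hNp x hx).1) hx.1 ?_)
    · exact (hNp z hz).2.elim Or.inr fun e => Or.inl e
    · rintro (e | e | hh)
      exacts [hxw e, hxp e, hBc p hpO hh]

/-- Bob may claim all vertices labelled `1` outside an upwards closed set. -/
theorem winsOn_of_closed [Finite V] (h : Rooted G r l₀ up ch O) (hW : AliceWin G {r} ∅ .bob)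
    {T : Set V} (hT : T ⊆ O) (hcl : ∀ w ∈ T, ∀ p ∈ O, up w = ch p → p ∈ T) :
    WinsOn G r ch O T :=
  WinsOn.clear h (R := O) (by simpa [WinsOn] using hW) subset_rfl hT hcl

/-- Bob may claim all vertices labelled `1` outside a set that is upwards closed up to one vertex,
if there are further vertices labelled `1` above the latter. -/
theorem winsOn_of_cut [Finite V] (h : Rooted G r l₀ up ch O) (hW : AliceWin G {r} ∅ .bob)
    {T : Set V} (hT : T ⊆ O) {e f : V} (he : e ∈ O) (hf : f ∈ O) (hef : up e = ch f) (heT : e ∉ T)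
    (hfT : f ∉ T) (hcl : ∀ w ∈ T, ∀ p ∈ O, up w = ch p → p ∈ T ∨ p = e) : WinsOn G r ch O T := by
  have hde := h.depth e (h.ne_root he)
  rw [hef, h.depth_ch hf] at hde
  have hRO : T ∪ {p | p ∈ O ∧ ∃ n, up^[n] e = p} ⊆ O := by
    rintro p (hp | ⟨hp, -⟩)
    exacts [hT hp, hp]
  have hcl' : ∀ w, (∃ n, up^[n] e = w) → ∀ p ∈ O, up w = ch p → ∃ n, up^[n] e = p := by
    rintro w ⟨n, rfl⟩ p hp hwp
    refine ⟨n + 2, ?_⟩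
    rw [Nat.add_comm, Function.iterate_add_apply]
    change up (up (up^[n] e)) = p
    rw [hwp, h.up_ch p hp]
  -- Adding `e` and all vertices labelled `1` above it makes `T` upwards closed.
  have h1 : WinsOn G r ch O (T ∪ {p | p ∈ O ∧ ∃ n, up^[n] e = p}) := by
    refine h.winsOn_of_closed hW hRO ?_
    rintro w (hw | ⟨-, hw⟩) p hp hwp
    · rcases hcl w hw p hp hwp with h | rfl
      exacts [Or.inl h, Or.inr ⟨hp, 0, rfl⟩]
    · exact Or.inr ⟨hp, hcl' w hw p hp hwp⟩
  -- Among the remaining vertices only `e` lies below `ch f`, so `e` can be pruned; this detaches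
  -- `T`, and the vertices above can then be cleared.
  refine ((h1.prune h hRO (p := e) (q := f) (Or.inr ⟨he, 0, rfl⟩)
    (Or.inr ⟨hf, hcl' e ⟨0, rfl⟩ f hf hef⟩) hef ?_).clear h (Set.sdiff_subset.trans hRO)
    (fun v hv => ⟨Or.inl hv, fun e' => heT (e' ▸ hv)⟩) ?_)
  · rintro w (hw | ⟨hwO, n, hn⟩) hwf
    · rcases hcl w hw f hf hwf with h | rfl
      · exact absurd h hfT
      · omega
    · have h2 := h.depth w (h.ne_root hwO)
      rw [hwf, h.depth_ch hf] at h2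
      have h3 := h.depth_iterate n e
      rw [hn] at h3
      obtain rfl : n = 0 := by omega
      exact hn.symm
  · rintro w hw p ⟨hp, hpe⟩ hwp
    exact (hcl w hw p (hRO hp) hwp).resolve_right hpe

end Rooted

/-! ### Bob's local fights -/

/-- The set of the members of `l`, as a mask. -/
def listMask (l : List ℕ) : ℕ := l.foldr (fun i c => 2 ^ i ||| c) 0

theorem testBit_listMask (l : List ℕ) (i : ℕ) : (listMask l).testBit i = true ↔ i ∈ l := by
  induction l with
  | nil => simp [listMask]
  | cons a l ih =>
    have : listMask (a :: l) = 2 ^ a ||| listMask l := rfl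
    rw [this, Nat.testBit_or, Bool.or_eq_true, ih, testBit_two_pow_iff, List.mem_cons]

/-- The `i`-th entry of the list `par` describes the vertex above a vertex `p i` labelled `1`:
`2 * j + 1` is the child of `p j`, larger numbers than `2 * par.length` are children of the root,
and `0` is a vertex that Alice dominates for Bob. These are the numbers of the children of a
vertex. -/
def childIndices (par : List ℕ) (v : ℕ) : List ℕ :=
  ((List.range par.length).filter fun i => par.getD i 0 == v).map fun i => 2 * i

theorem mem_childIndices {par : List ℕ} {v z : ℕ} :
    z ∈ childIndices par v ↔ ∃ i < par.length, par.getD i 0 = v ∧ 2 * i = z := by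
  simp [childIndices, and_assoc]

/-- The position on the tree described by `par`, in which `n` children of the root are involved
and the vertices in `marks` are already dominated by Bob. -/
def shapePos (par marks : List ℕ) (n : ℕ) : MaskPos where
  free := 2 ^ (2 * par.length + 1 + n) - 1
  -- The closed neighbourhoods of the child of `p i` and of `p i`; the latter is dropped if the
  -- vertex above is Alice's.
  EA := (List.range par.length).flatMap fun i =>
    listMask (2 * i :: (2 * i + 1) :: childIndices par (2 * i + 1)) ::
      if par.getD i 0 = 0 then [] else [listMask [2 * i, 2 * i + 1, par.getD i 0]]
  -- The set of the leaf also serves the root, which that leaf dominates. A child of some `p j` gets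
  -- a set only if it occurs in `par`; otherwise `IsShape.live` provides a vertex of Bob below it.
  EB := listMask [2 * par.length] :: (List.range par.length).flatMap fun i =>
    if par.getD i 0 = 0 then [listMask [2 * i, 2 * i + 1]]
    else listMask [2 * i, 2 * i + 1, par.getD i 0] ::
      if par.getD i 0 ∈ marks then []
      -- An entry `2 * j + 1` is the child of `p j`, whose number is the predecessor; children of
      -- the root have no such neighbour.
      else [listMask (par.getD i 0 :: (if par.getD i 0 < 2 * par.length then [par.getD i 0 - 1]
        else []) ++ childIndices par (par.getD i 0))]

/-- The vertices which occur in a local fight: the members `p` of `ps` and their children, the leaf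
at the root, and the members of `rs`. -/
def shapeVertex (l₀ : V) (ch : V → V) (ps rs : List V) (j : ℕ) : V :=
  if j < 2 * ps.length then
    if j % 2 = 0 then ps.getD (j / 2) l₀ else ch (ps.getD (j / 2) l₀)
  else (l₀ :: rs).getD (j - 2 * ps.length) l₀

section

variable {l₀ : V} {ch : V → V} {ps rs : List V}

theorem shapeVertex_even {i : ℕ} (hi : i < ps.length) :
    shapeVertex l₀ ch ps rs (2 * i) = ps.getD i l₀ := by
  rw [shapeVertex, if_pos (by omega), if_pos (by omega), Nat.mul_div_cancel_left _ (by omega)]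

theorem shapeVertex_odd {i : ℕ} (hi : i < ps.length) :
    shapeVertex l₀ ch ps rs (2 * i + 1) = ch (ps.getD i l₀) := by
  rw [shapeVertex, if_pos (by omega), if_neg (by omega), show (2 * i + 1) / 2 = i by omega]

theorem shapeVertex_leaf : shapeVertex l₀ ch ps rs (2 * ps.length) = l₀ := by
  rw [shapeVertex, if_neg (by omega), Nat.sub_self]
  rfl

theorem shapeVertex_root (t : ℕ) :
    shapeVertex l₀ ch ps rs (2 * ps.length + 1 + t) = rs.getD t l₀ := by
  rw [shapeVertex, if_neg (by omega), show 2 * ps.length + 1 + t - 2 * ps.length = t + 1 by omega]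
  rfl

theorem index_cases {r n j : ℕ} (hj : j < 2 * r + 1 + n) :
    (∃ i < r, j = 2 * i) ∨ (∃ i < r, j = 2 * i + 1) ∨ j = 2 * r ∨ ∃ t < n, j = 2 * r + 1 + t := by
  rcases lt_trichotomy j (2 * r) with h | h | h
  · rcases Nat.even_or_odd' j with ⟨i, rfl | rfl⟩
    exacts [Or.inl ⟨i, by omega, rfl⟩, Or.inr (Or.inl ⟨i, by omega, rfl⟩)]
  · exact Or.inr (Or.inr (Or.inl h))
  · exact Or.inr (Or.inr (Or.inr ⟨j - (2 * r + 1), by omega, by omega⟩))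

end

/-- The vertices of a local fight. -/
structure IsShape (G : SimpleGraph V) (r l₀ : V) (up ch : V → V) (O : Set V) (ps rs : List V)
    (par marks : List ℕ) : Prop where
  length_eq : par.length = ps.length
  ps_nodup : ps.Nodup
  ps_mem : ∀ p ∈ ps, p ∈ O
  live : ∀ p ∈ ps, ∃ w ∈ O, up w = ch p
  rs_nodup : rs.Nodup
  rs_spec : ∀ v ∈ rs, v ≠ r ∧ up v = r ∧ v ∉ O ∧ v ≠ l₀
  par_spec : ∀ i < ps.length,
    (par.getD i 0 = 0 ∧ (up (ps.getD i l₀) = r ∨ ∃ q ∈ O, q ∉ ps ∧ up (ps.getD i l₀) = ch q)) ∨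
    (par.getD i 0 ≠ 0 ∧ par.getD i 0 < 2 * ps.length + 1 + rs.length ∧
      up (ps.getD i l₀) = shapeVertex l₀ ch ps rs (par.getD i 0))
  mark_spec : ∀ j ∈ marks, ∃ w ∈ O, w ∉ ps ∧ up w = shapeVertex l₀ ch ps rs j

namespace IsShape

variable {G : SimpleGraph V} {r l₀ : V} {up ch : V → V} {O : Set V} {ps rs : List V}
  {par marks : List ℕ}

theorem getD_mem {l : List V} {i : ℕ} (hi : i < l.length) (d : V) : l.getD i d ∈ l := by
  rw [List.getD_eq_getElem _ _ hi]
  exact List.getElem_mem hi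

theorem getD_inj {l : List V} (hl : l.Nodup) {i j : ℕ} (hi : i < l.length) (hj : j < l.length)
    {d : V} (e : l.getD i d = l.getD j d) : i = j := by
  rw [List.getD_eq_getElem _ _ hi, List.getD_eq_getElem _ _ hj] at e
  exact (List.Nodup.getElem_inj_iff hl).1 e

theorem exists_index {l : List V} {v : V} (hv : v ∈ l) (d : V) :
    ∃ i < l.length, l.getD i d = v := by
  obtain ⟨i, hi, rfl⟩ := List.getElem_of_mem hv
  exact ⟨i, hi, List.getD_eq_getElem _ _ hi⟩

theorem leaf_notMem (h : Rooted G r l₀ up ch O) : l₀ ∉ O := fun hl =>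
  h.l₀_childless (ch l₀) (h.ch_ne _ hl) (h.up_ch _ hl)

theorem inj (h : Rooted G r l₀ up ch O) (hs : IsShape G r l₀ up ch O ps rs par marks) :
    ∀ i < 2 * ps.length + 1 + rs.length, ∀ j < 2 * ps.length + 1 + rs.length,
      shapeVertex l₀ ch ps rs i = shapeVertex l₀ ch ps rs j → i = j := by
  have hO : ∀ {i}, i < ps.length → ps.getD i l₀ ∈ O := fun hi => hs.ps_mem _ (getD_mem hi _)
  have hch : ∀ {i}, i < ps.length → up (ch (ps.getD i l₀)) ≠ r := fun hi => by
    rw [h.up_ch _ (hO hi)]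
    exact h.ne_root (hO hi)
  have hR := fun {t} (ht : t < rs.length) => hs.rs_spec _ (getD_mem ht l₀)
  intro i hi' j hj' e
  have key : ∀ {j}, j < 2 * ps.length + 1 + rs.length →
      (∃ i < ps.length, j = 2 * i ∧ shapeVertex l₀ ch ps rs j = ps.getD i l₀) ∨
      (∃ i < ps.length, j = 2 * i + 1 ∧ shapeVertex l₀ ch ps rs j = ch (ps.getD i l₀)) ∨
      (j = 2 * ps.length ∧ shapeVertex l₀ ch ps rs j = l₀) ∨
      ∃ t < rs.length, j = 2 * ps.length + 1 + t ∧ shapeVertex l₀ ch ps rs j = rs.getD t l₀ := by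
    intro j hj
    rcases index_cases hj with ⟨i, hi, rfl⟩ | ⟨i, hi, rfl⟩ | rfl | ⟨t, ht, rfl⟩
    · exact Or.inl ⟨i, hi, rfl, shapeVertex_even hi⟩
    · exact Or.inr (Or.inl ⟨i, hi, rfl, shapeVertex_odd hi⟩)
    · exact Or.inr (Or.inr (Or.inl ⟨rfl, shapeVertex_leaf⟩))
    · exact Or.inr (Or.inr (Or.inr ⟨t, ht, rfl, shapeVertex_root t⟩))
  rcases key hi' with ⟨i, hi, rfl, ei⟩ | ⟨i, hi, rfl, ei⟩ | ⟨rfl, ei⟩ | ⟨s, hs', rfl, ei⟩ <;>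
    rcases key hj' with ⟨j, hj, rfl, ej⟩ | ⟨j, hj, rfl, ej⟩ | ⟨rfl, ej⟩ | ⟨t, ht, rfl, ej⟩ <;>
    replace e := ei.symm.trans (e.trans ej)
  · rw [getD_inj hs.ps_nodup hi hj e]
  · exact absurd e.symm (h.ch_ne_mem (hO hj) (hO hi))
  · exact absurd (Set.mem_of_eq_of_mem e.symm (hO hi)) (leaf_notMem h)
  · exact absurd (hO hi) (e ▸ (hR ht).2.2.1)
  · exact absurd e (h.ch_ne_mem (hO hi) (hO hj))
  · rw [getD_inj hs.ps_nodup hi hj (h.ch_inj (hO hi) (hO hj) e)]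
  · exact absurd h.up_l₀ (e ▸ hch hi)
  · exact absurd (hR ht).2.1 (e ▸ hch hi)
  · exact absurd (Set.mem_of_eq_of_mem e (hO hj)) (leaf_notMem h)
  · exact absurd h.up_l₀ (e ▸ hch hj)
  · rfl
  · exact absurd e.symm (hR ht).2.2.2
  · exact absurd (hO hj) (e ▸ (hR hs').2.2.1)
  · exact absurd (hR hs').2.1 (e ▸ hch hj)
  · exact absurd e (hR hs').2.2.2
  · rw [getD_inj hs.rs_nodup hs' ht e]

/-- The point is that the listed sets account for the whole tree. A vertex labelled `1` outside `ps`
is Bob's, and he dominates its child from there. A vertex labelled `0` that is neither of this kind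
nor `l₀` has a child labelled `1`, which is either Bob's or takes part in the fight. -/
theorem rep (h : Rooted G r l₀ up ch O) (hs : IsShape G r l₀ up ch O ps rs par marks) :
    MaskPos.Rep G (shapeVertex l₀ ch ps rs) (2 * ps.length + 1 + rs.length)
      ({r} ∪ ch '' (O \ {p | p ∈ ps})) (O \ {p | p ∈ ps}) (shapePos par marks rs.length) := by
  have hO : ∀ {i}, i < ps.length → ps.getD i l₀ ∈ O := fun hi => hs.ps_mem _ (getD_mem hi _)
  have hP : ∀ {i}, i < ps.length → ps.getD i l₀ ∈ {p | p ∈ ps} := fun hi => getD_mem hi _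
  have hPO : {p | p ∈ ps} ⊆ O := fun p hp => hs.ps_mem p hp
  have hR := fun {t} (ht : t < rs.length) => hs.rs_spec _ (getD_mem ht l₀)
  have hlA : ∀ {v}, v ≠ r → up v = r → v ∉ ({r} ∪ ch '' (O \ {p | p ∈ ps}) : Set V) := by
    rintro v hv hu (e | ⟨q, hq, rfl⟩)
    · exact hv e
    · rw [h.up_ch q hq.1] at hu
      exact h.ne_root hq.1 hu
  have hkid : ∀ {w i}, w ∈ ps → i < ps.length → up w = ch (ps.getD i l₀) →
      ∃ k < ps.length, ps.getD k l₀ = w ∧ par.getD k 0 = 2 * i + 1 := by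
    intro w i hw hi hwi
    obtain ⟨k, hk, rfl⟩ := exists_index hw l₀
    refine ⟨k, hk, rfl, ?_⟩
    rcases hs.par_spec k hk with ⟨-, e | ⟨q, hq, hqps, e⟩⟩ | ⟨-, h2, e⟩
    · rw [hwi] at e
      exact absurd e (h.ch_ne _ (hO hi))
    · rw [hwi] at e
      exact absurd (getD_mem hi l₀) (h.ch_inj (hO hi) hq e ▸ hqps)
    · rw [hwi, ← shapeVertex_odd (ch := ch) (rs := rs) hi] at e
      exact (hs.inj h _ (by omega) _ h2 e).symm
  have hroot : ∀ {k}, k < ps.length → ∀ {t}, up (ps.getD k l₀) = t → t ≠ r → up t = r →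
      ∃ s < rs.length, par.getD k 0 = 2 * ps.length + 1 + s ∧ rs.getD s l₀ = t := by
    intro k hk t hkt htr hut
    rcases hs.par_spec k hk with ⟨-, e | ⟨q, hq, hqps, e⟩⟩ | ⟨-, h2, e⟩
    · exact absurd (hkt.symm.trans e) htr
    · rw [← hkt, e, h.up_ch q hq] at hut
      exact absurd hut (h.ne_root hq)
    · rw [hkt] at e
      rcases index_cases h2 with ⟨j, hj, e'⟩ | ⟨j, hj, e'⟩ | e' | ⟨s, hs', e'⟩ <;> rw [e'] at e
      · rw [shapeVertex_even hj] at e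
        exact absurd (hkt.trans e ▸ hO hj) (h.up_notMem (hO hk))
      · rw [shapeVertex_odd hj] at e
        rw [e, h.up_ch _ (hO hj)] at hut
        exact absurd hut (h.ne_root (hO hj))
      · rw [shapeVertex_leaf] at e
        exact absurd (hkt.trans e) (h.l₀_childless _ (h.ne_root (hO hk)))
      · rw [shapeVertex_root] at e
        exact ⟨s, hs', e', e.symm⟩
  have hclaimed : ∀ {w v}, w ∈ O → w ∉ ps → up w = v → v ≠ w →
      ∃ x ∈ O \ {p | p ∈ ps}, x = v ∨ G.Adj x v := fun hw hwps hwv hne =>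
    ⟨_, ⟨hw, hwps⟩, Or.inr ((h.adj_iff _ _).2 (Or.inr ⟨h.ne_root hw, hwv⟩))⟩
  refine ⟨fun i => ?_, fun c hc => ?_, fun v => ?_⟩
  · rw [shapePos, hs.length_eq, Nat.testBit_two_pow_sub_one, decide_eq_true_iff]
    refine ⟨fun hi => ⟨hi, ?_⟩, fun hi => hi.1⟩
    rcases index_cases hi with ⟨i, hi, e⟩ | ⟨i, hi, e⟩ | e | ⟨t, ht, e⟩ <;> rw [e]
    · rw [shapeVertex_even hi]
      exact ⟨h.mem_notMem (hO hi), fun hh => hh.2 (hP hi)⟩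
    · rw [shapeVertex_odd hi]
      exact ⟨h.ch_mem_notMem (hO hi) (hP hi), fun hh => h.ch_notMem _ (hO hi) hh.1⟩
    · rw [shapeVertex_leaf]
      exact ⟨hlA h.l₀_ne h.up_l₀, fun hh => leaf_notMem h hh.1⟩
    · rw [shapeVertex_root]
      exact ⟨hlA (hR ht).1 (hR ht).2.1, fun hh => (hR ht).2.2.1 hh.1⟩
  · simp only [shapePos, List.mem_flatMap, List.mem_range, List.mem_cons, hs.length_eq] at hc
    obtain ⟨i, hi, rfl | hc⟩ := hc
    · refine ⟨ch (ps.getD i l₀), fun x hx => ?_⟩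
      rcases h.nhds_ch (hO hi) hx with rfl | rfl | ⟨hxO, hx⟩
      · refine ⟨h.ch_mem_notMem (hO hi) (hP hi), Or.inr ⟨2 * i + 1, by omega, ?_,
          shapeVertex_odd hi⟩⟩
        simp [testBit_listMask]
      · refine ⟨h.mem_notMem (hO hi), Or.inr ⟨2 * i, by omega, ?_, shapeVertex_even hi⟩⟩
        simp [testBit_listMask]
      · refine ⟨h.mem_notMem hxO, ?_⟩
        by_cases hxps : x ∈ ps
        · obtain ⟨k, hk, rfl, hki⟩ := hkid hxps hi hx
          refine Or.inr ⟨2 * k, by omega, ?_, shapeVertex_even hk⟩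
          rw [testBit_listMask, List.mem_cons, List.mem_cons, mem_childIndices]
          exact Or.inr (Or.inr ⟨k, hs.length_eq ▸ hk, hki, rfl⟩)
        · exact Or.inl ⟨hxO, hxps⟩
    · split_ifs at hc with h0
      · simp at hc
      rw [List.mem_singleton] at hc
      subst hc
      obtain ⟨-, h2, e⟩ := (hs.par_spec i hi).resolve_left fun hh => h0 hh.1
      refine ⟨ps.getD i l₀, fun x hx => ?_⟩
      rcases h.nhds_mem (hO hi) hx with rfl | rfl | rfl
      · refine ⟨h.mem_notMem (hO hi), Or.inr ⟨2 * i, by omega, ?_, shapeVertex_even hi⟩⟩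
        simp [testBit_listMask]
      · refine ⟨h.ch_mem_notMem (hO hi) (hP hi), Or.inr ⟨2 * i + 1, by omega, ?_,
          shapeVertex_odd hi⟩⟩
        simp [testBit_listMask]
      · refine ⟨?_, Or.inr ⟨par.getD i 0, h2, by simp [testBit_listMask], e.symm⟩⟩
        rw [e]
        rcases index_cases h2 with ⟨j, hj, e'⟩ | ⟨j, hj, e'⟩ | e' | ⟨s, hs', e'⟩ <;> rw [e']
        · rw [shapeVertex_even hj]
          exact h.mem_notMem (hO hj)
        · rw [shapeVertex_odd hj]
          exact h.ch_mem_notMem (hO hj) (hP hj)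
        · rw [shapeVertex_leaf]
          exact hlA h.l₀_ne h.up_l₀
        · rw [shapeVertex_root]
          exact hlA (hR hs').1 (hR hs').2.1
  · have hadj : ∀ {w}, w ≠ r → G.Adj w (up w) := fun hw => (h.adj_iff _ _).2 (Or.inr ⟨hw, rfl⟩)
    have hmem : ∀ {d i}, i < ps.length → d ∈ (if par.getD i 0 = 0 then [listMask [2 * i, 2 * i + 1]]
        else listMask [2 * i, 2 * i + 1, par.getD i 0] ::
          if par.getD i 0 ∈ marks then []
          else [listMask (par.getD i 0 :: (if par.getD i 0 < 2 * par.length then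
            [par.getD i 0 - 1] else []) ++ childIndices par (par.getD i 0))]) →
        d ∈ (shapePos par marks rs.length).EB := fun hi hd =>
      List.mem_cons_of_mem _ (List.mem_flatMap.2 ⟨_, List.mem_range.2 (hs.length_eq ▸ hi), hd⟩)
    have hl : ∀ i, (listMask [2 * par.length]).testBit i = true →
        shapeVertex l₀ ch ps rs i = l₀ := by
      intro i hi
      rw [testBit_listMask, List.mem_singleton, hs.length_eq] at hi
      rw [hi, shapeVertex_leaf]
    have hlEB : listMask [2 * par.length] ∈ (shapePos par marks rs.length).EB :=
      List.mem_cons_self ..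
    by_cases hvr : v = r
    · subst hvr
      exact Or.inr ⟨_, hlEB, fun i _ hi => Or.inr (by rw [hl i hi]; simpa [h.up_l₀] using hadj h.l₀_ne)⟩
    by_cases hvl : v = l₀
    · subst hvl
      exact Or.inr ⟨_, hlEB, fun i _ hi => Or.inl (hl i hi)⟩
    by_cases hvO : v ∈ O
    · by_cases hvps : v ∈ ps
      · obtain ⟨k, hk, rfl⟩ := exists_index hvps l₀
        right
        have h1 : shapeVertex l₀ ch ps rs (2 * k) = ps.getD k l₀ ∨
            G.Adj (shapeVertex l₀ ch ps rs (2 * k)) (ps.getD k l₀) := Or.inl (shapeVertex_even hk)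
        have h2 : shapeVertex l₀ ch ps rs (2 * k + 1) = ps.getD k l₀ ∨
            G.Adj (shapeVertex l₀ ch ps rs (2 * k + 1)) (ps.getD k l₀) := by
          rw [shapeVertex_odd hk]
          have := hadj (h.ch_ne _ (hO hk))
          rw [h.up_ch _ (hO hk)] at this
          exact Or.inr this
        rcases hs.par_spec k hk with ⟨h0, -⟩ | ⟨h0, h3, e⟩
        · refine ⟨listMask [2 * k, 2 * k + 1], hmem hk ?_, fun i _ hi => ?_⟩
          · rw [if_pos h0]
            exact List.mem_singleton_self _
          · simp only [testBit_listMask, List.mem_cons, List.not_mem_nil, or_false] at hi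
            rcases hi with rfl | rfl
            exacts [h1, h2]
        · refine ⟨listMask [2 * k, 2 * k + 1, par.getD k 0], hmem hk ?_, fun i _ hi => ?_⟩
          · rw [if_neg h0]
            exact List.mem_cons_self ..
          · simp only [testBit_listMask, List.mem_cons, List.not_mem_nil, or_false] at hi
            rcases hi with rfl | rfl | rfl
            · exact h1
            · exact h2
            · rw [← e]
              exact Or.inr (hadj (h.ne_root (hO hk))).symm
      · exact Or.inl ⟨v, ⟨hvO, hvps⟩, Or.inl rfl⟩
    -- a vertex labelled `0`, all children of which take part in the fight
    have hfin : ∀ k < ps.length, up (ps.getD k l₀) = v → par.getD k 0 ≠ 0 →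
        shapeVertex l₀ ch ps rs (par.getD k 0) = v →
        (par.getD k 0 < 2 * ps.length → ∃ i < ps.length, par.getD k 0 = 2 * i + 1) →
        (∃ x ∈ O \ {p | p ∈ ps}, x = v ∨ G.Adj x v) ∨
        ∃ d ∈ (shapePos par marks rs.length).EB, ∀ i < 2 * ps.length + 1 + rs.length,
          d.testBit i = true → shapeVertex l₀ ch ps rs i = v ∨
            G.Adj (shapeVertex l₀ ch ps rs i) v := by
      intro k hk hkv h0 hv hodd
      by_cases hm : par.getD k 0 ∈ marks
      · obtain ⟨w, hw, hwps, hwv⟩ := hs.mark_spec _ hm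
        rw [hv] at hwv
        exact Or.inl (hclaimed hw hwps hwv fun e => hvO (e ▸ hw))
      · refine Or.inr ⟨listMask (par.getD k 0 :: (if par.getD k 0 < 2 * par.length then
          [par.getD k 0 - 1] else []) ++ childIndices par (par.getD k 0)), hmem hk ?_, ?_⟩
        · rw [if_neg h0, if_neg hm]
          exact List.mem_cons_of_mem _ (List.mem_singleton_self _)
        · intro i _ hi
          rw [testBit_listMask, List.cons_append, List.mem_cons, List.mem_append,
            mem_childIndices] at hi
          rcases hi with rfl | hi | ⟨m, hm, hm', rfl⟩
          · exact Or.inl hv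
          · split_ifs at hi with hlt
            · rw [List.mem_singleton] at hi
              obtain ⟨j, hj, e⟩ := hodd (hs.length_eq ▸ hlt)
              rw [e, Nat.add_sub_cancel] at hi
              rw [hi, shapeVertex_even hj, ← hv, e, shapeVertex_odd hj]
              have := hadj (h.ch_ne _ (hO hj))
              rw [h.up_ch _ (hO hj)] at this
              exact Or.inr this.symm
            · simp at hi
          · rw [hs.length_eq] at hm
            obtain ⟨-, -, e⟩ := (hs.par_spec m hm).resolve_left fun hh => h0 (hm' ▸ hh.1)
            rw [hm', hv] at e
            rw [shapeVertex_even hm, ← e]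
            exact Or.inr (hadj (h.ne_root (hO hm)))
    by_cases hur : up v = r
    · obtain ⟨w, hwr, hwv⟩ : ∃ w, w ≠ r ∧ up w = v := by
        by_contra hcon
        push Not at hcon
        exact hvl (h.eq_l₀ v hvr hur hcon)
      have hwO : w ∈ O := h.mem_of_up w hwr (hwv ▸ hvr) (hwv ▸ hvO)
      by_cases hwps : w ∈ ps
      · obtain ⟨k, hk, rfl⟩ := exists_index hwps l₀
        obtain ⟨s, hs', e, e'⟩ := hroot hk hwv hvr hur
        refine hfin k hk hwv (by omega) ?_ fun hlt => by omega
        rw [e, shapeVertex_root, e']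
      · exact Or.inl (hclaimed hwO hwps hwv fun e => hvO (e ▸ hwO))
    · have huO := h.up_mem hvr hvO hur
      have hvc := h.eq_ch v hvr huO
      by_cases hups : up v ∈ ps
      · obtain ⟨w, hw, hwv⟩ := hs.live _ hups
        rw [← hvc] at hwv
        by_cases hwps : w ∈ ps
        · obtain ⟨i, hi, hie⟩ := exists_index hups l₀
          obtain ⟨k, hk, rfl, e⟩ := hkid hwps hi (by rw [hie, hwv, ← hvc])
          refine hfin k hk hwv (by omega) ?_ fun _ => ⟨i, hi, e⟩
          rw [e, shapeVertex_odd hi, hie, ← hvc]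
        · exact Or.inl (hclaimed hw hwps hwv fun e => hvO (e ▸ hw))
      · exact Or.inl ⟨up v, ⟨huO, hups⟩, Or.inr (hadj hvr).symm⟩

/-- Bob wins a local fight for which he has a winning strategy. -/
theorem not_winsOn (h : Rooted G r l₀ up ch O) (hs : IsShape G r l₀ up ch O ps rs par marks)
    (s : Strategy) (hc : s.check (2 * ps.length + 1 + rs.length) [0]
      (shapePos par marks rs.length) = true) : ¬ Rooted.WinsOn G r ch O {p | p ∈ ps} :=
  s.not_aliceWin_of_check (hs.inj h) hc (List.mem_singleton_self 0)
    (by rw [MaskPos.alice_zero]; exact hs.rep h)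

end IsShape

/-! ### Strategies of Bob for the local fights

Each strategy is verified by evaluation against all answers of Alice. -/

/-- For four pairs one below the other, the top one hanging from a vertex of Alice, with the child
of the second pair dominated by Bob. The next two strategies treat five pairs whose top is a child
of the root, respectively lies below one. -/
def pathStrategy : Strategy :=
  .go 1 (.alt 1 (.go 3 (.go 5 (.win 8))) (.alt 132 (.go 5 (.alt 256 (.go 4 (.win 3)) (.win 8)))
    (.alt 8 (.go 6 (.go 4 (.win 8))) (.alt 368 (.go 2 (.win 3)) (.go 0 (.go 5 (.alt 256 (.go 4
    (.win 3)) (.win 8))))))))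

theorem check_pathStrategy :
    pathStrategy.check 9 [0] (shapePos [0, 1, 3, 5] [3] 0) = true := by
  decide +kernel

def pathStrategy₁ : Strategy :=
  .go 3 (.alt 1986 (.go 4 (.win 5)) (.alt 4 (.go 7 (.alt 528 (.go 6 (.win 5)) (.alt 32 (.go 8
    (.win 9)) (.alt 64 (.go 10 (.alt 1 (.win 1) (.win 0))) (.alt 256 (.go 5 (.win 6)) (.go 4 (.go
    8 (.win 9)))))))) (.alt 16 (.go 1 (.go 7 (.alt 1024 (.go 6 (.win 5)) (.win 10)))) (.alt 32
    (.go 2 (.win 1)) (.go 1 (.go 5 (.go 7 (.win 10))))))))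

theorem check_pathStrategy₁ :
    pathStrategy₁.check 11 [0] (shapePos [0, 1, 3, 5, 7] [5] 0) = true := by
  decide +kernel

def pathStrategy₂ : Strategy :=
  .go 0 (.alt 2050 (.go 3 (.alt 4 (.go 5 (.go 7 (.win 10))) (.alt 528 (.go 7 (.alt 1024 (.go 6
    (.win 5)) (.win 10))) (.alt 32 (.go 8 (.go 6 (.win 10))) (.alt 1472 (.go 4 (.win 5)) (.go 2
    (.go 7 (.alt 1024 (.go 6 (.win 5)) (.win 10))))))))) (.alt 4 (.go 8 (.go 6 (.go 10 (.alt 8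
    (.go 1 (.win 4)) (.win 3))))) (.go 1 (.win 11))))

theorem check_pathStrategy₂ :
    pathStrategy₂.check 12 [0] (shapePos [11, 1, 3, 5, 7] [5] 1) = true := by
  decide +kernel

/-- The child of the top vertex hits all sets of Bob except that of the leaf at the root, so Alice
must take this leaf. Claiming the two lower vertices in turn then leaves her two sets with one
vertex each. -/
def branchStrategy : Strategy :=
  .go 1 (.alt 64 (.go 2 (.go 4 (.win 5))) (.win 6))

theorem check_branchStrategy :
    branchStrategy.check 7 [0] (shapePos [0, 1, 1] [] 0) = true := by
  decide +kernel

def branchStrategy₁ : Strategy :=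
  .go 1 (.alt 241 (.go 3 (.win 8)) (.alt 4 (.go 8 (.alt 8 (.go 4 (.win 6)) (.win 3))) (.alt 8
    (.go 4 (.go 6 (.win 8))) (.alt 256 (.go 2 (.win 3)) (.go 0 (.go 8 (.alt 8 (.go 4 (.win 6))
    (.win 3))))))))

theorem check_branchStrategy₁ :
    branchStrategy₁.check 9 [0] (shapePos [0, 1, 3, 3] [] 0) = true := by
  decide +kernel

def branchStrategy₂ : Strategy :=
  .go 0 (.alt 514 (.go 3 (.alt 256 (.go 4 (.go 6 (.win 7))) (.win 8))) (.alt 4 (.go 1 (.go 8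
    (.alt 8 (.go 4 (.win 6)) (.win 3)))) (.go 1 (.win 9))))

theorem check_branchStrategy₂ :
    branchStrategy₂.check 10 [0] (shapePos [9, 1, 3, 3] [] 1) = true := by
  decide +kernel

/-- Again the first claim leaves Bob only the leaf at the root to take. After Alice has taken it,
the upper vertex produces two sets of hers with one vertex each. -/
def firstStrategy : Strategy :=
  .go 1 (.alt 16 (.go 0 (.win 5)) (.win 4))

theorem check_firstStrategy :
    firstStrategy.check 6 [0] (shapePos [5, 1] [5] 1) = true := by
  decide +kernel

/-- Bob starts with the leaf at the root. He then dominates with the common parent, or, if Alice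
takes that, with the two vertices below it, the first of which forces her. -/
def topBranchStrategy : Strategy :=
  .go 4 (.alt 32 (.go 0 (.win 2)) (.win 5))

theorem check_topBranchStrategy :
    topBranchStrategy.check 6 [0] (shapePos [5, 5] [] 1) = true := by
  decide +kernel

def longPathStrategy : Strategy :=
  .go 9 (.alt 14463 (.go 8 (.win 7)) (.alt 128 (.go 10 (.win 11)) (.alt 256 (.go 6 (.alt 7183
    (.go 5 (.win 7)) (.alt 16 (.go 0 (.alt 8194 (.go 12 (.alt 8 (.go 5 (.win 2)) (.win 3))) (.alt
    4 (.go 1 (.go 5 (.win 12))) (.go 1 (.win 13))))) (.alt 32 (.go 3 (.alt 15361 (.go 2 (.win 1))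
    (.alt 6 (.go 12 (.alt 1 (.win 13) (.win 0))) (.go 1 (.go 0 (.win 12)))))) (.go 4 (.go 2 (.go
    0 (.win 12)))))))) (.alt 1024 (.go 7 (.go 5 (.go 1 (.alt 8193 (.go 3 (.win 4)) (.alt 4 (.go 0
    (.win 12)) (.go 0 (.win 13))))))) (.go 7 (.go 5 (.go 3 (.go 1 (.go 0 (.win 12))))))))))

theorem check_longPathStrategy :
    longPathStrategy.check 14 [0] (shapePos [13, 1, 3, 5, 7, 9] [1, 3] 1) = true := by
  decide +kernel

def longForkStrategy : Strategy :=
  .go 3 (.alt 769 (.go 2 (.win 1)) (.alt 2 (.go 4 (.win 5)) (.alt 4 (.go 6 (.go 8 (.alt 1 (.win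
    9) (.win 0)))) (.go 1 (.go 0 (.win 8))))))

theorem check_longForkStrategy :
    longForkStrategy.check 10 [0] (shapePos [9, 1, 3, 1] [] 1) = true := by
  decide +kernel

def forkForkStrategy : Strategy :=
  .go 12 (.alt 1 (.go 8 (.go 10 (.go 6 (.go 13 (.alt 2 (.go 2 (.win 4)) (.win 1)))))) (.alt 2
    (.go 2 (.go 4 (.go 7 (.alt 1 (.go 6 (.win 13)) (.alt 64 (.go 14 (.alt 1 (.win 13) (.win 0)))
    (.alt 16384 (.go 8 (.go 10 (.win 11))) (.go 6 (.win 0)))))))) (.alt 4 (.go 4 (.go 7 (.alt 64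
    (.go 14 (.alt 3841 (.go 13 (.alt 2 (.win 3) (.win 1))) (.alt 2 (.go 3 (.alt 1 (.win 13) (.win
    0))) (.alt 8 (.go 8 (.go 1 (.alt 1 (.win 13) (.win 0)))) (.alt 8192 (.go 0 (.alt 2 (.win 3)
    (.win 1))) (.go 8 (.go 0 (.alt 2 (.win 3) (.win 1))))))))) (.alt 1792 (.go 6 (.go 0 (.alt 2
    (.win 3) (.win 1)))) (.alt 16384 (.go 8 (.go 10 (.win 11))) (.go 6 (.go 8 (.win 9))))))))
    (.alt 8 (.go 4 (.go 7 (.alt 64 (.go 14 (.alt 3841 (.go 13 (.alt 2 (.win 2) (.win 1))) (.alt 2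
    (.go 2 (.alt 1 (.win 13) (.win 0))) (.alt 4 (.go 8 (.go 1 (.alt 1 (.win 13) (.win 0)))) (.go
    8 (.go 0 (.alt 2 (.win 2) (.win 1)))))))) (.alt 1792 (.go 6 (.go 0 (.alt 2 (.win 2) (.win
    1)))) (.alt 16384 (.go 8 (.go 10 (.win 11))) (.go 6 (.go 8 (.win 9)))))))) (.alt 16 (.go 2
    (.go 7 (.alt 64 (.go 14 (.alt 3841 (.go 13 (.alt 2 (.win 5) (.win 1))) (.alt 2 (.go 5 (.alt 1
    (.win 13) (.win 0))) (.alt 32 (.go 8 (.go 1 (.alt 1 (.win 13) (.win 0)))) (.alt 8192 (.go 0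
    (.alt 2 (.win 5) (.win 1))) (.go 8 (.go 0 (.alt 2 (.win 5) (.win 1))))))))) (.alt 1792 (.go 6
    (.go 0 (.alt 2 (.win 5) (.win 1)))) (.alt 16384 (.go 8 (.go 10 (.win 11))) (.go 6 (.go 8
    (.win 9)))))))) (.alt 32 (.go 2 (.go 7 (.alt 64 (.go 14 (.alt 3841 (.go 13 (.alt 2 (.win 4)
    (.win 1))) (.alt 2 (.go 4 (.alt 1 (.win 13) (.win 0))) (.alt 16 (.go 8 (.go 1 (.alt 1 (.win
    13) (.win 0)))) (.go 8 (.go 0 (.alt 2 (.win 4) (.win 1)))))))) (.alt 1792 (.go 6 (.go 0 (.alt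
    2 (.win 4) (.win 1)))) (.alt 16384 (.go 8 (.go 10 (.win 11))) (.go 6 (.go 8 (.win 9))))))))
    (.alt 64 (.go 2 (.go 4 (.go 0 (.go 14 (.alt 128 (.go 8 (.win 10)) (.win 7)))))) (.alt 128
    (.go 8 (.go 10 (.go 1 (.alt 1 (.go 13 (.alt 64 (.win 14) (.win 6))) (.alt 64 (.go 0 (.win
    14)) (.alt 8192 (.go 2 (.go 4 (.win 5))) (.go 0 (.win 6)))))))) (.alt 3840 (.go 2 (.go 4 (.go
    0 (.go 7 (.alt 64 (.win 14) (.win 6)))))) (.go 2 (.go 4 (.go 0 (.go 8 (.go 10 (.win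
    6)))))))))))))))

theorem check_forkForkStrategy :
    forkForkStrategy.check 15 [0] (shapePos [13, 1, 1, 14, 7, 7] [] 2) = true := by
  decide +kernel

def forkPathStrategy : Strategy :=
  .go 11 (.alt 90563 (.go 2 (.go 4 (.go 10 (.win 9)))) (.alt 12 (.go 4 (.go 10 (.win 9))) (.alt
    48 (.go 2 (.go 10 (.win 9))) (.alt 512 (.go 2 (.go 4 (.go 0 (.go 12 (.win 13))))) (.alt 1024
    (.go 14 (.alt 1 (.go 6 (.alt 12 (.go 4 (.go 7 (.win 16))) (.alt 48 (.go 2 (.go 7 (.win 16)))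
    (.alt 65664 (.go 15 (.alt 12348 (.go 1 (.alt 256 (.win 9) (.win 8))) (.alt 256 (.go 2 (.go 4
    (.win 9))) (.go 2 (.go 4 (.win 8)))))) (.alt 256 (.go 2 (.go 4 (.go 7 (.win 15)))) (.go 2
    (.go 4 (.go 7 (.win 16))))))))) (.alt 12802 (.go 2 (.go 4 (.go 7 (.alt 320 (.go 16 (.alt 1
    (.win 15) (.win 0))) (.alt 65536 (.go 6 (.win 0)) (.go 6 (.win 16))))))) (.alt 4 (.go 4 (.go
    7 (.alt 64 (.go 16 (.alt 13057 (.go 15 (.alt 2 (.win 3) (.win 1))) (.alt 2 (.go 3 (.alt 1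
    (.win 15) (.win 0))) (.alt 8 (.go 8 (.go 1 (.alt 1 (.win 15) (.win 0)))) (.alt 32768 (.go 0
    (.alt 2 (.win 3) (.win 1))) (.go 8 (.go 0 (.alt 2 (.win 3) (.win 1))))))))) (.alt 65792 (.go
    6 (.go 0 (.alt 2 (.win 3) (.win 1)))) (.go 6 (.win 16)))))) (.alt 8 (.go 4 (.go 7 (.alt 64
    (.go 16 (.alt 13057 (.go 15 (.alt 2 (.win 2) (.win 1))) (.alt 2 (.go 2 (.alt 1 (.win 15)
    (.win 0))) (.alt 4 (.go 8 (.go 1 (.alt 1 (.win 15) (.win 0)))) (.go 8 (.go 0 (.alt 2 (.win 2)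
    (.win 1)))))))) (.alt 65792 (.go 6 (.go 0 (.alt 2 (.win 2) (.win 1)))) (.go 6 (.win 16))))))
    (.alt 16 (.go 2 (.go 7 (.alt 64 (.go 16 (.alt 13057 (.go 15 (.alt 2 (.win 5) (.win 1))) (.alt
    2 (.go 5 (.alt 1 (.win 15) (.win 0))) (.alt 32 (.go 8 (.go 1 (.alt 1 (.win 15) (.win 0))))
    (.alt 32768 (.go 0 (.alt 2 (.win 5) (.win 1))) (.go 8 (.go 0 (.alt 2 (.win 5) (.win
    1))))))))) (.alt 65792 (.go 6 (.go 0 (.alt 2 (.win 5) (.win 1)))) (.go 6 (.win 16)))))) (.alt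
    32 (.go 2 (.go 7 (.alt 64 (.go 16 (.alt 13057 (.go 15 (.alt 2 (.win 4) (.win 1))) (.alt 2
    (.go 4 (.alt 1 (.win 15) (.win 0))) (.alt 16 (.go 8 (.go 1 (.alt 1 (.win 15) (.win 0)))) (.go
    8 (.go 0 (.alt 2 (.win 4) (.win 1)))))))) (.alt 65792 (.go 6 (.go 0 (.alt 2 (.win 4) (.win
    1)))) (.go 6 (.win 16)))))) (.alt 64 (.go 2 (.go 4 (.go 0 (.go 16 (.alt 128 (.win 8) (.win
    7)))))) (.alt 128 (.go 1 (.alt 1 (.go 15 (.alt 12348 (.go 6 (.alt 256 (.win 9) (.win 8)))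
    (.alt 64 (.go 2 (.go 16 (.alt 256 (.win 9) (.win 8)))) (.alt 256 (.go 2 (.go 9 (.alt 64 (.win
    16) (.win 6)))) (.alt 512 (.go 2 (.go 8 (.alt 64 (.win 16) (.win 6)))) (.go 2 (.go 6 (.alt
    256 (.win 9) (.win 8))))))))) (.alt 28 (.go 0 (.go 6 (.alt 256 (.win 9) (.win 8)))) (.alt
    32768 (.go 2 (.go 4 (.win 5))) (.go 0 (.go 2 (.win 3))))))) (.alt 65792 (.go 2 (.go 4 (.go 0
    (.go 6 (.alt 128 (.win 9) (.win 7)))))) (.go 2 (.go 4 (.go 0 (.go 12 (.go 7 (.alt 64 (.win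
    16) (.win 6))))))))))))))))) (.alt 4096 (.go 2 (.go 4 (.go 0 (.go 7 (.alt 65600 (.go 9 (.win
    10)) (.alt 256 (.go 6 (.win 14)) (.go 6 (.win 16)))))))) (.go 2 (.go 4 (.go 0 (.go 9 (.go 7
    (.go 6 (.win 14)))))))))))))

theorem check_forkPathStrategy :
    forkPathStrategy.check 17 [0] (shapePos [15, 1, 1, 16, 7, 9, 11] [7, 9] 2) = true := by
  decide +kernel

def pathPathStrategy : Strategy :=
  .go 5 (.alt 262023 (.go 4 (.win 3)) (.alt 8 (.go 6 (.win 7)) (.alt 16 (.go 13 (.alt 192 (.go 12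
    (.win 11)) (.alt 2048 (.go 6 (.go 14 (.win 15))) (.alt 4096 (.go 16 (.alt 1 (.go 8 (.alt 192
    (.go 9 (.win 18)) (.alt 262656 (.go 17 (.alt 49354 (.go 2 (.alt 1024 (.win 11) (.win 10)))
    (.alt 4 (.go 1 (.alt 1024 (.win 11) (.win 10))) (.alt 1024 (.go 6 (.go 11 (.alt 2 (.win 2)
    (.win 1)))) (.alt 2048 (.go 6 (.go 10 (.alt 2 (.win 2) (.win 1)))) (.go 6 (.go 1 (.alt 1024
    (.win 11) (.win 10))))))))) (.alt 1024 (.go 6 (.go 9 (.go 17 (.alt 2 (.win 2) (.win 1)))))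
    (.go 6 (.go 9 (.win 18))))))) (.alt 2 (.go 9 (.alt 192 (.go 8 (.win 18)) (.alt 256 (.go 18
    (.alt 1 (.go 6 (.go 17 (.alt 4 (.win 3) (.win 2)))) (.alt 4 (.go 6 (.go 3 (.alt 1 (.win 17)
    (.win 0)))) (.alt 8 (.go 6 (.go 2 (.alt 1 (.win 17) (.win 0)))) (.alt 52416 (.go 0 (.alt 4
    (.win 3) (.win 2))) (.go 6 (.go 0 (.alt 4 (.win 3) (.win 2))))))))) (.alt 263168 (.go 8 (.go
    0 (.alt 4 (.win 3) (.win 2)))) (.go 6 (.go 8 (.win 18))))))) (.alt 4 (.go 6 (.go 9 (.alt 256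
    (.go 18 (.alt 52225 (.go 17 (.alt 2 (.win 3) (.win 1))) (.alt 2 (.go 3 (.alt 1 (.win 17)
    (.win 0))) (.alt 8 (.go 10 (.go 1 (.alt 1 (.win 17) (.win 0)))) (.alt 131072 (.go 0 (.alt 2
    (.win 3) (.win 1))) (.go 10 (.go 0 (.alt 2 (.win 3) (.win 1))))))))) (.alt 263168 (.go 8 (.go
    0 (.alt 2 (.win 3) (.win 1)))) (.go 8 (.win 18)))))) (.alt 8 (.go 6 (.go 9 (.alt 256 (.go 18
    (.alt 52225 (.go 17 (.alt 2 (.win 2) (.win 1))) (.alt 2 (.go 2 (.alt 1 (.win 17) (.win 0)))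
    (.alt 4 (.go 10 (.go 1 (.alt 1 (.win 17) (.win 0)))) (.go 10 (.go 0 (.alt 2 (.win 2) (.win
    1)))))))) (.alt 263168 (.go 8 (.go 0 (.alt 2 (.win 2) (.win 1)))) (.go 8 (.win 18)))))) (.alt
    2240 (.go 0 (.alt 131074 (.go 9 (.alt 1280 (.go 18 (.alt 4 (.win 3) (.win 2))) (.alt 262144
    (.go 8 (.win 2)) (.go 8 (.win 18))))) (.alt 4 (.go 1 (.go 14 (.go 9 (.alt 256 (.win 18) (.win
    8))))) (.go 1 (.win 17))))) (.alt 256 (.go 0 (.alt 131074 (.go 18 (.alt 4 (.go 6 (.go 3 (.alt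
    512 (.win 10) (.win 9)))) (.alt 51392 (.go 2 (.alt 512 (.win 10) (.win 9))) (.alt 512 (.go 2
    (.alt 1024 (.win 11) (.win 10))) (.alt 1024 (.go 2 (.alt 512 (.win 11) (.win 9))) (.go 6 (.go
    2 (.alt 512 (.win 10) (.win 9))))))))) (.alt 4 (.go 1 (.go 6 (.go 18 (.alt 512 (.win 10)
    (.win 9))))) (.go 1 (.win 17))))) (.alt 512 (.go 1 (.alt 1 (.go 17 (.alt 49356 (.go 8 (.alt
    1024 (.win 11) (.win 10))) (.alt 256 (.go 2 (.go 18 (.alt 1024 (.win 11) (.win 10)))) (.alt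
    1024 (.go 2 (.go 11 (.alt 256 (.win 18) (.win 8)))) (.alt 2048 (.go 2 (.go 10 (.alt 256 (.win
    18) (.win 8)))) (.go 2 (.go 8 (.alt 1024 (.win 11) (.win 10))))))))) (.alt 131076 (.go 0 (.go
    8 (.alt 1024 (.win 11) (.win 10)))) (.go 0 (.win 17))))) (.alt 1024 (.go 6 (.go 1 (.alt 1
    (.go 17 (.alt 311308 (.go 8 (.alt 512 (.win 11) (.win 9))) (.alt 256 (.go 18 (.alt 512 (.win
    11) (.win 9))) (.alt 512 (.go 11 (.alt 256 (.win 18) (.win 8))) (.alt 2048 (.go 2 (.go 9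
    (.alt 256 (.win 18) (.win 8)))) (.go 2 (.go 8 (.alt 512 (.win 11) (.win 9))))))))) (.alt
    131076 (.go 0 (.go 8 (.alt 512 (.win 11) (.win 9)))) (.go 0 (.win 17)))))) (.alt 49152 (.go 0
    (.alt 131074 (.go 9 (.alt 192 (.go 8 (.win 18)) (.alt 1280 (.go 18 (.alt 4 (.win 3) (.win
    2))) (.alt 262144 (.go 6 (.go 10 (.win 11))) (.go 6 (.go 8 (.win 18))))))) (.alt 4 (.go 1
    (.go 6 (.go 9 (.alt 256 (.win 18) (.win 8))))) (.go 1 (.win 17))))) (.alt 131072 (.go 0 (.alt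
    51202 (.go 6 (.go 9 (.alt 1280 (.go 18 (.alt 4 (.win 3) (.win 2))) (.alt 262144 (.go 8 (.win
    2)) (.go 8 (.win 18)))))) (.alt 4 (.go 6 (.go 9 (.alt 1280 (.go 18 (.alt 2 (.win 3) (.win
    1))) (.alt 262144 (.go 8 (.win 1)) (.go 8 (.win 18)))))) (.alt 1216 (.go 1 (.go 14 (.go 9
    (.alt 256 (.win 18) (.win 8))))) (.alt 256 (.go 1 (.go 6 (.go 18 (.alt 512 (.win 10) (.win
    9))))) (.alt 262656 (.go 1 (.go 8 (.alt 1024 (.win 11) (.win 10)))) (.go 1 (.go 6 (.go 14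
    (.go 9 (.alt 256 (.win 18) (.win 8)))))))))))) (.alt 262144 (.go 0 (.alt 131074 (.go 8 (.alt
    4 (.go 6 (.go 9 (.win 3))) (.alt 49344 (.go 9 (.win 2)) (.alt 512 (.go 2 (.alt 1024 (.win 11)
    (.win 10))) (.alt 1024 (.go 2 (.alt 512 (.win 11) (.win 9))) (.go 6 (.go 9 (.win 2))))))))
    (.alt 4 (.go 1 (.go 6 (.go 8 (.alt 512 (.win 10) (.win 9))))) (.go 1 (.win 17))))) (.go 6
    (.go 0 (.alt 131074 (.go 9 (.alt 1280 (.go 18 (.alt 4 (.win 3) (.win 2))) (.alt 262144 (.go 8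
    (.win 2)) (.go 8 (.win 18))))) (.alt 4 (.go 1 (.go 14 (.go 9 (.alt 256 (.win 18) (.win 8)))))
    (.go 1 (.win 17)))))))))))))))))) (.alt 16384 (.go 0 (.alt 131074 (.go 9 (.alt 192 (.go 8
    (.win 18)) (.alt 262400 (.go 6 (.go 11 (.win 12))) (.alt 1024 (.go 8 (.go 16 (.alt 4 (.win 3)
    (.win 2)))) (.go 6 (.go 8 (.win 18))))))) (.alt 4 (.go 1 (.go 6 (.go 9 (.alt 262400 (.go 11
    (.win 12)) (.alt 1024 (.go 8 (.win 16)) (.go 8 (.win 18))))))) (.go 1 (.win 17))))) (.go 6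
    (.go 12 (.win 11)))))))) (.alt 64 (.go 14 (.go 12 (.go 10 (.go 8 (.go 1 (.alt 131073 (.go 3
    (.win 4)) (.alt 4 (.go 0 (.win 16)) (.go 0 (.win 17))))))))) (.go 3 (.go 1 (.go 0 (.go 14
    (.go 12 (.go 10 (.go 8 (.win 16))))))))))))

theorem check_pathPathStrategy :
    pathPathStrategy.check 19 [0] (shapePos [17, 1, 3, 5, 18, 9, 11, 13] [1, 3, 9, 11] 2) = true := by
  decide +kernel

/-! ### Necessity: configurations in which Bob has a local win. -/

/-! ### Forbidden configurations -/

/-- The vertex `p` is labelled `1`, and its child has a child. -/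
def Live (up ch : V → V) (O : Set V) (p : V) : Prop := p ∈ O ∧ ∃ w ∈ O, up w = ch p

/-- The vertex `v` has a child labelled `1` whose child has no child. -/
def Marked (up ch : V → V) (O : Set V) (v : V) : Prop := ∃ w, w ∈ O ∧ up w = v ∧ ¬ Live up ch O w

namespace Rooted

variable {G : SimpleGraph V} {r l₀ : V} {up ch : V → V} {O : Set V}

theorem depth_of_up_ch (h : Rooted G r l₀ up ch O) {p q : V} (hp : p ∈ O) (hq : q ∈ O)
    (e : up p = ch q) : G.dist r p = G.dist r q + 2 := by
  rw [h.depth p (h.ne_root hp), e, h.depth_ch hq]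

theorem depth_of_up_up (h : Rooted G r l₀ up ch O) {p x : V} (hp : p ∈ O) (e : up p = x)
    (hx : x ≠ r) (hxr : up x = r) : G.dist r p = 2 := by
  rw [h.depth p (h.ne_root hp), e, h.depth x hx, hxr, SimpleGraph.dist_self]

theorem spec_of_up (h : Rooted G r l₀ up ch O) {p x : V} (hp : p ∈ O) (e : up p = x) (hx : x ≠ r)
    (hxr : up x = r) : x ≠ r ∧ up x = r ∧ x ∉ O ∧ x ≠ l₀ :=
  ⟨hx, hxr, e ▸ h.up_notMem hp, fun e' => h.l₀_childless p (h.ne_root hp) (e.trans e')⟩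

/-- The first vertices of the local fight are children of the root, or lie below a vertex where Bob
may cut the tree. -/
def Top (r l₀ : V) (up ch : V → V) (O : Set V) (ps : List V) (par : List ℕ) : Prop :=
  (∀ i < ps.length, par.getD i 0 = 0 → up (ps.getD i l₀) = r) ∨
    ∃ e ∈ O, ∃ f ∈ O, up e = ch f ∧ e ∉ ps ∧ f ∉ ps ∧
      ∀ i < ps.length, par.getD i 0 = 0 → up (ps.getD i l₀) = ch e

/-- Bob clears everything outside `ps`, or cuts at `e` if the top hangs from `ch e`, and then
follows the verified strategy. -/
theorem false_of_shape [Finite V] (h : Rooted G r l₀ up ch O) (hW : AliceWin G {r} ∅ .bob)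
    {ps rs : List V} {par marks : List ℕ} (hs : IsShape G r l₀ up ch O ps rs par marks)
    (ht : Top r l₀ up ch O ps par) {s : Strategy}
    (hc : s.check (2 * ps.length + 1 + rs.length) [0] (shapePos par marks rs.length) = true) :
    False := by
  have hO : ∀ {i}, i < ps.length → ps.getD i l₀ ∈ O := fun hi =>
    hs.ps_mem _ (IsShape.getD_mem hi _)
  have hab : ∀ w ∈ ps, ∀ p ∈ O, up w = ch p → p ∈ ps ∨
      ∃ i < ps.length, par.getD i 0 = 0 ∧ ps.getD i l₀ = w := by
    intro w hw p hp hwp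
    obtain ⟨k, hk, rfl⟩ := IsShape.exists_index hw l₀
    rcases hs.par_spec k hk with ⟨h0, -⟩ | ⟨-, h2, e⟩
    · exact Or.inr ⟨k, hk, h0, rfl⟩
    · rw [hwp] at e
      rcases index_cases h2 with ⟨j, hj, e'⟩ | ⟨j, hj, e'⟩ | e' | ⟨t, ht, e'⟩ <;> rw [e'] at e
      · rw [shapeVertex_even hj] at e
        exact absurd e (h.ch_ne_mem hp (hO hj))
      · rw [shapeVertex_odd hj] at e
        exact Or.inl (h.ch_inj hp (hO hj) e ▸ IsShape.getD_mem hj _)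
      · rw [shapeVertex_leaf] at e
        exact absurd (hwp.trans e) (h.l₀_childless _ (h.ne_root (hO hk)))
      · rw [shapeVertex_root] at e
        have := (hs.rs_spec _ (IsShape.getD_mem ht l₀)).2.1
        rw [← e, h.up_ch p hp] at this
        exact absurd this (h.ne_root hp)
  refine hs.not_winsOn h s hc ?_
  rcases ht with ht | ⟨e, he, f, hf, hef, heps, hfps, ht⟩
  · refine h.winsOn_of_closed hW (fun p hp => hs.ps_mem p hp) fun w hw p hp hwp => ?_
    rcases hab w hw p hp hwp with hh | ⟨i, hi, h0, rfl⟩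
    · exact hh
    · exact absurd (hwp.symm.trans (ht i hi h0)) (h.ch_ne p hp)
  · refine h.winsOn_of_cut hW (fun p hp => hs.ps_mem p hp) he hf hef heps hfps
      fun w hw p hp hwp => ?_
    rcases hab w hw p hp hwp with hh | ⟨i, hi, h0, rfl⟩
    · exact Or.inl hh
    · exact Or.inr (h.ch_inj hp he (hwp.symm.trans (ht i hi h0)))

theorem isShape (h : Rooted G r l₀ up ch O) {ps rs : List V} {par marks : List ℕ}
    (hl : par.length = ps.length) (hnd : ps.Nodup) (hlive : ∀ p ∈ ps, Live up ch O p)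
    (hrnd : rs.Nodup) (hrs : ∀ v ∈ rs, v ≠ r ∧ up v = r ∧ ∃ p ∈ O, up p = v)
    (hpar : ∀ i < ps.length,
      (par.getD i 0 = 0 ∧ (up (ps.getD i l₀) = r ∨ ∃ q ∈ O, q ∉ ps ∧ up (ps.getD i l₀) = ch q)) ∨
      (par.getD i 0 ≠ 0 ∧ par.getD i 0 < 2 * ps.length + 1 + rs.length ∧
        up (ps.getD i l₀) = shapeVertex l₀ ch ps rs (par.getD i 0)))
    (hm : ∀ j ∈ marks, Marked up ch O (shapeVertex l₀ ch ps rs j)) :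
    IsShape G r l₀ up ch O ps rs par marks := by
  refine ⟨hl, hnd, fun p hp => (hlive p hp).1, fun p hp => (hlive p hp).2, hrnd, fun v hv => ?_,
    hpar, fun j hj => ?_⟩
  · obtain ⟨h1, h2, p, hp, rfl⟩ := hrs v hv
    exact h.spec_of_up hp rfl h1 h2
  · obtain ⟨w, hw, hwv, hwl⟩ := hm j hj
    -- A mark comes from a vertex that is not live, so it lies outside `ps` and has been claimed by
    -- Bob.
    exact ⟨w, hw, fun hh => hwl (hlive w hh), hwv⟩

theorem top_of_zero_notMem {ps : List V} {par : List ℕ} (hl : par.length = ps.length)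
    (h0 : 0 ∉ par) : Top r l₀ up ch O ps par := by
  refine Or.inl fun i hi h => absurd ?_ h0
  rw [List.getD_eq_getElem _ _ (hl ▸ hi)] at h
  exact h ▸ List.getElem_mem _

/-- If four consecutive vertices labelled `1` are live and the child of the second one is marked,
then the first one has depth `2`. -/
theorem depth_of_path [Finite V] (h : Rooted G r l₀ up ch O) (hW : AliceWin G {r} ∅ .bob)
    {a b c d : V} (ha : Live up ch O a) (hb : Live up ch O b) (hc : Live up ch O c)
    (hd : Live up ch O d) (hab : up a = ch b) (hbc : up b = ch c) (hcd : up c = ch d)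
    (hm : Marked up ch O (ch c)) : up d ≠ r ∧ up (up d) = r := by
  have h1 := h.depth_of_up_ch ha.1 hb.1 hab
  have h2 := h.depth_of_up_ch hb.1 hc.1 hbc
  have h3 := h.depth_of_up_ch hc.1 hd.1 hcd
  -- The fight with four pairs can be isolated if its top hangs from the root, or if two further
  -- vertices labelled `1` above it allow a cut.
  have key : (up d = r ∨ ∃ e ∈ O, ∃ f ∈ O, up e = ch f ∧ up d = ch e) → False := by
    intro ht
    have hdist : ∀ {e}, e ∈ O → up d = ch e → ∀ f, G.dist r f ≤ G.dist r e →
        f ∉ [d, c, b, a] := by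
      intro e he hde f hf
      have h4 := h.depth_of_up_ch hd.1 he hde
      simp only [List.mem_cons, List.not_mem_nil, or_false, not_or]
      and_intros <;> exact fun e => absurd (congrArg (G.dist r) e) (by omega)
    refine h.false_of_shape hW (ps := [d, c, b, a]) (rs := []) (par := [0, 1, 3, 5]) (marks := [3])
      (h.isShape rfl ?_ (by simp [ha, hb, hc, hd]) List.nodup_nil (by simp) ?_
        (List.forall_mem_singleton.2 hm)) ?_ check_pathStrategy
    · simp only [List.nodup_cons, List.mem_cons, List.not_mem_nil, not_or, or_false, not_false_iff,
        List.nodup_nil, and_true]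
      and_intros <;> exact fun e => absurd (congrArg (G.dist r) e) (by omega)
    · intro i hi
      simp only [List.length_cons, List.length_nil] at hi
      interval_cases i
      · refine Or.inl ⟨rfl, ht.imp id ?_⟩
        rintro ⟨e, he, f, hf, hef, hde⟩
        exact ⟨e, he, hdist he hde e le_rfl, hde⟩
      exacts [Or.inr ⟨by simp, by simp, hcd⟩, Or.inr ⟨by simp, by simp, hbc⟩,
        Or.inr ⟨by simp, by simp, hab⟩]
    · have h0 : ∀ v, up d = v → ∀ i < 4, [0, 1, 3, 5].getD i 0 = 0 →
          up ([d, c, b, a].getD i l₀) = v := by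
        intro v hv i hi h0
        interval_cases i
        exacts [hv, by simp at h0, by simp at h0, by simp at h0]
      rcases ht with ht | ⟨e, he, f, hf, hef, hde⟩
      · exact Or.inl (h0 r ht)
      · have := h.depth_of_up_ch he hf hef
        exact Or.inr ⟨e, he, f, hf, hef, hdist he hde e le_rfl, hdist he hde f (by omega), h0 _ hde⟩
  have hdr : up d ≠ r := fun e => key (Or.inl e)
  refine ⟨hdr, by_contra fun hur => ?_⟩
  obtain ⟨e, he⟩ : ∃ e, up (up d) = e := ⟨_, rfl⟩
  have heO : e ∈ O := he ▸ h.up_mem hdr (h.up_notMem hd.1) hur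
  have hde : up d = ch e := he ▸ h.eq_ch _ hdr (he ▸ heO)
  have heL : Live up ch O e := ⟨heO, d, hd.1, hde⟩
  have h4 := h.depth_of_up_ch hd.1 heO hde
  have hnd : [e, d, c, b, a].Nodup := by
    simp only [List.nodup_cons, List.mem_cons, List.not_mem_nil, not_or, or_false, not_false_iff,
      List.nodup_nil, and_true]
    and_intros <;> exact fun e => absurd (congrArg (G.dist r) e) (by omega)
  -- If `e` is a child or a grandchild of the root there is no `f` to cut with, so `e` joins the
  -- fight as a fifth pair.
  by_cases hur' : up e = r
  · refine h.false_of_shape hW (ps := [e, d, c, b, a]) (rs := []) (par := [0, 1, 3, 5, 7])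
      (marks := [5]) (h.isShape rfl hnd (by simp [ha, hb, hc, hd, heL]) List.nodup_nil (by simp) ?_
        (List.forall_mem_singleton.2 hm)) (Or.inl ?_) check_pathStrategy₁
    · intro i hi
      simp only [List.length_cons, List.length_nil] at hi
      interval_cases i
      exacts [Or.inl ⟨rfl, Or.inl hur'⟩, Or.inr ⟨by simp, by simp, hde⟩,
        Or.inr ⟨by simp, by simp, hcd⟩, Or.inr ⟨by simp, by simp, hbc⟩,
        Or.inr ⟨by simp, by simp, hab⟩]
    · intro i hi h0
      simp only [List.length_cons, List.length_nil] at hi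
      interval_cases i
      exacts [hur', by simp at h0, by simp at h0, by simp at h0, by simp at h0]
  by_cases huur : up (up e) = r
  · refine h.false_of_shape hW (ps := [e, d, c, b, a]) (rs := [up e]) (par := [11, 1, 3, 5, 7])
      (marks := [5]) (h.isShape rfl hnd (by simp [ha, hb, hc, hd, heL]) (by simp)
        (by simpa using ⟨hur', huur, e, heO, rfl⟩) ?_ (List.forall_mem_singleton.2 hm))
        (top_of_zero_notMem rfl (by simp)) check_pathStrategy₂
    intro i hi
    simp only [List.length_cons, List.length_nil] at hi
    interval_cases i
    exacts [Or.inr ⟨by simp, by simp, rfl⟩, Or.inr ⟨by simp, by simp, hde⟩,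
      Or.inr ⟨by simp, by simp, hcd⟩, Or.inr ⟨by simp, by simp, hbc⟩,
      Or.inr ⟨by simp, by simp, hab⟩]
  · have hf := h.up_mem hur' (h.up_notMem heO) huur
    exact key (Or.inr ⟨e, heO, _, hf, h.eq_ch _ hur' hf, hde⟩)

/-- If two live vertices labelled `1` have the same parent, which is not a child of the root, then
this parent has depth `3`. -/
theorem depth_of_branch [Finite V] (h : Rooted G r l₀ up ch O) (hW : AliceWin G {r} ∅ .bob)
    {a b c : V} (ha : Live up ch O a) (hb : Live up ch O b) (hc : c ∈ O) (hne : a ≠ b)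
    (hac : up a = ch c) (hbc : up b = ch c) : up c ≠ r ∧ up (up c) = r := by
  have hcL : Live up ch O c := ⟨hc, a, ha.1, hac⟩
  have h1 := h.depth_of_up_ch ha.1 hc hac
  have h2 := h.depth_of_up_ch hb.1 hc hbc
  -- The top is treated in the same way as for paths: by isolation here, and with `e` as an
  -- additional pair below.
  have key : (up c = r ∨ ∃ e ∈ O, ∃ f ∈ O, up e = ch f ∧ up c = ch e) → False := by
    intro ht
    have hdist : ∀ {e}, e ∈ O → up c = ch e → ∀ f, G.dist r f ≤ G.dist r e →
        f ∉ [c, a, b] := by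
      intro e he hde f hf
      have h4 := h.depth_of_up_ch hc he hde
      simp only [List.mem_cons, List.not_mem_nil, or_false, not_or]
      and_intros <;> exact fun e => absurd (congrArg (G.dist r) e) (by omega)
    refine h.false_of_shape hW (ps := [c, a, b]) (rs := []) (par := [0, 1, 1]) (marks := [])
      (h.isShape rfl ?_ (by simp [ha, hb, hcL]) List.nodup_nil (by simp) ?_ (by simp)) ?_
      check_branchStrategy
    · simp only [List.nodup_cons, List.mem_cons, List.not_mem_nil, not_or, or_false, not_false_iff,
        List.nodup_nil, and_true]
      and_intros <;> first | assumption | exact fun e => absurd (congrArg (G.dist r) e) (by omega)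
    · intro i hi
      simp only [List.length_cons, List.length_nil] at hi
      interval_cases i
      · refine Or.inl ⟨rfl, ht.imp id ?_⟩
        rintro ⟨e, he, f, hf, hef, hde⟩
        exact ⟨e, he, hdist he hde e le_rfl, hde⟩
      exacts [Or.inr ⟨by simp, by simp, hac⟩, Or.inr ⟨by simp, by simp, hbc⟩]
    · have h0 : ∀ v, up c = v → ∀ i < 3, [0, 1, 1].getD i 0 = 0 → up ([c, a, b].getD i l₀) = v := by
        intro v hv i hi h0
        interval_cases i
        exacts [hv, by simp at h0, by simp at h0]
      rcases ht with ht | ⟨e, he, f, hf, hef, hde⟩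
      · exact Or.inl (h0 r ht)
      · have := h.depth_of_up_ch he hf hef
        exact Or.inr ⟨e, he, f, hf, hef, hdist he hde e le_rfl, hdist he hde f (by omega), h0 _ hde⟩
  have hdr : up c ≠ r := fun e => key (Or.inl e)
  refine ⟨hdr, by_contra fun hur => ?_⟩
  obtain ⟨e, he⟩ : ∃ e, up (up c) = e := ⟨_, rfl⟩
  have heO : e ∈ O := he ▸ h.up_mem hdr (h.up_notMem hc) hur
  have hde : up c = ch e := he ▸ h.eq_ch _ hdr (he ▸ heO)
  have heL : Live up ch O e := ⟨heO, c, hc, hde⟩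
  have h4 := h.depth_of_up_ch hc heO hde
  have hnd : [e, c, a, b].Nodup := by
    simp only [List.nodup_cons, List.mem_cons, List.not_mem_nil, not_or, or_false, not_false_iff,
      List.nodup_nil, and_true]
    and_intros <;> first | assumption | exact fun e => absurd (congrArg (G.dist r) e) (by omega)
  by_cases hur' : up e = r
  · refine h.false_of_shape hW (ps := [e, c, a, b]) (rs := []) (par := [0, 1, 3, 3])
      (marks := []) (h.isShape rfl hnd (by simp [ha, hb, hcL, heL]) List.nodup_nil (by simp) ?_
        (by simp)) (Or.inl ?_) check_branchStrategy₁
    · intro i hi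
      simp only [List.length_cons, List.length_nil] at hi
      interval_cases i
      exacts [Or.inl ⟨rfl, Or.inl hur'⟩, Or.inr ⟨by simp, by simp, hde⟩,
        Or.inr ⟨by simp, by simp, hac⟩, Or.inr ⟨by simp, by simp, hbc⟩]
    · intro i hi h0
      simp only [List.length_cons, List.length_nil] at hi
      interval_cases i
      exacts [hur', by simp at h0, by simp at h0, by simp at h0]
  by_cases huur : up (up e) = r
  · refine h.false_of_shape hW (ps := [e, c, a, b]) (rs := [up e]) (par := [9, 1, 3, 3])
      (marks := []) (h.isShape rfl hnd (by simp [ha, hb, hcL, heL]) (by simp)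
        (by simpa using ⟨hur', huur, e, heO, rfl⟩) ?_ (by simp))
        (top_of_zero_notMem rfl (by simp)) check_branchStrategy₂
    intro i hi
    simp only [List.length_cons, List.length_nil] at hi
    interval_cases i
    exacts [Or.inr ⟨by simp, by simp, rfl⟩, Or.inr ⟨by simp, by simp, hde⟩,
      Or.inr ⟨by simp, by simp, hac⟩, Or.inr ⟨by simp, by simp, hbc⟩]
  · have hf := h.up_mem hur' (h.up_notMem heO) huur
    exact key (Or.inr ⟨e, heO, _, hf, h.eq_ch _ hur' hf, hde⟩)

/-- If a child `x` of the root is marked, then no grandchild of `x` has live children. -/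
theorem false_of_marked_top [Finite V] (h : Rooted G r l₀ up ch O) (hW : AliceWin G {r} ∅ .bob)
    {x a b : V} (hx : x ≠ r) (hxr : up x = r) (hm : Marked up ch O x) (ha : Live up ch O a)
    (hb : Live up ch O b) (hab : up a = ch b) (hbx : up b = x) : False := by
  have h1 := h.depth_of_up_ch ha.1 hb.1 hab
  have hnd : [b, a].Nodup := by
    simpa using fun e => absurd (congrArg (G.dist r) e) (by omega)
  refine h.false_of_shape hW (ps := [b, a]) (rs := [x]) (par := [5, 1])
    (marks := [5]) (h.isShape rfl hnd (by simp [ha, hb]) (by simp)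
      (by simpa using ⟨hx, hxr, b, hb.1, hbx⟩) ?_ (List.forall_mem_singleton.2 hm))
      (top_of_zero_notMem rfl (by simp)) check_firstStrategy
  intro i hi
  simp only [List.length_cons, List.length_nil] at hi
  interval_cases i
  exacts [Or.inr ⟨by simp, by simp, hbx⟩, Or.inr ⟨by simp, by simp, hab⟩]

/-- A child of the root has at most one live child. -/
theorem eq_of_live_top [Finite V] (h : Rooted G r l₀ up ch O) (hW : AliceWin G {r} ∅ .bob)
    {x a b : V} (hx : x ≠ r) (hxr : up x = r) (ha : Live up ch O a)
    (hb : Live up ch O b) (hax : up a = x) (hbx : up b = x) : a = b := by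
  by_contra hne
  refine h.false_of_shape hW (ps := [a, b]) (rs := [x]) (par := [5, 5])
    (marks := []) (h.isShape rfl (by simpa using hne) (by simp [ha, hb]) (by simp)
      (by simpa using ⟨hx, hxr, b, hb.1, hbx⟩) ?_ (by simp))
      (top_of_zero_notMem rfl (by simp)) check_topBranchStrategy
  intro i hi
  simp only [List.length_cons, List.length_nil] at hi
  interval_cases i
  exacts [Or.inr ⟨by simp, by simp, hax⟩, Or.inr ⟨by simp, by simp, hbx⟩]

/-- Four vertices labelled `1`, each being a grandchild of the previous one, below a child `x` of
the root, such that the children of the first two are marked. -/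
structure PathAt (r : V) (up ch : V → V) (O : Set V) (x : V) (p : Fin 4 → V) : Prop where
  ne : x ≠ r
  up_eq : up x = r
  live : ∀ i, Live up ch O (p i)
  up_zero : up (p 0) = x
  up_one : up (p 1) = ch (p 0)
  up_two : up (p 2) = ch (p 1)
  up_three : up (p 3) = ch (p 2)
  marked_zero : Marked up ch O (ch (p 0))
  marked_one : Marked up ch O (ch (p 1))

/-- A vertex `p` labelled `1` below a child `x` of the root, and two live grandchildren of `p`. -/
structure ForkAt (r : V) (up ch : V → V) (O : Set V) (x p a b : V) : Prop where
  ne : x ≠ r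
  up_eq : up x = r
  live : Live up ch O p
  live_left : Live up ch O a
  live_right : Live up ch O b
  up_top : up p = x
  up_left : up a = ch p
  up_right : up b = ch p
  left_ne_right : a ≠ b

/-- With six pairs Bob wins; this is what limits the weakly favorable paths to `9` or `11` vertices.
-/
theorem false_of_path_long [Finite V] (h : Rooted G r l₀ up ch O) (hW : AliceWin G {r} ∅ .bob)
    {x : V} {p : Fin 4 → V} (hp : PathAt r up ch O x p) {a b : V} (ha : Live up ch O a)
    (hb : Live up ch O b) (hap : up a = ch (p 3)) (hba : up b = ch a) : False := by
  have h1 := h.depth_of_up_ch (hp.live 1).1 (hp.live 0).1 hp.up_one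
  have h2 := h.depth_of_up_ch (hp.live 2).1 (hp.live 1).1 hp.up_two
  have h3 := h.depth_of_up_ch (hp.live 3).1 (hp.live 2).1 hp.up_three
  have h4 := h.depth_of_up_ch ha.1 (hp.live 3).1 hap
  have h5 := h.depth_of_up_ch hb.1 ha.1 hba
  have hnd : [p 0, p 1, p 2, p 3, a, b].Nodup := by
    simp only [List.nodup_cons, List.mem_cons, List.not_mem_nil, not_or, or_false, not_false_iff,
      List.nodup_nil, and_true]
    and_intros <;> exact fun e => absurd (congrArg (G.dist r) e) (by omega)
  refine h.false_of_shape hW (ps := [p 0, p 1, p 2, p 3, a, b]) (rs := [x])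
    (par := [13, 1, 3, 5, 7, 9]) (marks := [1, 3]) (h.isShape rfl hnd (by simp [ha, hb, hp.live])
      (by simp) (by simpa using ⟨hp.ne, hp.up_eq, p 0, (hp.live 0).1, hp.up_zero⟩) ?_
      (by simpa using ⟨hp.marked_zero, hp.marked_one⟩))
      (top_of_zero_notMem rfl (by simp)) check_longPathStrategy
  intro i hi
  simp only [List.length_cons, List.length_nil] at hi
  interval_cases i
  exacts [Or.inr ⟨by simp, by simp, hp.up_zero⟩, Or.inr ⟨by simp, by simp, hp.up_one⟩,
    Or.inr ⟨by simp, by simp, hp.up_two⟩, Or.inr ⟨by simp, by simp, hp.up_three⟩,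
    Or.inr ⟨by simp, by simp, hap⟩, Or.inr ⟨by simp, by simp, hba⟩]

/-- This limits each branch of a fork to two vertices besides the center. -/
theorem false_of_fork_long [Finite V] (h : Rooted G r l₀ up ch O) (hW : AliceWin G {r} ∅ .bob)
    {x p a b c : V} (hf : ForkAt r up ch O x p a b) (hc : Live up ch O c) (hca : up c = ch a) :
    False := by
  have h1 := h.depth_of_up_ch hf.live_left.1 hf.live.1 hf.up_left
  have h2 := h.depth_of_up_ch hf.live_right.1 hf.live.1 hf.up_right
  have h3 := h.depth_of_up_ch hc.1 hf.live_left.1 hca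
  have hne := hf.left_ne_right
  have hnd : [p, a, c, b].Nodup := by
    simp only [List.nodup_cons, List.mem_cons, List.not_mem_nil, not_or, or_false, not_false_iff,
      List.nodup_nil, and_true]
    and_intros <;> first | assumption | exact fun e => absurd (congrArg (G.dist r) e) (by omega)
  refine h.false_of_shape hW (ps := [p, a, c, b]) (rs := [x])
    (par := [9, 1, 3, 1]) (marks := []) (h.isShape rfl hnd
      (by simp [hc, hf.live, hf.live_left, hf.live_right])
      (by simp) (by simpa using ⟨hf.ne, hf.up_eq, p, hf.live.1, hf.up_top⟩) ?_ (by simp))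
      (top_of_zero_notMem rfl (by simp)) check_longForkStrategy
  intro i hi
  simp only [List.length_cons, List.length_nil] at hi
  interval_cases i
  exacts [Or.inr ⟨by simp, by simp, hf.up_top⟩, Or.inr ⟨by simp, by simp, hf.up_left⟩,
    Or.inr ⟨by simp, by simp, hca⟩, Or.inr ⟨by simp, by simp, hf.up_right⟩]

/-- Two weak configurations below different children of the root are jointly lost for Alice. Two
further branches of each fork suffice for Bob. The next two results treat the other combinations. -/
theorem fork_fork [Finite V] (h : Rooted G r l₀ up ch O) (hW : AliceWin G {r} ∅ .bob)
    {x p a b y q c d : V} (hf : ForkAt r up ch O x p a b) (hg : ForkAt r up ch O y q c d) :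
    x = y := by
  by_contra hxy
  have h1 := h.depth_of_up_up hf.live.1 hf.up_top hf.ne hf.up_eq
  have h2 := h.depth_of_up_ch hf.live_left.1 hf.live.1 hf.up_left
  have h3 := h.depth_of_up_ch hf.live_right.1 hf.live.1 hf.up_right
  have h4 := h.depth_of_up_up hg.live.1 hg.up_top hg.ne hg.up_eq
  have h5 := h.depth_of_up_ch hg.live_left.1 hg.live.1 hg.up_left
  have h6 := h.depth_of_up_ch hg.live_right.1 hg.live.1 hg.up_right
  have hne1 := hf.left_ne_right
  have hne2 := hg.left_ne_right
  have hpq : p ≠ q := fun e => hxy (by rw [← hf.up_top, ← hg.up_top, e])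
  have key : ∀ {v w}, up v = ch p → up w = ch q → v ≠ w := fun hv hw e =>
    hpq (h.ch_inj hf.live.1 hg.live.1 (by rw [← hv, ← hw, e]))
  have hac := key hf.up_left hg.up_left
  have had := key hf.up_left hg.up_right
  have hbc := key hf.up_right hg.up_left
  have hbd := key hf.up_right hg.up_right
  have hnd : [p, a, b, q, c, d].Nodup := by
    simp only [List.nodup_cons, List.mem_cons, List.not_mem_nil, not_or, or_false, not_false_iff,
      List.nodup_nil, and_true]
    and_intros <;> first | assumption | exact fun e => absurd (congrArg (G.dist r) e) (by omega)
  refine h.false_of_shape hW (ps := [p, a, b, q, c, d]) (rs := [x, y])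
    (par := [13, 1, 1, 14, 7, 7]) (marks := []) (h.isShape rfl hnd
      (by simp [hf.live, hf.live_left, hf.live_right, hg.live, hg.live_left, hg.live_right])
      (by simpa using hxy) (by simpa using ⟨⟨hf.ne, hf.up_eq, p, hf.live.1, hf.up_top⟩,
        ⟨hg.ne, hg.up_eq, q, hg.live.1, hg.up_top⟩⟩) ?_ (by simp))
      (top_of_zero_notMem rfl (by simp)) check_forkForkStrategy
  intro i hi
  simp only [List.length_cons, List.length_nil] at hi
  interval_cases i
  exacts [Or.inr ⟨by simp, by simp, hf.up_top⟩, Or.inr ⟨by simp, by simp, hf.up_left⟩,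
    Or.inr ⟨by simp, by simp, hf.up_right⟩, Or.inr ⟨by simp, by simp, hg.up_top⟩,
    Or.inr ⟨by simp, by simp, hg.up_left⟩, Or.inr ⟨by simp, by simp, hg.up_right⟩]

theorem fork_path [Finite V] (h : Rooted G r l₀ up ch O) (hW : AliceWin G {r} ∅ .bob)
    {x p a b y : V} {q : Fin 4 → V} (hf : ForkAt r up ch O x p a b) (hg : PathAt r up ch O y q) :
    x = y := by
  by_contra hxy
  have h1 := h.depth_of_up_up hf.live.1 hf.up_top hf.ne hf.up_eq
  have h2 := h.depth_of_up_ch hf.live_left.1 hf.live.1 hf.up_left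
  have h3 := h.depth_of_up_ch hf.live_right.1 hf.live.1 hf.up_right
  have h4 := h.depth_of_up_up (hg.live 0).1 hg.up_zero hg.ne hg.up_eq
  have h5 := h.depth_of_up_ch (hg.live 1).1 (hg.live 0).1 hg.up_one
  have h6 := h.depth_of_up_ch (hg.live 2).1 (hg.live 1).1 hg.up_two
  have h7 := h.depth_of_up_ch (hg.live 3).1 (hg.live 2).1 hg.up_three
  have hne1 := hf.left_ne_right
  have hpq : p ≠ q 0 := fun e => hxy (by rw [← hf.up_top, ← hg.up_zero, e])
  have key : ∀ {v}, up v = ch p → v ≠ q 1 := fun hv e =>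
    hpq (h.ch_inj hf.live.1 (hg.live 0).1 (by rw [← hv, ← hg.up_one, e]))
  have hac := key hf.up_left
  have hbc := key hf.up_right
  have hnd : [p, a, b, q 0, q 1, q 2, q 3].Nodup := by
    simp only [List.nodup_cons, List.mem_cons, List.not_mem_nil, not_or, or_false, not_false_iff,
      List.nodup_nil, and_true]
    and_intros <;> first | assumption | exact fun e => absurd (congrArg (G.dist r) e) (by omega)
  refine h.false_of_shape hW (ps := [p, a, b, q 0, q 1, q 2, q 3]) (rs := [x, y])
    (par := [15, 1, 1, 16, 7, 9, 11]) (marks := [7, 9]) (h.isShape rfl hnd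
      (by simp [hf.live, hf.live_left, hf.live_right, hg.live])
      (by simpa using hxy) (by simpa using ⟨⟨hf.ne, hf.up_eq, p, hf.live.1, hf.up_top⟩,
        ⟨hg.ne, hg.up_eq, q 0, (hg.live 0).1, hg.up_zero⟩⟩) ?_
      (by simpa using ⟨hg.marked_zero, hg.marked_one⟩))
      (top_of_zero_notMem rfl (by simp)) check_forkPathStrategy
  intro i hi
  simp only [List.length_cons, List.length_nil] at hi
  interval_cases i
  exacts [Or.inr ⟨by simp, by simp, hf.up_top⟩, Or.inr ⟨by simp, by simp, hf.up_left⟩,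
    Or.inr ⟨by simp, by simp, hf.up_right⟩, Or.inr ⟨by simp, by simp, hg.up_zero⟩,
    Or.inr ⟨by simp, by simp, hg.up_one⟩, Or.inr ⟨by simp, by simp, hg.up_two⟩,
    Or.inr ⟨by simp, by simp, hg.up_three⟩]

theorem path_path [Finite V] (h : Rooted G r l₀ up ch O) (hW : AliceWin G {r} ∅ .bob)
    {x y : V} {p q : Fin 4 → V} (hf : PathAt r up ch O x p) (hg : PathAt r up ch O y q) :
    x = y := by
  by_contra hxy
  have h1 := h.depth_of_up_up (hf.live 0).1 hf.up_zero hf.ne hf.up_eq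
  have h2 := h.depth_of_up_ch (hf.live 1).1 (hf.live 0).1 hf.up_one
  have h3 := h.depth_of_up_ch (hf.live 2).1 (hf.live 1).1 hf.up_two
  have h3' := h.depth_of_up_ch (hf.live 3).1 (hf.live 2).1 hf.up_three
  have h4 := h.depth_of_up_up (hg.live 0).1 hg.up_zero hg.ne hg.up_eq
  have h5 := h.depth_of_up_ch (hg.live 1).1 (hg.live 0).1 hg.up_one
  have h6 := h.depth_of_up_ch (hg.live 2).1 (hg.live 1).1 hg.up_two
  have h7 := h.depth_of_up_ch (hg.live 3).1 (hg.live 2).1 hg.up_three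
  have e0 : p 0 ≠ q 0 := fun e => hxy (by rw [← hf.up_zero, ← hg.up_zero, e])
  have e1 : p 1 ≠ q 1 := fun e =>
    e0 (h.ch_inj (hf.live 0).1 (hg.live 0).1 (by rw [← hf.up_one, ← hg.up_one, e]))
  have e2 : p 2 ≠ q 2 := fun e =>
    e1 (h.ch_inj (hf.live 1).1 (hg.live 1).1 (by rw [← hf.up_two, ← hg.up_two, e]))
  have e3 : p 3 ≠ q 3 := fun e =>
    e2 (h.ch_inj (hf.live 2).1 (hg.live 2).1 (by rw [← hf.up_three, ← hg.up_three, e]))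
  have hnd : [p 0, p 1, p 2, p 3, q 0, q 1, q 2, q 3].Nodup := by
    simp only [List.nodup_cons, List.mem_cons, List.not_mem_nil, not_or, or_false, not_false_iff,
      List.nodup_nil, and_true]
    and_intros <;> first | assumption | exact fun e => absurd (congrArg (G.dist r) e) (by omega)
  refine h.false_of_shape hW (ps := [p 0, p 1, p 2, p 3, q 0, q 1, q 2, q 3]) (rs := [x, y])
    (par := [17, 1, 3, 5, 18, 9, 11, 13]) (marks := [1, 3, 9, 11]) (h.isShape rfl hnd
      (by simp [hf.live, hg.live])
      (by simpa using hxy) (by simpa using ⟨⟨hf.ne, hf.up_eq, p 0, (hf.live 0).1, hf.up_zero⟩,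
        ⟨hg.ne, hg.up_eq, q 0, (hg.live 0).1, hg.up_zero⟩⟩) ?_
      (by simpa using ⟨hf.marked_zero, hf.marked_one, hg.marked_zero, hg.marked_one⟩))
      (top_of_zero_notMem rfl (by simp)) check_pathPathStrategy
  intro i hi
  simp only [List.length_cons, List.length_nil] at hi
  interval_cases i
  exacts [Or.inr ⟨by simp, by simp, hf.up_zero⟩, Or.inr ⟨by simp, by simp, hf.up_one⟩,
    Or.inr ⟨by simp, by simp, hf.up_two⟩, Or.inr ⟨by simp, by simp, hf.up_three⟩,
    Or.inr ⟨by simp, by simp, hg.up_zero⟩, Or.inr ⟨by simp, by simp, hg.up_one⟩,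
    Or.inr ⟨by simp, by simp, hg.up_two⟩, Or.inr ⟨by simp, by simp, hg.up_three⟩]

end Rooted

/-! ### Necessity: labels, the skeleton and the shape of its components. -/

/-! ### The rooted tree of the statement -/

theorem Label.not_label {G : SimpleGraph V} {r v : V} {b : Bool} (h : Label G r v b) :
    ¬ Label G r v !b := by
  induction h with
  | zero hv h ih =>
    rintro (- | ⟨-, hw, h'⟩)
    exact ih _ hw h'
  | one hv hw h ih =>
    rintro (⟨-, h'⟩ | -)
    exact ih (h' _ hw)

/-- The parent is the penultimate vertex of the path from the root; uniqueness of paths in a tree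
identifies it with any neighbour nearer to the root. -/
theorem exists_up {G : SimpleGraph V} (hG : G.IsTree) (r : V) :
    ∃ up : V → V, up r = r ∧ (∀ v, v ≠ r → G.dist r v = G.dist r (up v) + 1) ∧
      ∀ x y, G.Adj x y ↔ (y ≠ r ∧ up y = x) ∨ (x ≠ r ∧ up x = y) := by
  choose p hp hlen using fun v => hG.connected.exists_path_of_dist r v
  have hnil : ∀ v, v ≠ r → ¬ (p v).Nil := fun v hv hn => hv hn.eq.symm
  have hadj : ∀ v, v ≠ r → G.Adj (p v).penultimate v := fun v hv =>
    (p v).adj_penultimate (hnil v hv)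
  have hdist : ∀ v, v ≠ r → G.dist r v = G.dist r (p v).penultimate + 1 := by
    intro v hv
    have h1 := SimpleGraph.dist_le (p v).dropLast
    have h2 : (p v).dropLast.length + 1 = (p v).length :=
      SimpleGraph.Walk.length_dropLast_add_one (hnil v hv)
    rcases hG.dist_eq_dist_add_one_of_adj r (hadj v hv) with h | h
    · have := hlen v
      omega
    · exact h
  have hup : ∀ x y, G.Adj x y → G.dist r y = G.dist r x + 1 → y ≠ r ∧ (p y).penultimate = x := by
    intro x y h hd
    refine ⟨fun e => by simp [e] at hd, ?_⟩
    have hc : ((p x).concat h).IsPath := by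
      refine SimpleGraph.Walk.isPath_of_length_eq_dist _ ?_
      rw [SimpleGraph.Walk.length_concat, hlen, hd]
    have := congrArg (fun q : G.Path r y => q.1.penultimate)
      ((hG.isAcyclic.subsingleton_path r y).elim ⟨p y, hp y⟩ ⟨_, hc⟩)
    simpa using this
  refine ⟨fun v => (p v).penultimate, ?_, hdist, fun x y => ⟨fun h => ?_, ?_⟩⟩
  · simp [SimpleGraph.Walk.eq_nil_iff_nil.2 (SimpleGraph.Walk.isPath_iff_nil.1 (hp r))]
  · rcases hG.dist_eq_dist_add_one_of_adj r h with hd | hd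
    exacts [Or.inr (hup y x h.symm hd), Or.inl (hup x y h hd)]
  · rintro (⟨hy, rfl⟩ | ⟨hx, rfl⟩)
    exacts [hadj y hy, (hadj x hx).symm]

theorem exists_rooted [Finite V] {F : SimpleGraph V} (hF : F.IsTree) (hcherry : ¬ HasCherry F)
    {v₀ : V} (hv₀ : v₀ ∈ leafParents F) (hfirst : FirstMoveCondition F v₀) :
    ∃ l₀ up ch O, Rooted F v₀ l₀ up ch O := by
  obtain ⟨up, hr, hd, hadj⟩ := exists_up hF v₀
  obtain ⟨l, hl, hvl⟩ := hv₀
  have hchild : ∀ v w, IsChild F v₀ v w ↔ w ≠ v₀ ∧ up w = v := by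
    intro v w
    constructor
    · rintro ⟨h1, h2⟩
      rcases (hadj v w).1 h1 with h | ⟨h3, rfl⟩
      · exact h
      · have := hd v h3
        omega
    · rintro ⟨h1, rfl⟩
      exact ⟨(hadj _ _).2 (Or.inl ⟨h1, rfl⟩), hd w h1⟩
  -- A deepest vertex without a label would have only labelled children, and would therefore receive
  -- one itself.
  have htotal : ∀ v, v ≠ v₀ → Label F v₀ v true ∨ Label F v₀ v false := by
    by_contra! hcon
    obtain ⟨v, hv, hmax⟩ := Set.exists_max_image
      {v | v ≠ v₀ ∧ ¬ Label F v₀ v true ∧ ¬ Label F v₀ v false} (fun v => F.dist v₀ v)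
      (Set.toFinite _) hcon
    refine hv.2.2 (Label.zero hv.1 fun w hw => ?_)
    by_contra hw1
    have hw2 : Label F v₀ w false := by
      by_contra hw2
      have h1 := hmax w ⟨((hchild v w).1 hw).1, hw1, hw2⟩
      have h2 := hw.2
      omega
    exact hv.2.1 (Label.one hv.1 hw hw2)
  have hch : ∀ p, ∃ w, Label F v₀ p true → IsChild F v₀ p w ∧ Label F v₀ w false ∧
      ∀ x, IsChild F v₀ p x → x = w := by
    intro p
    by_cases hp : Label F v₀ p true
    · obtain ⟨w, hw, huniq⟩ := hfirst.2 p hp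
      refine ⟨w, fun _ => ⟨hw, ?_, huniq⟩⟩
      cases hp with
      | one hv hx h => exact huniq _ hx ▸ h
    · exact ⟨p, fun h => absurd h hp⟩
  choose ch hch using hch
  have hlv : l ≠ v₀ := fun e => hvl.ne e.symm
  have hleaf : ∀ v, v ≠ v₀ → (∀ w, w ≠ v₀ → up w ≠ v) → v ∈ leaves F := by
    intro v hv hno
    refine Set.ncard_eq_one.2 ⟨up v, ?_⟩
    ext x
    rw [SimpleGraph.mem_neighborSet, hadj, Set.mem_singleton_iff]
    constructor
    · rintro (⟨h1, h2⟩ | ⟨-, h2⟩)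
      exacts [absurd h2 (hno x h1), h2.symm]
    · rintro rfl
      exact Or.inr ⟨hv, rfl⟩
  refine ⟨l, up, ch, {v | Label F v₀ v true}, hadj, hd, hr, ?_, ?_, ?_, ?_, ?_, ?_, hlv, ?_, ?_, ?_⟩
  · rintro (_ | ⟨h, -, -⟩)
    exact h rfl
  · exact fun p hp => ((hchild _ _).1 (hch p hp).1).1
  · exact fun p hp => ((hchild _ _).1 (hch p hp).1).2
  · exact fun p hp => (hch p hp).2.1.not_label
  · exact fun w hw hu => (hch _ hu).2.2 w ((hchild _ _).2 ⟨hw, rfl⟩)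
  · intro w hw hu huO
    cases (htotal _ hu).resolve_left huO with
    | zero _ h => exact h w ((hchild _ _).2 ⟨hw, rfl⟩)
  · rcases (hadj v₀ l).1 hvl with h | h
    exacts [h.2, absurd rfl h.1]
  · intro w hw hwl
    have := eq_of_adj_leaf hl ((hadj l w).2 (Or.inl ⟨hw, hwl⟩)) hvl.symm
    exact hw this
  · intro v hv hu hno
    by_contra hne
    exact hcherry ⟨v₀, v, hleaf v hv hno, l, hl, hne, (hadj _ _).2 (Or.inl ⟨hv, hu⟩), hvl⟩

namespace Rooted

variable {G : SimpleGraph V} {r l₀ : V} {up ch : V → V} {O : Set V}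

theorem mem_leaves_iff (h : Rooted G r l₀ up ch O) {v : V} (hv : v ≠ r) :
    v ∈ leaves G ↔ ∀ w, w ≠ r → up w ≠ v := by
  constructor
  · rintro hl w hw rfl
    have e := eq_of_adj_leaf hl ((h.adj_iff _ _).2 (Or.inl ⟨hw, rfl⟩))
      ((h.adj_iff _ _).2 (Or.inr ⟨hv, rfl⟩))
    have h1 := h.depth w hw
    have h2 := h.depth _ hv
    rw [← e] at h2
    omega
  · intro hno
    refine Set.ncard_eq_one.2 ⟨up v, ?_⟩
    ext x
    rw [SimpleGraph.mem_neighborSet, h.adj_iff, Set.mem_singleton_iff]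
    constructor
    · rintro (⟨h1, h2⟩ | ⟨-, h2⟩)
      exacts [absurd h2 (hno x h1), h2.symm]
    · rintro rfl
      exact Or.inr ⟨hv, rfl⟩

theorem live_iff (h : Rooted G r l₀ up ch O) {p : V} (hp : p ∈ O) :
    Live up ch O p ↔ ch p ∉ leaves G := by
  rw [h.mem_leaves_iff (h.ch_ne p hp)]
  push Not
  constructor
  · rintro ⟨-, w, hw, e⟩
    exact ⟨w, h.ne_root hw, e⟩
  · rintro ⟨w, hw, e⟩
    exact ⟨hp, w, h.mem_of_up_ch hp hw e, e⟩

theorem mem_notMem_leaves (h : Rooted G r l₀ up ch O) {p : V} (hp : p ∈ O) : p ∉ leaves G := by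
  rw [h.mem_leaves_iff (h.ne_root hp)]
  push Not
  exact ⟨ch p, h.ch_ne p hp, h.up_ch p hp⟩

theorem adj_ch (h : Rooted G r l₀ up ch O) {p : V} (hp : p ∈ O) : G.Adj p (ch p) :=
  (h.adj_iff _ _).2 (Or.inl ⟨h.ch_ne p hp, h.up_ch p hp⟩)

/-- The parents of leaves, except for the root, are the vertices labelled `1` that are not live. -/
theorem mem_leafParents_iff (h : Rooted G r l₀ up ch O) (hr : r ∉ leaves G) {m : V} (hm : m ≠ r) :
    m ∈ leafParents G ↔ m ∈ O ∧ ¬ Live up ch O m := by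
  constructor
  · rintro ⟨l, hl, hml⟩
    have hlr : l ≠ r := fun e => hr (e ▸ hl)
    rcases (h.adj_iff _ _).1 hml with ⟨-, e⟩ | ⟨-, e⟩
    · have hmO : m ∈ O := by
        by_contra hmO
        exact h.mem_notMem_leaves (h.mem_of_up l hlr (e ▸ hm) (e ▸ hmO)) hl
      refine ⟨hmO, fun hL => (h.live_iff hmO).1 hL ?_⟩
      rw [← e, ← h.eq_ch l hlr (e ▸ hmO)]
      exact hl
    · exact absurd e ((h.mem_leaves_iff hlr).1 hl m hm)
  · rintro ⟨hmO, hL⟩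
    rw [h.live_iff hmO, not_not] at hL
    exact ⟨_, hL, h.adj_ch hmO⟩

/-- The leaves are the vertices without children, and the parents of leaves other than the root are
the vertices labelled `1` that are not live. -/
theorem mem_skeleton_iff (h : Rooted G r l₀ up ch O) (hr : r ∉ leaves G) (hr' : r ∈ leafParents G)
    {v : V} : v ∈ skeleton G ↔ v ≠ r ∧ (Live up ch O v ∨ (v ∉ O ∧ ∃ w ∈ O, up w = v)) := by
  constructor
  · rintro ⟨hv, hvM⟩
    have hvr : v ≠ r := fun e => hvM (e ▸ hr')
    refine ⟨hvr, ?_⟩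
    rw [h.mem_leafParents_iff hr hvr] at hvM
    rw [h.mem_leaves_iff hvr] at hv
    push Not at hv hvM
    by_cases hvO : v ∈ O
    · exact Or.inl (hvM hvO)
    · obtain ⟨w, hw, rfl⟩ := hv
      exact Or.inr ⟨hvO, w, h.mem_of_up w hw hvr hvO, rfl⟩
  · rintro ⟨hvr, hv⟩
    constructor
    · rcases hv with hv | ⟨-, w, hw, e⟩
      · exact h.mem_notMem_leaves hv.1
      · exact fun hl => (h.mem_leaves_iff hvr).1 hl w (h.ne_root hw) e
    · rw [h.mem_leafParents_iff hr hvr]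
      rintro ⟨h1, h2⟩
      rcases hv with hv | ⟨hv, -⟩
      exacts [h2 hv, hv h1]

/-- A vertex of the skeleton cannot lie below a parent of a leaf other than the root, since the only
child of the latter is that leaf; so the neighbour in question is a child. -/
theorem meetsParents_iff (h : Rooted G r l₀ up ch O) (hr : r ∉ leaves G) (hr' : r ∈ leafParents G)
    {v : V} (hv : v ∈ skeleton G) : MeetsParents G r v ↔ Marked up ch O v := by
  have hvr := ((h.mem_skeleton_iff hr hr').1 hv).1
  constructor
  · rintro ⟨m, hm, hmr, hvm⟩
    obtain ⟨hmO, hmL⟩ := (h.mem_leafParents_iff hr hmr).1 hm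
    rcases (h.adj_iff _ _).1 hvm with ⟨-, e⟩ | ⟨-, e⟩
    · exact ⟨m, hmO, e, hmL⟩
    · rw [h.live_iff hmO, not_not] at hmL
      have := h.eq_ch v hvr (e ▸ hmO)
      rw [e] at this
      exact absurd (this ▸ hmL) hv.1
  · rintro ⟨w, hw, rfl, hwL⟩
    have hwr := h.ne_root hw
    exact ⟨w, (h.mem_leafParents_iff hr hwr).2 ⟨hw, hwL⟩, hwr,
      ((h.adj_iff _ _).2 (Or.inl ⟨hwr, rfl⟩))⟩

theorem up_mem_skeleton (h : Rooted G r l₀ up ch O) (hr : r ∉ leaves G) (hr' : r ∈ leafParents G)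
    {v : V} (hv : v ∈ skeleton G) (hu : up v ≠ r) : up v ∈ skeleton G := by
  obtain ⟨hvr, hv⟩ := (h.mem_skeleton_iff hr hr').1 hv
  refine (h.mem_skeleton_iff hr hr').2 ⟨hu, ?_⟩
  rcases hv with hv | ⟨hvO, w, hw, rfl⟩
  · exact Or.inr ⟨h.up_notMem hv.1, v, hv.1, rfl⟩
  · have huO := h.up_mem hvr hvO hu
    exact Or.inl ⟨huO, w, hw, h.eq_ch _ hvr huO⟩

theorem live_of_mem (h : Rooted G r l₀ up ch O) (hr : r ∉ leaves G) (hr' : r ∈ leafParents G)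
    {v : V} (hv : v ∈ skeleton G) (hvO : v ∈ O) : Live up ch O v :=
  ((h.mem_skeleton_iff hr hr').1 hv).2.resolve_right fun h => h.1 hvO

theorem mem_skeleton_of_live (h : Rooted G r l₀ up ch O) (hr : r ∉ leaves G)
    (hr' : r ∈ leafParents G) {v : V} (hv : Live up ch O v) : v ∈ skeleton G :=
  (h.mem_skeleton_iff hr hr').2 ⟨h.ne_root hv.1, Or.inl hv⟩

theorem ch_mem_skeleton (h : Rooted G r l₀ up ch O) (hr : r ∉ leaves G)
    (hr' : r ∈ leafParents G) {v : V} (hv : Live up ch O v) : ch v ∈ skeleton G :=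
  (h.mem_skeleton_iff hr hr').2 ⟨h.ch_ne v hv.1, Or.inr ⟨h.ch_notMem v hv.1, hv.2⟩⟩

end Rooted

/-! ### The components of the skeleton -/

theorem componentSet_induction {G : SimpleGraph V}
    {C : (G.induce (skeleton G)).ConnectedComponent} {P : V → Prop} {x : V}
    (hx : x ∈ componentSet G C) (hPx : P x)
    (h : ∀ v ∈ componentSet G C, P v → ∀ w ∈ skeleton G, G.Adj v w → P w) :
    ∀ v ∈ componentSet G C, P v := by
  intro v hv
  have hxS := componentSet_subset C hx
  have hvS := componentSet_subset C hv
  have hC := (mem_componentSet hxS).1 hx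
  obtain ⟨w⟩ := SimpleGraph.ConnectedComponent.exact (hC.trans ((mem_componentSet hvS).1 hv).symm)
  have key : ∀ (a b : skeleton G), (G.induce (skeleton G)).Walk a b → a.1 ∈ componentSet G C →
      P a.1 → P b.1 := by
    intro a b w
    induction w with
    | nil => exact fun _ h => h
    | @cons a b c hadj _ ih =>
      intro ha hPa
      have hadj' : G.Adj a.1 b.1 := SimpleGraph.induce_adj.1 hadj
      exact ih ((componentSet_adj ha hadj').resolve_right b.2.2) (h _ ha hPa _ b.2 hadj')
  exact key _ _ w hx hPx

theorem componentSet_nonempty {G : SimpleGraph V}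
    (C : (G.induce (skeleton G)).ConnectedComponent) : ∃ v, v ∈ componentSet G C := by
  obtain ⟨v, hv⟩ := C.nonempty_supp
  exact ⟨v.1, v, hv, rfl⟩

theorem mem_componentSet_of_adj {G : SimpleGraph V}
    {C : (G.induce (skeleton G)).ConnectedComponent} {v x : V} (hv : v ∈ componentSet G C)
    (h : G.Adj v x) (hx : x ∈ skeleton G) : x ∈ componentSet G C :=
  (componentSet_adj hv h).resolve_right hx.2

namespace Rooted

variable {G : SimpleGraph V} {r l₀ : V} {up ch : V → V} {O : Set V}

theorem exists_top [Finite V] (h : Rooted G r l₀ up ch O) (hr : r ∉ leaves G)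
    (hr' : r ∈ leafParents G) (C : (G.induce (skeleton G)).ConnectedComponent) :
    ∃ x ∈ componentSet G C, x ≠ r ∧ up x = r := by
  obtain ⟨x, hx, hmin⟩ := Set.exists_min_image (componentSet G C) (fun v => G.dist r v)
    (Set.toFinite _) (componentSet_nonempty C)
  have hxS := componentSet_subset C hx
  have hxr := ((h.mem_skeleton_iff hr hr').1 hxS).1
  refine ⟨x, hx, hxr, by_contra fun hu => ?_⟩
  have h1 := hmin _ (mem_componentSet_of_adj hx ((h.adj_iff _ _).2 (Or.inr ⟨hxr, rfl⟩))
    (h.up_mem_skeleton hr hr' hxS hu))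
  have h2 := h.depth x hxr
  omega

/-- Walking inside the component, each vertex keeps `x` among its ancestors, because the root is not
in the skeleton. -/
theorem eq_top (h : Rooted G r l₀ up ch O) (hr' : r ∈ leafParents G)
    {C : (G.induce (skeleton G)).ConnectedComponent} {x y : V} (hx : x ∈ componentSet G C)
    (hxr : up x = r) (hy : y ∈ componentSet G C) (hyr : up y = r) : x = y := by
  have hne : ∀ v ∈ skeleton G, v ≠ r := fun v hv e => hv.2 (e ▸ hr')
  obtain ⟨k, hk⟩ := componentSet_induction (P := fun v => ∃ k, up^[k] v = x) hx ⟨0, rfl⟩ (by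
    rintro v hv ⟨k, hk⟩ w hw hvw
    rcases (h.adj_iff _ _).1 hvw with ⟨-, e⟩ | ⟨-, e⟩
    · exact ⟨k + 1, by rw [Function.iterate_succ_apply, e, hk]⟩
    · rcases k with - | k
      · simp only [Function.iterate_zero, id_eq] at hk
        rw [hk, hxr] at e
        exact absurd e.symm (hne w hw)
      · rw [Function.iterate_succ_apply, e] at hk
        exact ⟨k, hk⟩) y hy
  rcases k with - | k
  · exact hk.symm
  · rw [Function.iterate_succ_apply, hyr] at hk
    have : up^[k] r = r := Function.iterate_fixed h.up_root k
    rw [this] at hk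
    exact absurd hk.symm (hne x (componentSet_subset C hx))

end Rooted

section Path

variable {G : SimpleGraph V} {r l₀ : V} {up ch : V → V} {O : Set V}
  {C : (G.induce (skeleton G)).ConnectedComponent} {n : ℕ} {p : ℕ → V}

theorem IsPathFrom.mem {v₀ : V} {K : Set V} (hp : IsPathFrom G v₀ K n p) {i : ℕ} (h1 : 1 ≤ i)
    (h2 : i ≤ n) : p i ∈ K := hp.image_eq ▸ ⟨i, ⟨h1, h2⟩, rfl⟩

theorem IsPathFrom.up_one (h : Rooted G r l₀ up ch O)
    (hp : IsPathFrom G r (componentSet G C) n p) : up (p 1) = r := by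
  have := (hp.root_adj_iff 1 ⟨le_rfl, hp.pos⟩).2 rfl
  rcases (h.adj_iff _ _).1 this with h | h
  exacts [h.2, absurd rfl h.1]

theorem IsPathFrom.up_succ (h : Rooted G r l₀ up ch O) (hr' : r ∈ leafParents G)
    (hp : IsPathFrom G r (componentSet G C) n p) {i : ℕ} (h1 : 1 ≤ i) (h2 : i + 1 ≤ n) :
    up (p (i + 1)) = p i := by
  have hadj : ∀ i, 1 ≤ i → i + 1 ≤ n → G.Adj (p i) (p (i + 1)) := fun i h1 h2 =>
    (hp.adj_iff i ⟨h1, by omega⟩ (i + 1) ⟨by omega, h2⟩).2 (Or.inl rfl)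
  have hne : ∀ i, 1 ≤ i → i ≤ n → p i ≠ r := fun i h1 h2 e =>
    (componentSet_subset C (hp.mem h1 h2)).2 (e ▸ hr')
  induction i, h1 using Nat.le_induction with
  | base =>
    rcases (h.adj_iff _ _).1 (hadj 1 le_rfl h2) with ⟨-, e⟩ | ⟨-, e⟩
    · exact e
    · rw [hp.up_one h] at e
      exact absurd e.symm (hne 2 (by omega) h2)
  | succ i h1 ih =>
    rcases (h.adj_iff _ _).1 (hadj (i + 1) (by omega) h2) with ⟨-, e⟩ | ⟨-, e⟩
    · exact e
    · rw [ih (by omega)] at e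
      have := hp.injOn ⟨h1, by omega⟩ ⟨by omega, h2⟩ e
      omega

/-- The last vertex cannot be labelled `1`: it would be live, and its child would continue the path.
From there upwards the labels alternate. -/
theorem IsPathFrom.mem_iff (h : Rooted G r l₀ up ch O) (hr : r ∉ leaves G)
    (hr' : r ∈ leafParents G) (hp : IsPathFrom G r (componentSet G C) n p) {i : ℕ} (h1 : 1 ≤ i)
    (h2 : i ≤ n) : p i ∈ O ↔ Odd (n - i) := by
  have hS : ∀ i, 1 ≤ i → i ≤ n → p i ∈ skeleton G := fun i h1 h2 =>
    componentSet_subset C (hp.mem h1 h2)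
  have hne : ∀ i, 1 ≤ i → i ≤ n → p i ≠ r := fun i h1 h2 e => (hS i h1 h2).2 (e ▸ hr')
  obtain ⟨k, hk⟩ : ∃ k, n - i = k := ⟨_, rfl⟩
  induction k generalizing i with
  | zero =>
    obtain rfl : i = n := by omega
    rw [Nat.sub_self]
    simp only [Nat.not_odd_zero, iff_false]
    intro hO
    have hL := h.live_of_mem hr hr' (hS i h1 h2) hO
    have hc := mem_componentSet_of_adj (hp.mem h1 h2) (h.adj_ch hO) (h.ch_mem_skeleton hr hr' hL)
    rw [← hp.image_eq] at hc
    obtain ⟨j, ⟨hj1, hj2⟩, hj⟩ := hc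
    have hu := h.up_ch _ hO
    rw [← hj] at hu
    obtain rfl | ⟨j, rfl⟩ : j = 1 ∨ ∃ j', j = j' + 1 := by
      rcases j with - | j
      exacts [by omega, Or.inr ⟨j, rfl⟩]
    · rw [hp.up_one h] at hu
      exact hne i h1 h2 hu.symm
    · rcases j with - | j
      · rw [hp.up_one h] at hu
        exact hne i h1 h2 hu.symm
      · rw [hp.up_succ h hr' (by omega) hj2] at hu
        have := hp.injOn ⟨by omega, by omega⟩ ⟨h1, h2⟩ hu
        omega
  | succ k ih =>
    have hi := ih (i := i + 1) (by omega) (by omega) (by omega)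
    have hu := hp.up_succ h hr' h1 (i := i) (by omega)
    have e : n - i = (n - (i + 1)) + 1 := by omega
    rw [e, Nat.odd_add_one]
    refine Iff.trans ⟨?_, ?_⟩ (not_congr hi)
    · intro hO hO'
      exact h.up_notMem hO' (hu ▸ hO)
    · intro hO
      have := h.up_mem (hne (i + 1) (by omega) (by omega)) hO (hu ▸ hne i h1 h2)
      rwa [hu] at this

theorem IsPathFrom.live (h : Rooted G r l₀ up ch O) (hr : r ∉ leaves G)
    (hr' : r ∈ leafParents G) (hp : IsPathFrom G r (componentSet G C) n p) {i : ℕ} (h1 : 1 ≤ i)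
    (h2 : i ≤ n) (hodd : Odd (n - i)) : Live up ch O (p i) :=
  h.live_of_mem hr hr' (componentSet_subset C (hp.mem h1 h2))
    ((hp.mem_iff h hr hr' h1 h2).2 hodd)

theorem IsPathFrom.ch_eq (h : Rooted G r l₀ up ch O) (hr : r ∉ leaves G)
    (hr' : r ∈ leafParents G) (hp : IsPathFrom G r (componentSet G C) n p) {i : ℕ} (h1 : 1 ≤ i)
    (h2 : i + 1 ≤ n) (hodd : Odd (n - i)) : ch (p i) = p (i + 1) := by
  have hu := hp.up_succ h hr' h1 h2
  have hO := (hp.mem_iff h hr hr' h1 (by omega)).2 hodd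
  have hne : p (i + 1) ≠ r := fun e =>
    (componentSet_subset C (hp.mem (by omega) h2)).2 (e ▸ hr')
  rw [h.eq_ch _ hne (hu ▸ hO), hu]

theorem IsPathFrom.up_add_two (h : Rooted G r l₀ up ch O) (hr : r ∉ leaves G)
    (hr' : r ∈ leafParents G) (hp : IsPathFrom G r (componentSet G C) n p) {i : ℕ} (h1 : 1 ≤ i)
    (h2 : i + 2 ≤ n) (hodd : Odd (n - i)) : up (p (i + 2)) = ch (p i) := by
  rw [hp.ch_eq h hr hr' h1 (by omega) hodd, hp.up_succ h hr' (by omega) (by omega)]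

/-- A vertex with a child labelled `1` is labelled `0`, hence at even distance from the end of the
path. -/
theorem IsPathFrom.marked (h : Rooted G r l₀ up ch O) (hr : r ∉ leaves G)
    (hr' : r ∈ leafParents G) (hp : IsPathFrom G r (componentSet G C) n p) {i : ℕ}
    (hi : i ∈ pendantIndices G r n p) : 1 ≤ i ∧ i + 2 ≤ n ∧ Even (n - i) ∧ Marked up ch O (p i) := by
  obtain ⟨h1, h2, hm⟩ := hi
  rw [h.meetsParents_iff hr hr' (componentSet_subset C (hp.mem h1 (by omega)))] at hm
  have hev : Even (n - i) := by
    rw [← Nat.not_odd_iff_even, ← hp.mem_iff h hr hr' h1 (by omega)]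
    obtain ⟨w, hw, e, -⟩ := hm
    exact e ▸ h.up_notMem hw
  refine ⟨h1, ?_, hev, hm⟩
  obtain ⟨k, hk⟩ := hev
  omega

theorem IsPathFrom.pathAt (h : Rooted G r l₀ up ch O) (hr : r ∉ leaves G)
    (hr' : r ∈ leafParents G) (hp : IsPathFrom G r (componentSet G C) n p) (hn : 9 ≤ n)
    (hodd : Odd n) (h3 : 3 ∈ pendantIndices G r n p) (h5 : 5 ∈ pendantIndices G r n p) :
    Rooted.PathAt r up ch O (p 1) fun i => p (2 * i + 2) := by
  have ho : ∀ i, 2 * i + 2 ≤ n → Odd (n - (2 * i + 2)) := by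
    intro i hi
    obtain ⟨k, hk⟩ := hodd
    exact ⟨k - i - 1, by omega⟩
  have hu : ∀ i, 2 * i + 4 ≤ n → up (p (2 * i + 4)) = ch (p (2 * i + 2)) := fun i hi =>
    hp.up_add_two h hr hr' (by omega) hi (ho i (by omega))
  have hc : ∀ i, 2 * i + 3 ≤ n → ch (p (2 * i + 2)) = p (2 * i + 3) := fun i hi =>
    hp.ch_eq h hr hr' (by omega) hi (ho i (by omega))
  refine ⟨fun e => ?_, hp.up_one h, fun i => hp.live h hr hr' (by omega) (by omega)
    (ho i (by omega)), hp.up_succ h hr' le_rfl (by omega), hu 0 (by omega), hu 1 (by omega),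
    hu 2 (by omega), ?_, ?_⟩
  · exact (componentSet_subset C (hp.mem le_rfl (by omega))).2 (e ▸ hr')
  · have := (hp.marked h hr hr' h3).2.2.2
    rwa [← hc 0 (by omega)] at this
  · have := (hp.marked h hr hr' h5).2.2.2
    rwa [← hc 1 (by omega)] at this

/-- A component which is a path is favorable if Alice wins. -/
theorem IsPathFrom.cases [Finite V] (h : Rooted G r l₀ up ch O) (hr : r ∉ leaves G)
    (hr' : r ∈ leafParents G) (hW : AliceWin G {r} ∅ .bob)
    (hp : IsPathFrom G r (componentSet G C) n p) {U : Set ℕ} (hU : U = pendantIndices G r n p) :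
    PathCaseA n U ∨ PathCaseB n U ∨ PathCaseC n U ∨ PathCaseD n U ∨ PathCaseE n U := by
  subst hU
  have hn := hp.pos
  -- By parity an index other than `n - 2` is at most `n - 4`, so live vertices at `i + 1` and `i +
  -- 3` are available for the forbidden configurations.
  have key : ∀ i ∈ pendantIndices G r n p, i + 2 = n ∨ (i + 4 ≤ n ∧ (i = 2 ∨ i = 3 ∨ i = 5)) := by
    intro i hi
    obtain ⟨h1, h2, hev, hm⟩ := hp.marked h hr hr' hi
    obtain ⟨k, hk⟩ := hev
    have ho : ∀ j, j + 1 = i ∨ j = i + 1 ∨ j + 3 = i ∨ j = i + 3 → j ≤ n → Odd (n - j) := by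
      intro j hj hjn
      rcases hj with rfl | rfl | rfl | rfl
      exacts [⟨k, by omega⟩, ⟨k - 1, by omega⟩, ⟨k + 1, by omega⟩, ⟨k - 2, by omega⟩]
    by_cases hi4 : i + 2 = n
    · exact Or.inl hi4
    refine Or.inr ⟨by omega, ?_⟩
    by_cases hi1 : i = 1
    · subst hi1
      refine (h.false_of_marked_top hW ?_ (hp.up_one h) hm (a := p 4) (b := p 2)
        (hp.live h hr hr' (by omega) (by omega) (ho 4 (by omega) (by omega)))
        (hp.live h hr hr' (by omega) (by omega) (ho 2 (by omega) (by omega)))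
        (hp.up_add_two h hr hr' (by omega) (by omega) (ho 2 (by omega) (by omega)))
        (hp.up_succ h hr' le_rfl (by omega))).elim
      exact fun e => (componentSet_subset C (hp.mem le_rfl (by omega))).2 (e ▸ hr')
    by_cases hi2 : i = 2 ∨ i = 3
    · omega
    obtain ⟨j, rfl⟩ : ∃ j, i = j + 3 := ⟨i - 3, by omega⟩
    have hL : ∀ {j'}, (j' = j ∨ j' = j + 2 ∨ j' = j + 4 ∨ j' = j + 6) → Live up ch O (p j') :=
      fun hj => hp.live h hr hr' (by omega) (by omega) (ho _ (by omega) (by omega))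
    have hu : ∀ {j'}, (j' = j ∨ j' = j + 2 ∨ j' = j + 4) → up (p (j' + 2)) = ch (p j') :=
      fun hj => hp.up_add_two h hr hr' (by omega) (by omega) (ho _ (by omega) (by omega))
    rw [← hp.ch_eq h hr hr' (i := j + 2) (by omega) (by omega)
      (ho _ (by omega) (by omega))] at hm
    -- With `i = j + 3`, the four live vertices start at `p j`, whose parent must be the child `p 1`
    -- of the root. So `j = 2` and `i = 5`.
    have hd := h.depth_of_path hW (a := p (j + 6)) (b := p (j + 4)) (c := p (j + 2)) (d := p j)
      (hL (by omega)) (hL (by omega)) (hL (by omega)) (hL (by omega)) (hu (by omega))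
      (hu (by omega)) (hu (by omega)) hm
    rcases j with - | - | - | j
    · omega
    · exact absurd (hp.up_one h) hd.1
    · omega
    · rw [hp.up_succ h hr' (i := j + 2) (by omega) (by omega),
        hp.up_succ h hr' (i := j + 1) (by omega) (by omega)] at hd
      exact absurd (hd.2 ▸ hr') (componentSet_subset C (hp.mem (by omega) (by omega))).2
  rcases Nat.lt_or_ge n 4 with hn4 | hn4
  · by_cases hn3 : n = 3
    · refine Or.inr (Or.inl ⟨hn3, Or.inl fun i hi => ?_⟩)
      have := key i hi
      simp only [Set.mem_singleton_iff]
      omega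
    · refine Or.inl ⟨by omega, Set.eq_empty_iff_forall_notMem.2 fun i hi => ?_⟩
      have := key i hi
      have := (hp.marked h hr hr' hi).1
      omega
  by_cases h5 : 5 ∈ pendantIndices G r n p ∧ 9 ≤ n
  · obtain ⟨h5, hn9⟩ := h5
    have hodd : Odd n := by
      obtain ⟨k, hk⟩ := (hp.marked h hr hr' h5).2.2.1
      exact ⟨k + 2, by omega⟩
    by_cases h3 : 3 ∈ pendantIndices G r n p
    · have hP := hp.pathAt h hr hr' hn9 hodd h3 h5
      refine Or.inr (Or.inr (Or.inr (Or.inr ⟨?_, ?_, fun i hi => ?_⟩)))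
      -- Otherwise `n ≥ 13`, and the vertices `p 10` and `p 12` prolong the configuration beyond
      -- what Alice can hold.
      · by_contra hcon
        obtain ⟨k, rfl⟩ := hodd
        have ho : ∀ j, j = 8 ∨ j = 10 ∨ j = 12 → Odd (2 * k + 1 - j) := by
          rintro j (rfl | rfl | rfl)
          exacts [⟨k - 4, by omega⟩, ⟨k - 5, by omega⟩, ⟨k - 6, by omega⟩]
        exact h.false_of_path_long hW hP (a := p 10) (b := p 12)
          (hp.live h hr hr' (by omega) (by omega) (ho _ (by omega)))
          (hp.live h hr hr' (by omega) (by omega) (ho _ (by omega)))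
          (hp.up_add_two h hr hr' (by omega) (by omega) (ho _ (by omega)))
          (hp.up_add_two h hr hr' (by omega) (by omega) (ho _ (by omega)))
      · rintro i (rfl | rfl)
        exacts [h3, h5]
      · have := key i hi
        simp only [Set.mem_insert_iff, Set.mem_singleton_iff]
        omega
    · refine Or.inr (Or.inr (Or.inr (Or.inl ⟨hn9, hodd, fun i hi => ?_⟩)))
      have := key i hi
      have hi3 : i ≠ 3 := fun e => h3 (e ▸ hi)
      simp only [Set.mem_insert_iff, Set.mem_singleton_iff]
      omega
  · refine Or.inr (Or.inr (Or.inl ⟨hn4, fun i hi => ?_⟩))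
    have := key i hi
    have hi5 : ¬ (i = 5 ∧ 9 ≤ n) := fun e => h5 ⟨e.1 ▸ hi, e.2⟩
    simp only [Set.mem_insert_iff, Set.mem_singleton_iff]
    omega

end Path

section

variable {G : SimpleGraph V} {r l₀ : V} {up ch : V → V} {O : Set V}
  {C : (G.induce (skeleton G)).ConnectedComponent}

/-- A component of the skeleton without branching is a path. -/
theorem exists_isPathFrom [Finite V] (h : Rooted G r l₀ up ch O) (hr : r ∉ leaves G)
    (hr' : r ∈ leafParents G)
    (hC : ∀ v w, v ∈ skeleton G → w ∈ skeleton G → up v = up w → up v ∈ componentSet G C → v = w) :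
    ∃ n p, IsPathFrom G r (componentSet G C) n p := by
  obtain ⟨x, hx, hxr, hxu⟩ := h.exists_top hr hr' C
  obtain ⟨z, hz, hmax⟩ := Set.exists_max_image (componentSet G C) (fun v => G.dist r v)
    (Set.toFinite _) ⟨x, hx⟩
  have hne : ∀ v ∈ componentSet G C, v ≠ r := fun v hv e => (componentSet_subset C hv).2 (e ▸ hr')
  obtain ⟨n, hn⟩ : ∃ n, G.dist r z = n := ⟨_, rfl⟩
  -- The path is read off by climbing from a deepest vertex `z`, of depth `n`; thus `p i` has depth
  -- `i` and `p 0` is the root.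
  obtain ⟨p, hp⟩ : ∃ p : ℕ → V, ∀ i, p i = up^[n - i] z := ⟨_, fun _ => rfl⟩
  have hpn : p n = z := by rw [hp, Nat.sub_self]; rfl
  have hdp : ∀ i ≤ n, G.dist r (p i) = i := by
    intro i hi
    rw [hp, h.depth_iterate, hn]
    omega
  have hup : ∀ i, i + 1 ≤ n → up (p (i + 1)) = p i := by
    intro i hi
    rw [hp, hp, ← Function.iterate_succ_apply' up, show (n - (i + 1)).succ = n - i by omega]
  have hinj : ∀ i ≤ n, ∀ j ≤ n, p i = p j → i = j := by
    intro i hi j hj e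
    rw [← hdp i hi, ← hdp j hj, e]
  have hmem : ∀ i, 1 ≤ i → i ≤ n → p i ∈ componentSet G C := by
    intro i h1 h2
    induction h2 using Nat.decreasingInduction with
    | self => exact hpn ▸ hz
    | of_succ i hi ih =>
      have hi' := ih (by omega)
      have hu := hup i (by omega)
      have hpr : p i ≠ r := fun e => by
        have := hdp i (by omega)
        rw [e, SimpleGraph.dist_self] at this
        omega
      rw [← hu]
      exact mem_componentSet_of_adj hi' ((h.adj_iff _ _).2 (Or.inr ⟨hne _ hi', rfl⟩))
        (h.up_mem_skeleton hr hr' (componentSet_subset C hi') (hu ▸ hpr))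
  have hn1 : 1 ≤ n := by
    have := h.depth z (hne z hz)
    omega
  have hp0 : p 0 = r := by
    have := hdp 0 (Nat.zero_le _)
    by_contra hcon
    have := h.depth _ hcon
    omega
  have hp1 : up (p 1) = r := (hup 0 hn1).trans hp0
  refine ⟨n, p, hn1, fun i hi j hj e => hinj i hi.2 j hj.2 e, ?_, ?_, ?_⟩
  · refine Set.Subset.antisymm ?_ ?_
    · rintro _ ⟨i, hi, rfl⟩
      exact hmem i hi.1 hi.2
    · refine componentSet_induction (hmem 1 le_rfl hn1) ⟨1, ⟨le_rfl, hn1⟩, rfl⟩ ?_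
      rintro _ hv ⟨i, ⟨h1, h2⟩, rfl⟩ w hw hadj
      have hwC := mem_componentSet_of_adj hv hadj hw
      rcases (h.adj_iff _ _).1 hadj with ⟨hwr, e⟩ | ⟨-, rfl⟩
      · rcases h2.eq_or_lt with rfl | hlt
        · have h3 := hmax w hwC
          have h4 := h.depth w hwr
          rw [e, hpn] at h4
          omega
        · refine ⟨i + 1, ⟨by omega, hlt⟩, ?_⟩
          exact hC _ _ (componentSet_subset C (hmem _ (by omega) hlt)) hw
            ((hup i hlt).trans e.symm) ((hup i hlt).symm ▸ hv)
      · rcases i with - | - | i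
        · omega
        · exact absurd hp1 (hne _ hwC)
        · exact ⟨i + 1, ⟨by omega, by omega⟩, (hup (i + 1) h2).symm⟩
  · rintro i ⟨hi1, hi2⟩ j ⟨hj1, hj2⟩
    rw [h.adj_iff]
    constructor
    · rintro (⟨-, e⟩ | ⟨-, e⟩)
      · obtain ⟨j, rfl⟩ : ∃ k, j = k + 1 := ⟨j - 1, by omega⟩
        rw [hup j hj2] at e
        exact Or.inl (by rw [hinj _ (by omega) _ hi2 e])
      · obtain ⟨i, rfl⟩ : ∃ k, i = k + 1 := ⟨i - 1, by omega⟩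
        rw [hup i hi2] at e
        exact Or.inr (by rw [hinj _ (by omega) _ hj2 e])
    · rintro (rfl | rfl)
      · exact Or.inl ⟨hne _ (hmem _ hj1 hj2), hup _ hj2⟩
      · exact Or.inr ⟨hne _ (hmem _ hi1 hi2), hup _ hi2⟩
  · rintro i ⟨hi1, hi2⟩
    rw [h.adj_iff]
    constructor
    · rintro (⟨-, e⟩ | ⟨e, -⟩)
      · obtain ⟨i, rfl⟩ : ∃ k, i = k + 1 := ⟨i - 1, by omega⟩
        rw [hup i hi2, ← hp0] at e
        rw [hinj _ (by omega) _ (by omega) e]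
      · exact absurd rfl e
    · rintro rfl
      exact Or.inl ⟨hne _ (hmem _ hi1 hi2), hp1⟩

/-- A component of the skeleton with branching is a fork. -/
theorem favorableFork_of_branch [Finite V] (h : Rooted G r l₀ up ch O) (hr : r ∉ leaves G)
    (hr' : r ∈ leafParents G) (hW : AliceWin G {r} ∅ .bob) {w w' : V} (hw : w ∈ skeleton G)
    (hw' : w' ∈ skeleton G) (hne : w ≠ w') (huw : up w = up w') (hv : up w ∈ componentSet G C) :
    FavorableFork G r (componentSet G C) := by
  have hner : ∀ v ∈ skeleton G, v ≠ r := fun v hv e => hv.2 (e ▸ hr')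
  have hner' : ∀ v ∈ componentSet G C, v ≠ r := fun v hv => hner v (componentSet_subset C hv)
  obtain ⟨v, huv⟩ : ∃ v, up w = v := ⟨_, rfl⟩
  rw [huv] at hv huw
  have hvr := hner' v hv
  -- The branching vertex is labelled `0`, because a vertex labelled `1` has a single child.
  have hvO : v ∉ O := fun hO => hne (by
    rw [h.eq_ch w (hner w hw) (huv ▸ hO), h.eq_ch w' (hner w' hw') (huw ▸ hO), huv, ← huw])
  have hlive : ∀ u ∈ skeleton G, up u = v → Live up ch O u := fun u hu e =>
    h.live_of_mem hr hr' hu (h.mem_of_up u (hner u hu) (e ▸ hvr) (e ▸ hvO))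
  have hwL := hlive w hw huv
  have hwL' := hlive w' hw' huw.symm
  have hvu : up v ≠ r := fun e => hne (h.eq_of_live_top hW hvr e hwL hwL' huv huw.symm)
  obtain ⟨c, hc⟩ : ∃ c, up v = c := ⟨_, rfl⟩
  have hcO : c ∈ O := hc ▸ h.up_mem hvr hvO hvu
  have hvc : v = ch c := hc ▸ h.eq_ch v hvr (hc ▸ hcO)
  obtain ⟨hcr, hcu⟩ := h.depth_of_branch hW hwL hwL' hcO hne (huv.trans hvc) (huw.symm.trans hvc)
  obtain ⟨x, hx⟩ : ∃ x, up c = x := ⟨_, rfl⟩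
  rw [hx] at hcr hcu
  have hcL : Live up ch O c := ⟨hcO, w, hwL.1, huv.trans hvc⟩
  have hfork : ∀ a b, Live up ch O a → Live up ch O b → up a = v → up b = v → a ≠ b →
      Rooted.ForkAt r up ch O x c a b := fun a b ha hb hav hbv hab =>
    ⟨hcr, hcu, hcL, ha, hb, hx, hav.trans hvc, hbv.trans hvc, hab⟩
  have hcS := h.mem_skeleton_of_live hr hr' hcL
  have hcC : c ∈ componentSet G C :=
    mem_componentSet_of_adj hv ((h.adj_iff _ _).2 (Or.inr ⟨hvr, hc⟩)) hcS
  have hxC : x ∈ componentSet G C :=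
    mem_componentSet_of_adj hcC ((h.adj_iff _ _).2 (Or.inr ⟨hner c hcS, hx⟩))
      (hx ▸ h.up_mem_skeleton hr hr' hcS (hx ▸ hcr))
  have hdc := h.depth_of_up_up hcO hx hcr hcu
  have hdx := h.depth x hcr
  rw [hcu, SimpleGraph.dist_self] at hdx
  have hdv := h.depth_ch hcO
  rw [← hvc] at hdv
  -- the branches
  obtain ⟨K, hK⟩ : ∃ K : Set V, K = {a | Live up ch O a ∧ up a = v} := ⟨_, rfl⟩
  have hKd : ∀ a ∈ K, G.dist r a = 4 := by
    rintro a ha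
    rw [hK] at ha
    have := h.depth a (h.ne_root ha.1.1)
    rw [ha.2] at this
    omega
  have hcK : c ∉ K := fun hh => by
    have := hKd c hh
    omega
  -- The branch towards the root is `v, c, x`; the other branches are `v, a, ch a` with `a` in `K`.
  obtain ⟨b, hb⟩ : ∃ b : V → V, ∀ a, (a = c → b a = x) ∧ (a ≠ c → b a = ch a) := by
    classical
    exact ⟨fun a => if a = c then x else ch a, fun a => ⟨fun e => if_pos e, fun e => if_neg e⟩⟩
  have hbc : b c = x := (hb c).1 rfl
  have hbK : ∀ a ∈ K, b a = ch a := fun a ha => (hb a).2 fun e => hcK (e ▸ ha)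
  have hKL : ∀ a ∈ K, Live up ch O a ∧ up a = v := fun a ha => by rwa [hK] at ha
  have hKC : ∀ a ∈ K, a ∈ componentSet G C := fun a ha =>
    mem_componentSet_of_adj hv ((h.adj_iff _ _).2 (Or.inl ⟨h.ne_root (hKL a ha).1.1, (hKL a ha).2⟩))
      (h.mem_skeleton_of_live hr hr' (hKL a ha).1)
  have hKch : ∀ a ∈ K, ch a ∈ componentSet G C := fun a ha =>
    mem_componentSet_of_adj (hKC a ha) (h.adj_ch (hKL a ha).1.1)
      (h.ch_mem_skeleton hr hr' (hKL a ha).1)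
  have hKd' : ∀ a ∈ K, G.dist r (ch a) = 5 := fun a ha => by
    rw [h.depth_ch (hKL a ha).1.1, hKd a ha]
  have hunion : componentSet G C = {v} ∪ insert c K ∪ b '' insert c K := by
    refine Set.Subset.antisymm (componentSet_induction hv (Or.inl (Or.inl rfl)) ?_) ?_
    · rintro u hu hcase y hy hadj
      have hyr := hner y hy
      rcases hcase with (rfl | rfl | huK) | ⟨a, rfl | haK, rfl⟩
      · rcases (h.adj_iff _ _).1 hadj with ⟨-, e⟩ | ⟨-, e⟩
        · exact Or.inl (Or.inr (Or.inr (hK ▸ ⟨hlive y hy e, e⟩)))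
        · exact Or.inl (Or.inr (Or.inl (e.symm.trans hc)))
      · rcases (h.adj_iff _ _).1 hadj with ⟨-, e⟩ | ⟨-, e⟩
        · refine Or.inl (Or.inl ?_)
          rw [Set.mem_singleton_iff, h.eq_ch y hyr (e ▸ hcO), e, ← hvc]
        · exact Or.inr ⟨u, Or.inl rfl, hbc.trans (hx.symm.trans e)⟩
      · obtain ⟨huL, huv'⟩ := hKL u huK
        rcases (h.adj_iff _ _).1 hadj with ⟨-, e⟩ | ⟨-, e⟩
        · refine Or.inr ⟨u, Or.inr huK, ?_⟩
          rw [hbK u huK, h.eq_ch y hyr (e ▸ huL.1), e]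
        · exact Or.inl (Or.inl (e.symm.trans huv'))
      · rw [hbc] at hadj
        rcases (h.adj_iff _ _).1 hadj with ⟨-, e⟩ | ⟨-, e⟩
        · have hxO : x ∉ O := hx ▸ h.up_notMem hcO
          have hyL := h.live_of_mem hr hr' hy (h.mem_of_up y hyr (e ▸ hcr) (e ▸ hxO))
          exact Or.inl (Or.inr (Or.inl (h.eq_of_live_top hW hcr hcu hyL hcL e hx)))
        · exact absurd (e.symm.trans hcu) hyr
      · rw [hbK a haK] at hadj
        obtain ⟨haL, hav⟩ := hKL a haK
        rcases (h.adj_iff _ _).1 hadj with ⟨-, e⟩ | ⟨-, e⟩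
        · have hyL := h.live_of_mem hr hr' hy (h.mem_of_up_ch haL.1 hyr e)
          by_cases haw : a = w
          · exact (h.false_of_fork_long hW (hfork a w' haL hwL' hav huw.symm (haw ▸ hne)) hyL e).elim
          · exact (h.false_of_fork_long hW (hfork a w haL hwL hav huv haw) hyL e).elim
        · rw [h.up_ch a haL.1] at e
          exact Or.inl (Or.inr (Or.inr (e ▸ haK)))
    · rintro u ((rfl | rfl | huK) | ⟨a, rfl | haK, rfl⟩)
      exacts [hv, hcC, hKC u huK, hbc ▸ hxC, hbK a haK ▸ hKch a haK]
  have hwK : w ∈ K := hK ▸ ⟨hwL, huv⟩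
  have hwK' : w' ∈ K := hK ▸ ⟨hwL', huw.symm⟩
  have hK3 : 3 ≤ (insert c K).ncard := by
    rw [Set.ncard_insert_of_notMem hcK]
    have := (Set.one_lt_ncard (Set.toFinite K)).2 ⟨w, hwK, w', hwK', hne⟩
    omega
  obtain ⟨e⟩ : Nonempty (Fin (insert c K).ncard ≃ (insert c K : Set V)) :=
    ⟨((Finite.equivFin _).trans (finCongr (Nat.card_coe_set_eq _))).symm⟩
  have hcases : ∀ i, (e i).1 = c ∨ (e i).1 ∈ K := fun i => (e i).2
  have hei : ∀ {i j}, (e i).1 = (e j).1 → i = j := fun hij => e.injective (Subtype.ext hij)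
  have he0 : (e (e.symm ⟨c, Or.inl rfl⟩)).1 = c := by rw [e.apply_symm_apply]
  -- The depths are `1` and `2` on the branch towards the root, `3` at the center, `4` and `5` on
  -- the other branches. Comparing them settles most of the required distinctness and non-adjacency.
  have hda : ∀ i, ((e i).1 = c ∧ G.dist r (e i).1 = 2 ∧ b (e i).1 = x ∧ G.dist r (b (e i).1) = 1) ∨
      ((e i).1 ∈ K ∧ G.dist r (e i).1 = 4 ∧ b (e i).1 = ch (e i).1 ∧
        G.dist r (b (e i).1) = 5) := by
    intro i
    rcases hcases i with hi | hi
    · exact Or.inl ⟨hi, by rw [hi, hdc], by rw [hi, hbc], by rw [hi, hbc, hdx]⟩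
    · exact Or.inr ⟨hi, hKd _ hi, hbK _ hi, by rw [hbK _ hi, hKd' _ hi]⟩
  have hadjd : ∀ {y z}, G.Adj y z → G.dist r y = G.dist r z + 1 ∨ G.dist r z = G.dist r y + 1 := by
    intro y z hyz
    rcases (h.adj_iff _ _).1 hyz with ⟨h1, rfl⟩ | ⟨h1, rfl⟩
    exacts [Or.inr (h.depth z h1), Or.inl (h.depth y h1)]
  refine ⟨(insert c K).ncard, v, fun i => (e i).1, fun i => b (e i).1, e.symm ⟨c, Or.inl rfl⟩,
    ⟨hK3, fun i j => hei, fun i j hij => ?_, fun i hi => ?_, fun i hi => ?_, fun i j hij => ?_, ?_,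
      fun i => ?_, fun i hadj => ?_, fun i j => ⟨fun hadj => ?_, ?_⟩, fun i j hadj => ?_,
      fun i j hadj => ?_, fun u hu => ⟨fun hadj => ?_, ?_⟩⟩, fun u hu hM => ?_⟩
  · change b (e i).1 = b (e j).1 at hij
    have hdij := congrArg (G.dist r) hij
    rcases hda i with ⟨h1, h2, h3, h4⟩ | ⟨h1, h2, h3, h4⟩ <;>
      rcases hda j with ⟨h5, h6, h7, h8⟩ | ⟨h5, h6, h7, h8⟩
    · exact hei (h1.trans h5.symm)
    · omega
    · omega
    · exact hei (h.ch_inj (hKL _ h1).1.1 (hKL _ h5).1.1 (by rw [← h3, ← h7, hij]))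
  · have := congrArg (G.dist r) hi
    have := hda i
    omega
  · have := congrArg (G.dist r) hi
    have := hda i
    omega
  · have := congrArg (G.dist r) hij
    have := hda i
    have := hda j
    omega
  · rw [hunion, ← Function.comp_def b, Set.range_comp b]
    have : Set.range (fun i => (e i).1) = insert c K := by
      ext u
      constructor
      · rintro ⟨i, rfl⟩
        exact (e i).2
      · intro hu
        exact ⟨e.symm ⟨u, hu⟩, by simp⟩
    rw [this]
  · rcases hcases i with hi | hi
    · rw [hi]
      exact (h.adj_iff _ _).2 (Or.inr ⟨hvr, hc⟩)
    · exact (h.adj_iff _ _).2 (Or.inl ⟨h.ne_root (hKL _ hi).1.1, (hKL _ hi).2⟩)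
  · have := hadjd hadj
    have := hda i
    omega
  · have hd := hadjd hadj
    rcases hda i with ⟨h1, h2, h3, h4⟩ | ⟨h1, h2, h3, h4⟩ <;>
      rcases hda j with ⟨h5, h6, h7, h8⟩ | ⟨h5, h6, h7, h8⟩
    · exact hei (h1.trans h5.symm)
    · omega
    · omega
    · rcases (h.adj_iff _ _).1 hadj with ⟨-, e'⟩ | ⟨-, e'⟩
      · rw [h7, h.up_ch _ (hKL _ h5).1.1] at e'
        exact hei e'.symm
      · rw [(hKL _ h1).2] at e'
        rw [← e'] at h8
        omega
  · rintro rfl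
    rcases hda i with ⟨h1, h2, h3, h4⟩ | ⟨h1, h2, h3, h4⟩
    · rw [h3, h1]
      exact (h.adj_iff _ _).2 (Or.inr ⟨h.ne_root hcO, hx⟩)
    · rw [h3]
      exact h.adj_ch (hKL _ h1).1.1
  · have := hadjd hadj
    have := hda i
    have := hda j
    omega
  · have := hadjd hadj
    have := hda i
    have := hda j
    omega
  · rcases (h.adj_iff _ _).1 hadj with ⟨-, e'⟩ | ⟨e', -⟩
    · rw [he0, hbc]
      exact h.eq_top hr' hu e' hxC hcu
    · exact absurd rfl e'
  · rw [he0, hbc]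
    rintro rfl
    exact (h.adj_iff _ _).2 (Or.inl ⟨hcr, hcu⟩)
  -- A vertex of the fork next to a parent of a leaf other than the root is labelled `0`, and it
  -- cannot be `x` by `false_of_marked_top`.
  · rw [h.meetsParents_iff hr hr' (componentSet_subset C hu)] at hM
    have huO : u ∉ O := by
      obtain ⟨y, hy, rfl, -⟩ := hM
      exact h.up_notMem hy
    rw [hunion] at hu
    rcases hu with (rfl | rfl | huK) | ⟨a, rfl | haK, rfl⟩
    · exact Or.inl rfl
    · exact absurd hcO huO
    · exact absurd (hKL u huK).1.1 huO
    · rw [hbc] at hM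
      exact (h.false_of_marked_top hW hcr hcu hM hwL hcL (huv.trans hvc) hx).elim
    · refine Or.inr (Or.inl ⟨e.symm ⟨a, Or.inr haK⟩, fun e' => ?_, by simp⟩)
      have := congrArg Subtype.val (e.symm.injective e')
      exact hcK (Set.mem_of_eq_of_mem this.symm haK)

/-- A component which is a fork contains two branches below a child of the root. -/
theorem FavorableFork.forkAt (h : Rooted G r l₀ up ch O) (hr : r ∉ leaves G)
    (hr' : r ∈ leafParents G) (hf : FavorableFork G r (componentSet G C)) :
    ∃ x p a b, x ∈ componentSet G C ∧ Rooted.ForkAt r up ch O x p a b := by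
  obtain ⟨k, c, a, b, i₀, hf, -⟩ := hf
  have hU := hf.eq_union
  have hc : c ∈ componentSet G C := by rw [hU]; simp
  have ha : ∀ i, a i ∈ componentSet G C := by intro i; rw [hU]; simp
  have hb : ∀ i, b i ∈ componentSet G C := by intro i; rw [hU]; simp
  have hne : ∀ v ∈ componentSet G C, v ≠ r := fun v hv e => (componentSet_subset C hv).2 (e ▸ hr')
  have hbr : up (b i₀) = r := by
    rcases (h.adj_iff _ _).1 ((hf.root_adj_iff _ (hb i₀)).2 rfl) with h' | h'
    exacts [h'.2, absurd rfl h'.1]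
  have har : up (a i₀) = b i₀ := by
    rcases (h.adj_iff _ _).1 ((hf.adj_a_b i₀ i₀).2 rfl) with ⟨-, e⟩ | ⟨-, e⟩
    · exact absurd (e.symm.trans hbr) (hne _ (ha i₀))
    · exact e
  have hcr : up c = a i₀ := by
    rcases (h.adj_iff _ _).1 (hf.adj_c_a i₀) with ⟨-, e⟩ | ⟨-, e⟩
    · exact absurd (e.symm.trans har).symm (hf.b_ne_c i₀)
    · exact e
  have hau : ∀ i, i ≠ i₀ → up (a i) = c := by
    intro i hi
    rcases (h.adj_iff _ _).1 (hf.adj_c_a i) with ⟨-, e⟩ | ⟨-, e⟩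
    · exact e
    · exact absurd (hf.a_injective (e.symm.trans hcr)) hi
  have hbu : ∀ i, i ≠ i₀ → up (b i) = a i := by
    intro i hi
    rcases (h.adj_iff _ _).1 ((hf.adj_a_b i i).2 rfl) with ⟨-, e⟩ | ⟨-, e⟩
    · exact e
    · exact absurd (e.symm.trans (hau i hi)) (hf.b_ne_c i)
  -- If `b i` were labelled `1`, its child would belong to the component, but no vertex of the fork
  -- lies below `b i`.
  have hbO : ∀ i, i ≠ i₀ → b i ∉ O := by
    intro i hi hO
    have hL := h.live_of_mem hr hr' (componentSet_subset C (hb i)) hO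
    have hch := mem_componentSet_of_adj (hb i) (h.adj_ch hO) (h.ch_mem_skeleton hr hr' hL)
    have hu := h.up_ch _ hO
    obtain ⟨y, hy⟩ : ∃ y, ch (b i) = y := ⟨_, rfl⟩
    rw [hy] at hch hu
    rw [hU] at hch
    rcases hch with (rfl | ⟨j, rfl⟩) | ⟨j, rfl⟩
    · exact hf.a_ne_b _ _ (hcr.symm.trans hu)
    · by_cases hj : j = i₀
      · rw [hj, har] at hu
        exact hi (hf.b_injective hu).symm
      · exact hf.b_ne_c i (hu.symm.trans (hau j hj))
    · by_cases hj : j = i₀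
      · rw [hj, hbr] at hu
        exact hne _ (hb i) hu.symm
      · exact hf.a_ne_b _ _ ((hbu j hj).symm.trans hu)
  have haL : ∀ i, i ≠ i₀ → Live up ch O (a i) := by
    intro i hi
    have := h.up_mem (hne _ (hb i)) (hbO i hi) (hbu i hi ▸ hne _ (ha i))
    exact h.live_of_mem hr hr' (componentSet_subset C (ha i)) (hbu i hi ▸ this)
  obtain ⟨i, j, hi, hj, hij⟩ : ∃ i j, i ≠ i₀ ∧ j ≠ i₀ ∧ i ≠ j := by
    obtain ⟨i, hi⟩ := Fintype.exists_ne_of_one_lt_card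
      (by rw [Fintype.card_fin]; have := hf.three_le; omega) i₀
    obtain ⟨j, hj⟩ := Finset.exists_mem_notMem_of_card_lt_card (s := {i₀, i})
      (t := (Finset.univ : Finset (Fin k))) (by
        rw [Finset.card_pair hi.symm, Finset.card_univ, Fintype.card_fin]
        have := hf.three_le
        omega)
    simp only [Finset.mem_univ, Finset.mem_insert, Finset.mem_singleton, not_or, true_and] at hj
    exact ⟨i, j, hi, hj.1, fun e => hj.2 e.symm⟩
  have hcO : c ∉ O := hau i hi ▸ h.up_notMem (haL i hi).1
  have hpO : a i₀ ∈ O := hcr ▸ h.up_mem (hne c hc) hcO (hcr ▸ hne _ (ha i₀))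
  have hcp : c = ch (a i₀) := by
    have := h.eq_ch c (hne c hc) (hcr ▸ hpO)
    rwa [hcr] at this
  exact ⟨b i₀, a i₀, a i, a j, hb i₀, hne _ (hb i₀), hbr,
    h.live_of_mem hr hr' (componentSet_subset C (ha i₀)) hpO, haL i hi, haL j hj, har,
    (hau i hi).trans hcp, (hau j hj).trans hcp, hf.a_injective.ne hij⟩

theorem WeaklyFavorable.exists_top (h : Rooted G r l₀ up ch O) (hr : r ∉ leaves G)
    (hr' : r ∈ leafParents G) (hf : WeaklyFavorable G r (componentSet G C)) :
    ∃ x ∈ componentSet G C, (∃ p, Rooted.PathAt r up ch O x p) ∨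
      ∃ p a b, Rooted.ForkAt r up ch O x p a b := by
  rcases hf with ⟨n, p, hp, hn, hU, -⟩ | hf
  · refine ⟨p 1, hp.mem le_rfl hp.pos, Or.inl ⟨_, hp.pathAt h hr hr' (by omega) ?_
      (hU (Or.inl rfl)) (hU (Or.inr rfl))⟩⟩
    rcases hn with rfl | rfl
    exacts [⟨4, rfl⟩, ⟨5, rfl⟩]
  · obtain ⟨x, p, a, b, hx, hx'⟩ := hf.forkAt h hr hr'
    exact ⟨x, hx, Or.inr ⟨p, a, b, hx'⟩⟩

end

/-- If Alice wins, then all components are favorable and at most one is weakly favorable. -/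
theorem favorable_of_aliceWin [Finite V] {F : SimpleGraph V} (hF : F.IsTree)
    (hcherry : ¬ HasCherry F) {v₀ : V} (hv₀ : v₀ ∈ leafParents F)
    (hfirst : FirstMoveCondition F v₀) (hW : AliceWin F {v₀} ∅ .bob) :
    (∀ C : (F.induce (skeleton F)).ConnectedComponent, Favorable F v₀ (componentSet F C)) ∧
      ∀ C C' : (F.induce (skeleton F)).ConnectedComponent,
        WeaklyFavorable F v₀ (componentSet F C) → WeaklyFavorable F v₀ (componentSet F C') →
        C = C' := by
  -- If `v₀` were a leaf next to a leaf, the tree would have two vertices and an empty skeleton.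
  have hleaf : (F.induce (skeleton F)).ConnectedComponent → v₀ ∉ leaves F := by
    intro C hl
    obtain ⟨v, hv⟩ := componentSet_nonempty C
    have hvS := componentSet_subset C hv
    obtain ⟨x, rfl, rfl | hx⟩ := isDominating_of_leaf_of_leafParent hF.connected hl hv₀ v₀ v
    exacts [hvS.1 hl, hvS.2 ⟨x, hl, hx.symm⟩]
  obtain ⟨l₀, up, ch, O, h⟩ := exists_rooted hF hcherry hv₀ hfirst
  refine ⟨fun C => ?_, fun C C' hC hC' => ?_⟩
  · have hr := hleaf C
    by_cases hbr : ∀ v w, v ∈ skeleton F → w ∈ skeleton F → up v = up w →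
        up v ∈ componentSet F C → v = w
    · obtain ⟨n, p, hp⟩ := exists_isPathFrom h hr hv₀ hbr
      exact Or.inl ⟨n, p, hp, hp.cases h hr hv₀ hW rfl⟩
    · push Not at hbr
      obtain ⟨v, w, hv, hw, huv, hC, hne⟩ := hbr
      exact Or.inr (favorableFork_of_branch h hr hv₀ hW hv hw hne huv hC)
  · have hr := hleaf C
    obtain ⟨x, hx, hx'⟩ := hC.exists_top h hr hv₀
    obtain ⟨y, hy, hy'⟩ := hC'.exists_top h hr hv₀
    -- Each weak component contains the child of the root that tops its configuration, and two such
    -- configurations share this child.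
    have hxy : x = y := by
      rcases hx' with ⟨p, hp⟩ | ⟨p, a, b, hp⟩ <;> rcases hy' with ⟨q, hq⟩ | ⟨q, c, d, hq⟩
      exacts [h.path_path hW hp hq, (h.fork_path hW hq hp).symm, h.fork_path hW hp hq,
        h.fork_fork hW hp hq]
    exact componentSet_disjoint hx (hxy ▸ hy)

end DominationGame

theorem mainTheorem1 {V : Type*} [Finite V] (F : SimpleGraph V) (hF : F.IsTree)
    (hcherry : ¬ DominationGame.HasCherry F)
    (v₀ : V) (hv₀ : v₀ ∈ DominationGame.leafParents F)
    (hfirst : DominationGame.FirstMoveCondition F v₀) :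
    DominationGame.AliceWin F {v₀} ∅ DominationGame.Player.bob ↔
      (∀ C : (F.induce (DominationGame.skeleton F)).ConnectedComponent,
          DominationGame.Favorable F v₀ (DominationGame.componentSet F C)) ∧
        ∀ C C' : (F.induce (DominationGame.skeleton F)).ConnectedComponent,
          DominationGame.WeaklyFavorable F v₀ (DominationGame.componentSet F C) →
          DominationGame.WeaklyFavorable F v₀ (DominationGame.componentSet F C') → C = C' :=
  ⟨DominationGame.favorable_of_aliceWin hF hcherry hv₀ hfirst, fun h =>
    DominationGame.aliceWin_of_favorable hF.connected hcherry hv₀ h.1 h.2⟩
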